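/- **Setting.** Fix a set $K$ of constants $k$, each with arities $\mathrm{dom}(k),\mathrm{cod}(k)\in\mathbb N$ (we write $k:\mathrm{dom}(k)\to\mathrm{cod}(k)$), and an infinite set $\mathbb A$ of names. Terms are $$M ::= k \mid 0 \mid i \mid \gamma \mid M;M \mid M\otimes M \mid x \mid \mathrm{Tr}^{j}(M) \mid \overline{xy}.M ,\qquad x,y\in\mathbb A,\ j\in\mathbb N .$$ Here $0$ is the identity at $0$, $i$ (also written $1$) the identity at $1$, $\gamma$ the symmetry, $\mathrm{Tr}^j$ the trace over $j$ wires; $\overline{xy}.M$ ("link $x$ and $y$ in $M$") binds $x$ and $y$ in $M$. Identities $n$ at $n$ and symmetries $\gamma_{m,n}:m+n\to n+m$ are the usual composites of $0$, $i$ and $\gamma$; $\mathit{fv}(M)$ is the set of free variables. **Typing.** $\Gamma\mid\Delta\vdash M:m\to n$ ($\Gamma$ a finite set of input variables, $\Delta$ a finite set of output variables) is generated by the following rules. - $x\mid-\vdash x:0\to1$ and $-\mid x\vdash x:1\to0$; and $-\mid-\vdash 0:0\to0$, $\ i:1\to1$, $\ \gamma:2\to2$, $\ k:\mathrm{dom}(k)\to\mathrm{cod}(k)$.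 - If $\Gamma\mid\Delta\vdash M:a\to b$, $\Gamma'\mid\Delta'\vdash N:c\to d$ and $\Gamma\cup\Delta$, $\Gamma'\cup\Delta'$ are disjoint, then $\Gamma\cup\Gamma'\mid\Delta\cup\Delta'\vdash M\otimes N:a+c\to b+d$ and, if $b=c$, $\Gamma\cup\Gamma'\mid\Delta\cup\Delta'\vdash M;N:a\to d$. - If $\Gamma\mid\Delta\vdash M:m+j\to n+j$ then $\Gamma\mid\Delta\vdash\mathrm{Tr}^j(M):m\to n$. - If $\Gamma\cup\{y\}\mid\Delta\cup\{x\}\vdash M:m\to n$ with $x\notin\Delta$, $y\notin\Gamma$, then $\Gamma\mid\Delta\vdash\overline{xy}.M:m\to n$. **Diagrams.** An interfaced graph $(V,I,O,E,f)$ is a finite directed graph, cycles allowed, with vertices $V$ and edges $E\subseteq V^2$, a partial labelling $f$ of its vertices, and two lists $I,O$ of unlabelled vertices. Labels are the names, and, for each $k\in K$, a box label $k$, input-port labels $p^k_1,\dots,p^k_{\mathrm{dom}(k)}$ and output-port labels $q^k_1,\dots,q^k_{\mathrm{cod}(k)}$. Unlabelled vertices are called wire nodes. A *biflow diagram* is an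 interfaced graph up to the equivalence generated by isomorphism (respecting $E$, labels and interface lists) and insertion or removal of wire nodes along wires: a wire node $w\notin I,O$ with a unique incoming edge $a\to w$ and a unique outgoing edge $w\to b$, where $a,b\neq w$, $a$ or $b$ is a wire node and there is no edge $a\to b$, may be removed and replaced by an edge $a\to b$, and conversely. The diagram $[\![\Gamma\mid\Delta\vdash M:m\to n]\!]$ is defined by induction on the derivation: - an input variable $x$ is a vertex labelled $x$ with an edge to the single output; an output variable $x$ is the single input with an edge to a vertex labelled $x$; - $0$ is empty, $i$ is one edge from an input to an output, $\gamma$ is two crossing such edges; - $k$ has a vertex labelled $k$ and paths $a_r\to p^k_r\to k\to q^k_s\to b_s$ from inputs $a_r$ and to outputs $b_s$; - $M\otimes N$ is the disjoint union with concatenated interfaces; $M;N$ is the disjoint union with edges from the $r$-th output of $M$ to the $r$-th input of $N$; - $\mathrm{Tr}^j(M)$ adds edges from the last $j$ outputs of $M$ to its last $j$ inputs, in order, and removes these vertices from the interfaces; - $\overline{xy}.M$ adds an edge from the vertex labelled $x$ to the vertex labelled $y$ and erases these two labels. **Equations.** $\Gamma\mid\Delta\vdash M\equiv N:m\to n$ is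 the least congruence (equivalence relation closed under $;$, $\otimes$, $\mathrm{Tr}^j$ and link) on well-typed terms that contains all well-typed instances of: - $(M_1;M_2);M_3\equiv M_1;(M_2;M_3)$; $\quad m;M\equiv M\equiv M;n$ for $M:m\to n$; $\quad (M;M')\otimes(N;N')\equiv(M\otimes N);(M'\otimes N')$; - $(M_1\otimes M_2)\otimes M_3\equiv M_1\otimes(M_2\otimes M_3)$; $\quad M\otimes0\equiv0\otimes M\equiv M$; - $(M_1\otimes M_2);\gamma_{n_1,n_2}\equiv\gamma_{m_1,m_2};(M_2\otimes M_1)$ for $M_r:m_r\to n_r$; $\quad\gamma_{0,1}\equiv\gamma_{1,0}\equiv1$; $\quad\gamma_{m,n+p}\equiv(\gamma_{m,n}\otimes p);(n\otimes\gamma_{m,p})$; - $\overline{xy}.M\equiv\overline{x'y'}.M\{x'y'/xy\}$ for fresh distinct $x',y'$; - $\overline{xy}.(M;N)\equiv(\overline{xy}.M);N$ and $\overline{xy}.(M\otimes N)\equiv(\overline{xy}.M)\otimes N$ if $x,y\notin\mathit{fv}(N)$; - $\overline{xy}.(M;N)\equiv M;\overline{xy}.N$ and $\overline{xy}.(M\otimes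 N)\equiv M\otimes\overline{xy}.N$ if $x,y\notin\mathit{fv}(M)$; $\quad\overline{xy}.(x;y)\equiv1$; - $\mathrm{Tr}^m((g\otimes m);f)\equiv g;\mathrm{Tr}^m(f)$; $\quad\mathrm{Tr}^m(f;(g\otimes m))\equiv\mathrm{Tr}^m(f);g$; $\quad\mathrm{Tr}^m(f;(n\otimes g))\equiv\mathrm{Tr}^p((q\otimes g);f)$ for $g:p\to m$, $f:q+m\to n+p$; - $\mathrm{Tr}^0(f)\equiv f$; $\quad\mathrm{Tr}^{m+n}(f)\equiv\mathrm{Tr}^m(\mathrm{Tr}^n(f))$; $\quad\mathrm{Tr}^m(n\otimes f)\equiv n\otimes\mathrm{Tr}^m(f)$; $\quad\mathrm{Tr}^1(\gamma)\equiv1$; - $\overline{xy}.\mathrm{Tr}^j(M)\equiv\mathrm{Tr}^j(\overline{xy}.M)$ for $j\in\{0,1\}$. **Theorem (the equational theory of biflow diagrams is sound and complete).** For all terms $M,N$ with $\Gamma\mid\Delta\vdash M:m\to n$ and $\Gamma\mid\Delta\vdash N:m\to n$, $$\Gamma\mid\Delta\vdash M\equiv N:m\to n\quad\Longleftrightarrow\quad[\![\Gamma\mid\Delta\vdash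 M:m\to n]\!]=[\![\Gamma\mid\Delta\vdash N:m\to n]\!]\ \text{ as biflow diagrams},$$ whatever derivations of the two typing judgements are used to compute the diagrams. -/

import Mathlib

namespace Biflow

universe u v

/-! ### Syntax -/

/-- A signature: a set `K` of constants `k : dom k → cod k`. -/
structure Signature where
  K : Type u
  dom : K → ℕ
  cod : K → ℕ

/-- Raw terms over the constants of `S` and the names `A`.
`zero` is the identity at `0`, `one` the identity `i : 1 → 1`, `sym` the symmetry `γ : 2 → 2`,
`trace i M` is `Trⁱ(M)`, and `link x y M` is the binder that links `x` and `y` in `M`. -/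
inductive Term (S : Signature.{u}) (A : Type v) : Type (max u v)
  | const (k : S.K) : Term S A
  | zero : Term S A
  | one : Term S A
  | sym : Term S A
  | comp (M N : Term S A) : Term S A
  | tensor (M N : Term S A) : Term S A
  | var (x : A) : Term S A
  | trace (i : ℕ) (M : Term S A) : Term S A
  | link (x y : A) (M : Term S A) : Term S A

namespace Term

variable {S : Signature.{u}} {A : Type v}

/-- The identity at `n`. -/
def idn : ℕ → Term S A
  | 0 => zero
  | n + 1 => tensor (idn n) one

/-- The symmetry `γ_{m,1} : m + 1 → 1 + m`. -/
def symOne : ℕ → Term S A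
  | 0 => one
  | m + 1 => comp (tensor (idn m) sym) (tensor (symOne m) one)

/-- The symmetry `γ_{m,n} : m + n → n + m`, built from `γ` and identities. -/
def symn (m : ℕ) : ℕ → Term S A
  | 0 => idn m
  | n + 1 => comp (tensor (symn m n) one) (tensor (idn n) (symOne m))

variable [DecidableEq A]

/-- Free variables. -/
def fv : Term S A → Finset A
  | const _ => ∅
  | zero => ∅
  | one => ∅
  | sym => ∅
  | comp M N => fv M ∪ fv N
  | tensor M N => fv M ∪ fv N
  | var x => {x}
  | trace _ M => fv M
  | link x y M => fv M \ {x, y}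

/-- All names that occur in a term, free, bound or binding. -/
def names : Term S A → Finset A
  | const _ => ∅
  | zero => ∅
  | one => ∅
  | sym => ∅
  | comp M N => names M ∪ names N
  | tensor M N => names M ∪ names N
  | var x => {x}
  | trace _ M => names M
  | link x y M => {x, y} ∪ names M

/-- Replace the free occurrences of `x` by `x'` (used only for `x'` not occurring in the term). -/
def rename (x x' : A) : Term S A → Term S A
  | const k => const k
  | zero => zero
  | one => one
  | sym => sym
  | comp M N => comp (rename x x' M) (rename x x' N)
  | tensor M N => tensor (rename x x' M) (rename x x' N)
  | var z => var (if z = x then x' else z)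
  | trace i M => trace i (rename x x' M)
  | link a b M => if a = x ∨ b = x then link a b M else link a b (rename x x' M)

end Term

open Term

/-! ### Type system -/

/-- Derivations of the judgement `Γ ∣ Δ ⊢ M : m → n`, where `Γ` is the set of input variables (of
type `0 → 1`) and `Δ` the set of output variables (of type `1 → 0`), all of them distinct.
In `link x y M` the variable `x` is an output and `y` an input of `M`: the wire
that ends in `x` is continued by the wire that starts in `y`. -/
inductive Derivation {S : Signature.{u}} {A : Type v} [DecidableEq A] :
    Finset A → Finset A → Term S A → ℕ → ℕ → Type (max u v)
  | inVar (x : A) : Derivation {x} ∅ (var x) 0 1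
  | outVar (x : A) : Derivation ∅ {x} (var x) 1 0
  | const (k : S.K) : Derivation ∅ ∅ (const k) (S.dom k) (S.cod k)
  | zero : Derivation ∅ ∅ zero 0 0
  | one : Derivation ∅ ∅ one 1 1
  | sym : Derivation ∅ ∅ sym 2 2
  | comp {Γ Δ Γ' Δ' : Finset A} {M N : Term S A} {a b c : ℕ}
      (h : Disjoint (Γ ∪ Δ) (Γ' ∪ Δ'))
      (d : Derivation Γ Δ M a b) (e : Derivation Γ' Δ' N b c) :
      Derivation (Γ ∪ Γ') (Δ ∪ Δ') (comp M N) a c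
  | tensor {Γ Δ Γ' Δ' : Finset A} {M N : Term S A} {m₁ m₂ n₁ n₂ : ℕ}
      (h : Disjoint (Γ ∪ Δ) (Γ' ∪ Δ'))
      (d : Derivation Γ Δ M m₁ m₂) (e : Derivation Γ' Δ' N n₁ n₂) :
      Derivation (Γ ∪ Γ') (Δ ∪ Δ') (tensor M N) (m₁ + n₁) (m₂ + n₂)
  | trace {Γ Δ : Finset A} {M : Term S A} {m n : ℕ} (i : ℕ)
      (d : Derivation Γ Δ M (m + i) (n + i)) :
      Derivation Γ Δ (trace i M) m n
  | link {Γ Δ : Finset A} {M : Term S A} {m n : ℕ} (x y : A) (hx : x ∉ Δ) (hy : y ∉ Γ)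
      (d : Derivation (insert y Γ) (insert x Δ) M m n) :
      Derivation Γ Δ (link x y M) m n

/-- The judgement `Γ ∣ Δ ⊢ M : m → n` is derivable. -/
def HasType {S : Signature.{u}} {A : Type v} [DecidableEq A]
    (Γ Δ : Finset A) (M : Term S A) (m n : ℕ) : Prop :=
  Nonempty (Derivation Γ Δ M m n)

/-- `M` has type `m → n` as a subterm in the context `Γ ∣ Δ`, of which it may use only a part. -/
def HasTypeIn {S : Signature.{u}} {A : Type v} [DecidableEq A]
    (Γ Δ : Finset A) (M : Term S A) (m n : ℕ) : Prop :=
  ∃ Γ' ⊆ Γ, ∃ Δ' ⊆ Δ, HasType Γ' Δ' M m n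

/-! ### Diagrams -/

/-- Labels of vertices: the box of an occurrence of a constant `k`, its input ports and its output
ports, and variables. -/
inductive Label (S : Signature.{u}) (A : Type v) : Type (max u v)
  | box (k : S.K) : Label S A
  | inPort (k : S.K) (i : Fin (S.dom k)) : Label S A
  | outPort (k : S.K) (j : Fin (S.cod k)) : Label S A
  | var (x : A) : Label S A

/-- A finite directed graph with a partial labelling of its vertices and two lists of unlabelled
vertices, the input interface and the output interface. Unlabelled vertices are wire nodes. -/
structure Graph (S : Signature.{u}) (A : Type v) where
  V : Type
  finite : Finite V
  I : List V
  O : List V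
  E : V → V → Prop
  f : V → Option (Label S A)
  I_unlabelled : ∀ w ∈ I, f w = none
  O_unlabelled : ∀ w ∈ O, f w = none

namespace Graph

variable {S : Signature.{u}} {A : Type v}

/-- Equality up to renaming of vertices. -/
def Iso (D D' : Graph S A) : Prop :=
  ∃ e : D.V ≃ D'.V, D'.I = D.I.map e ∧ D'.O = D.O.map e ∧
    (∀ a b, D.E a b ↔ D'.E (e a) (e b)) ∧ ∀ a, D'.f (e a) = D.f a

/-- `D'` arises from `D` by the removal of one wire node along a wire: the unlabelled node `w`,
outside of the interfaces, with the unique incoming edge `a → w` and the unique outgoing edge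
`w → b`, is deleted, and `a → w → b` is replaced by an edge `a → b`. At least one of `a`, `b` is a
wire node (so the edges inside a box are not wires), and a node is never removed from a loop
`w → w`. The injection `e` identifies the nodes of `D'` with those of `D` other than `w`. -/
def WireRemoval (D D' : Graph S A) : Prop :=
  ∃ (w a b : D.V) (e : D'.V → D.V),
    D.f w = none ∧ a ≠ w ∧ b ≠ w ∧
    (∀ z, D.E z w ↔ z = a) ∧ (∀ z, D.E w z ↔ z = b) ∧ ¬ D.E a b ∧
    (D.f a = none ∨ D.f b = none) ∧
    Function.Injective e ∧ Set.range e = {w}ᶜ ∧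
    D.I = D'.I.map e ∧ D.O = D'.O.map e ∧ (∀ z, D'.f z = D.f (e z)) ∧
    ∀ s t, D'.E s t ↔ D.E (e s) (e t) ∨ (e s = a ∧ e t = b)

/-- One step: a renaming of vertices, or the removal of a wire node. -/
def Step (D D' : Graph S A) : Prop := Iso D D' ∨ WireRemoval D D'

/-- A vertex labelled with the input variable `x`, connected to one output. -/
def inVar (x : A) : Graph S A where
  V := Bool
  finite := inferInstance
  I := []
  O := [true]
  E a b := a = false ∧ b = true
  f a := if a = false then some (Label.var x) else none
  I_unlabelled := by simp
  O_unlabelled := by simp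

/-- One input, connected to a vertex labelled with the output variable `x`. -/
def outVar (x : A) : Graph S A where
  V := Bool
  finite := inferInstance
  I := [false]
  O := []
  E a b := a = false ∧ b = true
  f a := if a = true then some (Label.var x) else none
  I_unlabelled := by simp
  O_unlabelled := by simp

/-- The empty diagram. -/
def zero : Graph S A where
  V := Empty
  finite := inferInstance
  I := []
  O := []
  E _ _ := False
  f _ := none
  I_unlabelled := by simp
  O_unlabelled := by simp

/-- One wire. -/
def one : Graph S A where
  V := Bool
  finite := inferInstance
  I := [false]
  O := [true]
  E a b := a = false ∧ b = true
  f _ := none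
  I_unlabelled := by simp
  O_unlabelled := by simp

/-- Two crossing wires. -/
def sym : Graph S A where
  V := Bool × Bool
  finite := inferInstance
  I := [(false, false), (false, true)]
  O := [(true, false), (true, true)]
  E a b := a.1 = false ∧ b.1 = true ∧ a.2 ≠ b.2
  f _ := none
  I_unlabelled := by simp
  O_unlabelled := by simp

/-- The vertices of the diagram of a constant `k : m → n`. -/
inductive BoxVertex (m n : ℕ) : Type
  | inWire (i : Fin m) : BoxVertex m n
  | inPort (i : Fin m) : BoxVertex m n
  | box : BoxVertex m n
  | outPort (j : Fin n) : BoxVertex m n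
  | outWire (j : Fin n) : BoxVertex m n

theorem BoxVertex.finite (m n : ℕ) : Finite (BoxVertex m n) := by
  refine Finite.of_surjective
    (fun s : (Fin m ⊕ Fin m) ⊕ Unit ⊕ (Fin n ⊕ Fin n) => (match s with
      | .inl (.inl i) => BoxVertex.inWire i
      | .inl (.inr i) => BoxVertex.inPort i
      | .inr (.inl _) => BoxVertex.box
      | .inr (.inr (.inl j)) => BoxVertex.outPort j
      | .inr (.inr (.inr j)) => BoxVertex.outWire j : BoxVertex m n)) ?_
  intro w
  cases w with
  | inWire i => exact ⟨.inl (.inl i), rfl⟩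
  | inPort i => exact ⟨.inl (.inr i), rfl⟩
  | box => exact ⟨.inr (.inl ()), rfl⟩
  | outPort j => exact ⟨.inr (.inr (.inl j)), rfl⟩
  | outWire j => exact ⟨.inr (.inr (.inr j)), rfl⟩

/-- Edges `input i → port i → box → port j → output j`. -/
inductive BoxEdge (m n : ℕ) : BoxVertex m n → BoxVertex m n → Prop
  | input (i : Fin m) : BoxEdge m n (.inWire i) (.inPort i)
  | enter (i : Fin m) : BoxEdge m n (.inPort i) .box
  | leave (j : Fin n) : BoxEdge m n .box (.outPort j)
  | output (j : Fin n) : BoxEdge m n (.outPort j) (.outWire j)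

/-- Labels of the vertices of the diagram of a constant. -/
def boxLabel (k : S.K) : BoxVertex (S.dom k) (S.cod k) → Option (Label S A)
  | .inWire _ => none
  | .inPort i => some (Label.inPort k i)
  | .box => some (Label.box k)
  | .outPort j => some (Label.outPort k j)
  | .outWire _ => none

/-- The diagram of a constant: a box with labelled ports. -/
def const (k : S.K) : Graph S A where
  V := BoxVertex (S.dom k) (S.cod k)
  finite := BoxVertex.finite _ _
  I := List.ofFn BoxVertex.inWire
  O := List.ofFn BoxVertex.outWire
  E := BoxEdge (S.dom k) (S.cod k)
  f := boxLabel k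
  I_unlabelled := by
    intro w hw
    obtain ⟨i, rfl⟩ := (List.mem_ofFn' _ _).1 hw
    rfl
  O_unlabelled := by
    intro w hw
    obtain ⟨i, rfl⟩ := (List.mem_ofFn' _ _).1 hw
    rfl

/-- Sequential composition: disjoint union, with an edge from the `j`-th output of `D` to the
`j`-th input of `D'`. -/
def comp (D D' : Graph S A) : Graph S A where
  V := D.V ⊕ D'.V
  finite := by
    have := D.finite
    have := D'.finite
    infer_instance
  I := D.I.map Sum.inl
  O := D'.O.map Sum.inr
  E a b := Sum.LiftRel D.E D'.E a b ∨
    (a, b) ∈ (D.O.map (Sum.inl : D.V → D.V ⊕ D'.V)).zip (D'.I.map Sum.inr)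
  f := Sum.elim D.f D'.f
  I_unlabelled := by
    intro w hw
    obtain ⟨z, hz, rfl⟩ := List.mem_map.1 hw
    exact D.I_unlabelled z hz
  O_unlabelled := by
    intro w hw
    obtain ⟨z, hz, rfl⟩ := List.mem_map.1 hw
    exact D'.O_unlabelled z hz

/-- Tensor: disjoint union, with concatenated interfaces. -/
def tensor (D D' : Graph S A) : Graph S A where
  V := D.V ⊕ D'.V
  finite := by
    have := D.finite
    have := D'.finite
    infer_instance
  I := D.I.map Sum.inl ++ D'.I.map Sum.inr
  O := D.O.map Sum.inl ++ D'.O.map Sum.inr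
  E := Sum.LiftRel D.E D'.E
  f := Sum.elim D.f D'.f
  I_unlabelled := by
    intro w hw
    rcases List.mem_append.1 hw with hw | hw <;> obtain ⟨z, hz, rfl⟩ := List.mem_map.1 hw
    · exact D.I_unlabelled z hz
    · exact D'.I_unlabelled z hz
  O_unlabelled := by
    intro w hw
    rcases List.mem_append.1 hw with hw | hw <;> obtain ⟨z, hz, rfl⟩ := List.mem_map.1 hw
    · exact D.O_unlabelled z hz
    · exact D'.O_unlabelled z hz

/-- Trace: feedback edges from the last `i` outputs to the last `i` inputs, which leave the
interfaces. -/
def trace (i : ℕ) (D : Graph S A) : Graph S A where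
  V := D.V
  finite := D.finite
  I := D.I.rdrop i
  O := D.O.rdrop i
  E a b := D.E a b ∨ (a, b) ∈ (D.O.rtake i).zip (D.I.rtake i)
  f := D.f
  I_unlabelled := fun w hw => D.I_unlabelled w (List.mem_of_mem_take hw)
  O_unlabelled := fun w hw => D.O_unlabelled w (List.mem_of_mem_take hw)

open Classical in
/-- Link: an edge from the vertex labelled `x` to the vertex labelled `y`, which both lose their
labels. -/
noncomputable def link (x y : A) (D : Graph S A) : Graph S A where
  V := D.V
  finite := D.finite
  I := D.I
  O := D.O
  E a b := D.E a b ∨ (D.f a = some (Label.var x) ∧ D.f b = some (Label.var y))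
  f a := if D.f a = some (Label.var x) ∨ D.f a = some (Label.var y) then none else D.f a
  I_unlabelled := fun w hw => by simp [D.I_unlabelled w hw]
  O_unlabelled := fun w hw => by simp [D.O_unlabelled w hw]

end Graph

/-- Biflow diagrams: interfaced graphs up to the equivalence generated by renaming of vertices and
insertion and removal of wire nodes. -/
def Diagram (S : Signature.{u}) (A : Type v) : Type (max 1 u v) :=
  Quot (Graph.Step (S := S) (A := A))

/-- The graph of a derivation. -/
noncomputable def Derivation.graph {S : Signature.{u}} {A : Type v} [DecidableEq A]
    {Γ Δ : Finset A} {M : Term S A} {m n : ℕ} : Derivation Γ Δ M m n → Graph S A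
  | .inVar x => Graph.inVar x
  | .outVar x => Graph.outVar x
  | .const k => Graph.const k
  | .zero => Graph.zero
  | .one => Graph.one
  | .sym => Graph.sym
  | .comp _ d e => Graph.comp d.graph e.graph
  | .tensor _ d e => Graph.tensor d.graph e.graph
  | .trace i d => Graph.trace i d.graph
  | .link x y _ _ d => Graph.link x y d.graph

/-- The biflow diagram denoted by a derivable judgement. -/
noncomputable def Derivation.diagram {S : Signature.{u}} {A : Type v} [DecidableEq A]
    {Γ Δ : Finset A} {M : Term S A} {m n : ℕ} (d : Derivation Γ Δ M m n) : Diagram S A :=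
  Quot.mk _ d.graph

/-! ### Equational theory -/

/-- The equations, in the context `Γ ∣ Δ`. Typing assumptions are made here only where the
well-typedness of the two sides does not imply them. -/
inductive Equation {S : Signature.{u}} {A : Type v} [DecidableEq A] (Γ Δ : Finset A) :
    Term S A → Term S A → Prop
  | comp_assoc (M₁ M₂ M₃ : Term S A) :
      Equation Γ Δ (comp (comp M₁ M₂) M₃) (comp M₁ (comp M₂ M₃))
  | id_comp (m : ℕ) (M : Term S A) : Equation Γ Δ (comp (idn m) M) M
  | comp_id (n : ℕ) (M : Term S A) : Equation Γ Δ (comp M (idn n)) M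
  | functoriality (M M' N N' : Term S A) :
      Equation Γ Δ (tensor (comp M M') (comp N N')) (comp (tensor M N) (tensor M' N'))
  | tensor_assoc (M₁ M₂ M₃ : Term S A) :
      Equation Γ Δ (tensor (tensor M₁ M₂) M₃) (tensor M₁ (tensor M₂ M₃))
  | tensor_zero (M : Term S A) : Equation Γ Δ (tensor M zero) M
  | zero_tensor (M : Term S A) : Equation Γ Δ (tensor zero M) M
  | symmetry (M₁ M₂ : Term S A) (m₁ n₁ m₂ n₂ : ℕ)
      (h₁ : HasTypeIn Γ Δ M₁ m₁ n₁) (h₂ : HasTypeIn Γ Δ M₂ m₂ n₂) :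
      Equation Γ Δ (comp (tensor M₁ M₂) (symn n₁ n₂)) (comp (symn m₁ m₂) (tensor M₂ M₁))
  | sym_zero_one : Equation Γ Δ (symn 0 1) one
  | sym_one_zero : Equation Γ Δ (symn 1 0) one
  | sym_add (m n p : ℕ) :
      Equation Γ Δ (symn m (n + p))
        (comp (tensor (symn m n) (idn p)) (tensor (idn n) (symn m p)))
  | alpha (x y x' y' : A) (M : Term S A) (hx : x' ∉ names (link x y M))
      (hy : y' ∉ names (link x y M)) (hxy : x' ≠ y') :
      Equation Γ Δ (link x y M) (link x' y' (rename y y' (rename x x' M)))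
  | link_comp_left (x y : A) (M N : Term S A) (hx : x ∉ fv N) (hy : y ∉ fv N) :
      Equation Γ Δ (link x y (comp M N)) (comp (link x y M) N)
  | link_tensor_left (x y : A) (M N : Term S A) (hx : x ∉ fv N) (hy : y ∉ fv N) :
      Equation Γ Δ (link x y (tensor M N)) (tensor (link x y M) N)
  | link_comp_right (x y : A) (M N : Term S A) (hx : x ∉ fv M) (hy : y ∉ fv M) :
      Equation Γ Δ (link x y (comp M N)) (comp M (link x y N))
  | link_tensor_right (x y : A) (M N : Term S A) (hx : x ∉ fv M) (hy : y ∉ fv M) :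
      Equation Γ Δ (link x y (tensor M N)) (tensor M (link x y N))
  | link_identity (x y : A) : Equation Γ Δ (link x y (comp (var x) (var y))) one
  | left_tightening (m : ℕ) (f g : Term S A) :
      Equation Γ Δ (trace m (comp (tensor g (idn m)) f)) (comp g (trace m f))
  | right_tightening (m : ℕ) (f g : Term S A) :
      Equation Γ Δ (trace m (comp f (tensor g (idn m)))) (comp (trace m f) g)
  | sliding (m n p q : ℕ) (f g : Term S A)
      (hf : HasTypeIn Γ Δ f (q + m) (n + p)) (hg : HasTypeIn Γ Δ g p m) :
      Equation Γ Δ (trace m (comp f (tensor (idn n) g))) (trace p (comp (tensor (idn q) g) f))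
  | vanishing_zero (f : Term S A) : Equation Γ Δ (trace 0 f) f
  | vanishing_add (m n : ℕ) (f : Term S A) :
      Equation Γ Δ (trace (m + n) f) (trace m (trace n f))
  | superposing (m n : ℕ) (f : Term S A) :
      Equation Γ Δ (trace m (tensor (idn n) f)) (tensor (idn n) (trace m f))
  | yanking : Equation Γ Δ (trace 1 sym) one
  | link_trace (x y : A) (i : ℕ) (hi : i ≤ 1) (M : Term S A) :
      Equation Γ Δ (link x y (trace i M)) (trace i (link x y M))

/-- `Γ ∣ Δ ⊢ M ≡ N : m → n`: the least congruence on well-typed terms that contains all the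
well-typed instances of the equations. -/
inductive Provable {S : Signature.{u}} {A : Type v} [DecidableEq A] :
    Finset A → Finset A → ℕ → ℕ → Term S A → Term S A → Prop
  | ax {Γ Δ : Finset A} {m n : ℕ} {M N : Term S A} (h : Equation Γ Δ M N)
      (hM : HasType Γ Δ M m n) (hN : HasType Γ Δ N m n) : Provable Γ Δ m n M N
  | refl {Γ Δ : Finset A} {m n : ℕ} {M : Term S A}
      (hM : HasType Γ Δ M m n) : Provable Γ Δ m n M M
  | symm {Γ Δ : Finset A} {m n : ℕ} {M N : Term S A}
      (h : Provable Γ Δ m n M N) : Provable Γ Δ m n N M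
  | trans {Γ Δ : Finset A} {m n : ℕ} {M N P : Term S A}
      (h : Provable Γ Δ m n M N) (h' : Provable Γ Δ m n N P) : Provable Γ Δ m n M P
  | comp {Γ Δ Γ' Δ' : Finset A} {a b c : ℕ} {M M' N N' : Term S A}
      (hd : Disjoint (Γ ∪ Δ) (Γ' ∪ Δ'))
      (h : Provable Γ Δ a b M M') (h' : Provable Γ' Δ' b c N N') :
      Provable (Γ ∪ Γ') (Δ ∪ Δ') a c (comp M N) (comp M' N')
  | tensor {Γ Δ Γ' Δ' : Finset A} {m₁ m₂ n₁ n₂ : ℕ} {M M' N N' : Term S A}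
      (hd : Disjoint (Γ ∪ Δ) (Γ' ∪ Δ'))
      (h : Provable Γ Δ m₁ m₂ M M') (h' : Provable Γ' Δ' n₁ n₂ N N') :
      Provable (Γ ∪ Γ') (Δ ∪ Δ') (m₁ + n₁) (m₂ + n₂) (tensor M N) (tensor M' N')
  | trace {Γ Δ : Finset A} {m n : ℕ} {M M' : Term S A} (i : ℕ)
      (h : Provable Γ Δ (m + i) (n + i) M M') : Provable Γ Δ m n (trace i M) (trace i M')
  | link {Γ Δ : Finset A} {m n : ℕ} {M M' : Term S A} (x y : A) (hx : x ∉ Δ) (hy : y ∉ Γ)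
      (h : Provable (insert y Γ) (insert x Δ) m n M M') :
      Provable Γ Δ m n (link x y M) (link x y M')

end Biflow

/-!
# Biflow diagrams: soundness and completeness

Every derivation splits the names into input and output variables. For a fixed polarity
`P : A → Bool` of the names, a term has at most one type, its contexts are determined by its free
variables, and its graph is a function `graphP` of the term alone (`Derivation.ty`). All of the
argument takes place relative to such a `P`, and no longer mentions derivations.

**Completeness.** Terms modulo provable equality form an algebra `Cl S P`, with composition `*`,
tensor `+`, traces and links. A variable of a term can be abstracted, that is, moved to an
additional interface (`Ty.exists_out`, `Ty.exists_in`), and the link of two abstracted variables is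
a trace (`link_eq_trace`). As links commute with traces by the axioms, they commute with each other
(`link_comm`). Therefore a graph has a normal form, its `soup`: the tensor of its atoms (wire nodes
and boxes, with variables at all their ends), linked along the edges. The atoms are diagrams
`0 → 0`, so neither the order of the atoms nor that of the links matters (`cl_soup_perm`), the
list of atoms and edges is unique up to order (`Pres.ats_perm`), and the names at the ends of the
edges are bound (`cl_soup_alpha`).

By induction on terms, a term with variables attached to its interface (`hub`) is provably equal to
the soup of its graph (`Ty.soupFor`): linking outputs to inputs is composition for two diagrams
(`links_zip_add`) and trace for a single one (`links_zip_trace`). Removing a wire node from a graph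
means fusing two linked wire atoms into one (`Naming.fuse`), which is an instance of the equation
`link x y (x ; y) = 1`. Hence the class that a graph reads as is an invariant of the biflow diagram
(`reads_of_eqvGen`). Terms with the same diagram thus become equal when variables are attached to
their interfaces, and these variables can be removed again by links (`hub_injective`). Fresh names
are needed throughout, and an infinite set of names admits a polarity with infinitely many input and
infinitely many output names (`exists_polarity`).

**Soundness.** Each equation is checked up to `Graph.Same`, the equivalence generated by
isomorphisms and removals of wire nodes. The operations preserve this equivalence. For the trace
this requires that no wire starts at an output (`Graph.Same.trace`), which holds for the graphs of
terms (`Ty.tidy`). Identities and symmetries are `Graph.wiring`s, and composition with a wiring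
permutes the outputs of a diagram (`Graph.comp_wiring`). Tightening, sliding and naturality of the
symmetry are then isomorphisms, once identities are composed with the diagrams on both sides, and
renaming of bound names is a change of labels (`Ty.iso_alpha`).
-/

namespace Biflow

universe u v

open Term

variable {S : Signature.{u}} {A : Type v} [DecidableEq A]

/-! ### Typing relative to a polarity of the names -/

/-- The polarity `P` changed so that `x` is an output variable and `y` an input variable. -/
def polUpdate (P : A → Bool) (x y : A) : A → Bool :=
  Function.update (Function.update P x false) y true

theorem polUpdate_congr {P Q : A → Bool} {x y : A} {s : Finset A}
    (h : ∀ z ∈ s \ {x, y}, P z = Q z) : ∀ z ∈ s, polUpdate P x y z = polUpdate Q x y z := by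
  intro z hz
  simp only [polUpdate, Function.update_apply]
  split_ifs with h1 h2 <;> try rfl
  exact h z (by simp [hz, h1, h2])

theorem polUpdate_self {P : A → Bool} {x y : A} (hx : P x = false) (hy : P y = true) :
    polUpdate P x y = P := by
  funext z
  simp only [polUpdate, Function.update_apply]
  split_ifs with h1 h2 <;> simp_all

theorem polUpdate_of_ne {P : A → Bool} {x y z : A} (hx : z ≠ x) (hy : z ≠ y) :
    polUpdate P x y z = P z := by
  simp [polUpdate, hx, hy]

theorem polUpdate_right {P : A → Bool} {x y : A} : polUpdate P x y y = true := by
  simp [polUpdate]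

theorem polUpdate_left {P : A → Bool} {x y : A} (h : x ≠ y) : polUpdate P x y x = false := by
  simp [polUpdate, h]

/-- Typing `M : m → n` where the names have fixed polarities: `x` is an input variable if `P x` and
an output variable otherwise. The contexts are then determined by the free variables, and linearity
becomes disjointness of free variables. -/
def Ty : (A → Bool) → Term S A → ℕ → ℕ → Prop
  | _, .const k, m, n => m = S.dom k ∧ n = S.cod k
  | _, .zero, m, n => m = 0 ∧ n = 0
  | _, .one, m, n => m = 1 ∧ n = 1
  | _, .sym, m, n => m = 2 ∧ n = 2
  | P, .comp M N, m, n => Disjoint (fv M) (fv N) ∧ ∃ k, Ty P M m k ∧ Ty P N k n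
  | P, .tensor M N, m, n => Disjoint (fv M) (fv N) ∧
      ∃ m₁ n₁ m₂ n₂, m = m₁ + m₂ ∧ n = n₁ + n₂ ∧ Ty P M m₁ n₁ ∧ Ty P N m₂ n₂
  | P, .var x, m, n => if P x then m = 0 ∧ n = 1 else m = 1 ∧ n = 0
  | P, .trace i M, m, n => Ty P M (m + i) (n + i)
  | P, .link x y M, m, n => x ∈ fv M ∧ y ∈ fv M ∧ x ≠ y ∧ Ty (polUpdate P x y) M m n

/-- The graph of a term whose variables have the polarities `P`. -/
noncomputable def graphP : (A → Bool) → Term S A → Graph S A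
  | _, .const k => Graph.const k
  | _, .zero => Graph.zero
  | _, .one => Graph.one
  | _, .sym => Graph.sym
  | P, .comp M N => Graph.comp (graphP P M) (graphP P N)
  | P, .tensor M N => Graph.tensor (graphP P M) (graphP P N)
  | P, .var x => if P x then Graph.inVar x else Graph.outVar x
  | P, .trace i M => Graph.trace i (graphP P M)
  | P, .link x y M => Graph.link x y (graphP (polUpdate P x y) M)

/-- Arities are unique once the polarities are fixed. -/
theorem Ty.unique {M : Term S A} : ∀ {P : A → Bool} {m n m' n' : ℕ},
    Ty P M m n → Ty P M m' n' → m = m' ∧ n = n' := by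
  induction M with
  | const k | zero | one | sym =>
    intro P m n m' n' h h'
    obtain ⟨rfl, rfl⟩ := h
    obtain ⟨rfl, rfl⟩ := h'
    exact ⟨rfl, rfl⟩
  | comp M N ihM ihN =>
    intro P m n m' n' h h'
    obtain ⟨-, k, h1, h2⟩ := h
    obtain ⟨-, k', h1', h2'⟩ := h'
    obtain ⟨rfl, rfl⟩ := ihM h1 h1'
    exact ⟨rfl, (ihN h2 h2').2⟩
  | tensor M N ihM ihN =>
    intro P m n m' n' h h'
    obtain ⟨-, a, b, c, d, rfl, rfl, h1, h2⟩ := h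
    obtain ⟨-, a', b', c', d', rfl, rfl, h1', h2'⟩ := h'
    obtain ⟨rfl, rfl⟩ := ihM h1 h1'
    obtain ⟨rfl, rfl⟩ := ihN h2 h2'
    exact ⟨rfl, rfl⟩
  | var x =>
    intro P m n m' n' h h'
    simp only [Ty] at h h'
    split_ifs at h h' <;> omega
  | trace i M ih =>
    intro P m n m' n' h h'
    have := ih (P := P) h h'
    omega
  | link x y M ih =>
    intro P m n m' n' h h'
    exact ih h.2.2.2 h'.2.2.2

theorem Ty.congr {M : Term S A} : ∀ {P Q : A → Bool} {m n : ℕ},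
    (∀ z ∈ fv M, P z = Q z) → Ty P M m n → Ty Q M m n := by
  induction M with
  | const k | zero | one | sym => intro P Q m n _ h; exact h
  | comp M N ihM ihN =>
    intro P Q m n hPQ h
    obtain ⟨hd, k, h1, h2⟩ := h
    exact ⟨hd, k, ihM (fun z hz => hPQ z (by simp [fv, hz])) h1,
      ihN (fun z hz => hPQ z (by simp [fv, hz])) h2⟩
  | tensor M N ihM ihN =>
    intro P Q m n hPQ h
    obtain ⟨hd, a, b, c, d, rfl, rfl, h1, h2⟩ := h
    exact ⟨hd, a, b, c, d, rfl, rfl, ihM (fun z hz => hPQ z (by simp [fv, hz])) h1,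
      ihN (fun z hz => hPQ z (by simp [fv, hz])) h2⟩
  | var x =>
    intro P Q m n hPQ h
    simp only [Ty] at h ⊢
    rwa [← hPQ x (by simp [fv])]
  | trace i M ih => intro P Q m n hPQ h; exact ih (P := P) hPQ h
  | link x y M ih =>
    intro P Q m n hPQ h
    exact ⟨h.1, h.2.1, h.2.2.1, ih (polUpdate_congr hPQ) h.2.2.2⟩

theorem graphP_congr {M : Term S A} : ∀ {P Q : A → Bool},
    (∀ z ∈ fv M, P z = Q z) → graphP P M = graphP Q M := by
  induction M with
  | const k | zero | one | sym => intros; rfl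
  | comp M N ihM ihN | tensor M N ihM ihN =>
    intro P Q h
    simp only [graphP]
    rw [ihM (fun z hz => h z (by simp [fv, hz])), ihN (fun z hz => h z (by simp [fv, hz]))]
  | var x => intro P Q h; simp only [graphP]; rw [h x (by simp [fv])]
  | trace i M ih => intro P Q h; simp only [graphP]; rw [ih h]
  | link x y M ih =>
    intro P Q h
    simp only [graphP]
    rw [ih (polUpdate_congr h)]

/-- The input variables of `M`. -/
def ctxIn (P : A → Bool) (M : Term S A) : Finset A := (fv M).filter (fun z => P z = true)

/-- The output variables of `M`. -/
def ctxOut (P : A → Bool) (M : Term S A) : Finset A := (fv M).filter (fun z => P z = false)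

theorem ctx_union (P : A → Bool) (M : Term S A) : ctxIn P M ∪ ctxOut P M = fv M := by
  ext z
  simp only [ctxIn, ctxOut, Finset.mem_union, Finset.mem_filter]
  cases P z <;> simp

theorem ctxIn_comp (P : A → Bool) (M N : Term S A) :
    ctxIn P (.comp M N) = ctxIn P M ∪ ctxIn P N := Finset.filter_union _ _ _

theorem ctxOut_comp (P : A → Bool) (M N : Term S A) :
    ctxOut P (.comp M N) = ctxOut P M ∪ ctxOut P N := Finset.filter_union _ _ _

theorem ctxIn_tensor (P : A → Bool) (M N : Term S A) :
    ctxIn P (.tensor M N) = ctxIn P M ∪ ctxIn P N := Finset.filter_union _ _ _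

theorem ctxOut_tensor (P : A → Bool) (M N : Term S A) :
    ctxOut P (.tensor M N) = ctxOut P M ∪ ctxOut P N := Finset.filter_union _ _ _

theorem ctxIn_link (P : A → Bool) {x y : A} {M : Term S A} (hxy : x ≠ y) (hy : y ∈ fv M) :
    ctxIn (polUpdate P x y) M = insert y (ctxIn P (.link x y M)) := by
  ext z
  simp only [ctxIn, fv, Finset.mem_filter, Finset.mem_insert, Finset.mem_sdiff,
    Finset.mem_singleton]
  by_cases h1 : z = y
  · subst h1; simp [polUpdate_right, hy]
  · by_cases h2 : z = x
    · subst h2; simp [polUpdate_left hxy, hxy]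
    · rw [polUpdate_of_ne h2 h1]; simp [h1, h2]

theorem ctxOut_link (P : A → Bool) {x y : A} {M : Term S A} (hxy : x ≠ y) (hx : x ∈ fv M) :
    ctxOut (polUpdate P x y) M = insert x (ctxOut P (.link x y M)) := by
  ext z
  simp only [ctxOut, fv, Finset.mem_filter, Finset.mem_insert, Finset.mem_sdiff,
    Finset.mem_singleton]
  by_cases h1 : z = y
  · subst h1; simp [polUpdate_right, hxy.symm]
  · by_cases h2 : z = x
    · subst h2; simp [polUpdate_left hxy, hx]
    · rw [polUpdate_of_ne h2 h1]; simp [h1, h2]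

/-- Typing relative to a polarity is derivability, in the contexts of the free variables. -/
theorem Ty.hasType {M : Term S A} : ∀ {P : A → Bool} {m n : ℕ},
    Ty P M m n → HasType (ctxIn P M) (ctxOut P M) M m n := by
  induction M with
  | const k => rintro P m n ⟨rfl, rfl⟩; exact ⟨.const k⟩
  | zero => rintro P m n ⟨rfl, rfl⟩; exact ⟨.zero⟩
  | one => rintro P m n ⟨rfl, rfl⟩; exact ⟨.one⟩
  | sym => rintro P m n ⟨rfl, rfl⟩; exact ⟨.sym⟩
  | comp M N ihM ihN =>
    rintro P m n ⟨hd, k, h1, h2⟩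
    obtain ⟨d⟩ := ihM h1
    obtain ⟨e⟩ := ihN h2
    rw [ctxIn_comp, ctxOut_comp]
    exact ⟨.comp (by rwa [ctx_union, ctx_union]) d e⟩
  | tensor M N ihM ihN =>
    rintro P m n ⟨hd, a, b, c, d, rfl, rfl, h1, h2⟩
    obtain ⟨d⟩ := ihM h1
    obtain ⟨e⟩ := ihN h2
    rw [ctxIn_tensor, ctxOut_tensor]
    exact ⟨.tensor (by rwa [ctx_union, ctx_union]) d e⟩
  | var x =>
    intro P m n h
    simp only [Ty] at h
    split_ifs at h with hP <;> obtain ⟨rfl, rfl⟩ := h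
    · have h1 : ctxIn P (.var x : Term S A) = {x} := by simp [ctxIn, fv, hP]
      have h2 : ctxOut P (.var x : Term S A) = ∅ := by simp [ctxOut, fv, hP]
      rw [h1, h2]; exact ⟨.inVar x⟩
    · have h1 : ctxIn P (.var x : Term S A) = ∅ := by simp [ctxIn, fv, hP]
      have h2 : ctxOut P (.var x : Term S A) = {x} := by simp [ctxOut, fv, hP]
      rw [h1, h2]; exact ⟨.outVar x⟩
  | trace i M ih =>
    intro P m n h
    obtain ⟨d⟩ := ih (P := P) h
    exact ⟨.trace i d⟩
  | link x y M ih =>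
    rintro P m n ⟨hx, hy, hxy, h⟩
    obtain ⟨d⟩ := ih h
    rw [ctxIn_link P hxy hy, ctxOut_link P hxy hx] at d
    refine ⟨.link x y ?_ ?_ d⟩ <;> simp [ctxIn, ctxOut, fv]

theorem Derivation.ctx {Γ Δ : Finset A} {M : Term S A} {m n : ℕ} (d : Derivation Γ Δ M m n) :
    Disjoint Γ Δ ∧ fv M = Γ ∪ Δ := by
  induction d with
  | inVar x | outVar x | const k | zero | one | sym => simp [fv]
  | comp h d e ih1 ih2 | tensor h d e ih1 ih2 =>
    obtain ⟨h1, h1'⟩ := ih1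
    obtain ⟨h2, h2'⟩ := ih2
    simp only [Finset.disjoint_union_left, Finset.disjoint_union_right] at h ⊢
    have h3 := h.1.2.symm
    have h4 := h.2.1.symm
    have h5 := h.1.2
    have h6 := h.2.1
    refine ⟨by tauto, ?_⟩
    · simp only [fv, h1', h2']; ext z; simp; tauto
  | trace i d ih => exact ih
  | @link Γ Δ M m n x y hx hy d ih =>
    obtain ⟨h1, h2⟩ := ih
    simp only [Finset.disjoint_insert_left, Finset.disjoint_insert_right, Finset.mem_insert,
      not_or] at h1
    refine ⟨h1.2.2, ?_⟩
    simp only [fv, h2]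
    ext z
    simp only [Finset.mem_sdiff, Finset.mem_union, Finset.mem_insert, Finset.mem_singleton]
    constructor
    · tauto
    · intro hz
      have : z ≠ x := by rintro rfl; tauto
      have : z ≠ y := by rintro rfl; tauto
      tauto

/-- Once the polarities are fixed, the graph of a derivation is determined by the term. -/
theorem Derivation.ty {Γ Δ : Finset A} {M : Term S A} {m n : ℕ} (d : Derivation Γ Δ M m n) :
    ∀ {P : A → Bool}, (∀ z ∈ Γ, P z = true) → (∀ z ∈ Δ, P z = false) →
      Ty P M m n ∧ graphP P M = d.graph := by
  induction d with
  | inVar x | outVar x => intro P h1 h2; simp_all [Ty, graphP, Derivation.graph]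
  | const k | zero | one | sym => intros; exact ⟨⟨rfl, rfl⟩, rfl⟩
  | comp h d e ih1 ih2 =>
    intro P h1 h2
    simp only [Finset.mem_union] at h1 h2
    obtain ⟨t1, g1⟩ := ih1 (P := P) (fun z hz => h1 z (.inl hz)) (fun z hz => h2 z (.inl hz))
    obtain ⟨t2, g2⟩ := ih2 (P := P) (fun z hz => h1 z (.inr hz)) (fun z hz => h2 z (.inr hz))
    refine ⟨⟨by rwa [d.ctx.2, e.ctx.2], _, t1, t2⟩, ?_⟩
    simp only [graphP, Derivation.graph, g1, g2]
  | tensor h d e ih1 ih2 =>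
    intro P h1 h2
    simp only [Finset.mem_union] at h1 h2
    obtain ⟨t1, g1⟩ := ih1 (P := P) (fun z hz => h1 z (.inl hz)) (fun z hz => h2 z (.inl hz))
    obtain ⟨t2, g2⟩ := ih2 (P := P) (fun z hz => h1 z (.inr hz)) (fun z hz => h2 z (.inr hz))
    refine ⟨⟨by rwa [d.ctx.2, e.ctx.2], _, _, _, _, rfl, rfl, t1, t2⟩, ?_⟩
    simp only [graphP, Derivation.graph, g1, g2]
  | trace i d ih =>
    intro P h1 h2
    refine ⟨(ih h1 h2).1, ?_⟩
    simp only [graphP, Derivation.graph, (ih h1 h2).2]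
  | @link Γ Δ M m n x y hx hy d ih =>
    intro P h1 h2
    have hd := d.ctx.1
    simp only [Finset.disjoint_insert_left, Finset.disjoint_insert_right, Finset.mem_insert,
      not_or] at hd
    have hxy : x ≠ y := fun h => hd.1.1 h
    have key := ih (P := polUpdate P x y) (fun z hz => ?_) (fun z hz => ?_)
    · refine ⟨⟨by simp [d.ctx.2], by simp [d.ctx.2], hxy, key.1⟩, ?_⟩
      simp only [graphP, Derivation.graph, key.2]
    · rcases Finset.mem_insert.1 hz with rfl | hz
      · exact polUpdate_right
      · rw [polUpdate_of_ne, h1 z hz] <;> rintro rfl <;> tauto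
    · rcases Finset.mem_insert.1 hz with rfl | hz
      · exact polUpdate_left hxy
      · rw [polUpdate_of_ne, h2 z hz] <;> rintro rfl <;> tauto

theorem Derivation.ctx_eq {Γ Δ : Finset A} {M : Term S A} {m n : ℕ} (d : Derivation Γ Δ M m n)
    {P : A → Bool} (h1 : ∀ z ∈ Γ, P z = true) (h2 : ∀ z ∈ Δ, P z = false) :
    ctxIn P M = Γ ∧ ctxOut P M = Δ := by
  constructor <;> ext z <;> simp only [ctxIn, ctxOut, d.ctx.2, Finset.mem_filter, Finset.mem_union]
  · exact ⟨fun h => h.1.resolve_right fun hz => by simp [h2 z hz] at h, fun h => ⟨.inl h, h1 z h⟩⟩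
  · exact ⟨fun h => h.1.resolve_left fun hz => by simp [h1 z hz] at h, fun h => ⟨.inr h, h2 z h⟩⟩

/-! ### The algebra of terms modulo provable equality -/

/-- `M` and `N` have the same types with respect to the polarity `P`, and are provably equal at
each of them. Ill-typed terms are all related, which makes this relation a congruence for all term
formers without side conditions. -/
def Eqv (P : A → Bool) (M N : Term S A) : Prop :=
  ∀ m n, Ty P M m n ∨ Ty P N m n →
    Ty P M m n ∧ Ty P N m n ∧ fv M = fv N ∧ Provable (ctxIn P M) (ctxOut P M) m n M N

theorem ctxIn_congr {P : A → Bool} {M N : Term S A} (h : fv M = fv N) : ctxIn P M = ctxIn P N := by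
  simp only [ctxIn, h]

theorem ctxOut_congr {P : A → Bool} {M N : Term S A} (h : fv M = fv N) :
    ctxOut P M = ctxOut P N := by
  simp only [ctxOut, h]

theorem Eqv.refl (P : A → Bool) (M : Term S A) : Eqv P M M := by
  intro m n h
  have h : Ty P M m n := by tauto
  exact ⟨h, h, rfl, .refl h.hasType⟩

theorem Eqv.symm {P : A → Bool} {M N : Term S A} (h : Eqv P M N) : Eqv P N M := by
  intro m n h'
  obtain ⟨h1, h2, h3, h4⟩ := h m n h'.symm
  refine ⟨h2, h1, h3.symm, ?_⟩
  rw [← ctxIn_congr h3, ← ctxOut_congr h3]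
  exact h4.symm

theorem Eqv.trans {P : A → Bool} {M N K : Term S A} (h : Eqv P M N) (h' : Eqv P N K) :
    Eqv P M K := by
  have key : ∀ m n, Ty P M m n → Ty P N m n → Ty P K m n → Ty P M m n ∧ Ty P K m n ∧
      fv M = fv K ∧ Provable (ctxIn P M) (ctxOut P M) m n M K := by
    intro m n h1 h2 h3
    obtain ⟨-, -, a3, a4⟩ := h m n (.inl h1)
    obtain ⟨-, -, b3, b4⟩ := h' m n (.inl h2)
    rw [← ctxIn_congr a3, ← ctxOut_congr a3] at b4
    exact ⟨h1, h3, a3.trans b3, a4.trans b4⟩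
  rintro m n (h1 | h3)
  · have h2 := (h m n (.inl h1)).2.1
    exact key m n h1 h2 (h' m n (.inl h2)).2.1
  · have h2 := (h' m n (.inr h3)).1
    exact key m n (h m n (.inr h2)).1 h2 h3

theorem Eqv.ty_iff {P : A → Bool} {M N : Term S A} (h : Eqv P M N) (m n : ℕ) :
    Ty P M m n ↔ Ty P N m n :=
  ⟨fun h1 => (h m n (.inl h1)).2.1, fun h1 => (h m n (.inr h1)).1⟩

theorem Eqv.comp {P : A → Bool} {M M' N N' : Term S A} (h : Eqv P M M') (h' : Eqv P N N') :
    Eqv P (.comp M N) (.comp M' N') := by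
  have key : ∀ m k n, Ty P M m k → Ty P N k n → (fv M = fv M' → fv N = fv N' →
      Disjoint (fv M) (fv N)) →
      Ty P (.comp M N) m n ∧ Ty P (.comp M' N') m n ∧ fv (.comp M N) = fv (.comp M' N') ∧
        Provable (ctxIn P (.comp M N)) (ctxOut P (.comp M N)) m n (.comp M N) (.comp M' N') := by
    intro m k n h1 h2 hd
    obtain ⟨a1, a2, a3, a4⟩ := h m k (.inl h1)
    obtain ⟨b1, b2, b3, b4⟩ := h' k n (.inl h2)
    have hd := hd a3 b3
    refine ⟨⟨hd, k, a1, b1⟩, ⟨by rwa [← a3, ← b3], k, a2, b2⟩, by simp only [fv, a3, b3], ?_⟩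
    rw [ctxIn_comp, ctxOut_comp]
    exact .comp (by rwa [ctx_union, ctx_union]) a4 b4
  rintro m n (⟨hd, k, h1, h2⟩ | ⟨hd, k, h1, h2⟩)
  · exact key m k n h1 h2 fun _ _ => hd
  · exact key m k n ((h.ty_iff m k).2 h1) ((h'.ty_iff k n).2 h2) fun e e' => by rwa [e, e']

theorem Eqv.tensor {P : A → Bool} {M M' N N' : Term S A} (h : Eqv P M M') (h' : Eqv P N N') :
    Eqv P (.tensor M N) (.tensor M' N') := by
  have key : ∀ m k m' k', Ty P M m k → Ty P N m' k' → (fv M = fv M' → fv N = fv N' →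
      Disjoint (fv M) (fv N)) →
      Ty P (.tensor M N) (m + m') (k + k') ∧ Ty P (.tensor M' N') (m + m') (k + k') ∧
        fv (.tensor M N) = fv (.tensor M' N') ∧
        Provable (ctxIn P (.tensor M N)) (ctxOut P (.tensor M N)) (m + m') (k + k')
          (.tensor M N) (.tensor M' N') := by
    intro m k m' k' h1 h2 hd
    obtain ⟨a1, a2, a3, a4⟩ := h m k (.inl h1)
    obtain ⟨b1, b2, b3, b4⟩ := h' m' k' (.inl h2)
    have hd := hd a3 b3
    refine ⟨⟨hd, _, _, _, _, rfl, rfl, a1, b1⟩,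
      ⟨by rwa [← a3, ← b3], _, _, _, _, rfl, rfl, a2, b2⟩, by simp only [fv, a3, b3], ?_⟩
    rw [ctxIn_tensor, ctxOut_tensor]
    exact .tensor (by rwa [ctx_union, ctx_union]) a4 b4
  rintro m n (⟨hd, a, b, c, d, rfl, rfl, h1, h2⟩ | ⟨hd, a, b, c, d, rfl, rfl, h1, h2⟩)
  · exact key a b c d h1 h2 fun _ _ => hd
  · exact key a b c d ((h.ty_iff _ _).2 h1) ((h'.ty_iff _ _).2 h2) fun e e' => by rwa [e, e']

theorem Eqv.trace {P : A → Bool} {M M' : Term S A} (i : ℕ) (h : Eqv P M M') :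
    Eqv P (.trace i M) (.trace i M') := by
  intro m n h'
  obtain ⟨h1, h2, h3, h4⟩ := h (m + i) (n + i) h'
  exact ⟨h1, h2, h3, .trace i h4⟩

theorem Eqv.link {P : A → Bool} {M M' : Term S A} (x y : A) (h : Eqv (polUpdate P x y) M M') :
    Eqv P (.link x y M) (.link x y M') := by
  have key : ∀ m n, Ty (polUpdate P x y) M m n → x ≠ y → (fv M = fv M' → x ∈ fv M ∧ y ∈ fv M) →
      Ty P (.link x y M) m n ∧ Ty P (.link x y M') m n ∧ fv (.link x y M) = fv (.link x y M') ∧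
        Provable (ctxIn P (.link x y M)) (ctxOut P (.link x y M)) m n
          (.link x y M) (.link x y M') := by
    intro m n h1 hxy hm
    obtain ⟨a1, a2, a3, a4⟩ := h m n (.inl h1)
    obtain ⟨hx, hy⟩ := hm a3
    refine ⟨⟨hx, hy, hxy, a1⟩, ⟨a3 ▸ hx, a3 ▸ hy, hxy, a2⟩, by simp only [fv, a3], ?_⟩
    rw [ctxIn_link P hxy hy, ctxOut_link P hxy hx] at a4
    exact .link x y (by simp [ctxOut, fv]) (by simp [ctxIn, fv]) a4
  rintro m n (⟨hx, hy, hxy, h1⟩ | ⟨hx, hy, hxy, h1⟩)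
  · exact key m n h1 hxy fun _ => ⟨hx, hy⟩
  · exact key m n ((h.ty_iff _ _).2 h1) hxy fun e => ⟨e ▸ hx, e ▸ hy⟩

/-- An equation both of whose sides have the same types and variables. -/
theorem Eqv.of_equation {P : A → Bool} {M N : Term S A}
    (h : ∀ m n, Ty P M m n ∨ Ty P N m n → Ty P M m n ∧ Ty P N m n ∧ fv M = fv N ∧
      Equation (ctxIn P M) (ctxOut P M) M N) : Eqv P M N := by
  intro m n h'
  obtain ⟨h1, h2, h3, h4⟩ := h m n h'
  refine ⟨h1, h2, h3, .ax h4 h1.hasType ?_⟩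
  rw [ctxIn_congr h3, ctxOut_congr h3]
  exact h2.hasType

/-- The setoid of provable equality. -/
def eqvSetoid (S : Signature.{u}) (P : A → Bool) : Setoid (Term S A) :=
  ⟨Eqv P, Eqv.refl P, Eqv.symm, Eqv.trans⟩

/-- Terms modulo provable equality, for names of fixed polarities. Composition is written `*` and
tensor `+`: the latter makes this a monoid with unit the empty diagram, and arities add up. -/
def Cl (S : Signature.{u}) (P : A → Bool) : Type (max u v) := Quotient (eqvSetoid S P)

/-- The class of a term. -/
def cl (P : A → Bool) (M : Term S A) : Cl S P := Quotient.mk (eqvSetoid S P) M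

theorem cl_eq {P : A → Bool} {M N : Term S A} : cl P M = cl P N ↔ Eqv P M N :=
  Quotient.eq (r := eqvSetoid S P)

theorem Cl.ind {P : A → Bool} {p : Cl S P → Prop} (h : ∀ M, p (cl P M)) (a : Cl S P) : p a :=
  Quotient.ind (s := eqvSetoid S P) h a

theorem Ty.id (P : A → Bool) (n : ℕ) : Ty P (idn n : Term S A) n n := by
  induction n with
  | zero => exact ⟨rfl, rfl⟩
  | succ n ih => exact ⟨by simp [fv], n, n, 1, 1, rfl, rfl, ih, rfl, rfl⟩

theorem fv_idn (n : ℕ) : fv (idn n : Term S A) = ∅ := by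
  induction n with
  | zero => rfl
  | succ n ih => simp [idn, fv, ih]

theorem Eqv.comp_assoc (P : A → Bool) (M N K : Term S A) :
    Eqv P (.comp (.comp M N) K) (.comp M (.comp N K)) := by
  refine .of_equation fun m n h => ?_
  have : Ty P (.comp (.comp M N) K) m n ↔ Ty P (.comp M (.comp N K)) m n := by
    simp only [Ty, fv, Finset.disjoint_union_left, Finset.disjoint_union_right]
    constructor
    · rintro ⟨⟨h1, h2⟩, k, ⟨h3, l, h4, h5⟩, h6⟩
      exact ⟨⟨h3, h1⟩, l, h4, h2, k, h5, h6⟩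
    · rintro ⟨⟨h3, h1⟩, l, h4, h2, k, h5, h6⟩
      exact ⟨⟨h1, h2⟩, k, ⟨h3, l, h4, h5⟩, h6⟩
  exact ⟨by tauto, by tauto, Finset.union_assoc _ _ _, .comp_assoc _ _ _⟩

theorem Eqv.tensor_assoc (P : A → Bool) (M N K : Term S A) :
    Eqv P (.tensor (.tensor M N) K) (.tensor M (.tensor N K)) := by
  refine .of_equation fun m n h => ?_
  have : Ty P (.tensor (.tensor M N) K) m n ↔ Ty P (.tensor M (.tensor N K)) m n := by
    simp only [Ty, fv, Finset.disjoint_union_left, Finset.disjoint_union_right]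
    constructor
    · rintro ⟨⟨h1, h2⟩, _, _, c, d, rfl, rfl, ⟨h3, a', b', c', d', rfl, rfl, h4, h5⟩, h6⟩
      exact ⟨⟨h3, h1⟩, a', b', _, _, add_assoc _ _ _, add_assoc _ _ _, h4, h2, _, _, _, _, rfl, rfl,
        h5, h6⟩
    · rintro ⟨⟨h3, h1⟩, a', b', _, _, rfl, rfl, h4, h2, _, _, _, _, rfl, rfl, h5, h6⟩
      exact ⟨⟨h1, h2⟩, _, _, _, _, (add_assoc _ _ _).symm, (add_assoc _ _ _).symm,
        ⟨h3, _, _, _, _, rfl, rfl, h4, h5⟩, h6⟩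
  exact ⟨by tauto, by tauto, Finset.union_assoc _ _ _, .tensor_assoc _ _ _⟩

theorem Eqv.tensor_zero (P : A → Bool) (M : Term S A) : Eqv P (.tensor M .zero) M := by
  refine .of_equation fun m n h => ?_
  have : Ty P (.tensor M .zero) m n ↔ Ty P M m n := by
    simp only [Ty, fv]
    constructor
    · rintro ⟨-, _, _, _, _, rfl, rfl, h1, rfl, rfl⟩; exact h1
    · intro h; exact ⟨by simp, m, n, 0, 0, rfl, rfl, h, rfl, rfl⟩
  exact ⟨by tauto, by tauto, by simp [fv], .tensor_zero _⟩

theorem Eqv.zero_tensor (P : A → Bool) (M : Term S A) : Eqv P (.tensor .zero M) M := by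
  refine .of_equation fun m n h => ?_
  have : Ty P (.tensor .zero M) m n ↔ Ty P M m n := by
    simp only [Ty, fv]
    constructor
    · rintro ⟨-, _, _, _, _, rfl, rfl, ⟨rfl, rfl⟩, h1⟩; simpa using h1
    · intro h; exact ⟨by simp, 0, 0, m, n, by simp, by simp, ⟨rfl, rfl⟩, h⟩
  exact ⟨by tauto, by tauto, by simp [fv], .zero_tensor _⟩

namespace Cl

variable {P : A → Bool}

instance : Semigroup (Cl S P) where
  mul := Quotient.map₂ .comp fun _ _ h _ _ h' => h.comp h'
  mul_assoc a b c := by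
    induction a, b, c using Quotient.inductionOn₃ with
    | h M N K => exact cl_eq.2 (.comp_assoc P M N K)

instance : Add (Cl S P) :=
  ⟨Quotient.map₂ .tensor fun _ _ h _ _ h' => h.tensor h'⟩

instance : Zero (Cl S P) := ⟨cl P .zero⟩

instance : AddMonoid (Cl S P) where
  add_assoc a b c := by
    induction a, b, c using Quotient.inductionOn₃ with
    | h M N K => exact cl_eq.2 (.tensor_assoc P M N K)
  add_zero a := by
    induction a using Quotient.inductionOn with
    | h M => exact cl_eq.2 (.tensor_zero P M)
  zero_add a := by
    induction a using Quotient.inductionOn with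
    | h M => exact cl_eq.2 (.zero_tensor P M)
  nsmul := nsmulRec

/-- The trace of a class. -/
def trace (i : ℕ) : Cl S P → Cl S P := Quotient.map (.trace i) fun _ _ h => h.trace i

open Classical in
/-- The link of `x` and `y` in a class. It is meaningful if `x` is an output and `y` an input
according to `P`. -/
noncomputable def link (x y : A) : Cl S P → Cl S P :=
  Quotient.lift (fun M => if polUpdate P x y = P then cl P (.link x y M) else 0) fun M N h => by
    split_ifs with hP
    · exact cl_eq.2 (.link x y (by rw [hP]; exact h))
    · rfl

/-- The types of a class. -/
def HasTy (a : Cl S P) (m n : ℕ) : Prop :=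
  Quotient.lift (fun M => Ty P M m n) (fun _ _ h => propext (Eqv.ty_iff h m n)) a

open Classical in
/-- The free variables of a class of typed terms; none if the terms are ill-typed. -/
noncomputable def fvs (a : Cl S P) : Finset A :=
  Quotient.lift (fun M : Term S A => if ∃ m n, Ty P M m n then fv M else ∅) (fun M N h => by
    by_cases h' : ∃ m n, Ty P M m n
    · obtain ⟨m, n, h1⟩ := h'
      obtain ⟨-, h2, h3, -⟩ := h m n (.inl h1)
      rw [if_pos ⟨m, n, h1⟩, if_pos ⟨m, n, h2⟩, h3]
    · have h2 : ¬ ∃ m n, Ty P N m n := fun ⟨m, n, h2⟩ => h' ⟨m, n, (h.ty_iff m n).2 h2⟩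
      rw [if_neg h', if_neg h2]) a

/-- The identity at `n`. -/
def id (n : ℕ) : Cl S P := cl P (idn n)

/-- A variable. -/
def var (x : A) : Cl S P := cl P (.var x)

theorem cl_comp (M N : Term S A) : cl P (.comp M N) = cl P M * cl P N := rfl

theorem cl_tensor (M N : Term S A) : cl P (.tensor M N) = cl P M + cl P N := rfl

theorem cl_trace (i : ℕ) (M : Term S A) : cl P (.trace i M) = (cl P M).trace i := rfl

theorem cl_link {x y : A} (hx : P x = false) (hy : P y = true) (M : Term S A) :
    cl P (.link x y M) = (cl P M).link x y :=
  (if_pos (polUpdate_self hx hy)).symm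

theorem hasTy_cl {M : Term S A} {m n : ℕ} : (cl P M).HasTy m n ↔ Ty P M m n := Iff.rfl

theorem fvs_cl {M : Term S A} {m n : ℕ} (h : Ty P M m n) : (cl P M).fvs = fv M :=
  if_pos ⟨m, n, h⟩

theorem fvs_cl_subset {M : Term S A} : (cl P M).fvs ⊆ fv M := by
  by_cases h : ∃ m n, Ty P M m n
  · obtain ⟨m, n, h⟩ := h; rw [fvs_cl h]
  · have : (cl P M).fvs = ∅ := if_neg h
    simp [this]

/-- Every class has a representative with no other free variables than those of the class. -/
theorem exists_rep (a : Cl S P) : ∃ M : Term S A, cl P M = a ∧ fv M = a.fvs := by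
  induction a using Cl.ind with
  | h M =>
    by_cases h : ∃ m n, Ty P M m n
    · obtain ⟨m, n, h⟩ := h; exact ⟨M, rfl, (fvs_cl h).symm⟩
    -- an ill-typed closed term
    · have h0 : ∀ m n, ¬ Ty P (.comp .one .zero : Term S A) m n := by
        rintro m n ⟨-, k, ⟨-, rfl⟩, h, -⟩
        exact one_ne_zero h
      refine ⟨.comp .one .zero, cl_eq.2 fun m n h' => ?_, ?_⟩
      · exact (h'.elim (h0 m n) fun h'' => h ⟨m, n, h''⟩).elim
      · have : (cl P M).fvs = ∅ := if_neg h
        rw [this]; rfl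

theorem HasTy.unique {a : Cl S P} {m n m' n' : ℕ} (h : a.HasTy m n) (h' : a.HasTy m' n') :
    m = m' ∧ n = n' := by
  induction a using Cl.ind with
  | h M => exact Ty.unique h h'

theorem hasTy_mul {a b : Cl S P} {m n : ℕ} :
    (a * b).HasTy m n ↔ Disjoint a.fvs b.fvs ∧ ∃ k, a.HasTy m k ∧ b.HasTy k n := by
  induction a using Cl.ind with
  | h M =>
    induction b using Cl.ind with
    | h N =>
      constructor
      · rintro ⟨hd, k, h1, h2⟩
        exact ⟨by rwa [fvs_cl h1, fvs_cl h2], k, h1, h2⟩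
      · rintro ⟨hd, k, h1, h2⟩
        exact ⟨by rwa [fvs_cl h1, fvs_cl h2] at hd, k, h1, h2⟩

theorem hasTy_add {a b : Cl S P} {m n : ℕ} :
    (a + b).HasTy m n ↔ Disjoint a.fvs b.fvs ∧
      ∃ m₁ n₁ m₂ n₂, m = m₁ + m₂ ∧ n = n₁ + n₂ ∧ a.HasTy m₁ n₁ ∧ b.HasTy m₂ n₂ := by
  induction a using Cl.ind with
  | h M =>
    induction b using Cl.ind with
    | h N =>
      constructor
      · rintro ⟨hd, _, _, _, _, rfl, rfl, h1, h2⟩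
        exact ⟨by rwa [fvs_cl h1, fvs_cl h2], _, _, _, _, rfl, rfl, h1, h2⟩
      · rintro ⟨hd, _, _, _, _, rfl, rfl, h1, h2⟩
        exact ⟨by rwa [fvs_cl h1, fvs_cl h2] at hd, _, _, _, _, rfl, rfl, h1, h2⟩

theorem HasTy.mul {a b : Cl S P} {m k n : ℕ} (h : a.HasTy m k) (h' : b.HasTy k n)
    (hd : Disjoint a.fvs b.fvs) : (a * b).HasTy m n := hasTy_mul.2 ⟨hd, k, h, h'⟩

theorem HasTy.add {a b : Cl S P} {m k m' k' : ℕ} (h : a.HasTy m k) (h' : b.HasTy m' k')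
    (hd : Disjoint a.fvs b.fvs) : (a + b).HasTy (m + m') (k + k') :=
  hasTy_add.2 ⟨hd, _, _, _, _, rfl, rfl, h, h'⟩

theorem fvs_mul_subset (a b : Cl S P) : (a * b).fvs ⊆ a.fvs ∪ b.fvs := by
  obtain ⟨M, rfl, hM⟩ := exists_rep a
  obtain ⟨N, rfl, hN⟩ := exists_rep b
  rw [← hM, ← hN]
  exact fvs_cl_subset (M := .comp M N)

theorem fvs_add_subset (a b : Cl S P) : (a + b).fvs ⊆ a.fvs ∪ b.fvs := by
  obtain ⟨M, rfl, hM⟩ := exists_rep a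
  obtain ⟨N, rfl, hN⟩ := exists_rep b
  rw [← hM, ← hN]
  exact fvs_cl_subset (M := .tensor M N)

theorem fvs_mul {a b : Cl S P} {m n : ℕ} (h : (a * b).HasTy m n) :
    (a * b).fvs = a.fvs ∪ b.fvs := by
  induction a using Cl.ind with
  | h M =>
    induction b using Cl.ind with
    | h N =>
      have h' : Ty P (.comp M N) m n := h
      obtain ⟨-, k, h1, h2⟩ := h'
      rw [← cl_comp, fvs_cl h, fvs_cl h1, fvs_cl h2]; rfl

theorem fvs_add {a b : Cl S P} {m n : ℕ} (h : (a + b).HasTy m n) :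
    (a + b).fvs = a.fvs ∪ b.fvs := by
  induction a using Cl.ind with
  | h M =>
    induction b using Cl.ind with
    | h N =>
      have h' : Ty P (.tensor M N) m n := h
      obtain ⟨-, _, _, _, _, rfl, rfl, h1, h2⟩ := h'
      rw [← cl_tensor, fvs_cl h, fvs_cl h1, fvs_cl h2]; rfl

theorem hasTy_link {x y : A} (hx : P x = false) (hy : P y = true) {a : Cl S P} {m n : ℕ} :
    (a.link x y).HasTy m n ↔ x ∈ a.fvs ∧ y ∈ a.fvs ∧ a.HasTy m n := by
  induction a using Cl.ind with
  | h M =>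
    rw [← cl_link hx hy, hasTy_cl]
    simp only [Ty, polUpdate_self hx hy]
    constructor
    · rintro ⟨h1, h2, -, h3⟩; exact ⟨by rwa [fvs_cl h3], by rwa [fvs_cl h3], h3⟩
    · rintro ⟨h1, h2, h3⟩
      refine ⟨by rwa [fvs_cl h3] at h1, by rwa [fvs_cl h3] at h2, ?_, h3⟩
      rintro rfl
      simp [hx] at hy

theorem fvs_link {x y : A} (hx : P x = false) (hy : P y = true) {a : Cl S P} {m n : ℕ}
    (h : (a.link x y).HasTy m n) : (a.link x y).fvs = a.fvs \ {x, y} := by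
  have ha := ((hasTy_link hx hy).1 h).2.2
  induction a using Cl.ind with
  | h M =>
    rw [← cl_link hx hy] at h ⊢
    rw [fvs_cl h, fvs_cl ha]; rfl

theorem fvs_link_subset {x y : A} (hx : P x = false) (hy : P y = true) (a : Cl S P) :
    (a.link x y).fvs ⊆ a.fvs \ {x, y} := by
  obtain ⟨M, rfl, hM⟩ := exists_rep a
  rw [← hM, ← cl_link hx hy]
  exact fvs_cl_subset (M := .link x y M)

theorem hasTy_id (n : ℕ) : (id n : Cl S P).HasTy n n := Ty.id P n

theorem hasTy_zero : (0 : Cl S P).HasTy 0 0 := ⟨rfl, rfl⟩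

@[simp] theorem fvs_id (n : ℕ) : (id n : Cl S P).fvs = ∅ := by
  rw [id, fvs_cl (Ty.id P n), fv_idn]

@[simp] theorem fvs_zero : (0 : Cl S P).fvs = ∅ := fvs_id 0

theorem id_zero : (id 0 : Cl S P) = 0 := rfl

theorem id_one : (id 1 : Cl S P) = cl P .one := zero_add (cl P .one)

theorem id_succ (n : ℕ) : (id (n + 1) : Cl S P) = id n + id 1 := by
  rw [id_one]; rfl

theorem id_add (m n : ℕ) : (id (m + n) : Cl S P) = id m + id n := by
  induction n with
  | zero => simp [id_zero]
  | succ n ih => rw [← add_assoc, id_succ, ih, id_succ n, add_assoc]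

theorem hasTy_var_in {x : A} (hx : P x = true) : (var x : Cl S P).HasTy 0 1 := by
  change Ty P (.var x : Term S A) 0 1
  simp [Ty, hx]

theorem hasTy_var_out {x : A} (hx : P x = false) : (var x : Cl S P).HasTy 1 0 := by
  change Ty P (.var x : Term S A) 1 0
  simp [Ty, hx]

@[simp] theorem fvs_var (x : A) : (var x : Cl S P).fvs = {x} := by
  cases hx : P x
  · rw [var, fvs_cl (hasTy_var_out hx)]; rfl
  · rw [var, fvs_cl (hasTy_var_in hx)]; rfl

end Cl

/-! ### The equations between classes -/

theorem ty_polUpdate {P : A → Bool} {x y : A} {N : Term S A} (hx : x ∉ fv N) (hy : y ∉ fv N)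
    {m n : ℕ} : Ty (polUpdate P x y) N m n ↔ Ty P N m n := by
  have h : ∀ z ∈ fv N, polUpdate P x y z = P z := fun z hz =>
    polUpdate_of_ne (by rintro rfl; exact hx hz) (by rintro rfl; exact hy hz)
  exact ⟨Ty.congr h, Ty.congr fun z hz => (h z hz).symm⟩

theorem ty_symOne (P : A → Bool) (m : ℕ) : Ty P (symOne m : Term S A) (m + 1) (1 + m) := by
  have hfv : ∀ m, fv (Term.symOne m : Term S A) = ∅ := by
    intro m
    induction m with
    | zero => rfl
    | succ m ih => simp [Term.symOne, fv, ih, fv_idn]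
  induction m with
  | zero => exact ⟨rfl, rfl⟩
  | succ m ih =>
    refine ⟨by simp [fv, fv_idn, hfv], m + 2, ?_, ?_⟩
    · exact ⟨by simp [fv], m, m, 2, 2, rfl, rfl, Ty.id P m, rfl, rfl⟩
    · exact ⟨by simp [fv], m + 1, 1 + m, 1, 1, rfl, by omega, ih, rfl, rfl⟩

theorem fv_symOne (m : ℕ) : fv (symOne m : Term S A) = ∅ := by
  induction m with
  | zero => rfl
  | succ m ih => simp [symOne, fv, ih, fv_idn]

theorem fv_symn (m n : ℕ) : fv (symn m n : Term S A) = ∅ := by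
  induction n with
  | zero => exact fv_idn m
  | succ n ih => simp [symn, fv, ih, fv_idn, fv_symOne]

theorem ty_symn (P : A → Bool) (m n : ℕ) : Ty P (symn m n : Term S A) (m + n) (n + m) := by
  induction n with
  | zero => simpa [Term.symn] using Ty.id P m
  | succ n ih =>
    refine ⟨by simp [fv, fv_idn, fv_symOne], n + m + 1, ?_, ?_⟩
    · exact ⟨by simp [fv], m + n, n + m, 1, 1, rfl, rfl, ih, rfl, rfl⟩
    · exact ⟨by simp [fv_symOne], n, n, m + 1, 1 + m, by omega, by omega, Ty.id P n,
        ty_symOne P m⟩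

theorem Ty.hasTypeIn {P : A → Bool} {M N : Term S A} {m n : ℕ} (h : Ty P M m n)
    (hMN : fv M ⊆ fv N) : HasTypeIn (ctxIn P N) (ctxOut P N) M m n :=
  ⟨_, Finset.filter_subset_filter _ hMN, _, Finset.filter_subset_filter _ hMN, h.hasType⟩

theorem Eqv.id_comp {P : A → Bool} {M : Term S A} {m n : ℕ} (hM : Ty P M m n) :
    Eqv P (.comp (idn m) M) M := by
  refine .of_equation fun m' n' h => ?_
  have hc : Ty P (.comp (idn m) M) m n := ⟨by simp [fv_idn], m, Ty.id P m, hM⟩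
  obtain ⟨rfl, rfl⟩ := h.elim hc.unique hM.unique
  exact ⟨hc, hM, by simp [fv, fv_idn], .id_comp _ _⟩

theorem Eqv.comp_id {P : A → Bool} {M : Term S A} {m n : ℕ} (hM : Ty P M m n) :
    Eqv P (.comp M (idn n)) M := by
  refine .of_equation fun m' n' h => ?_
  have hc : Ty P (.comp M (idn n)) m n := ⟨by simp [fv_idn], n, hM, Ty.id P n⟩
  obtain ⟨rfl, rfl⟩ := h.elim hc.unique hM.unique
  exact ⟨hc, hM, by simp [fv, fv_idn], .comp_id _ _⟩

theorem Eqv.interchange {P : A → Bool} {M M' N N' : Term S A}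
    (h : (∃ k, (∃ m, Ty P M m k) ∧ ∃ n, Ty P M' k n) ∨
      ∃ k, (∃ m, Ty P N m k) ∧ ∃ n, Ty P N' k n) :
    Eqv P (.comp (.tensor M N) (.tensor M' N')) (.tensor (.comp M M') (.comp N N')) := by
  refine Eqv.symm (.of_equation fun m n h' => ?_)
  have : Ty P (.comp (.tensor M N) (.tensor M' N')) m n ↔
      Ty P (.tensor (.comp M M') (.comp N N')) m n := by
    simp only [Ty, fv, Finset.disjoint_union_left, Finset.disjoint_union_right]
    constructor
    · rintro ⟨⟨⟨d1, d2⟩, d3, d4⟩, k, ⟨d5, m₁, k₁, m₂, k₂, rfl, rfl, h1, h2⟩, d6, l₁, n₁, l₂, n₂, e,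
        rfl, h3, h4⟩
      obtain rfl : k₁ = l₁ := by
        rcases h with ⟨k, ⟨m, a1⟩, n, a2⟩ | ⟨k, ⟨m, a1⟩, n, a2⟩
        · have := h1.unique a1
          have := h3.unique a2
          omega
        · have := h2.unique a1
          have := h4.unique a2
          omega
      obtain rfl : k₂ = l₂ := by omega
      exact ⟨⟨⟨d5, d2.symm⟩, d3, d6⟩, m₁, n₁, m₂, n₂, rfl, rfl, ⟨d1, k₁, h1, h3⟩, d4, k₂, h2, h4⟩
    · rintro ⟨⟨⟨d5, d2⟩, d3, d6⟩, m₁, n₁, m₂, n₂, rfl, rfl, ⟨d1, k₁, h1, h3⟩, d4, k₂, h2, h4⟩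
      exact ⟨⟨⟨d1, d2.symm⟩, d3, d4⟩, k₁ + k₂, ⟨d5, m₁, k₁, m₂, k₂, rfl, rfl, h1, h2⟩, d6,
        k₁, n₁, k₂, n₂, rfl, rfl, h3, h4⟩
  refine ⟨h'.elim id this.1, h'.elim this.2 id, ?_, .functoriality _ _ _ _⟩
  exact Finset.union_union_union_comm _ _ _ _

theorem Eqv.symmetry {P : A → Bool} {M N : Term S A} {m₁ n₁ m₂ n₂ : ℕ}
    (hM : Ty P M m₁ n₁) (hN : Ty P N m₂ n₂) :
    Eqv P (.comp (.tensor M N) (symn n₁ n₂)) (.comp (symn m₁ m₂) (.tensor N M)) := by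
  refine .of_equation fun m n h => ?_
  have hd : Disjoint (fv M) (fv N) := by
    rcases h with ⟨-, _, ⟨hd, -⟩, -⟩ | ⟨-, _, -, hd, -⟩
    · exact hd
    · exact hd.symm
  have h1 : Ty P (.comp (.tensor M N) (symn n₁ n₂)) (m₁ + m₂) (n₂ + n₁) :=
    ⟨by simp [fv_symn], _, ⟨hd, _, _, _, _, rfl, rfl, hM, hN⟩, ty_symn P _ _⟩
  have h2 : Ty P (.comp (symn m₁ m₂) (.tensor N M)) (m₁ + m₂) (n₂ + n₁) :=
    ⟨by simp [fv_symn], _, ty_symn P _ _, ⟨hd.symm, _, _, _, _, rfl, rfl, hN, hM⟩⟩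
  obtain ⟨rfl, rfl⟩ := h.elim h1.unique h2.unique
  refine ⟨h1, h2, ?_, .symmetry _ _ _ _ _ _ ?_ ?_⟩
  · simp [fv, fv_symn, Finset.union_comm]
  · exact hM.hasTypeIn (by simp only [fv]; intro z hz; simp [hz])
  · exact hN.hasTypeIn (by simp only [fv]; intro z hz; simp [hz])

theorem Eqv.left_tightening (P : A → Bool) (m : ℕ) (f g : Term S A) :
    Eqv P (.trace m (.comp (.tensor g (idn m)) f)) (.comp g (.trace m f)) := by
  refine .of_equation fun a b h => ?_
  have : Ty P (.trace m (.comp (.tensor g (idn m)) f)) a b ↔ Ty P (.comp g (.trace m f)) a b := by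
    simp only [Ty, fv, fv_idn, Finset.union_empty]
    constructor
    · rintro ⟨hd, k, ⟨-, m₁, k₁, m₂, k₂, e, rfl, h1, h2⟩, h3⟩
      obtain ⟨rfl, rfl⟩ := h2.unique (Ty.id P m)
      obtain rfl : a = m₁ := by omega
      exact ⟨hd, k₁, h1, h3⟩
    · rintro ⟨hd, k, h1, h3⟩
      exact ⟨hd, k + m, ⟨by simp, a, k, m, m, rfl, rfl, h1, Ty.id P m⟩, h3⟩
  exact ⟨by tauto, by tauto, by simp [fv, fv_idn], .left_tightening _ _ _⟩

theorem Eqv.right_tightening (P : A → Bool) (m : ℕ) (f g : Term S A) :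
    Eqv P (.trace m (.comp f (.tensor g (idn m)))) (.comp (.trace m f) g) := by
  refine .of_equation fun a b h => ?_
  have : Ty P (.trace m (.comp f (.tensor g (idn m)))) a b ↔ Ty P (.comp (.trace m f) g) a b := by
    simp only [Ty, fv, fv_idn, Finset.union_empty]
    constructor
    · rintro ⟨hd, k, h3, ⟨-, m₁, k₁, m₂, k₂, rfl, e, h1, h2⟩⟩
      obtain ⟨rfl, rfl⟩ := h2.unique (Ty.id P m)
      obtain rfl : b = k₁ := by omega
      exact ⟨hd, m₁, h3, h1⟩
    · rintro ⟨hd, k, h3, h1⟩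
      exact ⟨hd, k + m, h3, ⟨by simp, k, b, m, m, rfl, rfl, h1, Ty.id P m⟩⟩
  exact ⟨by tauto, by tauto, by simp [fv, fv_idn], .right_tightening _ _ _⟩

theorem Eqv.sliding {P : A → Bool} {m n p q : ℕ} {f g : Term S A}
    (hf : Ty P f (q + m) (n + p)) (hg : Ty P g p m) :
    Eqv P (.trace m (.comp f (.tensor (idn n) g))) (.trace p (.comp (.tensor (idn q) g) f)) := by
  refine .of_equation fun a b h => ?_
  have hd : Disjoint (fv f) (fv g) := by
    rcases h with ⟨hd, -⟩ | ⟨hd, -⟩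
    · simpa [fv, fv_idn] using hd
    · simpa [fv, fv_idn] using hd.symm
  have h1 : Ty P (.trace m (.comp f (.tensor (idn n) g))) q n :=
    ⟨by simpa [fv, fv_idn] using hd, _, hf, by simp [fv_idn], _, _, _, _, rfl, rfl, Ty.id P n, hg⟩
  have h2 : Ty P (.trace p (.comp (.tensor (idn q) g) f)) q n :=
    ⟨by simpa [fv, fv_idn] using hd.symm, _, ⟨by simp [fv_idn], _, _, _, _, rfl, rfl, Ty.id P q, hg⟩,
      hf⟩
  obtain ⟨rfl, rfl⟩ := h.elim h1.unique h2.unique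
  refine ⟨h1, h2, ?_, .sliding _ _ _ _ _ _ ?_ ?_⟩
  · simp [fv, fv_idn, Finset.union_comm]
  · exact hf.hasTypeIn (by simp only [fv]; intro z hz; simp [hz])
  · exact hg.hasTypeIn (by simp only [fv]; intro z hz; simp [hz])

theorem Eqv.trace_zero (P : A → Bool) (f : Term S A) : Eqv P (.trace 0 f) f :=
  .of_equation fun _ _ h => ⟨h.elim id id, h.elim id id, rfl, .vanishing_zero _⟩

theorem Eqv.trace_add (P : A → Bool) (m n : ℕ) (f : Term S A) :
    Eqv P (.trace (m + n) f) (.trace m (.trace n f)) := by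
  refine .of_equation fun a b h => ?_
  have : Ty P (.trace (m + n) f) a b ↔ Ty P (.trace m (.trace n f)) a b := by
    simp only [Ty, add_assoc]
  exact ⟨by tauto, by tauto, rfl, .vanishing_add _ _ _⟩

theorem Eqv.link_trace (P : A → Bool) (x y : A) (i : ℕ) (hi : i ≤ 1) (M : Term S A) :
    Eqv P (.link x y (.trace i M)) (.trace i (.link x y M)) :=
  .of_equation fun _ _ h => ⟨h.elim id id, h.elim id id, rfl, .link_trace _ _ _ hi _⟩

theorem disjoint_sdiff_pair {s t : Finset A} {x y : A} (hx : x ∉ t) (hy : y ∉ t) :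
    Disjoint (s \ {x, y}) t ↔ Disjoint s t := by
  simp only [Finset.disjoint_left, Finset.mem_sdiff, Finset.mem_insert, Finset.mem_singleton,
    not_or]
  refine ⟨fun h z hz ht => h ⟨hz, ?_, ?_⟩ ht, fun h z hz => h hz.1⟩ <;> rintro rfl <;> tauto

theorem union_sdiff_pair {s t : Finset A} {x y : A} (hx : x ∉ t) (hy : y ∉ t) :
    (s ∪ t) \ {x, y} = s \ {x, y} ∪ t := by
  ext z
  simp only [Finset.mem_sdiff, Finset.mem_union, Finset.mem_insert, Finset.mem_singleton, not_or]
  constructor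
  · tauto
  · rintro (h | h)
    · tauto
    · exact ⟨.inr h, by rintro rfl; exact hx h, by rintro rfl; exact hy h⟩

theorem Eqv.link_comp_left (P : A → Bool) {x y : A} (M : Term S A) {N : Term S A}
    (hx : x ∉ fv N) (hy : y ∉ fv N) : Eqv P (.link x y (.comp M N)) (.comp (.link x y M) N) := by
  refine .of_equation fun a b h => ?_
  have : Ty P (.link x y (.comp M N)) a b ↔ Ty P (.comp (.link x y M) N) a b := by
    simp only [Ty, fv, disjoint_sdiff_pair hx hy, ty_polUpdate hx hy, Finset.mem_union, hx, hy,
      or_false]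
    tauto
  exact ⟨by tauto, by tauto, union_sdiff_pair hx hy, .link_comp_left _ _ _ _ hx hy⟩

theorem Eqv.link_tensor_left (P : A → Bool) {x y : A} (M : Term S A) {N : Term S A}
    (hx : x ∉ fv N) (hy : y ∉ fv N) :
    Eqv P (.link x y (.tensor M N)) (.tensor (.link x y M) N) := by
  refine .of_equation fun a b h => ?_
  have : Ty P (.link x y (.tensor M N)) a b ↔ Ty P (.tensor (.link x y M) N) a b := by
    simp only [Ty, fv, disjoint_sdiff_pair hx hy, ty_polUpdate hx hy, Finset.mem_union, hx, hy,
      or_false]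
    tauto
  exact ⟨by tauto, by tauto, union_sdiff_pair hx hy, .link_tensor_left _ _ _ _ hx hy⟩

theorem Eqv.link_comp_right (P : A → Bool) {x y : A} {M : Term S A} (N : Term S A)
    (hx : x ∉ fv M) (hy : y ∉ fv M) : Eqv P (.link x y (.comp M N)) (.comp M (.link x y N)) := by
  refine .of_equation fun a b h => ?_
  have : Ty P (.link x y (.comp M N)) a b ↔ Ty P (.comp M (.link x y N)) a b := by
    simp only [Ty, fv, disjoint_comm (a := fv M), disjoint_sdiff_pair hx hy, ty_polUpdate hx hy,
      Finset.mem_union, hx, hy, false_or]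
    tauto
  refine ⟨by tauto, by tauto, ?_, .link_comp_right _ _ _ _ hx hy⟩
  simp only [fv]
  rw [Finset.union_comm, union_sdiff_pair hx hy, Finset.union_comm]

theorem Eqv.link_tensor_right (P : A → Bool) {x y : A} {M : Term S A} (N : Term S A)
    (hx : x ∉ fv M) (hy : y ∉ fv M) :
    Eqv P (.link x y (.tensor M N)) (.tensor M (.link x y N)) := by
  refine .of_equation fun a b h => ?_
  have : Ty P (.link x y (.tensor M N)) a b ↔ Ty P (.tensor M (.link x y N)) a b := by
    simp only [Ty, fv, disjoint_comm (a := fv M), disjoint_sdiff_pair hx hy, ty_polUpdate hx hy,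
      Finset.mem_union, hx, hy, false_or]
    tauto
  refine ⟨by tauto, by tauto, ?_, .link_tensor_right _ _ _ _ hx hy⟩
  simp only [fv]
  rw [Finset.union_comm, union_sdiff_pair hx hy, Finset.union_comm]

theorem Eqv.link_identity (P : A → Bool) {x y : A} (hxy : x ≠ y) :
    Eqv P (.link x y (.comp (.var x) (.var y)) : Term S A) .one := by
  refine .of_equation fun a b h => ?_
  have h1 : Ty P (.link x y (.comp (.var x) (.var y)) : Term S A) 1 1 :=
    ⟨by simp [fv], by simp [fv], hxy, by simpa [fv] using hxy, 0,
      by simp [Ty, polUpdate_left hxy], by simp [Ty, polUpdate_right]⟩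
  have h2 : Ty P (.one : Term S A) 1 1 := ⟨rfl, rfl⟩
  obtain ⟨rfl, rfl⟩ := h.elim h1.unique h2.unique
  refine ⟨h1, h2, ?_, .link_identity _ _⟩
  ext z; simp [fv]

namespace Cl

variable {P : A → Bool}

theorem id_mul {a : Cl S P} {m n : ℕ} (h : a.HasTy m n) : id m * a = a := by
  induction a using Cl.ind with
  | h M => exact cl_eq.2 (.id_comp h)

theorem mul_id {a : Cl S P} {m n : ℕ} (h : a.HasTy m n) : a * id n = a := by
  induction a using Cl.ind with
  | h M => exact cl_eq.2 (.comp_id h)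

theorem interchange {a b : Cl S P} (c d : Cl S P) {m k n : ℕ} (ha : a.HasTy m k)
    (hb : b.HasTy k n) : (a + c) * (b + d) = a * b + c * d := by
  induction a using Cl.ind; induction b using Cl.ind; induction c using Cl.ind
  induction d using Cl.ind
  exact cl_eq.2 (.interchange (.inl ⟨k, ⟨m, ha⟩, n, hb⟩))

theorem interchange' (a b : Cl S P) {c d : Cl S P} {m k n : ℕ} (hc : c.HasTy m k)
    (hd : d.HasTy k n) : (a + c) * (b + d) = a * b + c * d := by
  induction a using Cl.ind; induction b using Cl.ind; induction c using Cl.ind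
  induction d using Cl.ind
  exact cl_eq.2 (.interchange (.inr ⟨k, ⟨m, hc⟩, n, hd⟩))

/-- The symmetry of `m` and `n` wires. -/
def swap (m n : ℕ) : Cl S P := cl P (symn m n)

theorem hasTy_swap (m n : ℕ) : (swap m n : Cl S P).HasTy (m + n) (n + m) := ty_symn P m n

theorem symmetry {a b : Cl S P} {m₁ n₁ m₂ n₂ : ℕ} (ha : a.HasTy m₁ n₁) (hb : b.HasTy m₂ n₂) :
    (a + b) * swap n₁ n₂ = swap m₁ m₂ * (b + a) := by
  induction a using Cl.ind; induction b using Cl.ind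
  exact cl_eq.2 (.symmetry ha hb)

theorem swap_zero_right (m : ℕ) : (swap m 0 : Cl S P) = id m := rfl

theorem swap_zero_left (n : ℕ) : (swap 0 n : Cl S P) = id n := by
  induction n with
  | zero => rfl
  | succ n ih =>
    have h : (swap 0 (n + 1) : Cl S P) = (swap 0 n + id 1) * (id n + id 1) := by
      rw [id_one]; rfl
    rw [h, ih, ← id_succ, id_mul (hasTy_id _)]

theorem trace_left (m : ℕ) (f g : Cl S P) : trace m ((g + id m) * f) = g * trace m f := by
  induction f using Cl.ind; induction g using Cl.ind
  exact cl_eq.2 (.left_tightening P m _ _)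

theorem trace_right (m : ℕ) (f g : Cl S P) : trace m (f * (g + id m)) = trace m f * g := by
  induction f using Cl.ind; induction g using Cl.ind
  exact cl_eq.2 (.right_tightening P m _ _)

theorem sliding {m n p q : ℕ} {f g : Cl S P} (hf : f.HasTy (q + m) (n + p)) (hg : g.HasTy p m) :
    trace m (f * (id n + g)) = trace p ((id q + g) * f) := by
  induction f using Cl.ind; induction g using Cl.ind
  exact cl_eq.2 (.sliding hf hg)

theorem trace_zero (f : Cl S P) : trace 0 f = f := by
  induction f using Cl.ind; exact cl_eq.2 (.trace_zero P _)

theorem trace_add (m n : ℕ) (f : Cl S P) : trace (m + n) f = trace m (trace n f) := by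
  induction f using Cl.ind; exact cl_eq.2 (.trace_add P m n _)

section Link

variable {x y : A} (hx : P x = false) (hy : P y = true)
include hx hy

theorem link_trace (i : ℕ) (a : Cl S P) : link x y (trace i a) = trace i (link x y a) := by
  induction i generalizing a with
  | zero => rw [trace_zero, trace_zero]
  | succ i ih =>
    rw [trace_add, trace_add, ih]
    congr 1
    induction a using Cl.ind
    rw [← cl_link hx hy, ← cl_trace, ← cl_trace, ← cl_link hx hy]
    exact cl_eq.2 (.link_trace P x y 1 le_rfl _)

theorem link_mul_left (a : Cl S P) {b : Cl S P} (h1 : x ∉ b.fvs) (h2 : y ∉ b.fvs) :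
    link x y (a * b) = link x y a * b := by
  obtain ⟨N, rfl, hN⟩ := exists_rep b
  induction a using Cl.ind
  rw [← cl_link hx hy, ← cl_comp, ← cl_comp, ← cl_link hx hy]
  exact cl_eq.2 (.link_comp_left P _ (hN ▸ h1) (hN ▸ h2))

theorem link_add_left (a : Cl S P) {b : Cl S P} (h1 : x ∉ b.fvs) (h2 : y ∉ b.fvs) :
    link x y (a + b) = link x y a + b := by
  obtain ⟨N, rfl, hN⟩ := exists_rep b
  induction a using Cl.ind
  rw [← cl_link hx hy, ← cl_tensor, ← cl_tensor, ← cl_link hx hy]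
  exact cl_eq.2 (.link_tensor_left P _ (hN ▸ h1) (hN ▸ h2))

theorem link_mul_right {a : Cl S P} (b : Cl S P) (h1 : x ∉ a.fvs) (h2 : y ∉ a.fvs) :
    link x y (a * b) = a * link x y b := by
  obtain ⟨N, rfl, hN⟩ := exists_rep a
  induction b using Cl.ind
  rw [← cl_link hx hy, ← cl_comp, ← cl_comp, ← cl_link hx hy]
  exact cl_eq.2 (.link_comp_right P _ (hN ▸ h1) (hN ▸ h2))

theorem link_add_right {a : Cl S P} (b : Cl S P) (h1 : x ∉ a.fvs) (h2 : y ∉ a.fvs) :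
    link x y (a + b) = a + link x y b := by
  obtain ⟨N, rfl, hN⟩ := exists_rep a
  induction b using Cl.ind
  rw [← cl_link hx hy, ← cl_tensor, ← cl_tensor, ← cl_link hx hy]
  exact cl_eq.2 (.link_tensor_right P _ (hN ▸ h1) (hN ▸ h2))

theorem link_var_mul_var : link x y (var x * var y : Cl S P) = id 1 := by
  rw [id_one, var, var, ← cl_comp, ← cl_link hx hy]
  exact cl_eq.2 (.link_identity P (by rintro rfl; simp [hx] at hy))

end Link

end Cl

/-! ### Abstraction of variables, and commutation of links -/

namespace Cl

variable {P : A → Bool}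

theorem add_eq_mul {a b : Cl S P} {m n : ℕ} (ha : a.HasTy m 0) (hb : b.HasTy 0 n) :
    a + b = a * b := by
  have h := interchange (a := a) (b := 0) 0 b ha hasTy_zero
  rw [add_zero, zero_add] at h
  rw [h, ← id_zero, mul_id ha, id_mul hb]

theorem add_eq_mul' {a b : Cl S P} {m n : ℕ} (ha : a.HasTy m 0) (hb : b.HasTy 0 n) :
    b + a = a * b := by
  have h := interchange (a := 0) (b := b) a 0 hasTy_zero hb
  rw [add_zero, zero_add] at h
  rw [h, ← id_zero, mul_id ha, id_mul hb]

/-- No symmetry is needed to exchange a diagram without outputs and one without inputs. -/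
theorem add_comm_of_hasTy {a b : Cl S P} {m n : ℕ} (ha : a.HasTy m 0) (hb : b.HasTy 0 n) :
    a + b = b + a := by
  rw [add_eq_mul ha hb, add_eq_mul' ha hb]

theorem ext_of_hasTy {a b : Cl S P} (h : ∀ m n, a.HasTy m n ∨ b.HasTy m n → a = b) : a = b := by
  by_cases h' : ∃ m n, a.HasTy m n ∨ b.HasTy m n
  · obtain ⟨m, n, h'⟩ := h'; exact h m n h'
  · induction a using Cl.ind
    induction b using Cl.ind
    exact cl_eq.2 fun m n h'' => (h' ⟨m, n, h''⟩).elim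

/-- An output variable slides past a diagram. -/
theorem mul_add_out {a b : Cl S P} {m n : ℕ} (ha : a.HasTy m n) (hb : b.HasTy 1 0) :
    (id m + b) * a = (a + id 1) * (id n + b) := by
  have h1 := interchange' (id m) a hb hasTy_zero
  have h2 := interchange (id 1) b ha (hasTy_id n)
  rw [add_zero, id_mul ha, ← id_zero, mul_id hb] at h1
  rw [mul_id ha, id_mul hb] at h2
  rw [h1, h2]

/-- An input variable slides past a diagram. -/
theorem mul_add_in {a b : Cl S P} {m n : ℕ} (ha : a.HasTy m n) (hb : b.HasTy 0 1) :
    a * (id n + b) = (id m + b) * (a + id 1) := by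
  have h1 := interchange' a (id n) hasTy_zero hb
  have h2 := interchange b (id 1) (hasTy_id m) ha
  rw [add_zero, mul_id ha, ← id_zero, id_mul hb] at h1
  rw [id_mul ha, mul_id hb] at h2
  rw [h1, h2]

theorem add_mul_right {a b c : Cl S P} {k m n : ℕ} (ha : a.HasTy m k) (hb : b.HasTy k n)
    {p q : ℕ} (hc : c.HasTy p q) : a * b + c = (a + c) * (b + id q) := by
  rw [interchange c (id q) ha hb, mul_id hc]

theorem add_mul_right' {a b c : Cl S P} {k m n : ℕ} (ha : a.HasTy m k) (hb : b.HasTy k n)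
    {p q : ℕ} (hc : c.HasTy p q) : a * b + c = (a + id p) * (b + c) := by
  rw [interchange (id p) c ha hb, id_mul hc]

theorem add_mul_left {a b c : Cl S P} {k m n : ℕ} (ha : a.HasTy m k) (hb : b.HasTy k n)
    {p q : ℕ} (hc : c.HasTy p q) : c + a * b = (c + a) * (id q + b) := by
  rw [interchange' c (id q) ha hb, mul_id hc]

theorem add_mul_left' {a b c : Cl S P} {k m n : ℕ} (ha : a.HasTy m k) (hb : b.HasTy k n)
    {p q : ℕ} (hc : c.HasTy p q) : c + a * b = (id p + a) * (c + b) := by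
  rw [interchange' (id p) c ha hb, id_mul hc]

theorem hasTy_out {x : A} (hx : P x = false) (n : ℕ) : (id n + var x : Cl S P).HasTy (n + 1) n :=
  (hasTy_id n).add (hasTy_var_out hx) (by simp)

theorem hasTy_in {x : A} (hx : P x = true) (n : ℕ) : (id n + var x : Cl S P).HasTy n (n + 1) :=
  (hasTy_id n).add (hasTy_var_in hx) (by simp)

theorem out_add_id {x : A} (hx : P x = false) (n : ℕ) :
    (var x + id n : Cl S P) = swap 1 n * (id n + var x) := by
  rw [← symmetry (hasTy_var_out hx) (hasTy_id n), swap_zero_left, mul_id (m := 1 + n)]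
  simpa using (hasTy_var_out hx).add (hasTy_id (P := P) (S := S) n) (by simp)

theorem id_add_out {x : A} (hx : P x = false) (n : ℕ) :
    (id n + var x : Cl S P) = swap n 1 * (var x + id n) := by
  rw [← symmetry (hasTy_id n) (hasTy_var_out hx), swap_zero_right, mul_id (hasTy_out hx n)]

theorem in_add_id {x : A} (hx : P x = true) (n : ℕ) :
    (var x + id n : Cl S P) = (id n + var x) * swap n 1 := by
  rw [symmetry (hasTy_id n) (hasTy_var_in hx), swap_zero_right, id_mul (n := 1 + n)]
  simpa using (hasTy_var_in hx).add (hasTy_id (P := P) (S := S) n) (by simp)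

theorem id_add_in {x : A} (hx : P x = true) (n : ℕ) :
    (id n + var x : Cl S P) = (var x + id n) * swap 1 n := by
  rw [symmetry (hasTy_var_in hx) (hasTy_id n), swap_zero_left, id_mul (hasTy_in hx n)]

end Cl

open Cl

/-- Abstraction of an output variable: it can be moved to an additional last output. -/
theorem Ty.exists_out (M : Term S A) : ∀ {P : A → Bool} {m n : ℕ}, Ty P M m n →
    ∀ {x : A}, x ∈ fv M → P x = false → ∃ M' : Term S A, Ty P M' m (n + 1) ∧
      fv M' ⊆ (fv M).erase x ∧ cl P M = cl P M' * (Cl.id n + Cl.var x) := by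
  induction M with
  | const k | zero | one | sym => intro P m n _ x hx; simp [fv] at hx
  | comp M N ihM ihN =>
    rintro P m n ⟨hd, k, h1, h2⟩ x hx hP
    have hsub : ∀ {s t : Finset A}, s ⊆ t.erase x → s ⊆ t := fun h => h.trans (Finset.erase_subset _ _)
    rcases Finset.mem_union.1 (by simpa only [fv] using hx) with hx | hx
    · obtain ⟨M', t, hf, e⟩ := ihM h1 hx hP
      have hxN : x ∉ fv N := Finset.disjoint_left.1 hd hx
      refine ⟨.comp M' (.tensor N .one), ⟨?_, k + 1, t, ?_⟩, ?_, ?_⟩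
      · simpa [fv] using hd.mono_left (hsub hf)
      · exact ⟨by simp [fv], k, n, 1, 1, rfl, rfl, h2, rfl, rfl⟩
      · simp only [fv, Finset.union_empty, Finset.erase_union_distrib,
          Finset.erase_eq_of_notMem hxN]
        exact Finset.union_subset_union hf le_rfl
      · rw [cl_comp, e, mul_assoc, mul_add_out (a := cl P N) h2 (hasTy_var_out hP), cl_comp,
          cl_tensor, id_one, mul_assoc]
    · obtain ⟨N', t, hf, e⟩ := ihN h2 hx hP
      have hxM : x ∉ fv M := Finset.disjoint_right.1 hd hx
      refine ⟨.comp M N', ⟨hd.mono_right (hsub hf), k, h1, t⟩, ?_, ?_⟩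
      · simp only [fv, Finset.erase_union_distrib, Finset.erase_eq_of_notMem hxM]
        exact Finset.union_subset_union le_rfl hf
      · rw [cl_comp, e, cl_comp, mul_assoc]
  | tensor M N ihM ihN =>
    rintro P m n ⟨hd, m₁, n₁, m₂, n₂, rfl, rfl, h1, h2⟩ x hx hP
    have hsub : ∀ {s t : Finset A}, s ⊆ t.erase x → s ⊆ t := fun h => h.trans (Finset.erase_subset _ _)
    rcases Finset.mem_union.1 (by simpa only [fv] using hx) with hx | hx
    -- The new output of `M` crosses the outputs of `N` to become the last one.
    · obtain ⟨M', t, hf, e⟩ := ihM h1 hx hP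
      have hxN : x ∉ fv N := Finset.disjoint_left.1 hd hx
      refine ⟨.comp (.tensor M' N) (.tensor (idn n₁) (symn 1 n₂)), ⟨?_, n₁ + 1 + n₂, ?_, ?_⟩, ?_, ?_⟩
      · simp [fv, fv_idn, fv_symn]
      · exact ⟨hd.mono_left (hsub hf), _, _, _, _, rfl, rfl, t, h2⟩
      · exact ⟨by simp [fv_idn], n₁, n₁, 1 + n₂, n₂ + 1, by omega, by omega, Ty.id P _,
          ty_symn P _ _⟩
      · simp only [fv, fv_idn, fv_symn, Finset.union_empty, Finset.erase_union_distrib,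
          Finset.erase_eq_of_notMem hxN]
        exact Finset.union_subset_union hf le_rfl
      · have hs : (Cl.id n₂ + Cl.var x : Cl S P).HasTy (n₂ + 1) n₂ := hasTy_out hP n₂
        rw [cl_tensor, e, add_mul_right (a := cl P M') t (hasTy_out hP n₁) (c := cl P N) h2,
          add_assoc, out_add_id hP, add_mul_left (hasTy_swap 1 n₂) hs (hasTy_id n₁), ← add_assoc,
          ← id_add, ← mul_assoc]
        rfl
    · obtain ⟨N', t, hf, e⟩ := ihN h2 hx hP
      have hxM : x ∉ fv M := Finset.disjoint_right.1 hd hx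
      refine ⟨.tensor M N', ⟨hd.mono_right (hsub hf), _, _, _, _, rfl, (by omega), h1, t⟩, ?_, ?_⟩
      · simp only [fv, Finset.erase_union_distrib, Finset.erase_eq_of_notMem hxM]
        exact Finset.union_subset_union le_rfl hf
      · rw [cl_tensor, e, add_mul_left (a := cl P N') t (hasTy_out hP n₂) (c := cl P M) h1,
          ← add_assoc, ← id_add]
        rfl
  | var z =>
    intro P m n h x hx hP
    obtain rfl : x = z := by simpa [fv] using hx
    have h' : Ty P (.var x : Term S A) 1 0 := by simp [Ty, hP]
    obtain ⟨rfl, rfl⟩ := h.unique h'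
    refine ⟨.one, ⟨rfl, rfl⟩, by simp [fv], ?_⟩
    rw [← id_one, id_zero, zero_add]
    exact (id_mul (a := Cl.var x) h').symm
  | trace i M ih =>
    intro P m n h x hx hP
    obtain ⟨M', t, hf, e⟩ := ih (P := P) h hx hP
    -- The new output is moved in front of the traced ones.
    refine ⟨.trace i (.comp M' (.tensor (idn n) (symn i 1))), ⟨?_, n + i + 1, t, ?_⟩, ?_, ?_⟩
    · simp [fv, fv_idn, fv_symn]
    · exact ⟨by simp [fv_idn], n, n, i + 1, 1 + i, by omega, by omega, Ty.id P _, ty_symn P _ _⟩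
    · simpa [fv, fv_idn, fv_symn] using hf
    · have hs : (Cl.var x + Cl.id i : Cl S P).HasTy (1 + i) i := by
        simpa using (hasTy_var_out hP).add (hasTy_id (P := P) (S := S) i) (by simp)
      rw [cl_trace, e, id_add, add_assoc, id_add_out hP,
        add_mul_left (hasTy_swap i 1) hs (hasTy_id n), ← add_assoc, ← mul_assoc, trace_right]
      rfl
  | link a b M ih =>
    rintro P m n ⟨ha, hb, hab, h⟩ x hx hP
    have hx : x ∈ fv M ∧ x ≠ a ∧ x ≠ b := by simpa [fv] using hx
    have hQ : polUpdate P a b x = false := by rw [polUpdate_of_ne hx.2.1 hx.2.2, hP]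
    obtain ⟨M', t, hf, e⟩ := ih h hx.1 hQ
    have e' : Eqv (polUpdate P a b) M (.comp M' (.tensor (idn n) (.var x))) := cl_eq.1 e
    obtain ⟨-, ⟨hd, k, t1, t2⟩, e3, -⟩ := e' m n (.inl h)
    have hab' : ∀ z, z ∈ fv M → z ≠ x → z ∈ fv M' := by
      intro z hz hzx
      rw [e3] at hz
      simpa [fv, fv_idn, hzx] using hz
    refine ⟨.link a b M', ⟨hab' a ha (Ne.symm hx.2.1), hab' b hb (Ne.symm hx.2.2), hab, t⟩, ?_, ?_⟩
    · simp only [fv]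
      intro z hz
      have h1 := hf (Finset.mem_sdiff.1 hz).1
      simp only [Finset.mem_erase, Finset.mem_sdiff] at h1 hz ⊢
      exact ⟨h1.1, h1.2, hz.2⟩
    · refine (cl_eq.2 (Eqv.link a b e')).trans (cl_eq.2 (Eqv.link_comp_left P _ ?_ ?_))
      · simp [fv, fv_idn, Ne.symm hx.2.1]
      · simp [fv, fv_idn, Ne.symm hx.2.2]

/-- Abstraction of an input variable: it can be moved to an additional last input. -/
theorem Ty.exists_in (M : Term S A) : ∀ {P : A → Bool} {m n : ℕ}, Ty P M m n →
    ∀ {y : A}, y ∈ fv M → P y = true → ∃ M' : Term S A, Ty P M' (m + 1) n ∧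
      fv M' ⊆ (fv M).erase y ∧ cl P M = (Cl.id m + Cl.var y) * cl P M' := by
  induction M with
  | const k | zero | one | sym => intro P m n _ x hx; simp [fv] at hx
  | comp M N ihM ihN =>
    rintro P m n ⟨hd, k, h1, h2⟩ x hx hP
    have hsub : ∀ {s t : Finset A}, s ⊆ t.erase x → s ⊆ t := fun h => h.trans (Finset.erase_subset _ _)
    rcases Finset.mem_union.1 (by simpa only [fv] using hx) with hx | hx
    · obtain ⟨M', t, hf, e⟩ := ihM h1 hx hP
      have hxN : x ∉ fv N := Finset.disjoint_left.1 hd hx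
      refine ⟨.comp M' N, ⟨hd.mono_left (hsub hf), k, t, h2⟩, ?_, ?_⟩
      · simp only [fv, Finset.erase_union_distrib, Finset.erase_eq_of_notMem hxN]
        exact Finset.union_subset_union hf le_rfl
      · rw [cl_comp, e, cl_comp, mul_assoc]
    · obtain ⟨N', t, hf, e⟩ := ihN h2 hx hP
      have hxM : x ∉ fv M := Finset.disjoint_right.1 hd hx
      refine ⟨.comp (.tensor M .one) N', ⟨?_, k + 1, ?_, t⟩, ?_, ?_⟩
      · simpa [fv] using hd.mono_right (hsub hf)
      · exact ⟨by simp [fv], m, k, 1, 1, rfl, rfl, h1, rfl, rfl⟩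
      · simp only [fv, Finset.union_empty, Finset.erase_union_distrib,
          Finset.erase_eq_of_notMem hxM]
        exact Finset.union_subset_union le_rfl hf
      · rw [cl_comp, e, ← mul_assoc, mul_add_in (a := cl P M) h1 (hasTy_var_in hP), cl_comp,
          cl_tensor, id_one, mul_assoc]
  | tensor M N ihM ihN =>
    rintro P m n ⟨hd, m₁, n₁, m₂, n₂, rfl, rfl, h1, h2⟩ x hx hP
    have hsub : ∀ {s t : Finset A}, s ⊆ t.erase x → s ⊆ t := fun h => h.trans (Finset.erase_subset _ _)
    rcases Finset.mem_union.1 (by simpa only [fv] using hx) with hx | hx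
    · obtain ⟨M', t, hf, e⟩ := ihM h1 hx hP
      have hxN : x ∉ fv N := Finset.disjoint_left.1 hd hx
      refine ⟨.comp (.tensor (idn m₁) (symn m₂ 1)) (.tensor M' N), ⟨?_, m₁ + 1 + m₂, ?_, ?_⟩, ?_, ?_⟩
      · simp [fv, fv_idn, fv_symn]
      · exact ⟨by simp [fv_idn], m₁, m₁, m₂ + 1, 1 + m₂, by omega, by omega, Ty.id P _,
          ty_symn P _ _⟩
      · exact ⟨hd.mono_left (hsub hf), _, _, _, _, rfl, rfl, t, h2⟩
      · simp only [fv, fv_idn, fv_symn, Finset.union_empty, Finset.empty_union,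
          Finset.erase_union_distrib, Finset.erase_eq_of_notMem hxN]
        exact Finset.union_subset_union hf le_rfl
      · have hs : (Cl.id m₂ + Cl.var x : Cl S P).HasTy m₂ (m₂ + 1) := hasTy_in hP m₂
        rw [cl_tensor, e, add_mul_right' (b := cl P M') (hasTy_in hP m₁) t (c := cl P N) h2,
          add_assoc, in_add_id hP, add_mul_left' hs (hasTy_swap m₂ 1) (hasTy_id m₁), ← add_assoc,
          ← id_add, mul_assoc]
        rfl
    · obtain ⟨N', t, hf, e⟩ := ihN h2 hx hP
      have hxM : x ∉ fv M := Finset.disjoint_right.1 hd hx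
      refine ⟨.tensor M N', ⟨hd.mono_right (hsub hf), _, _, _, _, (by omega), rfl, h1, t⟩, ?_, ?_⟩
      · simp only [fv, Finset.erase_union_distrib, Finset.erase_eq_of_notMem hxM]
        exact Finset.union_subset_union le_rfl hf
      · rw [cl_tensor, e, add_mul_left' (b := cl P N') (hasTy_in hP m₂) t (c := cl P M) h1,
          ← add_assoc, ← id_add]
        rfl
  | var z =>
    intro P m n h x hx hP
    obtain rfl : x = z := by simpa [fv] using hx
    have h' : Ty P (.var x : Term S A) 0 1 := by simp [Ty, hP]
    obtain ⟨rfl, rfl⟩ := h.unique h'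
    refine ⟨.one, ⟨rfl, rfl⟩, by simp [fv], ?_⟩
    rw [← id_one, id_zero, zero_add]
    exact (mul_id (a := Cl.var x) h').symm
  | trace i M ih =>
    intro P m n h x hx hP
    obtain ⟨M', t, hf, e⟩ := ih (P := P) h hx hP
    refine ⟨.trace i (.comp (.tensor (idn m) (symn 1 i)) M'), ⟨?_, m + i + 1, ?_, t⟩, ?_, ?_⟩
    · simp [fv, fv_idn, fv_symn]
    · exact ⟨by simp [fv_idn], m, m, 1 + i, i + 1, by omega, by omega, Ty.id P _, ty_symn P _ _⟩
    · simpa [fv, fv_idn, fv_symn] using hf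
    · have hs : (Cl.var x + Cl.id i : Cl S P).HasTy i (1 + i) := by
        simpa using (hasTy_var_in hP).add (hasTy_id (P := P) (S := S) i) (by simp)
      rw [cl_trace, e, id_add, add_assoc, id_add_in hP,
        add_mul_left' hs (hasTy_swap 1 i) (hasTy_id m), ← add_assoc, mul_assoc, trace_left]
      rfl
  | link a b M ih =>
    rintro P m n ⟨ha, hb, hab, h⟩ x hx hP
    have hx : x ∈ fv M ∧ x ≠ a ∧ x ≠ b := by simpa [fv] using hx
    have hQ : polUpdate P a b x = true := by rw [polUpdate_of_ne hx.2.1 hx.2.2, hP]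
    obtain ⟨M', t, hf, e⟩ := ih h hx.1 hQ
    have e' : Eqv (polUpdate P a b) M (.comp (.tensor (idn m) (.var x)) M') := cl_eq.1 e
    obtain ⟨-, ⟨hd, k, t1, t2⟩, e3, -⟩ := e' m n (.inl h)
    have hab' : ∀ z, z ∈ fv M → z ≠ x → z ∈ fv M' := by
      intro z hz hzx
      rw [e3] at hz
      simpa [fv, fv_idn, hzx] using hz
    refine ⟨.link a b M', ⟨hab' a ha (Ne.symm hx.2.1), hab' b hb (Ne.symm hx.2.2), hab, t⟩, ?_, ?_⟩
    · simp only [fv]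
      intro z hz
      have h1 := hf (Finset.mem_sdiff.1 hz).1
      simp only [Finset.mem_erase, Finset.mem_sdiff] at h1 hz ⊢
      exact ⟨h1.1, h1.2, hz.2⟩
    · refine (cl_eq.2 (Eqv.link a b e')).trans (cl_eq.2 (Eqv.link_comp_right P _ ?_ ?_))
      · simp [fv, fv_idn, Ne.symm hx.2.1]
      · simp [fv, fv_idn, Ne.symm hx.2.2]

namespace Cl

variable {P : A → Bool}

theorem ne_of_pol {x y : A} (hx : P x = false) (hy : P y = true) : x ≠ y := by
  rintro rfl
  simp [hx] at hy

/-- A link is a trace of the diagram in which its two variables are abstracted. -/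
theorem link_eq_trace {x y : A} (hx : P x = false) (hy : P y = true) {f : Cl S P} {m n : ℕ}
    (hf : f.HasTy (m + 1) (n + 1)) (hxf : x ∉ f.fvs) (hyf : y ∉ f.fvs) :
    link x y ((id m + var y) * (f * (id n + var x))) = trace 1 f := by
  have hF : (f * (id n + var x)).HasTy (m + 1) (n + 0) := by
    refine hf.mul (hasTy_out hx n) ?_
    rw [fvs_add (hasTy_out hx n)]
    simpa using hxf
  -- `var y : 0 → 1` slides around a trace over one wire, which leaves a trace over no wire.
  have e := sliding (m := 1) (n := n) (p := 0) (q := m) hF (hasTy_var_in hy)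
  rw [trace_zero] at e
  rw [← e, link_trace hx hy, mul_assoc, interchange _ _ (hasTy_id n) (hasTy_id n),
    link_mul_right hx hy _ hxf hyf, mul_id (hasTy_id n), link_add_right hx hy _ (by simp) (by simp),
    link_var_mul_var hx hy, ← id_succ, mul_id hf]

/-- Links commute: after abstraction of `x` and `y` the outer link becomes a trace, and the inner
link commutes with it. If neither side is typed, they agree because all ill-typed terms do. -/
theorem link_comm {x y x' y' : A} (hx : P x = false) (hy : P y = true) (hx' : P x' = false)
    (hy' : P y' = true) (a : Cl S P) : link x y (link x' y' a) = link x' y' (link x y a) := by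
  have key : ∀ {x y x' y' : A}, P x = false → P y = true → P x' = false → P y' = true →
      ∀ m n, (link x y (link x' y' a)).HasTy m n →
        link x y (link x' y' a) = link x' y' (link x y a) := by
    intro x y x' y' hx hy hx' hy' m n h
    obtain ⟨h1, h2, h⟩ := (hasTy_link hx hy).1 h
    rw [fvs_link hx' hy' h] at h1 h2
    obtain ⟨h3, h4, h⟩ := (hasTy_link hx' hy').1 h
    simp only [Finset.mem_sdiff, Finset.mem_insert, Finset.mem_singleton, not_or] at h1 h2
    obtain ⟨M, rfl⟩ : ∃ M, cl P M = a := ⟨_, (exists_rep a).choose_spec.1⟩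
    have h : Ty P M m n := h
    rw [fvs_cl h] at h1 h2 h3 h4
    -- `M` is written as `M₂` with the variables `x` and `y` attached to its last wires.
    obtain ⟨M₁, t₁, f₁, e₁⟩ := h.exists_out M h1.1 hx
    have hfv : ∀ z, z ∈ fv M → z ≠ x → z ∈ fv M₁ := by
      intro z hz hzx
      have e₁' : Eqv P M (.comp M₁ (.tensor (idn n) (.var x))) := cl_eq.1 e₁
      rw [(e₁' m n (.inl h)).2.2.1] at hz
      simpa [fv, fv_idn, hzx] using hz
    obtain ⟨M₂, t₂, f₂, e₂⟩ := t₁.exists_in M₁ (hfv y h2.1 (ne_of_pol hx hy).symm) hy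
    have hfv₂ : ∀ z, z ∈ fv M → z ≠ x → z ≠ y → z ∈ fv M₂ := by
      intro z hz hzx hzy
      have e₂' : Eqv P M₁ (.comp (.tensor (idn m) (.var y)) M₂) := cl_eq.1 e₂
      have hz := hfv z hz hzx
      rw [(e₂' m (n + 1) (.inl t₁)).2.2.1] at hz
      simpa [fv, fv_idn, hzy] using hz
    have hx₂ : x ∉ fv M₂ := fun hz => by simpa using f₁ (Finset.erase_subset _ _ (f₂ hz))
    have hy₂ : y ∉ fv M₂ := fun hz => by simpa using f₂ hz
    have t₂' : (cl P M₂).HasTy (m + 1) (n + 1) := t₂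
    have t₃ : (link x' y' (cl P M₂)).HasTy (m + 1) (n + 1) := by
      refine (hasTy_link hx' hy').2 ⟨?_, ?_, t₂'⟩ <;> rw [fvs_cl t₂]
      · exact hfv₂ x' h3 (Ne.symm h1.2.1) (ne_of_pol hx' hy)
      · exact hfv₂ y' h4 (ne_of_pol hx hy').symm (Ne.symm h2.2.2)
    rw [e₁, e₂, mul_assoc, link_eq_trace hx hy t₂' (by rwa [fvs_cl t₂]) (by rwa [fvs_cl t₂]),
      link_mul_right hx' hy', link_mul_left hx' hy', link_eq_trace hx hy t₃, link_trace hx' hy']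
    · rw [fvs_link hx' hy' t₃, fvs_cl t₂]; simp [hx₂]
    · rw [fvs_link hx' hy' t₃, fvs_cl t₂]; simp [hy₂]
    · rw [fvs_add (hasTy_out hx n)]; simpa using Ne.symm h1.2.1
    · rw [fvs_add (hasTy_out hx n)]; simpa using (ne_of_pol hx hy').symm
    · rw [fvs_add (hasTy_in hy m)]; simpa using ne_of_pol hx' hy
    · rw [fvs_add (hasTy_in hy m)]; simpa using Ne.symm h2.2.2
  exact ext_of_hasTy fun m n h => h.elim (key hx hy hx' hy' m n)
    fun h => (key hx' hy' hx hy m n h).symm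

end Cl

/-! ### Lists of variables and of links -/

namespace Cl

variable {P : A → Bool}

/-- The tensor of a list of variables. -/
def vars (l : List A) : Cl S P := (l.map var).sum

/-- The term `M` with its inputs attached to the input variables `ys` and its outputs to the output
variables `xs`. -/
def hub (ys : List A) (a : Cl S P) (xs : List A) : Cl S P := vars ys * a * vars xs

/-- The links of a list of pairs of variables. -/
noncomputable def links (L : List (A × A)) (a : Cl S P) : Cl S P :=
  L.foldr (fun p c => c.link p.1 p.2) a

/-- All pairs of the list consist of an output variable and an input variable. -/
def IsPolar (P : A → Bool) (L : List (A × A)) : Prop := ∀ p ∈ L, P p.1 = false ∧ P p.2 = true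

@[simp] theorem vars_nil : (vars [] : Cl S P) = 0 := rfl

theorem vars_cons (x : A) (l : List A) : (vars (x :: l) : Cl S P) = var x + vars l :=
  List.sum_cons

theorem vars_append (l l' : List A) : (vars (l ++ l') : Cl S P) = vars l + vars l' := by
  simp [vars]

theorem fvs_vars_subset (l : List A) : (vars l : Cl S P).fvs ⊆ l.toFinset := by
  induction l with
  | nil => simp
  | cons x l ih =>
    rw [vars_cons, List.toFinset_cons, Finset.insert_eq]
    exact (fvs_add_subset _ _).trans (Finset.union_subset_union (by simp) ih)

theorem hasTy_vars_in {l : List A} (hl : l.Nodup) (hP : ∀ x ∈ l, P x = true) :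
    (vars l : Cl S P).HasTy 0 l.length := by
  induction l with
  | nil => exact hasTy_zero
  | cons x l ih =>
    rw [List.nodup_cons] at hl
    rw [vars_cons, List.length_cons, add_comm l.length]
    refine (hasTy_var_in (hP x (by simp))).add (ih hl.2 fun z hz => hP z (by simp [hz])) ?_
    rw [fvs_var, Finset.disjoint_singleton_left]
    exact fun h => hl.1 (by simpa using fvs_vars_subset l h)

theorem hasTy_vars_out {l : List A} (hl : l.Nodup) (hP : ∀ x ∈ l, P x = false) :
    (vars l : Cl S P).HasTy l.length 0 := by
  induction l with
  | nil => exact hasTy_zero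
  | cons x l ih =>
    rw [List.nodup_cons] at hl
    rw [vars_cons, List.length_cons, add_comm l.length]
    refine (hasTy_var_out (hP x (by simp))).add (ih hl.2 fun z hz => hP z (by simp [hz])) ?_
    rw [fvs_var, Finset.disjoint_singleton_left]
    exact fun h => hl.1 (by simpa using fvs_vars_subset l h)

theorem fvs_vars {l : List A} {m n : ℕ} (h : (vars l : Cl S P).HasTy m n) :
    (vars l : Cl S P).fvs = l.toFinset := by
  induction l generalizing m n with
  | nil => simp
  | cons x l ih =>
    rw [vars_cons] at h ⊢
    rw [fvs_add h]
    obtain ⟨-, _, _, _, _, -, -, -, h⟩ := hasTy_add.1 h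
    rw [ih h, fvs_var, List.toFinset_cons, Finset.insert_eq]

@[simp] theorem links_nil (a : Cl S P) : links [] a = a := rfl

@[simp] theorem links_cons (p : A × A) (L : List (A × A)) (a : Cl S P) :
    links (p :: L) a = link p.1 p.2 (links L a) := rfl

theorem links_append (L L' : List (A × A)) (a : Cl S P) :
    links (L ++ L') a = links L (links L' a) := by
  simp [links]

theorem IsPolar.of_cons {p : A × A} {L : List (A × A)} (h : IsPolar P (p :: L)) :
    (P p.1 = false ∧ P p.2 = true) ∧ IsPolar P L :=
  ⟨h p (by simp), fun q hq => h q (by simp [hq])⟩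

theorem IsPolar.perm {L L' : List (A × A)} (h : IsPolar P L) (e : L.Perm L') : IsPolar P L' :=
  fun p hp => h p (e.mem_iff.2 hp)

theorem links_perm {L L' : List (A × A)} (e : L.Perm L') (h : IsPolar P L) (a : Cl S P) :
    links L a = links L' a := by
  induction e with
  | nil => rfl
  | cons p e ih => simp only [links_cons, ih h.of_cons.2]
  | swap p q L =>
    have h1 := h.of_cons
    have h2 := h1.2.of_cons
    exact link_comm h1.1.1 h1.1.2 h2.1.1 h2.1.2 _
  | trans e e' ih ih' => rw [ih h, ih' (h.perm e)]

/-- No name of `L` is free in `a`. -/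
def Fresh (L : List (A × A)) (a : Cl S P) : Prop := ∀ p ∈ L, p.1 ∉ a.fvs ∧ p.2 ∉ a.fvs

theorem Fresh.of_cons {p : A × A} {L : List (A × A)} {a : Cl S P} (h : Fresh (p :: L) a) :
    (p.1 ∉ a.fvs ∧ p.2 ∉ a.fvs) ∧ Fresh L a :=
  ⟨h p (by simp), fun q hq => h q (by simp [hq])⟩

theorem Fresh.of_subset {L : List (A × A)} {a : Cl S P} {s : Finset A} (h : a.fvs ⊆ s)
    (h' : ∀ p ∈ L, p.1 ∉ s ∧ p.2 ∉ s) : Fresh L a :=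
  fun p hp => ⟨fun hz => (h' p hp).1 (h hz), fun hz => (h' p hp).2 (h hz)⟩

theorem links_mul_left {L : List (A × A)} (hL : IsPolar P L) (a : Cl S P) {b : Cl S P}
    (h : Fresh L b) : links L (a * b) = links L a * b := by
  induction L with
  | nil => rfl
  | cons p L ih =>
    rw [links_cons, ih hL.of_cons.2 h.of_cons.2, link_mul_left hL.of_cons.1.1 hL.of_cons.1.2 _
      h.of_cons.1.1 h.of_cons.1.2, links_cons]

theorem links_mul_right {L : List (A × A)} (hL : IsPolar P L) {a : Cl S P} (b : Cl S P)
    (h : Fresh L a) : links L (a * b) = a * links L b := by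
  induction L with
  | nil => rfl
  | cons p L ih =>
    rw [links_cons, ih hL.of_cons.2 h.of_cons.2, link_mul_right hL.of_cons.1.1 hL.of_cons.1.2 _
      h.of_cons.1.1 h.of_cons.1.2, links_cons]

theorem links_add_left {L : List (A × A)} (hL : IsPolar P L) (a : Cl S P) {b : Cl S P}
    (h : Fresh L b) : links L (a + b) = links L a + b := by
  induction L with
  | nil => rfl
  | cons p L ih =>
    rw [links_cons, ih hL.of_cons.2 h.of_cons.2, link_add_left hL.of_cons.1.1 hL.of_cons.1.2 _
      h.of_cons.1.1 h.of_cons.1.2, links_cons]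

theorem links_add_right {L : List (A × A)} (hL : IsPolar P L) {a : Cl S P} (b : Cl S P)
    (h : Fresh L a) : links L (a + b) = a + links L b := by
  induction L with
  | nil => rfl
  | cons p L ih =>
    rw [links_cons, ih hL.of_cons.2 h.of_cons.2, link_add_right hL.of_cons.1.1 hL.of_cons.1.2 _
      h.of_cons.1.1 h.of_cons.1.2, links_cons]

theorem links_trace {L : List (A × A)} (hL : IsPolar P L) (i : ℕ) (a : Cl S P) :
    links L (trace i a) = trace i (links L a) := by
  induction L with
  | nil => rfl
  | cons p L ih =>
    rw [links_cons, ih hL.of_cons.2, link_trace hL.of_cons.1.1 hL.of_cons.1.2, links_cons]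

theorem hasTy_links {L : List (A × A)} (hL : IsPolar P L) {a : Cl S P} {m n : ℕ}
    (h : (links L a).HasTy m n) : a.HasTy m n ∧
      (links L a).fvs = a.fvs \ (L.map Prod.fst ++ L.map Prod.snd).toFinset ∧
      (L.map Prod.fst).Nodup ∧ (L.map Prod.snd).Nodup ∧
      ∀ p ∈ L, p.1 ∈ a.fvs ∧ p.2 ∈ a.fvs := by
  induction L with
  | nil => exact ⟨h, by simp, by simp, by simp, by simp⟩
  | cons p L ih =>
    obtain ⟨⟨h1, h2⟩, h3⟩ := hL.of_cons
    have h' := h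
    rw [links_cons] at h h'
    rw [hasTy_link h1 h2] at h
    obtain ⟨h4, h5, h6⟩ := h
    obtain ⟨e1, e2, e3, e4, e5⟩ := ih h3 h6
    rw [e2] at h4 h5
    simp only [Finset.mem_sdiff, List.mem_toFinset, List.mem_append, not_or] at h4 h5
    refine ⟨e1, ?_, ?_, ?_, ?_⟩
    · rw [links_cons, fvs_link h1 h2 h', e2]
      ext z
      simp only [Finset.mem_sdiff, List.mem_toFinset, List.mem_append, Finset.mem_insert,
        Finset.mem_singleton, List.map_cons, List.mem_cons]
      tauto
    · rw [List.map_cons, List.nodup_cons]; exact ⟨h4.2.1, e3⟩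
    · rw [List.map_cons, List.nodup_cons]; exact ⟨h5.2.2, e4⟩
    · intro q hq
      rcases List.mem_cons.1 hq with rfl | hq
      · exact ⟨h4.1, h5.1⟩
      · exact e5 q hq

theorem sum_perm {l l' : List (Cl S P)} (e : l.Perm l') (h : ∀ a ∈ l, a.HasTy 0 0) :
    l.sum = l'.sum := by
  induction e with
  | nil => rfl
  | cons p e ih => rw [List.sum_cons, List.sum_cons, ih fun a ha => h a (by simp [ha])]
  | swap p q L =>
    simp only [List.sum_cons]
    rw [← add_assoc, add_comm_of_hasTy (h q (by simp)) (h p (by simp)), add_assoc]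
  | trans e e' ih ih' => rw [ih h, ih' fun a ha => h a (e.mem_iff.2 ha)]

theorem isPolar_zip {xs ys : List A} (hx : ∀ x ∈ xs, P x = false) (hy : ∀ y ∈ ys, P y = true) :
    IsPolar P (xs.zip ys) :=
  fun _ hp => ⟨hx _ (List.of_mem_zip hp).1, hy _ (List.of_mem_zip hp).2⟩

/-- Parallel wires, each cut in the middle and linked again. -/
theorem links_vars_mul_vars {xs ys : List A} (hlen : xs.length = ys.length) (hxs : xs.Nodup)
    (hys : ys.Nodup) (hx : ∀ x ∈ xs, P x = false) (hy : ∀ y ∈ ys, P y = true) :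
    links (xs.zip ys) (vars xs * vars ys : Cl S P) = id xs.length := by
  induction xs generalizing ys with
  | nil =>
    obtain rfl : ys = [] := List.length_eq_zero_iff.1 hlen.symm
    exact id_mul (a := 0) hasTy_zero
  | cons x xs ih =>
    obtain _ | ⟨y, ys⟩ := ys
    · simp at hlen
    simp only [List.length_cons, Nat.add_right_cancel_iff] at hlen
    rw [List.nodup_cons] at hxs hys
    have hx1 : P x = false := hx x (by simp)
    have hy1 : P y = true := hy y (by simp)
    have hx2 : ∀ x ∈ xs, P x = false := fun z hz => hx z (by simp [hz])
    have hy2 : ∀ x ∈ ys, P x = true := fun z hz => hy z (by simp [hz])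
    have hfr : Fresh (xs.zip ys) (var x * var y : Cl S P) := by
      refine Fresh.of_subset (s := {x} ∪ {y}) ((fvs_mul_subset _ _).trans (by simp)) ?_
      intro p hp
      obtain ⟨h1, h2⟩ := List.of_mem_zip (a := p.1) (b := p.2) hp
      have h3 := ne_of_pol (hx2 _ h1) hy1
      have h4 := ne_of_pol hx1 (hy2 _ h2)
      simp only [Finset.mem_union, Finset.mem_singleton, not_or]
      refine ⟨⟨?_, h3⟩, h4.symm, ?_⟩ <;> rintro rfl <;> tauto
    rw [vars_cons, vars_cons, interchange _ _ (hasTy_var_out hx1) (hasTy_var_in hy1),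
      List.zip_cons_cons, links_cons, links_add_right (isPolar_zip hx2 hy2) _ hfr,
      ih hlen hxs.2 hys.2 hx2 hy2, link_add_left hx1 hy1 _ (by simp) (by simp),
      link_var_mul_var hx1 hy1, ← id_add, List.length_cons, add_comm]

/-- Linking the outputs of one diagram to the inputs of another composes them. -/
theorem links_zip_add {xs ys : List A} (hlen : xs.length = ys.length) (hxs : xs.Nodup)
    (hys : ys.Nodup) (hx : ∀ x ∈ xs, P x = false) (hy : ∀ y ∈ ys, P y = true)
    {a b : Cl S P} (ha : a.HasTy 0 xs.length) (hb : b.HasTy ys.length 0)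
    (hfa : ∀ z, z ∈ xs ∨ z ∈ ys → z ∉ a.fvs) (hfb : ∀ z, z ∈ xs ∨ z ∈ ys → z ∉ b.fvs) :
    links (xs.zip ys) (a * vars xs + vars ys * b) = a * b := by
  have h1 : (a * vars xs).HasTy 0 0 := by
    refine ha.mul (hasTy_vars_out hxs hx) (Finset.disjoint_right.2 fun z hz => hfa z (.inl ?_))
    simpa using fvs_vars_subset _ hz
  have h2 : (vars ys * b).HasTy 0 0 := by
    refine (hasTy_vars_in hys hy).mul hb (Finset.disjoint_left.2 fun z hz => hfb z (.inr ?_))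
    simpa using fvs_vars_subset _ hz
  have hfr : ∀ c : Cl S P, (∀ z, z ∈ xs ∨ z ∈ ys → z ∉ c.fvs) → Fresh (xs.zip ys) c :=
    fun c hc p hp => ⟨hc _ (.inl (List.of_mem_zip (a := p.1) (b := p.2) hp).1),
      hc _ (.inr (List.of_mem_zip (a := p.1) (b := p.2) hp).2)⟩
  have hL := isPolar_zip (P := P) hx hy
  rw [add_eq_mul h1 h2, mul_assoc, links_mul_right hL _ (hfr a hfa), ← mul_assoc,
    links_mul_left hL _ (hfr b hfb), links_vars_mul_vars hlen hxs hys hx hy, ← mul_assoc,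
    mul_id ha]

/-- Linking the last outputs of a diagram to its last inputs is a trace. -/
theorem links_zip_trace {xs ys xs' ys' : List A} (hlen : xs'.length = ys'.length)
    (hys : (ys ++ ys').Nodup) (hxs : (xs ++ xs').Nodup) (hy : ∀ y ∈ ys ++ ys', P y = true)
    (hx : ∀ x ∈ xs ++ xs', P x = false) {a : Cl S P}
    (ha : a.HasTy (ys.length + ys'.length) (xs.length + ys'.length))
    (hfa : ∀ z ∈ a.fvs, z ∉ xs ∧ z ∉ ys ∧ z ∉ xs' ∧ z ∉ ys') :
    links (xs'.zip ys') (hub (ys ++ ys') a (xs ++ xs')) = hub ys (trace ys'.length a) xs := by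
  have hys2 := List.nodup_append.1 hys
  have hxs2 := List.nodup_append.1 hxs
  have hy1 : ∀ y ∈ ys, P y = true := fun z hz => hy z (by simp [hz])
  have hy2 : ∀ y ∈ ys', P y = true := fun z hz => hy z (by simp [hz])
  have hx1 : ∀ y ∈ xs, P y = false := fun z hz => hx z (by simp [hz])
  have hx2 : ∀ y ∈ xs', P y = false := fun z hz => hx z (by simp [hz])
  set i := ys'.length with hi
  have tY : (vars ys : Cl S P).HasTy 0 ys.length := hasTy_vars_in hys2.1 hy1
  have tY' : (vars ys' : Cl S P).HasTy 0 i := hasTy_vars_in hys2.2.1 hy2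
  have tX : (vars xs : Cl S P).HasTy xs.length 0 := hasTy_vars_out hxs2.1 hx1
  have tX' : (vars xs' : Cl S P).HasTy i 0 := hlen ▸ hasTy_vars_out hxs2.2.1 hx2
  -- The variables `ys` and `xs` are absorbed into `f`, which is left with the wires to be traced.
  have eY : (vars (ys ++ ys') : Cl S P) = vars ys' * (vars ys + id i) := by
    have h := interchange' (0 : Cl S P) (vars ys) tY' (hasTy_id i)
    rw [zero_add, ← id_zero, id_mul tY, mul_id tY'] at h
    rw [vars_append, h]
  have eX : (vars (xs ++ xs') : Cl S P) = (vars xs + id i) * vars xs' := by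
    have h := interchange' (vars xs) (0 : Cl S P) (hasTy_id i) tX'
    rw [zero_add, ← id_zero, mul_id tX, id_mul tX'] at h
    rw [vars_append, h]
  have tYi : (vars ys + id i : Cl S P).HasTy i (ys.length + i) := by
    simpa using tY.add (hasTy_id i) (by simp)
  have tXi : (vars xs + id i : Cl S P).HasTy (xs.length + i) i := by
    simpa using tX.add (hasTy_id i) (by simp)
  have fYi : (vars ys + id i : Cl S P).fvs = ys.toFinset := by
    rw [fvs_add tYi, fvs_vars tY]; simp
  have fXi : (vars xs + id i : Cl S P).fvs = xs.toFinset := by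
    rw [fvs_add tXi, fvs_vars tX]; simp
  set f : Cl S P := (vars ys + id i) * (a * (vars xs + id i)) with hf
  have tf1 : (a * (vars xs + id i)).HasTy (ys.length + i) i := by
    refine ha.mul tXi ?_
    rw [fXi, Finset.disjoint_left]
    intro z hz
    simpa using (hfa z hz).1
  have tf : f.HasTy i i := by
    refine tYi.mul tf1 ?_
    rw [fvs_mul tf1, fXi, fYi, Finset.disjoint_left]
    intro z hz hz'
    rw [List.mem_toFinset] at hz
    rcases Finset.mem_union.1 hz' with h | h
    · exact (hfa z h).2.1 hz
    · exact ne_of_pol (hx1 z (by simpa using h)) (hy1 z hz) rfl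
  have ff : ∀ z ∈ f.fvs, z ∉ xs' ∧ z ∉ ys' := by
    intro z hz
    rw [fvs_mul tf, fvs_mul tf1, fXi, fYi] at hz
    simp only [Finset.mem_union, List.mem_toFinset] at hz
    rcases hz with hz | hz | hz
    · exact ⟨fun h => ne_of_pol (hx2 z h) (hy1 z hz) rfl, fun h => hys2.2.2 z hz z h rfl⟩
    · exact (hfa z hz).2.2
    · exact ⟨fun h => hxs2.2.2 z hz z h rfl, fun h => ne_of_pol (hx1 z hz) (hy2 z h) rfl⟩
  have tfX : (f * vars xs').HasTy (0 + i) (0 + 0) := by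
    rw [zero_add]
    refine tf.mul tX' ?_
    rw [fvs_vars tX', Finset.disjoint_left]
    intro z hz
    simpa using (ff z hz).1
  have hL := isPolar_zip (P := P) hx2 hy2
  have hfr : Fresh (xs'.zip ys') f := fun p hp =>
    ⟨fun h => (ff _ h).1 (List.of_mem_zip (a := p.1) (b := p.2) hp).1,
      fun h => (ff _ h).2 (List.of_mem_zip (a := p.1) (b := p.2) hp).2⟩
  -- The variables `ys'` slide around a trace over `i` wires, which leaves a trace over no wire.
  have e := sliding (n := 0) (q := 0) tfX tY'
  rw [id_zero, zero_add, trace_zero] at e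
  have e0 : hub (ys ++ ys') a (xs ++ xs') = vars ys' * (f * vars xs') := by
    simp only [hub, eY, eX, hf, mul_assoc]
  rw [e0, ← e, links_trace hL, mul_assoc, links_mul_right hL _ hfr,
    links_vars_mul_vars hlen hxs2.2.1 hys2.2.1 hx2 hy2, hlen, mul_id tf, hf, trace_left,
    trace_right, hub, mul_assoc]

theorem hasTy_hub {ys xs : List A} {a : Cl S P} (ha : a.HasTy ys.length xs.length)
    (hys : ys.Nodup) (hxs : xs.Nodup) (hy : ∀ y ∈ ys, P y = true) (hx : ∀ x ∈ xs, P x = false)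
    (hfa : ∀ z ∈ a.fvs, z ∉ xs ∧ z ∉ ys) : (hub ys a xs).HasTy 0 0 := by
  have tY : (vars ys : Cl S P).HasTy 0 ys.length := hasTy_vars_in hys hy
  have tX : (vars xs : Cl S P).HasTy xs.length 0 := hasTy_vars_out hxs hx
  have t1 : (vars ys * a).HasTy 0 xs.length := by
    refine tY.mul ha ?_
    rw [fvs_vars tY, Finset.disjoint_right]
    intro z hz
    simpa using (hfa z hz).2
  refine t1.mul tX ?_
  rw [fvs_mul t1, fvs_vars tY, fvs_vars tX, Finset.disjoint_left]
  intro z hz hz'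
  rw [List.mem_toFinset] at hz'
  rcases Finset.mem_union.1 hz with h | h
  · exact ne_of_pol (hx z hz') (hy z (by simpa using h)) rfl
  · exact (hfa z h).1 hz'

theorem fvs_hub {ys xs : List A} {a : Cl S P} (h : (hub ys a xs).HasTy 0 0) :
    (hub ys a xs).fvs = ys.toFinset ∪ a.fvs ∪ xs.toFinset := by
  rw [hub, fvs_mul h]
  obtain ⟨-, k, h1, h2⟩ := hasTy_mul.1 h
  rw [fvs_mul h1, fvs_vars h2]
  obtain ⟨-, k, h1, h2⟩ := hasTy_mul.1 h1
  rw [fvs_vars h1]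

theorem fvs_hub_subset (ys xs : List A) (a : Cl S P) :
    (hub ys a xs).fvs ⊆ ys.toFinset ∪ a.fvs ∪ xs.toFinset :=
  (fvs_mul_subset _ _).trans (Finset.union_subset_union ((fvs_mul_subset _ _).trans
    (Finset.union_subset_union (fvs_vars_subset _) le_rfl)) (fvs_vars_subset _))

theorem hub_add {ys xs ys' xs' : List A} {a b : Cl S P} (ha : a.HasTy ys.length xs.length)
    (hys : ys.Nodup) (hxs : xs.Nodup) (hy : ∀ y ∈ ys, P y = true) (hx : ∀ x ∈ xs, P x = false)
    (hfa : ∀ z ∈ a.fvs, z ∉ xs ∧ z ∉ ys) :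
    hub (ys ++ ys') (a + b) (xs ++ xs') = hub ys a xs + hub ys' b xs' := by
  have tY : (vars ys : Cl S P).HasTy 0 ys.length := hasTy_vars_in hys hy
  have tX : (vars xs : Cl S P).HasTy xs.length 0 := hasTy_vars_out hxs hx
  have t := hasTy_hub ha hys hxs hy hx hfa
  obtain ⟨-, k, h1, h2⟩ := hasTy_mul.1 t
  obtain rfl := (h2.unique tX).1
  rw [hub, vars_append, vars_append, interchange _ _ tY ha, interchange _ _ h1 tX]
  rfl

end Cl

/-! ### Presentations of graphs by lists of atoms and wires -/

/-- A part of a graph: a wire node, or a vertex labelled with a variable (`wire`), or a box together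
with its input and output ports (`box`). -/
inductive Atom (S : Signature.{u}) (V : Type) : Type u
  | wire (v : V) : Atom S V
  | box (k : S.K) (v : V) (ins outs : List V) : Atom S V

namespace Atom

variable {V W : Type}

/-- The vertices at which wires enter the atom. -/
def ins : Atom S V → List V
  | wire v => [v]
  | box _ _ is _ => is

/-- The vertices at which wires leave the atom. -/
def outs : Atom S V → List V
  | wire v => [v]
  | box _ _ _ os => os

/-- All vertices of the atom. -/
def verts : Atom S V → List V
  | wire v => [v]
  | box _ v is os => v :: (is ++ os)

/-- The edges between ports and their box. -/
def Inner : Atom S V → V → V → Prop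
  | wire _, _, _ => False
  | box _ v is os, a, b => (a ∈ is ∧ b = v) ∨ (a = v ∧ b ∈ os)

/-- The closed term that the atom stands for. -/
def core : Atom S V → Term S A
  | wire _ => .one
  | box k _ _ _ => .const k

/-- Transport of an atom along a map of vertices. -/
def map (e : V → W) : Atom S V → Atom S W
  | wire v => wire (e v)
  | box k v is os => box k (e v) (is.map e) (os.map e)

/-- The labels of the vertices are as they should be. -/
def Good (f : V → Option (Label S A)) : Atom S V → Prop
  | wire v => f v = none ∨ ∃ z, f v = some (.var z)
  | box k v is os => f v = some (.box k) ∧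
      is.map f = List.ofFn (fun i => some (.inPort k i)) ∧
      os.map f = List.ofFn (fun j => some (.outPort k j))

@[simp] theorem ins_map (e : V → W) (t : Atom S V) : (t.map e).ins = t.ins.map e := by
  cases t <;> rfl

@[simp] theorem outs_map (e : V → W) (t : Atom S V) : (t.map e).outs = t.outs.map e := by
  cases t <;> rfl

@[simp] theorem verts_map (e : V → W) (t : Atom S V) : (t.map e).verts = t.verts.map e := by
  cases t <;> simp [map, verts]

@[simp] theorem core_map (e : V → W) (t : Atom S V) :
    ((t.map e).core : Term S A) = t.core := by
  cases t <;> rfl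

theorem inner_map (e : V → W) (t : Atom S V) (a b : W) :
    (t.map e).Inner a b ↔ ∃ a' b', a = e a' ∧ b = e b' ∧ t.Inner a' b' := by
  cases t with
  | wire v => simp [map, Inner]
  | box k v is os =>
    simp only [map, Inner, List.mem_map]
    constructor
    · rintro (⟨⟨a', h, rfl⟩, rfl⟩ | ⟨rfl, ⟨b', h, rfl⟩⟩)
      · exact ⟨a', v, rfl, rfl, .inl ⟨h, rfl⟩⟩
      · exact ⟨v, b', rfl, rfl, .inr ⟨rfl, h⟩⟩
    · rintro ⟨a', b', rfl, rfl, ⟨h, rfl⟩ | ⟨rfl, h⟩⟩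
      · exact .inl ⟨⟨a', h, rfl⟩, rfl⟩
      · exact .inr ⟨rfl, ⟨b', h, rfl⟩⟩

theorem good_map (e : V → W) {f : W → Option (Label S A)} {t : Atom S V} :
    (t.map e).Good f ↔ t.Good (f ∘ e) := by
  cases t <;> simp [map, Good]

theorem mem_verts_of_ins {t : Atom S V} {v : V} (h : v ∈ t.ins) : v ∈ t.verts := by
  cases t <;> simp_all [ins, verts]

theorem mem_verts_of_outs {t : Atom S V} {v : V} (h : v ∈ t.outs) : v ∈ t.verts := by
  cases t <;> simp_all [outs, verts]

theorem ins_nodup {t : Atom S V} (h : t.verts.Nodup) : t.ins.Nodup := by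
  cases t with
  | wire v => simp [ins]
  | box k v is os => exact (List.nodup_append.1 (List.nodup_cons.1 h).2).1

theorem outs_nodup {t : Atom S V} (h : t.verts.Nodup) : t.outs.Nodup := by
  cases t with
  | wire v => simp [outs]
  | box k v is os => exact (List.nodup_append.1 (List.nodup_cons.1 h).2).2.1

theorem hasTy_core (P : A → Bool) {f : V → Option (Label S A)} {t : Atom S V} (h : t.Good f) :
    (cl P t.core).HasTy t.ins.length t.outs.length := by
  cases t with
  | wire v => exact ⟨rfl, rfl⟩
  | box k v is os =>
    obtain ⟨-, h1, h2⟩ := h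
    have h1 := congrArg List.length h1
    have h2 := congrArg List.length h2
    simp only [List.length_map, List.length_ofFn] at h1 h2
    exact ⟨h1, h2⟩

theorem fv_core (t : Atom S V) : fv (t.core : Term S A) = ∅ := by
  cases t <;> rfl

end Atom

/-- `ats` and `es` present the graph on `V` with labelling `f` and edges `E`: the atoms partition
the vertices, and `es` enumerates the edges that are not between a box and its ports. -/
structure Pres {V : Type} (f : V → Option (Label S A)) (E : V → V → Prop)
    (ats : List (Atom S V)) (es : List (V × V)) : Prop where
  nodup : (ats.flatMap Atom.verts).Nodup
  complete : ∀ v, v ∈ ats.flatMap Atom.verts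
  good : ∀ t ∈ ats, t.Good f
  es_nodup : es.Nodup
  edge_iff : ∀ a b, E a b ↔ (a, b) ∈ es ∨ ∃ t ∈ ats, t.Inner a b
  es_box : ∀ p ∈ es, (∀ k, f p.1 ≠ some (.box k)) ∧ ∀ k, f p.2 ≠ some (.box k)

namespace Pres

variable {V W : Type} {f : V → Option (Label S A)} {E : V → V → Prop}
  {ats : List (Atom S V)} {es : List (V × V)}

theorem verts_nodup (h : Pres f E ats es) {t : Atom S V} (ht : t ∈ ats) : t.verts.Nodup :=
  (List.nodup_flatMap.1 h.nodup).1 t ht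

theorem exists_atom (h : Pres f E ats es) (v : V) : ∃ t ∈ ats, v ∈ t.verts :=
  List.mem_flatMap.1 (h.complete v)

theorem eq_of_mem (h : Pres f E ats es) {t t' : Atom S V} (ht : t ∈ ats) (ht' : t' ∈ ats) {v : V}
    (hv : v ∈ t.verts) (hv' : v ∈ t'.verts) : t = t' := by
  by_contra hne
  have : Std.Symm (Function.onFun List.Disjoint (Atom.verts (S := S) (V := V))) :=
    ⟨fun _ _ h => List.Disjoint.symm h⟩
  have := (List.nodup_flatMap.1 h.nodup).2.forall ht ht' hne
  exact this hv hv'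

theorem ats_nodup (h : Pres f E ats es) : ats.Nodup := by
  refine (List.nodup_flatMap.1 h.nodup).2.imp fun {t t'} hd he => ?_
  subst he
  cases t with
  | wire v => exact hd (a := v) (by simp [Atom.verts]) (by simp [Atom.verts])
  | box k v is os => exact hd (a := v) (by simp [Atom.verts]) (by simp [Atom.verts])

/-- A vertex without label is a wire atom. -/
theorem wire_mem (h : Pres f E ats es) {v : V}
    (hv : f v = none ∨ ∃ z, f v = some (.var z)) : Atom.wire v ∈ ats := by
  obtain ⟨t, ht, hvt⟩ := h.exists_atom v
  cases t with
  | wire w =>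
    obtain rfl : v = w := by simpa [Atom.verts] using hvt
    exact ht
  | box k w is os =>
    exfalso
    obtain ⟨h1, h2, h3⟩ := h.good _ ht
    simp only [Atom.verts, List.mem_cons, List.mem_append] at hvt
    rcases hvt with rfl | hvt | hvt
    · simp [h1] at hv
    · have : f v ∈ is.map f := List.mem_map_of_mem hvt
      rw [h2, List.mem_ofFn] at this
      obtain ⟨i, hi⟩ := this
      simp [← hi] at hv
    · have : f v ∈ os.map f := List.mem_map_of_mem hvt
      rw [h3, List.mem_ofFn] at this
      obtain ⟨i, hi⟩ := this
      simp [← hi] at hv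

theorem box_label_of_inner (h : Pres f E ats es) {t : Atom S V} (ht : t ∈ ats) {a b : V}
    (hi : t.Inner a b) : (∃ k, f a = some (.box k)) ∨ ∃ k, f b = some (.box k) := by
  cases t with
  | wire v => exact hi.elim
  | box k v is os =>
    obtain ⟨h1, -, -⟩ := h.good _ ht
    rcases hi with ⟨-, rfl⟩ | ⟨rfl, -⟩
    · exact .inr ⟨k, h1⟩
    · exact .inl ⟨k, h1⟩

/-- The list of wires is determined by the graph: the edges that do not meet a box vertex. -/
theorem mem_es_iff (h : Pres f E ats es) {a b : V} :
    (a, b) ∈ es ↔ E a b ∧ (∀ k, f a ≠ some (.box k)) ∧ ∀ k, f b ≠ some (.box k) := by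
  constructor
  · intro hab
    exact ⟨(h.edge_iff a b).2 (.inl hab), h.es_box _ hab⟩
  · rintro ⟨h1, h2, h3⟩
    refine ((h.edge_iff a b).1 h1).resolve_right ?_
    rintro ⟨t, ht, hi⟩
    rcases h.box_label_of_inner ht hi with ⟨k, hk⟩ | ⟨k, hk⟩
    · exact h2 k hk
    · exact h3 k hk

theorem es_perm (h : Pres f E ats es) {ats' : List (Atom S V)} {es' : List (V × V)}
    (h' : Pres f E ats' es') : es.Perm es' := by
  refine (List.perm_ext_iff_of_nodup h.es_nodup h'.es_nodup).2 fun p => ?_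
  rw [← Prod.mk.eta (p := p), h.mem_es_iff, h'.mem_es_iff]

/-- The ports of a box are determined by the graph. -/
theorem box_unique (h : Pres f E ats es) {ats' : List (Atom S V)} {es' : List (V × V)}
    (h' : Pres f E ats' es') {k k' : S.K} {v : V} {is os is' os' : List V}
    (ht : Atom.box k v is os ∈ ats) (ht' : Atom.box k' v is' os' ∈ ats') :
    Atom.box k v is os = Atom.box k' v is' os' := by
  have aux : ∀ {n : ℕ} {g : Fin n → Option (Label S A)}, Function.Injective g → ∀ {l l' : List V},
      l.map f = List.ofFn g → l'.map f = List.ofFn g → (∀ a ∈ l, a ∈ l') → l = l' := by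
    intro n g hg l l' e e' hsub
    have e1 := congrArg List.length e
    have e2 := congrArg List.length e'
    simp only [List.length_map, List.length_ofFn] at e1 e2
    refine List.ext_getElem (by omega) fun i hi hi' => ?_
    obtain ⟨j, hj, hj'⟩ := List.mem_iff_getElem.1 (hsub _ (List.getElem_mem hi))
    have f1 : f l[i] = g ⟨i, by omega⟩ := by
      have := List.getElem_of_eq e (i := i) (by simpa using hi)
      simpa using this
    have f2 : f l'[j] = g ⟨j, by omega⟩ := by
      have := List.getElem_of_eq e' (i := j) (by simpa using hj)
      simpa using this
    have : j = i := by
      rw [hj', f1] at f2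
      simpa using (hg f2).symm
    subst this
    exact hj'.symm
  obtain ⟨h1, h2, h3⟩ := h.good _ ht
  obtain ⟨h1', h2', h3'⟩ := h'.good _ ht'
  obtain rfl : k = k' := by simpa [h1] using h1'
  have hin : is = is' := by
    refine aux (fun i j hij => by simpa using hij) h2 h2' fun a ha => ?_
    have hE : E a v := (h.edge_iff a v).2 (.inr ⟨_, ht, .inl ⟨ha, rfl⟩⟩)
    obtain ⟨t, ht2, hi⟩ : ∃ t ∈ ats', t.Inner a v :=
      ((h'.edge_iff a v).1 hE).resolve_left fun hm => (h'.es_box _ hm).2 k h1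
    have hfa : f a ∈ is.map f := List.mem_map_of_mem ha
    rw [h2, List.mem_ofFn] at hfa
    obtain ⟨i, hfa⟩ := hfa
    cases t with
    | wire w => exact hi.elim
    | box k2 w is2 os2 =>
      rcases hi with ⟨hi, rfl⟩ | ⟨rfl, hi⟩
      · have := h'.eq_of_mem ht' ht2 (v := v) (by simp [Atom.verts]) (by simp [Atom.verts])
        cases this
        exact hi
      · have := (h'.good _ ht2).1
        rw [← hfa] at this
        simp at this
  have hout : os = os' := by
    refine aux (fun i j hij => by simpa using hij) h3 h3' fun a ha => ?_
    have hE : E v a := (h.edge_iff v a).2 (.inr ⟨_, ht, .inr ⟨rfl, ha⟩⟩)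
    obtain ⟨t, ht2, hi⟩ : ∃ t ∈ ats', t.Inner v a :=
      ((h'.edge_iff v a).1 hE).resolve_left fun hm => (h'.es_box _ hm).1 k h1
    have hfa : f a ∈ os.map f := List.mem_map_of_mem ha
    rw [h3, List.mem_ofFn] at hfa
    obtain ⟨i, hfa⟩ := hfa
    cases t with
    | wire w => exact hi.elim
    | box k2 w is2 os2 =>
      rcases hi with ⟨hi, rfl⟩ | ⟨rfl, hi⟩
      · have := (h'.good _ ht2).1
        rw [← hfa] at this
        simp at this
      · have := h'.eq_of_mem ht' ht2 (v := v) (by simp [Atom.verts]) (by simp [Atom.verts])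
        cases this
        exact hi
  rw [hin, hout]

theorem mem_ats_of_mem (h : Pres f E ats es) {ats' : List (Atom S V)} {es' : List (V × V)}
    (h' : Pres f E ats' es') {t : Atom S V} (ht : t ∈ ats) : t ∈ ats' := by
  cases t with
  | wire v => exact h'.wire_mem (h.good _ ht)
  | box k v is os =>
    obtain ⟨t', ht', hv⟩ := h'.exists_atom v
    have hf := (h.good _ ht).1
    cases t' with
    | wire w =>
      obtain rfl : v = w := by simpa [Atom.verts] using hv
      rcases h'.good _ ht' with h1 | ⟨z, h1⟩ <;> simp [hf] at h1
    | box k' w is' os' =>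
      simp only [Atom.verts, List.mem_cons, List.mem_append] at hv
      obtain ⟨h1, h2, h3⟩ := h'.good _ ht'
      rcases hv with rfl | hv | hv
      · rwa [h.box_unique h' ht ht']
      · have : f v ∈ is'.map f := List.mem_map_of_mem hv
        rw [h2, List.mem_ofFn] at this
        obtain ⟨i, hi⟩ := this
        simp [hf] at hi
      · have : f v ∈ os'.map f := List.mem_map_of_mem hv
        rw [h3, List.mem_ofFn] at this
        obtain ⟨i, hi⟩ := this
        simp [hf] at hi

/-- Presentations are unique up to the order of the lists. -/
theorem ats_perm (h : Pres f E ats es) {ats' : List (Atom S V)} {es' : List (V × V)}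
    (h' : Pres f E ats' es') : ats.Perm ats' :=
  (List.perm_ext_iff_of_nodup h.ats_nodup h'.ats_nodup).2 fun _ =>
    ⟨h.mem_ats_of_mem h', h'.mem_ats_of_mem h⟩

theorem flatMap_verts_map (e : V → W) (l : List (Atom S V)) :
    (l.map (Atom.map e)).flatMap Atom.verts = (l.flatMap Atom.verts).map e := by
  simp [List.flatMap_map, List.map_flatMap]

/-- New edges between vertices that are not boxes are wires. -/
theorem add_edges (h : Pres f E ats es) {E' : V → V → Prop} {ns : List (V × V)} (hns : ns.Nodup)
    (hd : ∀ p ∈ ns, p ∉ es)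
    (hb : ∀ p ∈ ns, (∀ k, f p.1 ≠ some (.box k)) ∧ ∀ k, f p.2 ≠ some (.box k))
    (hE : ∀ a b, E' a b ↔ E a b ∨ (a, b) ∈ ns) : Pres f E' ats (es ++ ns) where
  nodup := h.nodup
  complete := h.complete
  good := h.good
  es_nodup := h.es_nodup.append hns fun p hp hp' => hd p hp' hp
  edge_iff a b := by rw [hE, h.edge_iff, List.mem_append, or_right_comm]
  es_box p hp := (List.mem_append.1 hp).elim (h.es_box p) (hb p)

/-- The disjoint union of two presentations. -/
theorem sum {f' : W → Option (Label S A)} {E' : W → W → Prop} {ats' : List (Atom S W)}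
    {es' : List (W × W)} (h : Pres f E ats es) (h' : Pres f' E' ats' es') :
    Pres (Sum.elim f f') (Sum.LiftRel E E')
      (ats.map (Atom.map Sum.inl) ++ ats'.map (Atom.map Sum.inr))
      (es.map (Prod.map Sum.inl Sum.inl) ++ es'.map (Prod.map Sum.inr Sum.inr)) where
  nodup := by
    rw [List.flatMap_append, flatMap_verts_map, flatMap_verts_map]
    refine (h.nodup.map Sum.inl_injective).append (h'.nodup.map Sum.inr_injective) ?_
    intro v hv hv'
    obtain ⟨a, -, rfl⟩ := List.mem_map.1 hv
    obtain ⟨b, -, hb⟩ := List.mem_map.1 hv'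
    cases hb
  complete v := by
    rw [List.flatMap_append, flatMap_verts_map, flatMap_verts_map, List.mem_append]
    rcases v with v | v
    · exact .inl (List.mem_map_of_mem (h.complete v))
    · exact .inr (List.mem_map_of_mem (h'.complete v))
  good t ht := by
    rcases List.mem_append.1 ht with ht | ht <;> obtain ⟨t', ht', rfl⟩ := List.mem_map.1 ht <;>
      rw [Atom.good_map]
    · exact h.good t' ht'
    · exact h'.good t' ht'
  es_nodup := by
    refine (h.es_nodup.map (Sum.inl_injective.prodMap Sum.inl_injective)).append
      (h'.es_nodup.map (Sum.inr_injective.prodMap Sum.inr_injective)) ?_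
    intro p hp hp'
    obtain ⟨a, -, rfl⟩ := List.mem_map.1 hp
    obtain ⟨b, -, hb⟩ := List.mem_map.1 hp'
    cases hb
  edge_iff a b := by
    simp only [List.mem_append, or_and_right, exists_or, List.mem_map, exists_exists_and_eq_and,
      Atom.inner_map]
    rcases a with a | a <;> rcases b with b | b
    · simp [h.edge_iff]
    · simp
    · simp
    · simp [h'.edge_iff]
  es_box p hp := by
    rcases List.mem_append.1 hp with hp | hp <;> obtain ⟨q, hq, rfl⟩ := List.mem_map.1 hp
    · exact h.es_box q hq
    · exact h'.es_box q hq

/-- Erasing labels of variables does not affect a presentation. -/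
theorem relabel (h : Pres f E ats es) {f' : V → Option (Label S A)}
    (hf : ∀ v, f' v = f v ∨ (f' v = none ∧ ∃ z, f v = some (.var z))) : Pres f' E ats es where
  nodup := h.nodup
  complete := h.complete
  good t ht := by
    have ht := h.good t ht
    have aux : ∀ {n : ℕ} {g : Fin n → Label S A}, (∀ i z, g i ≠ .var z) → ∀ l : List V,
        l.map f = List.ofFn (fun i => some (g i)) → l.map f' = List.ofFn (fun i => some (g i)) := by
      intro n g hg l e
      rw [← e]
      refine List.map_congr_left fun v hv => (hf v).resolve_right ?_
      rintro ⟨-, z, hz⟩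
      have : f v ∈ l.map f := List.mem_map_of_mem hv
      rw [e, List.mem_ofFn, hz] at this
      obtain ⟨i, hi⟩ := this
      exact hg i z (by simpa using hi)
    cases t with
    | wire v =>
      rcases hf v with h1 | ⟨h1, -⟩
      · rwa [Atom.Good, h1]
      · exact .inl h1
    | box k v is os =>
      obtain ⟨h1, h2, h3⟩ := ht
      refine ⟨?_, aux (by simp) is h2, aux (by simp) os h3⟩
      rcases hf v with h4 | ⟨h4, z, h5⟩
      · rw [h4, h1]
      · simp [h1] at h5
  es_nodup := h.es_nodup
  edge_iff := h.edge_iff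
  es_box p hp := by
    obtain ⟨h1, h2⟩ := h.es_box p hp
    constructor <;> intro k hk
    · rcases hf p.1 with h3 | ⟨h3, -⟩
      · exact h1 k (h3 ▸ hk)
      · simp [h3] at hk
    · rcases hf p.2 with h3 | ⟨h3, -⟩
      · exact h2 k (h3 ▸ hk)
      · simp [h3] at hk

/-- Transport of a presentation along an isomorphism. -/
theorem map_equiv {f' : W → Option (Label S A)} {E' : W → W → Prop} (h : Pres f E ats es)
    (e : V ≃ W) (hf : ∀ v, f' (e v) = f v) (hE : ∀ a b, E a b ↔ E' (e a) (e b)) :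
    Pres f' E' (ats.map (Atom.map e)) (es.map (Prod.map e e)) where
  nodup := by rw [flatMap_verts_map]; exact h.nodup.map e.injective
  complete v := by
    rw [flatMap_verts_map]
    have := List.mem_map_of_mem (f := e) (h.complete (e.symm v))
    rwa [e.apply_symm_apply] at this
  good t ht := by
    obtain ⟨t', ht', rfl⟩ := List.mem_map.1 ht
    rw [Atom.good_map]
    have : f' ∘ e = f := funext hf
    rw [this]
    exact h.good t' ht'
  es_nodup := h.es_nodup.map (e.injective.prodMap e.injective)
  edge_iff a b := by
    obtain ⟨a, rfl⟩ := e.surjective a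
    obtain ⟨b, rfl⟩ := e.surjective b
    rw [← hE, h.edge_iff]
    simp only [List.mem_map, exists_exists_and_eq_and, Atom.inner_map, e.injective.eq_iff]
    simp [e.injective.eq_iff]
  es_box p hp := by
    obtain ⟨q, hq, rfl⟩ := List.mem_map.1 hp
    simpa [hf] using h.es_box q hq

end Pres

/-! ### Renaming of variables -/

theorem fv_subset_names (M : Term S A) : fv M ⊆ names M := by
  induction M with
  | const k | zero | one | sym | var x => simp [fv, names]
  | comp M N ihM ihN | tensor M N ihM ihN => exact Finset.union_subset_union ihM ihN
  | trace i M ih => exact ih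
  | link x y M ih =>
    exact (Finset.sdiff_subset.trans ih).trans Finset.subset_union_right

theorem fv_rename {x x' : A} {M : Term S A} (h : x' ∉ names M) :
    fv (rename x x' M) = (fv M).image (fun z => if z = x then x' else z) := by
  induction M with
  | const k | zero | one | sym => simp [fv, rename]
  | var z => simp [fv, rename]
  | comp M N ihM ihN | tensor M N ihM ihN =>
    simp only [names, Finset.mem_union, not_or] at h
    simp only [rename, fv, Finset.image_union, ihM h.1, ihN h.2]
  | trace i M ih => exact ih h
  | link a b M ih =>
    simp only [names, Finset.mem_union, Finset.mem_insert, Finset.mem_singleton, not_or] at h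
    simp only [rename]
    split_ifs with hab
    · have : x ∉ fv (.link a b M : Term S A) := by
        simp only [fv, Finset.mem_sdiff, Finset.mem_insert, Finset.mem_singleton]
        rcases hab with rfl | rfl <;> tauto
      conv_lhs => rw [← Finset.image_id (s := fv (.link a b M : Term S A))]
      refine Finset.image_congr fun z hz => ?_
      have : z ≠ x := by rintro rfl; exact this hz
      simp [this]
    · simp only [fv, ih h.2]
      push Not at hab
      ext z
      simp only [Finset.mem_sdiff, Finset.mem_image, Finset.mem_insert, Finset.mem_singleton]
      constructor
      · rintro ⟨⟨w, hw, rfl⟩, hz⟩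
        refine ⟨w, ⟨hw, ?_⟩, rfl⟩
        split_ifs at hz with hwx
        · subst hwx; tauto
        · exact hz
      · rintro ⟨w, ⟨hw, hz⟩, rfl⟩
        refine ⟨⟨w, hw, rfl⟩, ?_⟩
        split_ifs with hwx
        · exact h.1.imp id id |> fun h => by tauto
        · exact hz

theorem disjoint_image_rename {x x' : A} {s t : Finset A} (hs : x' ∉ s) (ht : x' ∉ t)
    (h : Disjoint s t) : Disjoint (s.image (fun z => if z = x then x' else z))
      (t.image (fun z => if z = x then x' else z)) := by
  simp only [Finset.disjoint_left, Finset.mem_image, not_exists, not_and] at h ⊢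
  rintro z ⟨a, ha, rfl⟩ b hb hab
  split_ifs at hab with h1 h2 h2
  · subst h1 h2; exact h ha hb
  · rw [← hab] at ha; exact hs ha
  · rw [hab] at hb; exact ht hb
  · subst hab; exact h ha hb

theorem Ty.rename {x x' : A} {M : Term S A} : ∀ {P Q : A → Bool} {m n : ℕ}, Ty P M m n →
    x' ∉ names M → (x ∈ fv M → Q x' = P x) → (∀ z ∈ fv M, z ≠ x → Q z = P z) →
    Ty Q (Term.rename x x' M) m n := by
  induction M with
  | const k | zero | one | sym => intro P Q m n h _ _ _; exact h
  | var z =>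
    intro P Q m n h _ h1 h2
    simp only [Term.rename]
    simp only [Ty] at h ⊢
    split_ifs with hz hz' hz'
    · subst hz; rw [h1 (by simp [fv])] at hz'; simpa [hz'] using h
    · subst hz; rw [h1 (by simp [fv])] at hz'; simpa [hz'] using h
    · rw [h2 z (by simp [fv]) hz] at hz'; simpa [hz'] using h
    · rw [h2 z (by simp [fv]) hz] at hz'; simpa [hz'] using h
  | comp M N ihM ihN =>
    rintro P Q m n ⟨hd, k, h3, h4⟩ h h1 h2
    simp only [names, Finset.mem_union, not_or] at h
    simp only [fv, Finset.mem_union] at h1 h2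
    refine ⟨?_, k, ihM h3 h.1 (fun h => h1 (.inl h)) (fun z hz => h2 z (.inl hz)),
      ihN h4 h.2 (fun h => h1 (.inr h)) (fun z hz => h2 z (.inr hz))⟩
    rw [fv_rename h.1, fv_rename h.2]
    exact disjoint_image_rename (fun h' => h.1 (fv_subset_names _ h'))
      (fun h' => h.2 (fv_subset_names _ h')) hd
  | tensor M N ihM ihN =>
    rintro P Q m n ⟨hd, _, _, _, _, rfl, rfl, h3, h4⟩ h h1 h2
    simp only [names, Finset.mem_union, not_or] at h
    simp only [fv, Finset.mem_union] at h1 h2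
    refine ⟨?_, _, _, _, _, rfl, rfl, ihM h3 h.1 (fun h => h1 (.inl h)) (fun z hz => h2 z (.inl hz)),
      ihN h4 h.2 (fun h => h1 (.inr h)) (fun z hz => h2 z (.inr hz))⟩
    rw [fv_rename h.1, fv_rename h.2]
    exact disjoint_image_rename (fun h' => h.1 (fv_subset_names _ h'))
      (fun h' => h.2 (fv_subset_names _ h')) hd
  | trace i M ih =>
    intro P Q m n h3 h h1 h2
    exact ih (P := P) h3 h h1 h2
  | link a b M ih =>
    rintro P Q m n ht h h1 h2
    obtain ⟨ha, hb, hab, h3⟩ := ht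
    simp only [names, Finset.mem_union, Finset.mem_insert, Finset.mem_singleton, not_or] at h
    simp only [Term.rename]
    split_ifs with hx
    · refine Ty.congr (fun z hz => (h2 z hz ?_).symm) ⟨ha, hb, hab, h3⟩
      rintro rfl
      simp only [fv, Finset.mem_sdiff, Finset.mem_insert, Finset.mem_singleton] at hz
      rcases hx with rfl | rfl <;> tauto
    · push Not at hx
      have hfv : ∀ z ∈ fv M, z ≠ x → z ∈ fv (Term.rename x x' M) := by
        intro z hz hzx
        rw [fv_rename h.2, Finset.mem_image]
        exact ⟨z, hz, if_neg hzx⟩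
      refine ⟨hfv a ha hx.1, hfv b hb hx.2, hab, ih h3 h.2 ?_ ?_⟩
      · intro hxM
        rw [polUpdate_of_ne h.1.1 h.1.2, polUpdate_of_ne hx.1.symm hx.2.symm]
        exact h1 (by simp [fv, hxM, hx.1.symm, hx.2.symm])
      · intro z hz hzx
        simp only [polUpdate, Function.update_apply]
        split_ifs with h4 h5 <;> try rfl
        exact h2 z (by simp [fv, hz, h4, h5]) hzx

theorem names_rename_subset (x x' : A) (M : Term S A) :
    names (rename x x' M) ⊆ insert x' (names M) := by
  induction M with
  | const k | zero | one | sym => simp [names, rename]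
  | var z => simp only [rename, names]; split_ifs <;> simp
  | comp M N ihM ihN | tensor M N ihM ihN =>
    simp only [rename, names]
    refine Finset.union_subset (ihM.trans ?_) (ihN.trans ?_) <;>
      exact Finset.insert_subset_insert _ (by simp)
  | trace i M ih => exact ih
  | link a b M ih =>
    simp only [rename]
    split_ifs
    · exact Finset.subset_insert _ _
    · simp only [names]
      refine Finset.union_subset ?_ (ih.trans (Finset.insert_subset_insert _ Finset.subset_union_right))
      exact Finset.subset_union_left.trans (Finset.subset_insert _ _)

/-- Renaming of the variables bound by a link, with new names of the right polarities. -/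
theorem cl_link_rename {P : A → Bool} {x y x' y' : A} {M : Term S A} {m n : ℕ}
    (h : Ty P (.link x y M) m n) (hx : x' ∉ names (.link x y M)) (hy : y' ∉ names (.link x y M))
    (hxP : P x' = false) (hyP : P y' = true) :
    cl P (.link x y M) = cl P (.link x' y' (rename y y' (rename x x' M))) := by
  have hxy' : x' ≠ y' := Cl.ne_of_pol hxP hyP
  have hx2 := hx
  have hy2 := hy
  simp only [names, Finset.mem_union, Finset.mem_insert, Finset.mem_singleton, not_or] at hx2 hy2
  have h0 := h
  obtain ⟨hxM, hyM, hxy, h⟩ := h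
  have hyr : y' ∉ names (rename x x' M) := fun h => by
    have := names_rename_subset x x' M h
    simp only [Finset.mem_insert] at this
    rcases this with h | h
    · exact hxy' h.symm
    · exact hy2.2 h
  have f1 := fv_rename (x := x) hx2.2
  have f2 := fv_rename (x := y) hyr
  have hyr' : y ∈ fv (rename x x' M) := by
    rw [f1, Finset.mem_image]; exact ⟨y, hyM, if_neg hxy.symm⟩
  have hxr' : x' ∈ fv (rename x x' M) := by
    rw [f1, Finset.mem_image]; exact ⟨x, hxM, if_pos rfl⟩
  have t1 : Ty (polUpdate (polUpdate P x y) x' y) (rename x x' M) m n := by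
    refine h.rename hx2.2 ?_ ?_
    · intro _; rw [polUpdate_left hx2.1.2, polUpdate_left hxy]
    · intro z hz hzx
      by_cases hzy : z = y
      · subst hzy; rw [polUpdate_right, polUpdate_right]
      · rw [polUpdate_of_ne _ hzy]
        rintro rfl
        exact hx2.2 (fv_subset_names _ hz)
  have t2 : Ty (polUpdate P x' y') (rename y y' (rename x x' M)) m n := by
    refine t1.rename hyr ?_ ?_
    · intro _; rw [polUpdate_right, polUpdate_right]
    · intro z hz hzy
      by_cases hzx : z = x'
      · subst hzx; rw [polUpdate_left hxy', polUpdate_left hx2.1.2]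
      · have hzx2 : z ≠ x := by
          rintro rfl
          rw [f1, Finset.mem_image] at hz
          obtain ⟨w, -, hw⟩ := hz
          split_ifs at hw with h'
          · exact hx2.1.1 hw
          · exact h' hw
        rw [polUpdate_of_ne hzx, polUpdate_of_ne hzx hzy, polUpdate_of_ne hzx2 hzy]
        rintro rfl
        exact hyr (fv_subset_names _ hz)
  have h1 : Ty P (.link x' y' (rename y y' (rename x x' M))) m n := by
    refine ⟨?_, ?_, hxy', t2⟩ <;> rw [f2, Finset.mem_image]
    · exact ⟨x', hxr', if_neg hx2.1.2⟩
    · exact ⟨y, hyr', if_pos rfl⟩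
  have hfv : fv (.link x y M) = fv (.link x' y' (rename y y' (rename x x' M))) := by
    simp only [fv, f2, f1]
    ext z
    simp only [Finset.mem_sdiff, Finset.mem_image, Finset.mem_insert, Finset.mem_singleton, not_or]
    constructor
    · rintro ⟨hz, hzx, hzy⟩
      refine ⟨⟨z, ⟨z, hz, if_neg hzx⟩, if_neg hzy⟩, ?_, ?_⟩ <;> rintro rfl
      · exact hx2.2 (fv_subset_names _ hz)
      · exact hy2.2 (fv_subset_names _ hz)
    · rintro ⟨⟨w, ⟨w', hw', rfl⟩, rfl⟩, h3, h4⟩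
      by_cases hwx : w' = x
      · simp [hwx, hx2.1.2] at h3
      · rw [if_neg hwx] at h3 h4 ⊢
        by_cases hwy : w' = y
        · simp [hwy] at h4
        · rw [if_neg hwy]
          exact ⟨hw', hwx, hwy⟩
  refine cl_eq.2 (.of_equation fun a b hab => ?_)
  obtain ⟨rfl, rfl⟩ := hab.elim h0.unique h1.unique
  exact ⟨h0, h1, hfv, .alpha _ _ _ _ _ hx hy hxy'⟩

/-! ### The terms read off from a presentation -/

/-- Names for the two ends of the vertices of a graph: `nm v true` is an input variable for the wire
that continues into `v`, and `nm v false` an output variable for the wire that starts at `v`.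
The names of the vertices that carry labels are these labels. -/
structure Naming {V : Type} (P : A → Bool) (f : V → Option (Label S A)) (nm : V → Bool → A) :
    Prop where
  inj : ∀ {v b w c}, nm v b = nm w c → v = w ∧ b = c
  pol : ∀ v b, P (nm v b) = b
  var : ∀ {v z}, f v = some (.var z) → nm v (P z) = z

/-- The tensor of a list of variables, as a term. -/
def varsTerm (l : List A) : Term S A := l.foldr (fun x M => .tensor (.var x) M) .zero

/-- The tensor of a list of terms. -/
def tensorTerm (l : List (Term S A)) : Term S A := l.foldr .tensor .zero

/-- Successive links around a term. -/
def linksTerm (L : List (A × A)) (M : Term S A) : Term S A :=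
  L.foldr (fun p M => .link p.1 p.2 M) M

/-- A term whose inputs and outputs are attached to variables. -/
def hubTerm (ys : List A) (M : Term S A) (xs : List A) : Term S A :=
  .comp (.comp (varsTerm ys) M) (varsTerm xs)

/-- The term `0 → 0` of an atom, with the names at its vertices as free variables. -/
def Atom.term {V : Type} (nm : V → Bool → A) (t : Atom S V) : Term S A :=
  hubTerm (t.ins.map (nm · true)) t.core (t.outs.map (nm · false))

/-- The pair of names that are linked along an edge. -/
def edgeNames {V : Type} (nm : V → Bool → A) : V × V → A × A := Prod.map (nm · false) (nm · true)

/-- The term `0 → 0` of a presentation: the tensor of the atoms, linked along the edges. -/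
def soup {V : Type} (nm : V → Bool → A) (ats : List (Atom S V)) (es : List (V × V)) : Term S A :=
  linksTerm (es.map (edgeNames nm)) (tensorTerm (ats.map (Atom.term nm)))

section Soup

variable {P : A → Bool} {V W : Type}

theorem cl_varsTerm (l : List A) : cl P (varsTerm l : Term S A) = vars l := by
  induction l with
  | nil => rfl
  | cons x l ih => rw [vars_cons, ← ih]; rfl

theorem cl_tensorTerm (l : List (Term S A)) : cl P (tensorTerm l) = (l.map (cl P)).sum := by
  induction l with
  | nil => rfl
  | cons x l ih => rw [List.map_cons, List.sum_cons, ← ih]; rfl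

theorem cl_linksTerm {L : List (A × A)} (hL : IsPolar P L) (M : Term S A) :
    cl P (linksTerm L M) = links L (cl P M) := by
  induction L with
  | nil => rfl
  | cons p L ih =>
    rw [links_cons, ← ih hL.of_cons.2, ← cl_link hL.of_cons.1.1 hL.of_cons.1.2]; rfl

theorem cl_hubTerm (ys xs : List A) (M : Term S A) :
    cl P (hubTerm ys M xs) = hub ys (cl P M) xs := by
  rw [hubTerm, cl_comp, cl_comp, cl_varsTerm, cl_varsTerm, hub]

/-- The class of the term of an atom. -/
def Atom.cls (P : A → Bool) (nm : V → Bool → A) (t : Atom S V) : Cl S P :=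
  hub (t.ins.map (nm · true)) (cl P t.core) (t.outs.map (nm · false))

theorem Naming.isPolar {f : V → Option (Label S A)} {nm : V → Bool → A} (h : Naming P f nm)
    (es : List (V × V)) : IsPolar P (es.map (edgeNames nm)) := by
  intro p hp
  obtain ⟨q, -, rfl⟩ := List.mem_map.1 hp
  exact ⟨h.pol _ _, h.pol _ _⟩

theorem cl_soup {f : V → Option (Label S A)} {nm : V → Bool → A} (h : Naming P f nm)
    (ats : List (Atom S V)) (es : List (V × V)) : cl P (soup nm ats es) =
      links (es.map (edgeNames nm)) (ats.map (Atom.cls P nm)).sum := by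
  rw [soup, cl_linksTerm (h.isPolar es), cl_tensorTerm, List.map_map]
  congr 3
  funext t
  exact cl_hubTerm _ _ _

theorem Atom.cls_map (e : V → W) (nm : W → Bool → A) (t : Atom S V) :
    (t.map e).cls P nm = t.cls P (fun v => nm (e v)) := by
  simp [Atom.cls, List.map_map, Function.comp_def]

theorem map_cls_map (e : V → W) (nm : W → Bool → A) (ats : List (Atom S V)) :
    (ats.map (Atom.map e)).map (Atom.cls P nm) = ats.map (Atom.cls P (fun v => nm (e v))) := by
  rw [List.map_map]
  exact List.map_congr_left fun t _ => Atom.cls_map e nm t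

theorem map_edgeNames_map (e : V → W) (nm : W → Bool → A) (es : List (V × V)) :
    (es.map (Prod.map e e)).map (edgeNames nm) = es.map (edgeNames (fun v => nm (e v))) := by
  rw [List.map_map]; rfl

theorem Naming.map_nodup {f : V → Option (Label S A)} {nm : V → Bool → A} (h : Naming P f nm)
    {l : List V} (hl : l.Nodup) (b : Bool) : (l.map (nm · b)).Nodup :=
  hl.map fun _ _ e => (h.inj e).1

theorem Naming.pol_of_mem {f : V → Option (Label S A)} {nm : V → Bool → A} (h : Naming P f nm)
    {l : List V} {b : Bool} : ∀ z ∈ l.map (nm · b), P z = b := by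
  intro z hz
  obtain ⟨v, -, rfl⟩ := List.mem_map.1 hz
  exact h.pol v b

theorem Naming.hasTy_cls {f : V → Option (Label S A)} {nm : V → Bool → A} (h : Naming P f nm)
    {t : Atom S V} (ht : t.Good f) (hn : t.verts.Nodup) : (t.cls P nm).HasTy 0 0 := by
  refine hasTy_hub ?_ (h.map_nodup (Atom.ins_nodup hn) _) (h.map_nodup (Atom.outs_nodup hn) _)
    h.pol_of_mem h.pol_of_mem ?_
  · simpa using Atom.hasTy_core P ht
  · intro z hz
    have := fvs_cl_subset hz
    simp [Atom.fv_core] at this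

theorem Atom.mem_fvs_cls {nm : V → Bool → A} {t : Atom S V} {z : A} (hz : z ∈ (t.cls P nm).fvs) :
    (∃ v ∈ t.ins, z = nm v true) ∨ ∃ v ∈ t.outs, z = nm v false := by
  have := fvs_hub_subset _ _ _ hz
  simp only [Finset.mem_union, List.mem_toFinset, List.mem_map] at this
  rcases this with (⟨v, hv, rfl⟩ | h) | ⟨v, hv, rfl⟩
  · exact .inl ⟨v, hv, rfl⟩
  · have := fvs_cl_subset h
    simp [Atom.fv_core] at this
  · exact .inr ⟨v, hv, rfl⟩

theorem mem_fvs_sum {nm : V → Bool → A} {ats : List (Atom S V)} {z : A}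
    (hz : z ∈ ((ats.map (Atom.cls P nm)).sum).fvs) : ∃ t ∈ ats,
      (∃ v ∈ t.ins, z = nm v true) ∨ ∃ v ∈ t.outs, z = nm v false := by
  induction ats with
  | nil => simp at hz
  | cons t ats ih =>
    rw [List.map_cons, List.sum_cons] at hz
    rcases Finset.mem_union.1 (fvs_add_subset _ _ hz) with h | h
    · exact ⟨t, by simp, Atom.mem_fvs_cls h⟩
    · obtain ⟨t', ht', h⟩ := ih h
      exact ⟨t', by simp [ht'], h⟩

theorem fvs_links_subset {L : List (A × A)} (hL : IsPolar P L) (a : Cl S P) :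
    (links L a).fvs ⊆ a.fvs := by
  induction L with
  | nil => exact le_rfl
  | cons p L ih =>
    rw [links_cons]
    exact ((fvs_link_subset hL.of_cons.1.1 hL.of_cons.1.2 _).trans Finset.sdiff_subset).trans
      (ih hL.of_cons.2)

/-- A soup does not depend on the order of its lists. -/
theorem cl_soup_perm {f : V → Option (Label S A)} {nm : V → Bool → A}
    (h : Naming P f nm) {ats ats' : List (Atom S V)} {es es' : List (V × V)}
    (hn : ∀ t ∈ ats, t.Good f ∧ t.verts.Nodup) (ha : ats.Perm ats') (he : es.Perm es') :
    cl P (soup nm ats es) = cl P (soup nm ats' es') := by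
  rw [cl_soup h, cl_soup h, links_perm (he.map _) (h.isPolar es), sum_perm (ha.map _)]
  intro a ha
  obtain ⟨t, ht, rfl⟩ := List.mem_map.1 ha
  exact h.hasTy_cls (hn t ht).1 (hn t ht).2

end Soup

/-! ### Shape of the graphs of terms -/

/-- Input vertices have no incoming and one outgoing edge, output vertices have one incoming and no
outgoing edge, and there are `m` inputs and `n` outputs. -/
structure Graph.Tidy (D : Graph S A) (m n : ℕ) : Prop where
  I_length : D.I.length = m
  O_length : D.O.length = n
  I_nodup : D.I.Nodup
  O_nodup : D.O.Nodup
  no_in : ∀ v ∈ D.I, ∀ u, ¬ D.E u v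
  no_out : ∀ v ∈ D.O, ∀ u, ¬ D.E v u
  exists_out : ∀ v ∈ D.I, ∃! u, D.E v u
  exists_in : ∀ v ∈ D.O, ∃! u, D.E u v

theorem Graph.Tidy.disjoint {D : Graph S A} {m n : ℕ} (h : D.Tidy m n) {v : D.V} (hI : v ∈ D.I)
    (hO : v ∈ D.O) : False := by
  obtain ⟨u, hu, -⟩ := h.exists_in v hO
  exact h.no_in v hI u hu

theorem rdrop_append_rtake {α : Type*} (l : List α) (i : ℕ) : l.rdrop i ++ l.rtake i = l :=
  List.take_append_drop _ _

theorem Graph.Tidy.tensor {D D' : Graph S A} {m n m' n' : ℕ} (h : D.Tidy m n)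
    (h' : D'.Tidy m' n') : (D.tensor D').Tidy (m + m') (n + n') where
  I_length := by simp [Graph.tensor, h.I_length, h'.I_length]
  O_length := by simp [Graph.tensor, h.O_length, h'.O_length]
  I_nodup := (h.I_nodup.map Sum.inl_injective).append (h'.I_nodup.map Sum.inr_injective)
    (by intro v hv hv'; simp only [List.mem_map] at hv hv'; aesop)
  O_nodup := (h.O_nodup.map Sum.inl_injective).append (h'.O_nodup.map Sum.inr_injective)
    (by intro v hv hv'; simp only [List.mem_map] at hv hv'; aesop)
  no_in v hv u hu := by
    rcases List.mem_append.1 hv with hv | hv <;> obtain ⟨w, hw, rfl⟩ := List.mem_map.1 hv <;>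
      rcases hu with hu | hu
    · exact h.no_in w hw _ ‹_›
    · exact h'.no_in w hw _ ‹_›
  no_out v hv u hu := by
    rcases List.mem_append.1 hv with hv | hv <;> obtain ⟨w, hw, rfl⟩ := List.mem_map.1 hv <;>
      rcases hu with hu | hu
    · exact h.no_out w hw _ ‹_›
    · exact h'.no_out w hw _ ‹_›
  exists_out v hv := by
    rcases List.mem_append.1 hv with hv | hv <;> obtain ⟨w, hw, rfl⟩ := List.mem_map.1 hv
    · obtain ⟨u, hu, hu'⟩ := h.exists_out w hw
      refine ⟨.inl u, .inl hu, ?_⟩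
      rintro _ (h1 | h1)
      exact congrArg Sum.inl (hu' _ ‹_›)
    · obtain ⟨u, hu, hu'⟩ := h'.exists_out w hw
      refine ⟨.inr u, .inr hu, ?_⟩
      rintro _ (h1 | h1)
      exact congrArg Sum.inr (hu' _ ‹_›)
  exists_in v hv := by
    rcases List.mem_append.1 hv with hv | hv <;> obtain ⟨w, hw, rfl⟩ := List.mem_map.1 hv
    · obtain ⟨u, hu, hu'⟩ := h.exists_in w hw
      refine ⟨.inl u, .inl hu, ?_⟩
      rintro _ (h1 | h1)
      exact congrArg Sum.inl (hu' _ ‹_›)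
    · obtain ⟨u, hu, hu'⟩ := h'.exists_in w hw
      refine ⟨.inr u, .inr hu, ?_⟩
      rintro _ (h1 | h1)
      exact congrArg Sum.inr (hu' _ ‹_›)

theorem mem_zip_inl_inr {α β : Type} {l : List α} {l' : List β} {a b : α ⊕ β}
    (h : (a, b) ∈ (l.map (Sum.inl : α → α ⊕ β)).zip (l'.map Sum.inr)) :
    ∃ v ∈ l, ∃ w ∈ l', a = .inl v ∧ b = .inr w := by
  obtain ⟨h1, h2⟩ := List.of_mem_zip h
  obtain ⟨v, hv, rfl⟩ := List.mem_map.1 h1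
  obtain ⟨w, hw, rfl⟩ := List.mem_map.1 h2
  exact ⟨v, hv, w, hw, rfl, rfl⟩

theorem Graph.Tidy.comp {D D' : Graph S A} {m k n : ℕ} (h : D.Tidy m k)
    (h' : D'.Tidy k n) : (D.comp D').Tidy m n where
  I_length := by simp [Graph.comp, h.I_length]
  O_length := by simp [Graph.comp, h'.O_length]
  I_nodup := h.I_nodup.map Sum.inl_injective
  O_nodup := h'.O_nodup.map Sum.inr_injective
  no_in v hv u hu := by
    obtain ⟨w, hw, rfl⟩ := List.mem_map.1 hv
    rcases hu with (hu | hu) | hu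
    · exact h.no_in w hw _ ‹_›
    · obtain ⟨_, _, _, _, _, h2⟩ := mem_zip_inl_inr hu
      cases h2
  no_out v hv u hu := by
    obtain ⟨w, hw, rfl⟩ := List.mem_map.1 hv
    rcases hu with (hu | hu) | hu
    · exact h'.no_out w hw _ ‹_›
    · obtain ⟨_, _, _, _, h2, _⟩ := mem_zip_inl_inr hu
      cases h2
  exists_out v hv := by
    obtain ⟨w, hw, rfl⟩ := List.mem_map.1 hv
    obtain ⟨u, hu, hu'⟩ := h.exists_out w hw
    refine ⟨.inl u, .inl (.inl hu), ?_⟩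
    rintro _ ((h1 | h1) | h1)
    · exact congrArg Sum.inl (hu' _ ‹_›)
    · obtain ⟨v, hv, _, _, h2, _⟩ := mem_zip_inl_inr h1
      cases h2
      exact (h.disjoint hw hv).elim
  exists_in v hv := by
    obtain ⟨w, hw, rfl⟩ := List.mem_map.1 hv
    obtain ⟨u, hu, hu'⟩ := h'.exists_in w hw
    refine ⟨.inr u, .inl (.inr hu), ?_⟩
    rintro _ ((h1 | h1) | h1)
    · exact congrArg Sum.inr (hu' _ ‹_›)
    · obtain ⟨_, _, v, hv, _, h2⟩ := mem_zip_inl_inr h1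
      cases h2
      exact (h'.disjoint hv hw).elim

theorem Graph.Tidy.trace {D : Graph S A} {i m n : ℕ} (h : D.Tidy (m + i) (n + i)) :
    (D.trace i).Tidy m n := by
  have hI : (D.I.rdrop i ++ D.I.rtake i).Nodup := by rw [rdrop_append_rtake]; exact h.I_nodup
  have hO : (D.O.rdrop i ++ D.O.rtake i).Nodup := by rw [rdrop_append_rtake]; exact h.O_nodup
  have mI : ∀ {v}, v ∈ D.I.rdrop i → v ∈ D.I := fun hv => List.mem_of_mem_take hv
  have mO : ∀ {v}, v ∈ D.O.rdrop i → v ∈ D.O := fun hv => List.mem_of_mem_take hv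
  have mI' : ∀ {v}, v ∈ D.I.rtake i → v ∈ D.I := fun hv => List.mem_of_mem_drop hv
  have mO' : ∀ {v}, v ∈ D.O.rtake i → v ∈ D.O := fun hv => List.mem_of_mem_drop hv
  rw [List.nodup_append] at hI hO
  constructor
  · simp [Graph.trace, List.rdrop, h.I_length]
  · simp [Graph.trace, List.rdrop, h.O_length]
  · exact hI.1
  · exact hO.1
  · rintro v hv u (hu | hu)
    · exact h.no_in v (mI hv) u hu
    · exact hI.2.2 v hv v (List.of_mem_zip hu).2 rfl
  · rintro v hv u (hu | hu)
    · exact h.no_out v (mO hv) u hu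
    · exact hO.2.2 v hv v (List.of_mem_zip hu).1 rfl
  · intro v hv
    obtain ⟨u, hu, hu'⟩ := h.exists_out v (mI hv)
    refine ⟨u, .inl hu, ?_⟩
    rintro w (hw | hw)
    · exact hu' w hw
    · exact (h.disjoint (mI hv) (mO' (List.of_mem_zip hw).1)).elim
  · intro v hv
    obtain ⟨u, hu, hu'⟩ := h.exists_in v (mO hv)
    refine ⟨u, .inl hu, ?_⟩
    rintro w (hw | hw)
    · exact hu' w hw
    · exact (h.disjoint (mI' (List.of_mem_zip hw).2) (mO hv)).elim

theorem Graph.Tidy.link {D : Graph S A} {m n : ℕ} (h : D.Tidy m n) (x y : A) :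
    (D.link x y).Tidy m n := by
  constructor
  · exact h.I_length
  · exact h.O_length
  · exact h.I_nodup
  · exact h.O_nodup
  · rintro v hv u (hu | hu)
    · exact h.no_in v hv u hu
    · simp [D.I_unlabelled v hv] at hu
  · rintro v hv u (hu | hu)
    · exact h.no_out v hv u hu
    · simp [D.O_unlabelled v hv] at hu
  · intro v hv
    obtain ⟨u, hu, hu'⟩ := h.exists_out v hv
    refine ⟨u, .inl hu, ?_⟩
    rintro w (hw | hw)
    · exact hu' w hw
    · simp [D.I_unlabelled v hv] at hw
  · intro v hv
    obtain ⟨u, hu, hu'⟩ := h.exists_in v hv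
    refine ⟨u, .inl hu, ?_⟩
    rintro w (hw | hw)
    · exact hu' w hw
    · simp [D.O_unlabelled v hv] at hw

theorem Graph.Tidy.const (k : S.K) : (Graph.const k : Graph S A).Tidy (S.dom k) (S.cod k) := by
  constructor
  · simp [Graph.const]
  · simp [Graph.const]
  · exact List.nodup_ofFn.2 fun i j h => BoxVertex.inWire.inj h
  · exact List.nodup_ofFn.2 fun i j h => BoxVertex.outWire.inj h
  · intro v hv u hu
    obtain ⟨i, rfl⟩ := (List.mem_ofFn' _ _).1 hv
    cases hu
  · intro v hv u hu
    obtain ⟨i, rfl⟩ := (List.mem_ofFn' _ _).1 hv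
    cases hu
  · intro v hv
    obtain ⟨i, rfl⟩ := (List.mem_ofFn' _ _).1 hv
    exact ⟨_, .input i, fun w hw => by cases hw; rfl⟩
  · intro v hv
    obtain ⟨i, rfl⟩ := (List.mem_ofFn' _ _).1 hv
    exact ⟨_, .output i, fun w hw => by cases hw; rfl⟩

theorem Graph.Tidy.one : (Graph.one : Graph S A).Tidy 1 1 := by
  constructor <;> simp [Graph.one] <;> first
    | exact (by decide : true ∉ [false])
    | exact (by decide : false ∉ [true])

theorem Graph.Tidy.zero : (Graph.zero : Graph S A).Tidy 0 0 := by
  constructor <;> simp [Graph.zero]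

theorem Graph.Tidy.sym : (Graph.sym : Graph S A).Tidy 2 2 := by
  constructor <;> simp [Graph.sym, ExistsUnique] <;> first
    | exact (by decide : (true, false) ∉ [(false, false), (false, true)] ∧
        (true, true) ∉ [(false, false), (false, true)])
    | exact (by decide : (false, false) ∉ [(true, false), (true, true)] ∧
        (false, true) ∉ [(true, false), (true, true)])

theorem Graph.Tidy.inVar (x : A) : (Graph.inVar x : Graph S A).Tidy 0 1 := by
  constructor <;> simp [Graph.inVar] <;> first
    | exact List.not_mem_nil
    | exact (by decide : true ∉ [false])
    | exact (by decide : false ∉ [true])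

theorem Graph.Tidy.outVar (x : A) : (Graph.outVar x : Graph S A).Tidy 1 0 := by
  constructor <;> simp [Graph.outVar] <;> first
    | exact List.not_mem_nil
    | exact (by decide : true ∉ [false])

theorem Ty.tidy {M : Term S A} : ∀ {P : A → Bool} {m n : ℕ}, Ty P M m n →
    (graphP P M).Tidy m n := by
  induction M with
  | const k => rintro P m n ⟨rfl, rfl⟩; exact .const k
  | zero => rintro P m n ⟨rfl, rfl⟩; exact .zero
  | one => rintro P m n ⟨rfl, rfl⟩; exact .one
  | sym => rintro P m n ⟨rfl, rfl⟩; exact .sym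
  | comp M N ihM ihN => rintro P m n ⟨-, k, h1, h2⟩; exact (ihM h1).comp (ihN h2)
  | tensor M N ihM ihN =>
    rintro P m n ⟨-, _, _, _, _, rfl, rfl, h1, h2⟩; exact (ihM h1).tensor (ihN h2)
  | var x =>
    intro P m n h
    simp only [Ty] at h
    simp only [graphP]
    split_ifs at h ⊢ <;> obtain ⟨rfl, rfl⟩ := h
    · exact .inVar x
    · exact .outVar x
  | trace i M ih => intro P m n h; exact (ih (P := P) h).trace
  | link x y M ih => intro P m n h; exact (ih h.2.2.2).link x y

theorem Graph.link_f_eq_var (D : Graph S A) (x y : A) (v : D.V) (z : A) :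
    (D.link x y).f v = some (.var z) ↔ D.f v = some (.var z) ∧ z ≠ x ∧ z ≠ y := by
  simp only [Graph.link]
  split_ifs with h
  · simp only [reduceCtorEq, false_iff, not_and]
    rintro e
    rw [e] at h
    simp only [Option.some.injEq, Label.var.injEq] at h
    tauto
  · constructor
    · intro e
      rw [e] at h
      simp only [Option.some.injEq, Label.var.injEq] at h
      exact ⟨e, by tauto⟩
    · exact fun e => e.1

/-- Each free variable labels exactly one vertex. -/
theorem Ty.labels {M : Term S A} : ∀ {P : A → Bool} {m n : ℕ}, Ty P M m n →
    (∀ z, z ∈ fv M ↔ ∃ v, (graphP P M).f v = some (.var z)) ∧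
    ∀ v w z, (graphP P M).f v = some (.var z) → (graphP P M).f w = some (.var z) → v = w := by
  have sum : ∀ {M N : Term S A} {P : A → Bool}, Disjoint (fv M) (fv N) →
      ((∀ z, z ∈ fv M ↔ ∃ v, (graphP P M).f v = some (.var z)) ∧
    ∀ v w z, (graphP P M).f v = some (.var z) → (graphP P M).f w = some (.var z) → v = w) →
      ((∀ z, z ∈ fv N ↔ ∃ v, (graphP P N).f v = some (.var z)) ∧
    ∀ v w z, (graphP P N).f v = some (.var z) → (graphP P N).f w = some (.var z) → v = w) →
      (∀ z, z ∈ fv M ∪ fv N ↔ ∃ v, Sum.elim (graphP P M).f (graphP P N).f v = some (.var z)) ∧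
      ∀ v w z, Sum.elim (graphP P M).f (graphP P N).f v = some (.var z) →
        Sum.elim (graphP P M).f (graphP P N).f w = some (.var z) → v = w := by
    rintro M N P hd ⟨h1, h2⟩ ⟨h3, h4⟩
    refine ⟨fun z => ?_, ?_⟩
    · simp [h1, h3]
    · rintro (v | v) (w | w) z hv hw <;> simp only [Sum.elim_inl, Sum.elim_inr] at hv hw
      · rw [h2 v w z hv hw]
      · exact (Finset.disjoint_left.1 hd ((h1 z).2 ⟨v, hv⟩) ((h3 z).2 ⟨w, hw⟩)).elim
      · exact (Finset.disjoint_left.1 hd ((h1 z).2 ⟨w, hw⟩) ((h3 z).2 ⟨v, hv⟩)).elim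
      · rw [h4 v w z hv hw]
  induction M with
  | const k =>
    intro P m n _
    have : ∀ v z, (graphP P (.const k : Term S A)).f v ≠ some (.var z) := by
      intro v z
      change Graph.boxLabel k v ≠ _
      cases v <;> simp [Graph.boxLabel]
    simp [fv, this]
  | zero => intro P m n _; simp [fv, graphP, Graph.zero]
  | one => intro P m n _; simp [fv, graphP, Graph.one]
  | sym => intro P m n _; simp [fv, graphP, Graph.sym]
  | comp M N ihM ihN => rintro P m n ⟨hd, k, h1, h2⟩; exact sum hd (ihM h1) (ihN h2)
  | tensor M N ihM ihN =>
    rintro P m n ⟨hd, _, _, _, _, rfl, rfl, h1, h2⟩; exact sum hd (ihM h1) (ihN h2)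
  | var x =>
    intro P m n h
    rcases Bool.eq_false_or_eq_true (P x) with hx | hx
    · have hg : graphP P (.var x : Term S A) = .inVar x := if_pos hx
      rw [hg]
      have : ∀ v z, (Graph.inVar x : Graph S A).f v = some (.var z) ↔ v = false ∧ z = x := by
        rintro (_ | _) z <;> simp [Graph.inVar, eq_comm]
      refine ⟨fun z => ⟨fun h => ⟨false, (this _ _).2 ⟨rfl, by simpa [fv] using h⟩⟩, ?_⟩, ?_⟩
      · rintro ⟨v, hv⟩
        simpa [fv] using ((this _ _).1 hv).2
      · exact fun v w z hv hw => ((this _ _).1 hv).1.trans ((this _ _).1 hw).1.symm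
    · have hg : graphP P (.var x : Term S A) = .outVar x := if_neg (by simp [hx])
      rw [hg]
      have : ∀ v z, (Graph.outVar x : Graph S A).f v = some (.var z) ↔ v = true ∧ z = x := by
        rintro (_ | _) z <;> simp [Graph.outVar, eq_comm]
      refine ⟨fun z => ⟨fun h => ⟨true, (this _ _).2 ⟨rfl, by simpa [fv] using h⟩⟩, ?_⟩, ?_⟩
      · rintro ⟨v, hv⟩
        simpa [fv] using ((this _ _).1 hv).2
      · exact fun v w z hv hw => ((this _ _).1 hv).1.trans ((this _ _).1 hw).1.symm
  | trace i M ih => intro P m n h; exact ih (P := P) h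
  | link x y M ih =>
    intro P m n h
    obtain ⟨h1, h2⟩ := ih h.2.2.2
    have key := (graphP (polUpdate P x y) M).link_f_eq_var x y
    refine ⟨fun z => ?_, fun v w z hv hw => h2 v w z ((key v z).1 hv).1 ((key w z).1 hw).1⟩
    simp only [fv, Finset.mem_sdiff, h1, Finset.mem_insert, Finset.mem_singleton, not_or]
    exact ⟨fun ⟨⟨v, hv⟩, h⟩ => ⟨v, (key v z).2 ⟨hv, h⟩⟩,
      fun ⟨v, hv⟩ => ⟨⟨v, ((key v z).1 hv).1⟩, ((key v z).1 hv).2⟩⟩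

/-! ### Terms are soups of their graphs -/

namespace Cl

variable {P : A → Bool}

/-- Two diagrams with variables at their interfaces are composed by links. -/
theorem links_zip_hub {ys xs ys' xs' : List A} (hlen : xs.length = ys'.length)
    (hys : (ys ++ ys').Nodup) (hxs : (xs ++ xs').Nodup) (hy : ∀ y ∈ ys ++ ys', P y = true)
    (hx : ∀ x ∈ xs ++ xs', P x = false) {a b : Cl S P} (ha : a.HasTy ys.length xs.length)
    (hb : b.HasTy ys'.length xs'.length)
    (hfa : ∀ z ∈ a.fvs, z ∉ xs ∧ z ∉ ys ∧ z ∉ xs' ∧ z ∉ ys')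
    (hfb : ∀ z ∈ b.fvs, z ∉ xs ∧ z ∉ ys ∧ z ∉ xs' ∧ z ∉ ys') :
    links (xs.zip ys') (hub ys a xs + hub ys' b xs') = hub ys (a * b) xs' := by
  rw [List.nodup_append] at hys hxs
  have hy1 : ∀ y ∈ ys, P y = true := fun z hz => hy z (by simp [hz])
  have hy2 : ∀ y ∈ ys', P y = true := fun z hz => hy z (by simp [hz])
  have hx1 : ∀ x ∈ xs, P x = false := fun z hz => hx z (by simp [hz])
  have hx2 : ∀ x ∈ xs', P x = false := fun z hz => hx z (by simp [hz])
  have h1 : (vars ys * a).HasTy 0 xs.length :=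
    (hasTy_mul.1 (hasTy_hub ha hys.1 hxs.1 hy1 hx1 fun z hz => ⟨(hfa z hz).1, (hfa z hz).2.1⟩)).2.elim
      fun k h => by
        obtain ⟨rfl, -⟩ := h.2.unique (hasTy_vars_out hxs.1 hx1); exact h.1
  have h2 : (b * vars xs').HasTy ys'.length 0 := by
    refine hb.mul (hasTy_vars_out hxs.2.1 hx2) (Finset.disjoint_left.2 fun z hz hz' => ?_)
    exact (hfb z hz).2.2.1 (by simpa using fvs_vars_subset _ hz')
  have := links_zip_add hlen hxs.1 hys.2.1 hx1 hy2 h1 h2 ?_ ?_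
  · rw [hub, hub, mul_assoc (vars ys'), this, hub]
    simp only [mul_assoc]
  · intro z hz h
    rcases Finset.mem_union.1 (fvs_mul_subset _ _ h) with h | h
    · have h := fvs_vars_subset _ h
      rw [List.mem_toFinset] at h
      rcases hz with hz | hz
      · exact ne_of_pol (hx1 z hz) (hy1 z h) rfl
      · exact hys.2.2 z h z hz rfl
    · have := hfa z h; tauto
  · intro z hz h
    rcases Finset.mem_union.1 (fvs_mul_subset _ _ h) with h | h
    · have := hfb z h; tauto
    · have h := fvs_vars_subset _ h
      rw [List.mem_toFinset] at h
      rcases hz with hz | hz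
      · exact hxs.2.2 z hz z h rfl
      · exact ne_of_pol (hx2 z h) (hy2 z hz) rfl

theorem cl_sym : cl P (.sym : Term S A) = swap 1 1 := by
  have h : (cl P (.sym : Term S A)).HasTy 2 2 := ⟨rfl, rfl⟩
  have e : (swap 1 1 : Cl S P) =
      (id 1 + id 1) * (0 + (0 + cl P .sym) * (id 1 + id 1)) := by
    have h1 : (cl P (symn 1 0 : Term S A)) = id 1 := rfl
    have h2 : (swap 1 1 : Cl S P) = (cl P (symn 1 0) + cl P .one) *
      (cl P (idn 0) + (cl P (idn 0) + cl P .sym) * (cl P (symOne 0) + cl P .one)) := rfl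
    have h3 : cl P (symOne 0 : Term S A) = id 1 := id_one.symm
    rw [h2, h1, h3, id_one]; rfl
  rw [e, zero_add, zero_add, ← id_add, mul_id h, id_mul h]

theorem hub_sym {y₀ y₁ x₀ x₁ : A} (hy₀ : P y₀ = true) (hy₁ : P y₁ = true) (hx₀ : P x₀ = false)
    (hx₁ : P x₁ = false) (hy : y₀ ≠ y₁) (hx : x₀ ≠ x₁) :
    hub [y₀, y₁] (cl P (.sym : Term S A)) [x₀, x₁] = hub [y₀] (id 1) [x₁] + hub [y₁] (id 1) [x₀] := by
  have t : ∀ {y x : A}, P y = true → P x = false → (var y * var x : Cl S P).HasTy 0 0 :=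
    fun h1 h2 => (hasTy_var_in h1).mul (hasTy_var_out h2) (by simpa using (ne_of_pol h2 h1).symm)
  have e : ∀ {y x : A}, P y = true → P x = false →
      (hub [y] (id 1) [x] : Cl S P) = var y * var x := by
    intro y x h1 h2
    rw [hub, vars_cons, vars_nil, add_zero, vars_cons, vars_nil, add_zero,
      mul_id (hasTy_var_in h1)]
  rw [e hy₀ hx₁, e hy₁ hx₀, hub, cl_sym]
  simp only [vars_cons, vars_nil, add_zero]
  rw [symmetry (hasTy_var_in hy₀) (hasTy_var_in hy₁), swap_zero_right, id_mul (n := 2),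
    interchange _ _ (hasTy_var_in hy₁) (hasTy_var_out hx₀),
    add_comm_of_hasTy (t hy₁ hx₀) (t hy₀ hx₁)]
  exact (hasTy_var_in hy₁).add (hasTy_var_in hy₀) (by simpa using hy.symm)

end Cl

variable {P : A → Bool}

theorem Naming.comp {V W : Type} {f : V → Option (Label S A)} {nm : V → Bool → A}
    (h : Naming P f nm) {e : W → V} (he : Function.Injective e) {g : W → Option (Label S A)}
    (hg : ∀ w, g w = f (e w)) : Naming P g (fun w => nm (e w)) where
  inj h' := ⟨he (h.inj h').1, (h.inj h').2⟩
  pol _ _ := h.pol _ _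
  var hv := h.var (hg _ ▸ hv)

/-- The names of `s` are used only for the vertices that they label. -/
def Avoids (P : A → Bool) {V : Type} (f : V → Option (Label S A)) (nm : V → Bool → A)
    (s : Finset A) : Prop :=
  ∀ v b, nm v b ∈ s → ∃ z, f v = some (.var z) ∧ P z = b

theorem Avoids.comp {V W : Type} {f : V → Option (Label S A)} {nm : V → Bool → A} {s : Finset A}
    (h : Avoids P f nm s) (e : W → V) {g : W → Option (Label S A)} (hg : ∀ w, g w = f (e w))
    {s' : Finset A} (hs : s' ⊆ s) : Avoids P g (fun w => nm (e w)) s' := by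
  intro v b hv
  rw [hg]
  exact h _ _ (hs hv)

/-- The class `a` is given by the presentations of the graph `D`. -/
def SoupFor (P : A → Bool) (D : Graph S A) (a : Cl S P) (s : Finset A) : Prop :=
  ∀ nm, Naming P D.f nm → Avoids P D.f nm s → ∃ ats es, Pres D.f D.E ats es ∧
    cl P (soup nm ats es) = hub (D.I.map (nm · true)) a (D.O.map (nm · false))

/-- Two named diagrams, linked along wires from the outputs of the first to the inputs of the
second, are composed. -/
theorem Naming.hub_fuse {V : Type} {f : V → Option (Label S A)} {nm : V → Bool → A}
    (h : Naming P f nm) {l₁ l₂ l₃ l₄ : List V} (hlen : l₂.length = l₃.length)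
    (h13 : (l₁ ++ l₃).Nodup) (h24 : (l₂ ++ l₄).Nodup)
    {a b : Cl S P} (ha : a.HasTy l₁.length l₂.length) (hb : b.HasTy l₃.length l₄.length)
    (hfa : ∀ z ∈ a.fvs, ∀ v ∈ l₁ ++ l₂ ++ l₃ ++ l₄, ∀ b, z ≠ nm v b)
    (hfb : ∀ z ∈ b.fvs, ∀ v ∈ l₁ ++ l₂ ++ l₃ ++ l₄, ∀ b, z ≠ nm v b) :
    links ((l₂.zip l₃).map (edgeNames nm)) (hub (l₁.map (nm · true)) a (l₂.map (nm · false)) +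
      hub (l₃.map (nm · true)) b (l₄.map (nm · false))) =
      hub (l₁.map (nm · true)) (a * b) (l₄.map (nm · false)) := by
  have aux : ∀ z, (∀ v ∈ l₁ ++ l₂ ++ l₃ ++ l₄, ∀ b, z ≠ nm v b) → z ∉ l₂.map (nm · false) ∧
      z ∉ l₁.map (nm · true) ∧ z ∉ l₄.map (nm · false) ∧ z ∉ l₃.map (nm · true) := by
    intro z hz
    refine ⟨?_, ?_, ?_, ?_⟩ <;> rw [List.mem_map] <;> rintro ⟨v, hv, rfl⟩ <;>
      exact hz v (by simp [hv]) _ rfl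
  rw [edgeNames, ← List.zip_map]
  refine links_zip_hub (by simpa using hlen) ?_ ?_ ?_ ?_ (by simpa using ha) (by simpa using hb)
    (fun z hz => aux z (hfa z hz)) (fun z hz => aux z (hfb z hz))
  · rw [← List.map_append]; exact h.map_nodup h13 _
  · rw [← List.map_append]; exact h.map_nodup h24 _
  · rw [← List.map_append]; exact h.pol_of_mem
  · rw [← List.map_append]; exact h.pol_of_mem

theorem Naming.sum_wires {V : Type} {f : V → Option (Label S A)} {nm : V → Bool → A}
    (h : Naming P f nm) {l : List V} (hl : l.Nodup) :
    ((l.map (Atom.wire (S := S))).map (Atom.cls P nm)).sum =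
      hub (l.map (nm · true)) (id l.length) (l.map (nm · false)) := by
  induction l with
  | nil =>
    have h0 : (0 * 0 : Cl S P) = 0 := id_mul (a := (0 : Cl S P)) hasTy_zero
    change (0 : Cl S P) = 0 * 0 * 0
    rw [h0, h0]
  | cons v l ih =>
    rw [List.nodup_cons] at hl
    rw [List.map_cons, List.map_cons, List.sum_cons, ih hl.2, List.length_cons, add_comm, id_add]
    have := hub_add (S := S) (P := P) (ys := [nm v true]) (xs := [nm v false])
      (ys' := l.map (nm · true)) (xs' := l.map (nm · false)) (a := id 1) (b := id l.length)
      (hasTy_id 1) (by simp) (by simp) (by simp [h.pol]) (by simp [h.pol]) (by simp)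
    rw [List.map_cons, List.map_cons]
    refine Eq.trans ?_ this.symm
    congr 1
    simp [Atom.cls, Atom.ins, Atom.outs, Atom.core, id_one]

theorem pres_bool {f : Bool → Option (Label S A)}
    (hf : ∀ v, f v = none ∨ ∃ z, f v = some (.var z)) :
    Pres f (fun a b => a = false ∧ b = true) [.wire false, .wire true] [(false, true)] where
  nodup := by simp [Atom.verts]
  complete := by simp [Atom.verts]
  good := by simpa [Atom.Good] using ⟨hf false, hf true⟩
  es_nodup := by simp
  edge_iff a b := by simp [Atom.Inner]
  es_box := by
    have : ∀ v k, f v ≠ some (.box k) := by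
      intro v k hv
      rcases hf v with h | ⟨z, h⟩ <;> simp [h] at hv
    simp [this]

theorem Naming.cl_soup_bool {f : Bool → Option (Label S A)} {nm : Bool → Bool → A}
    (h : Naming P f nm) : cl P (soup (S := S) nm [.wire false, .wire true] [(false, true)]) =
      hub [nm false true] (id 1) [nm true false] := by
  rw [cl_soup h]
  have h1 := h.hub_fuse (S := S) (l₁ := [false]) (l₂ := [false]) (l₃ := [true]) (l₄ := [true])
    rfl (by simp) (by simp) (hasTy_id 1) (hasTy_id 1) (by simp) (by simp)
  rw [mul_id (hasTy_id 1)] at h1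
  refine Eq.trans ?_ h1
  simp [Atom.cls, Atom.ins, Atom.outs, Atom.core, id_one]

theorem soupFor_one (s : Finset A) : SoupFor P (.one : Graph S A) (cl P .one) s := by
  intro nm hnm _
  refine ⟨_, _, pres_bool (f := fun _ => none) (by simp), ?_⟩
  exact (hnm.cl_soup_bool (f := fun _ => none)).trans (by rw [id_one]; rfl)

theorem soupFor_inVar {x : A} (hx : P x = true) (s : Finset A) :
    SoupFor P (.inVar x : Graph S A) (cl P (.var x)) s := by
  intro nm hnm _
  refine ⟨_, _, pres_bool (f := (Graph.inVar x : Graph S A).f)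
    (by rintro (_ | _) <;> simp [Graph.inVar]), ?_⟩
  refine (hnm.cl_soup_bool (f := (Graph.inVar x : Graph S A).f)).trans ?_
  have h : nm false true = x := hx ▸ hnm.var (v := false) (z := x) rfl
  rw [h]
  change hub [x] (id 1) [nm true false] = hub [] (var x) [nm true false]
  rw [hub, hub, vars_cons, vars_nil, add_zero, mul_id (hasTy_var_in hx), ← id_zero,
    id_mul (hasTy_var_in hx)]

theorem soupFor_outVar {x : A} (hx : P x = false) (s : Finset A) :
    SoupFor P (.outVar x : Graph S A) (cl P (.var x)) s := by
  intro nm hnm _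
  refine ⟨_, _, pres_bool (f := (Graph.outVar x : Graph S A).f)
    (by rintro (_ | _) <;> simp [Graph.outVar]), ?_⟩
  refine (hnm.cl_soup_bool (f := (Graph.outVar x : Graph S A).f)).trans ?_
  have h : nm true false = x := hx ▸ hnm.var (v := true) (z := x) rfl
  rw [h]
  change hub [nm false true] (id 1) [x] = hub [nm false true] (var x) []
  rw [hub, hub, vars_cons x, vars_nil, add_zero, mul_assoc, id_mul (hasTy_var_out hx), mul_assoc,
    ← id_zero, mul_id (hasTy_var_out hx)]

theorem pres_empty : Pres (S := S) (A := A) (V := Empty) (fun _ => none) (fun _ _ => False) [] [] where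
  nodup := by simp
  complete v := v.elim
  good := by simp
  es_nodup := by simp
  edge_iff v := v.elim
  es_box := by simp

theorem soupFor_zero (s : Finset A) : SoupFor P (.zero : Graph S A) (cl P .zero) s := by
  intro nm hnm _
  refine ⟨[], [], pres_empty, ?_⟩
  rw [cl_soup hnm]
  change (0 : Cl S P) = 0 * 0 * 0
  have : (0 * 0 : Cl S P) = 0 := id_mul (a := (0 : Cl S P)) hasTy_zero
  rw [this, this]

theorem pres_sym : Pres (S := S) (A := A) (V := Bool × Bool) (fun _ => none)
    (fun a b => a.1 = false ∧ b.1 = true ∧ a.2 ≠ b.2)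
    [.wire (false, false), .wire (true, true), .wire (false, true), .wire (true, false)]
    [((false, false), (true, true)), ((false, true), (true, false))] where
  nodup := by simp [Atom.verts]
  complete := by simp [Atom.verts]
  good := by simp [Atom.Good]
  es_nodup := by simp
  edge_iff := by simp [Atom.Inner]
  es_box := by simp

theorem Naming.cl_soup_sym {nm : Bool × Bool → Bool → A}
    (h : Naming P (fun _ => (none : Option (Label S A))) nm) : cl P (soup (S := S) nm
      [.wire (false, false), .wire (true, true), .wire (false, true), .wire (true, false)]
      [((false, false), (true, true)), ((false, true), (true, false))]) =
      hub [nm (false, false) true, nm (false, true) true] (cl P (.sym : Term S A))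
        [nm (true, false) false, nm (true, true) false] := by
  have e : ∀ {v w : Bool × Bool}, v ≠ w → links [edgeNames nm (v, w)]
      (Atom.cls P nm (.wire v : Atom S _) + Atom.cls P nm (.wire w : Atom S _)) =
      hub [nm v true] (id 1) [nm w false] := by
    intro v w hvw
    have h1 := h.hub_fuse (S := S) (l₁ := [v]) (l₂ := [v]) (l₃ := [w]) (l₄ := [w])
      rfl (by simpa using hvw) (by simpa using hvw) (hasTy_id 1) (hasTy_id 1) (by simp) (by simp)
    rw [mul_id (hasTy_id 1)] at h1
    refine Eq.trans ?_ h1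
    simp [Atom.cls, Atom.ins, Atom.outs, Atom.core, id_one]
  have hne : ∀ {v w : Bool × Bool} (b c : Bool), v ≠ w → nm v b ≠ nm w c :=
    fun _ _ hvw h' => hvw (h.inj h').1
  rw [hub_sym (h.pol _ _) (h.pol _ _) (h.pol _ _) (h.pol _ _) (hne _ _ (by simp))
    (hne _ _ (by simp)), ← e (by simp), ← e (by simp), cl_soup h]
  simp only [List.map_cons, List.map_nil, List.sum_cons, List.sum_nil, add_zero, links_cons,
    links_nil]
  have hp : ∀ v w, P (edgeNames nm (v, w)).1 = false ∧ P (edgeNames nm (v, w)).2 = true :=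
    fun v w => ⟨h.pol _ _, h.pol _ _⟩
  have hm : ∀ v w, v ≠ w → ∀ b, nm v b ∉ (Atom.cls P nm (.wire w : Atom S _)).fvs := by
    intro v w hvw b h'
    rcases Atom.mem_fvs_cls h' with ⟨u, hu, h'⟩ | ⟨u, hu, h'⟩ <;>
      exact hne _ _ (by simpa [List.mem_singleton.1 hu] using hvw) h'
  have hm2 : ∀ v w w', v ≠ w → v ≠ w' → ∀ b, nm v b ∉ (Atom.cls P nm (.wire w : Atom S _) +
      Atom.cls P nm (.wire w' : Atom S _)).fvs := by
    intro v w w' h1 h2 b h'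
    rcases Finset.mem_union.1 (fvs_add_subset _ _ h') with h' | h'
    · exact hm v w h1 b h'
    · exact hm v w' h2 b h'
  rw [← add_assoc (Atom.cls P nm (.wire (false, false))), link_add_right (hp _ _).1 (hp _ _).2,
    link_add_left (hp _ _).1 (hp _ _).2]
  · intro h'
    exact hm2 _ _ _ (by simp) (by simp) _ (Finset.mem_sdiff.1 (fvs_link_subset (hp _ _).1 (hp _ _).2 _ h')).1
  · intro h'
    exact hm2 _ _ _ (by simp) (by simp) _ (Finset.mem_sdiff.1 (fvs_link_subset (hp _ _).1 (hp _ _).2 _ h')).1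
  · exact hm2 _ _ _ (by simp) (by simp) _
  · exact hm2 _ _ _ (by simp) (by simp) _

theorem soupFor_sym (s : Finset A) : SoupFor P (.sym : Graph S A) (cl P .sym) s :=
  fun _ hnm _ => ⟨_, _, pres_sym, Naming.cl_soup_sym hnm⟩

theorem Cl.links_append_add {L L' : List (A × A)} (hL : IsPolar P L) (hL' : IsPolar P L')
    {a b : Cl S P} (ha : Fresh L' a) (hb : Fresh L b) :
    links (L ++ L') (a + b) = links L a + links L' b := by
  rw [links_append, links_add_right hL' _ ha,
    links_add_left hL _ (.of_subset (fvs_links_subset hL' b) hb)]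

theorem ofFn_pair {α β : Type*} {n : ℕ} (f : Fin n → α) (g : Fin n → β) :
    List.ofFn (fun i => (f i, g i)) = (List.ofFn f).zip (List.ofFn g) := by
  apply List.ext_getElem <;> simp

theorem pres_const (k : S.K) : Pres (A := A) (Graph.boxLabel k)
    (Graph.BoxEdge (S.dom k) (S.cod k))
    ((List.ofFn .inWire).map .wire ++
      (.box k .box (List.ofFn .inPort) (List.ofFn .outPort) :: (List.ofFn .outWire).map .wire))
    (List.ofFn (fun i => (.inWire i, .inPort i)) ++ List.ofFn (fun j => (.outPort j, .outWire j)))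
    where
  nodup := by
    have h : ∀ l : List (Graph.BoxVertex (S.dom k) (S.cod k)),
        (l.map (Atom.wire (S := S))).flatMap Atom.verts = l := by
      intro l
      rw [List.flatMap_map]
      simp [Atom.verts]
    rw [List.flatMap_append, h, List.flatMap_cons, h]
    have hi : ∀ {m n : ℕ}, (List.ofFn (Graph.BoxVertex.inWire (m := m) (n := n))).Nodup :=
      List.nodup_ofFn.2 fun i j h => Graph.BoxVertex.inWire.inj h
    have hi' : ∀ {m n : ℕ}, (List.ofFn (Graph.BoxVertex.inPort (m := m) (n := n))).Nodup :=
      List.nodup_ofFn.2 fun i j h => Graph.BoxVertex.inPort.inj h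
    have ho : ∀ {m n : ℕ}, (List.ofFn (Graph.BoxVertex.outWire (m := m) (n := n))).Nodup :=
      List.nodup_ofFn.2 fun i j h => Graph.BoxVertex.outWire.inj h
    have ho' : ∀ {m n : ℕ}, (List.ofFn (Graph.BoxVertex.outPort (m := m) (n := n))).Nodup :=
      List.nodup_ofFn.2 fun i j h => Graph.BoxVertex.outPort.inj h
    simp [List.nodup_append, List.nodup_cons, Atom.verts, hi, hi', ho, ho']
    grind
  complete v := by cases v <;> simp [Atom.verts]
  good := by
    intro t ht
    simp only [List.mem_append, List.mem_map, List.mem_cons, List.mem_ofFn] at ht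
    rcases ht with ⟨_, ⟨i, rfl⟩, rfl⟩ | rfl | ⟨_, ⟨i, rfl⟩, rfl⟩
    · exact .inl rfl
    · refine ⟨rfl, ?_, ?_⟩ <;> rw [List.map_ofFn] <;> rfl
    · exact .inl rfl
  es_nodup := by
    refine List.Nodup.append (List.nodup_ofFn.2 ?_) (List.nodup_ofFn.2 ?_) ?_
    · intro i j h; exact Graph.BoxVertex.inWire.inj (congrArg Prod.fst h)
    · intro i j h; exact Graph.BoxVertex.outPort.inj (congrArg Prod.fst h)
    · intro p hp hp'
      simp only [List.mem_ofFn] at hp hp'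
      obtain ⟨i, rfl⟩ := hp
      obtain ⟨j, hj⟩ := hp'
      cases hj
  edge_iff a b := by
    simp only [List.mem_append, List.mem_ofFn, List.mem_map, List.mem_cons, Prod.mk.injEq]
    constructor
    · rintro (i | i | j | j)
      · exact .inl (.inl ⟨i, rfl, rfl⟩)
      · exact .inr ⟨_, .inr (.inl rfl), .inl ⟨by simp, rfl⟩⟩
      · exact .inr ⟨_, .inr (.inl rfl), .inr ⟨rfl, by simp⟩⟩
      · exact .inl (.inr ⟨j, rfl, rfl⟩)
    · rintro ((⟨i, rfl, rfl⟩ | ⟨i, rfl, rfl⟩) | ⟨t, ⟨_, _, rfl⟩ | rfl | ⟨_, _, rfl⟩, h⟩)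
      · exact .input i
      · exact .output i
      · exact h.elim
      · rcases h with ⟨h, rfl⟩ | ⟨rfl, h⟩ <;> obtain ⟨i, rfl⟩ := List.mem_ofFn.1 h
        · exact .enter i
        · exact .leave i
      · exact h.elim
  es_box p hp := by
    simp only [List.mem_append, List.mem_ofFn] at hp
    rcases hp with ⟨i, rfl⟩ | ⟨i, rfl⟩ <;> simp [Graph.boxLabel]

theorem not_mem_fvs_sum {V : Type} {f : V → Option (Label S A)} {nm : V → Bool → A}
    (h : Naming P f nm) {ats : List (Atom S V)} {v : V} (hv : v ∉ ats.flatMap Atom.verts)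
    (b : Bool) : nm v b ∉ ((ats.map (Atom.cls P nm)).sum).fvs := by
  intro h'
  obtain ⟨t, ht, ⟨w, hw, e⟩ | ⟨w, hw, e⟩⟩ := mem_fvs_sum h' <;> obtain ⟨rfl, -⟩ := h.inj e
  · exact hv (List.mem_flatMap.2 ⟨t, ht, Atom.mem_verts_of_ins hw⟩)
  · exact hv (List.mem_flatMap.2 ⟨t, ht, Atom.mem_verts_of_outs hw⟩)

theorem fresh_sum {V : Type} {f : V → Option (Label S A)} {nm : V → Bool → A}
    (h : Naming P f nm) {ats : List (Atom S V)} {es : List (V × V)}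
    (hv : ∀ p ∈ es, p.1 ∉ ats.flatMap Atom.verts ∧ p.2 ∉ ats.flatMap Atom.verts) :
    Fresh (es.map (edgeNames nm)) ((ats.map (Atom.cls P nm)).sum) := by
  intro p hp
  obtain ⟨q, hq, rfl⟩ := List.mem_map.1 hp
  exact ⟨not_mem_fvs_sum h (hv q hq).1 _, not_mem_fvs_sum h (hv q hq).2 _⟩

theorem soupFor_const (k : S.K) (s : Finset A) :
    SoupFor P (.const k : Graph S A) (cl P (.const k)) s := by
  intro (nm : Graph.BoxVertex (S.dom k) (S.cod k) → Bool → A)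
    (hnm : Naming P (Graph.boxLabel k) nm) _
  change ∃ ats es, Pres (Graph.boxLabel k) (Graph.BoxEdge (S.dom k) (S.cod k)) ats es ∧
    cl P (soup nm ats es) = hub ((List.ofFn .inWire).map (nm · true)) (cl P (.const k))
      ((List.ofFn .outWire).map (nm · false))
  refine ⟨_, _, pres_const k, ?_⟩
  have hI : (List.ofFn (Graph.BoxVertex.inWire (m := S.dom k) (n := S.cod k))).Nodup :=
    (Graph.Tidy.const (S := S) (A := A) k).I_nodup
  have hO : (List.ofFn (Graph.BoxVertex.outWire (m := S.dom k) (n := S.cod k))).Nodup :=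
    (Graph.Tidy.const (S := S) (A := A) k).O_nodup
  have hi' : (List.ofFn (Graph.BoxVertex.inPort (m := S.dom k) (n := S.cod k))).Nodup :=
    List.nodup_ofFn.2 fun i j h => Graph.BoxVertex.inPort.inj h
  have ho' : (List.ofFn (Graph.BoxVertex.outPort (m := S.dom k) (n := S.cod k))).Nodup :=
    List.nodup_ofFn.2 fun i j h => Graph.BoxVertex.outPort.inj h
  have hk : (cl P (.const k : Term S A)).HasTy (S.dom k) (S.cod k) := ⟨rfl, rfl⟩
  have hkf : (cl P (.const k : Term S A)).fvs = ∅ := fvs_cl (M := .const k) hk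
  rw [cl_soup hnm, List.map_append, List.map_append, List.sum_append, links_append,
    links_add_right (hnm.isPolar _), List.map_cons, List.sum_cons, hnm.sum_wires hI,
    hnm.sum_wires hO]
  · have h1 := hnm.hub_fuse (S := S) (l₁ := List.ofFn .inPort) (l₂ := List.ofFn .outPort)
      (l₃ := List.ofFn .outWire) (l₄ := List.ofFn .outWire) (a := cl P (.const k)) (b := Cl.id _)
      (by simp) ?_ ?_ (by simpa using hk) (by simpa using hasTy_id _) (by simp [hkf]) (by simp)
    · rw [mul_id hk] at h1
      have h2 := hnm.hub_fuse (S := S) (l₁ := List.ofFn .inWire) (l₂ := List.ofFn .inWire)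
        (l₃ := List.ofFn .inPort) (l₄ := List.ofFn .outWire) (a := Cl.id _) (b := cl P (.const k))
        (by simp) ?_ ?_ (by simpa using hasTy_id _) (by simpa using hk) (by simp) (by simp [hkf])
      · rw [id_mul hk] at h2
        rw [ofFn_pair, ofFn_pair, List.length_ofFn, List.length_ofFn]
        refine Eq.trans ?_ h2
        rw [← h1]
        rfl
      · refine hI.append hi' ?_
        intro v hv hv'
        obtain ⟨i, rfl⟩ := List.mem_ofFn.1 hv
        simp at hv'
      · refine hI.append hO ?_
        intro v hv hv'
        obtain ⟨i, rfl⟩ := List.mem_ofFn.1 hv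
        simp at hv'
    · refine hi'.append hO ?_
      intro v hv hv'
      obtain ⟨i, rfl⟩ := List.mem_ofFn.1 hv
      simp at hv'
    · refine ho'.append hO ?_
      intro v hv hv'
      obtain ⟨i, rfl⟩ := List.mem_ofFn.1 hv
      simp at hv'
  · refine fresh_sum hnm ?_
    intro p hp
    obtain ⟨i, rfl⟩ := List.mem_ofFn.1 hp
    simp [Atom.verts]

/-- The variables free in a term are not used at the interface of its graph. -/
theorem Naming.ne_of_mem_fv {M : Term S A} {m n : ℕ} (hM : Ty P M m n) {nm : _ → Bool → A}
    (h : Naming P (graphP P M).f nm) {z : A} (hz : z ∈ (cl P M).fvs) {v : (graphP P M).V}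
    (hv : v ∈ (graphP P M).I ∨ v ∈ (graphP P M).O) (b : Bool) : z ≠ nm v b := by
  rw [fvs_cl hM, hM.labels.1] at hz
  obtain ⟨w, hw⟩ := hz
  intro e
  rw [← h.var hw] at e
  obtain ⟨rfl, -⟩ := h.inj e
  rcases hv with hv | hv
  · simp [(graphP P M).I_unlabelled _ hv] at hw
  · simp [(graphP P M).O_unlabelled _ hv] at hw

theorem cl_soup_sum {V W : Type} {f : V ⊕ W → Option (Label S A)} {nm : V ⊕ W → Bool → A}
    (h : Naming P f nm) {g : V → Option (Label S A)} {g' : W → Option (Label S A)}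
    (hg : ∀ v, g v = f (.inl v)) (hg' : ∀ w, g' w = f (.inr w))
    (ats : List (Atom S V)) (ats' : List (Atom S W)) (es : List (V × V)) (es' : List (W × W)) :
    cl P (soup nm (ats.map (Atom.map Sum.inl) ++ ats'.map (Atom.map Sum.inr))
      (es.map (Prod.map Sum.inl Sum.inl) ++ es'.map (Prod.map Sum.inr Sum.inr))) =
    cl P (soup (fun v => nm (.inl v)) ats es) + cl P (soup (fun v => nm (.inr v)) ats' es') := by
  rw [cl_soup h, cl_soup (h.comp Sum.inl_injective hg), cl_soup (h.comp Sum.inr_injective hg'),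
    List.map_append, List.map_append, List.sum_append, links_append_add (h.isPolar _)
    (h.isPolar _), map_cls_map, map_cls_map, map_edgeNames_map, map_edgeNames_map]
  · refine fresh_sum h fun p hp => ?_
    obtain ⟨q, -, rfl⟩ := List.mem_map.1 hp
    simp [Pres.flatMap_verts_map]
  · refine fresh_sum h fun p hp => ?_
    obtain ⟨q, -, rfl⟩ := List.mem_map.1 hp
    simp [Pres.flatMap_verts_map]

theorem soupFor_tensor {M N : Term S A} {m₁ n₁ m₂ n₂ : ℕ} (hM : Ty P M m₁ n₁) (hN : Ty P N m₂ n₂)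
    (hM' : SoupFor P (graphP P M) (cl P M) (names M))
    (hN' : SoupFor P (graphP P N) (cl P N) (names N)) :
    SoupFor P (graphP P (.tensor M N)) (cl P (.tensor M N)) (names (.tensor M N)) := by
  intro (nm : (graphP P M).V ⊕ (graphP P N).V → Bool → A)
    (hnm : Naming P (Sum.elim (graphP P M).f (graphP P N).f) nm) hs
  change ∃ ats es, Pres (Sum.elim (graphP P M).f (graphP P N).f)
    (Sum.LiftRel (graphP P M).E (graphP P N).E) ats es ∧ cl P (soup nm ats es) =
      hub (((graphP P M).I.map Sum.inl ++ (graphP P N).I.map Sum.inr).map (nm · true))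
        (cl P (.tensor M N))
        (((graphP P M).O.map Sum.inl ++ (graphP P N).O.map Sum.inr).map (nm · false))
  have n1 := hnm.comp (g := (graphP P M).f) Sum.inl_injective fun _ => rfl
  have n2 := hnm.comp (g := (graphP P N).f) Sum.inr_injective fun _ => rfl
  obtain ⟨ats, es, h1, e1⟩ := hM' _ n1
    (hs.comp (Sum.inl : (graphP P M).V → _) (fun _ => rfl) Finset.subset_union_left)
  obtain ⟨ats', es', h2, e2⟩ := hN' _ n2
    (hs.comp (Sum.inr : (graphP P N).V → _) (fun _ => rfl) Finset.subset_union_right)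
  refine ⟨_, _, h1.sum h2, ?_⟩
  rw [cl_soup_sum hnm (fun _ => rfl) (fun _ => rfl) ats ats' es es', e1, e2, cl_tensor,
    List.map_append, List.map_append, List.map_map, List.map_map, List.map_map, List.map_map]
  refine (hub_add ?_ (n1.map_nodup hM.tidy.I_nodup _) (n1.map_nodup hM.tidy.O_nodup _)
    n1.pol_of_mem n1.pol_of_mem ?_).symm
  · rw [List.length_map, List.length_map, hM.tidy.I_length, hM.tidy.O_length]; exact hM
  · intro z hz
    constructor <;> rw [List.mem_map] <;> rintro ⟨v, hv, e⟩
    · exact n1.ne_of_mem_fv hM hz (.inr hv) _ e.symm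
    · exact n1.ne_of_mem_fv hM hz (.inl hv) _ e.symm

/-- The wires between `M` and `N` are linked last, which composes their hubs. -/
theorem soupFor_comp {M N : Term S A} {m k n : ℕ} (hM : Ty P M m k) (hN : Ty P N k n)
    (hd : Disjoint (fv M) (fv N))
    (hM' : SoupFor P (graphP P M) (cl P M) (names M))
    (hN' : SoupFor P (graphP P N) (cl P N) (names N)) :
    SoupFor P (graphP P (.comp M N)) (cl P (.comp M N)) (names (.comp M N)) := by
  intro (nm : (graphP P M).V ⊕ (graphP P N).V → Bool → A)
    (hnm : Naming P (Sum.elim (graphP P M).f (graphP P N).f) nm) hs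
  let ns : List (((graphP P M).V ⊕ (graphP P N).V) × ((graphP P M).V ⊕ (graphP P N).V)) :=
    ((graphP P M).O.map .inl).zip ((graphP P N).I.map .inr)
  change ∃ ats es, Pres (Sum.elim (graphP P M).f (graphP P N).f)
    (fun a b => Sum.LiftRel (graphP P M).E (graphP P N).E a b ∨ (a, b) ∈ ns) ats es ∧
      cl P (soup nm ats es) = hub (((graphP P M).I.map .inl).map (nm · true))
        (cl P (.comp M N)) (((graphP P N).O.map .inr).map (nm · false))
  have n1 := hnm.comp (g := (graphP P M).f) Sum.inl_injective fun _ => rfl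
  have n2 := hnm.comp (g := (graphP P N).f) Sum.inr_injective fun _ => rfl
  obtain ⟨ats, es, h1, e1⟩ := hM' _ n1
    (hs.comp (Sum.inl : (graphP P M).V → _) (fun _ => rfl) Finset.subset_union_left)
  obtain ⟨ats', es', h2, e2⟩ := hN' _ n2
    (hs.comp (Sum.inr : (graphP P N).V → _) (fun _ => rfl) Finset.subset_union_right)
  have tM := hM.tidy
  have tN := hN.tidy
  have hns : ns.Nodup := List.Nodup.of_map Prod.fst (by
    rw [List.map_fst_zip (by simp [tM.O_length, tN.I_length])]
    exact tM.O_nodup.map Sum.inl_injective)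
  refine ⟨_, _, (h1.sum h2).add_edges (ns := ns) hns ?_ ?_ fun _ _ => Iff.rfl, ?_⟩
  · intro p hp hp'
    obtain ⟨v, -, w, -, h3, h4⟩ := mem_zip_inl_inr (a := p.1) (b := p.2) hp
    simp only [List.mem_append, List.mem_map] at hp'
    rcases hp' with ⟨q, -, rfl⟩ | ⟨q, -, rfl⟩
    · cases h4
    · cases h3
  · intro p hp
    obtain ⟨v, hv, w, hw, h3, h4⟩ := mem_zip_inl_inr (a := p.1) (b := p.2) hp
    rw [h3, h4]
    simp [(graphP P M).O_unlabelled _ hv, (graphP P N).I_unlabelled _ hw]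
  · have := cl_soup_sum hnm (fun _ => rfl) (fun _ => rfl) ats ats' es es'
    rw [cl_soup hnm] at this ⊢
    rw [List.map_append, links_perm List.perm_append_comm ((List.map_append ▸ hnm.isPolar _ :)),
      links_append, this, e1, e2, cl_comp]
    have h3 := hnm.hub_fuse (S := S) (l₁ := (graphP P M).I.map .inl)
      (l₂ := (graphP P M).O.map .inl) (l₃ := (graphP P N).I.map .inr)
      (l₄ := (graphP P N).O.map .inr) (a := cl P M) (b := cl P N)
      (by simp [tM.O_length, tN.I_length])
      ((tM.I_nodup.map Sum.inl_injective).append (tN.I_nodup.map Sum.inr_injective)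
        (by intro v hv hv'; simp only [List.mem_map] at hv hv'; aesop))
      ((tM.O_nodup.map Sum.inl_injective).append (tN.O_nodup.map Sum.inr_injective)
        (by intro v hv hv'; simp only [List.mem_map] at hv hv'; aesop))
      (by simpa [tM.I_length, tM.O_length] using hasTy_cl.2 hM)
      (by simpa [tN.I_length, tN.O_length] using hasTy_cl.2 hN)
      ?_ ?_
    · simp only [List.map_map] at h3 ⊢; exact h3
    all_goals
      intro z hz v hv b e
      have ht : Ty P (.comp M N) m n := ⟨hd, k, hM, hN⟩
      have hz' : z ∈ fv (.comp M N) := by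
        first
        | exact Finset.mem_union_left _ (fvs_cl_subset hz)
        | exact Finset.mem_union_right _ (fvs_cl_subset hz)
      obtain ⟨w, hw⟩ : ∃ w, Sum.elim (graphP P M).f (graphP P N).f w = some (.var z) :=
        (ht.labels.1 z).1 hz'
      rw [← hnm.var hw] at e
      obtain ⟨rfl, -⟩ := hnm.inj e
      rw [List.mem_append, List.mem_append, List.mem_append] at hv
      rcases hv with ((hv | hv) | hv) | hv <;> obtain ⟨v, hv', rfl⟩ := List.mem_map.1 hv
      · simp [(graphP P M).I_unlabelled _ hv'] at hw
      · simp [(graphP P M).O_unlabelled _ hv'] at hw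
      · simp [(graphP P N).I_unlabelled _ hv'] at hw
      · simp [(graphP P N).O_unlabelled _ hv'] at hw

/-- The wires of the trace are linked last. -/
theorem soupFor_trace {M : Term S A} {i m n : ℕ} (hM : Ty P M (m + i) (n + i))
    (hM' : SoupFor P (graphP P M) (cl P M) (names M)) :
    SoupFor P (graphP P (.trace i M)) (cl P (.trace i M)) (names (.trace i M)) := by
  intro (nm : (graphP P M).V → Bool → A) (hnm : Naming P (graphP P M).f nm) hs
  change ∃ ats es, Pres (graphP P M).f (fun a b => (graphP P M).E a b ∨
    (a, b) ∈ ((graphP P M).O.rtake i).zip ((graphP P M).I.rtake i)) ats es ∧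
      cl P (soup nm ats es) = hub (((graphP P M).I.rdrop i).map (nm · true))
        (cl P (.trace i M)) (((graphP P M).O.rdrop i).map (nm · false))
  obtain ⟨ats, es, h1, e1⟩ := hM' nm hnm hs
  have tM := hM.tidy
  have lI : ((graphP P M).I.rtake i).length = i := by simp [List.rtake, tM.I_length]
  have lO : ((graphP P M).O.rtake i).length = i := by simp [List.rtake, tM.O_length]
  have lI' : ((graphP P M).I.rdrop i).length = m := by simp [List.rdrop, tM.I_length]
  have lO' : ((graphP P M).O.rdrop i).length = n := by simp [List.rdrop, tM.O_length]
  have hI : ((graphP P M).I.rdrop i ++ (graphP P M).I.rtake i).Nodup := by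
    rw [rdrop_append_rtake]; exact tM.I_nodup
  have hO : ((graphP P M).O.rdrop i ++ (graphP P M).O.rtake i).Nodup := by
    rw [rdrop_append_rtake]; exact tM.O_nodup
  have mI : ∀ {v}, v ∈ (graphP P M).I.rtake i → v ∈ (graphP P M).I :=
    fun hv => List.mem_of_mem_drop hv
  have mO : ∀ {v}, v ∈ (graphP P M).O.rtake i → v ∈ (graphP P M).O :=
    fun hv => List.mem_of_mem_drop hv
  refine ⟨_, _, h1.add_edges ?_ ?_ ?_ fun _ _ => Iff.rfl, ?_⟩
  · refine List.Nodup.of_map Prod.fst ?_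
    rw [List.map_fst_zip (by rw [lI, lO])]
    exact (List.nodup_append.1 hO).2.1
  · intro p hp hp'
    exact tM.no_out _ (mO (List.of_mem_zip (a := p.1) (b := p.2) hp).1) p.2
      ((h1.edge_iff _ _).2 (.inl hp'))
  · intro p hp
    obtain ⟨h2, h3⟩ := List.of_mem_zip (a := p.1) (b := p.2) hp
    simp [(graphP P M).O_unlabelled _ (mO h2), (graphP P M).I_unlabelled _ (mI h3)]
  · rw [cl_soup hnm] at e1 ⊢
    rw [List.map_append, links_perm List.perm_append_comm ((List.map_append ▸ hnm.isPolar _ :)),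
      links_append, e1, cl_trace, edgeNames, ← List.zip_map]
    have h3 := links_zip_trace (P := P) (S := S) (ys := ((graphP P M).I.rdrop i).map (nm · true))
      (ys' := ((graphP P M).I.rtake i).map (nm · true))
      (xs := ((graphP P M).O.rdrop i).map (nm · false))
      (xs' := ((graphP P M).O.rtake i).map (nm · false)) (a := cl P M) (by simp [lI, lO])
      (by rw [← List.map_append]; exact hnm.map_nodup hI _)
      (by rw [← List.map_append]; exact hnm.map_nodup hO _)
      (by rw [← List.map_append]; exact hnm.pol_of_mem)
      (by rw [← List.map_append]; exact hnm.pol_of_mem)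
      (by simpa only [List.length_map, lI, lI', lO'] using hasTy_cl.2 hM) ?_
    · rw [← List.map_append, ← List.map_append, rdrop_append_rtake, rdrop_append_rtake,
        List.length_map, lI] at h3
      exact h3
    · intro z hz
      have hr : ∀ (l : List (graphP P M).V) (j : ℕ) v, v ∈ l.rdrop j → v ∈ l :=
        fun _ _ _ h => List.mem_of_mem_take h
      refine ⟨?_, ?_, ?_, ?_⟩ <;> rw [List.mem_map] <;> rintro ⟨v, hv, e⟩
      · exact hnm.ne_of_mem_fv hM hz (.inr (hr _ _ _ hv)) _ e.symm
      · exact hnm.ne_of_mem_fv hM hz (.inl (hr _ _ _ hv)) _ e.symm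
      · exact hnm.ne_of_mem_fv hM hz (.inr (mO hv)) _ e.symm
      · exact hnm.ne_of_mem_fv hM hz (.inl (mI hv)) _ e.symm

/-! ### Renaming the names of a presentation -/

theorem rename_varsTerm (x x' : A) (l : List A) : rename x x' (varsTerm l : Term S A) =
    varsTerm (l.map fun z => if z = x then x' else z) := by
  induction l with
  | nil => rfl
  | cons z l ih =>
    exact congrArg (Term.tensor _) ih

theorem rename_tensorTerm (x x' : A) (l : List (Term S A)) : rename x x' (tensorTerm l) =
    tensorTerm (l.map (rename x x')) := by
  induction l with
  | nil => rfl
  | cons z l ih =>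
    exact congrArg (Term.tensor _) ih

theorem rename_linksTerm {x x' : A} {L : List (A × A)} (hL : ∀ p ∈ L, p.1 ≠ x ∧ p.2 ≠ x)
    (M : Term S A) : rename x x' (linksTerm L M) = linksTerm L (rename x x' M) := by
  induction L with
  | nil => rfl
  | cons p L ih =>
    have h1 := hL p (by simp)
    change (if p.1 = x ∨ p.2 = x then _ else _) = Term.link p.1 p.2 _
    rw [if_neg (by tauto)]
    exact congrArg (Term.link _ _) (ih fun q hq => hL q (by simp [hq]))

theorem rename_atom {V : Type} (x x' : A) (nm : V → Bool → A) (t : Atom S V) :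
    rename x x' (t.term nm) = t.term (fun v b => if nm v b = x then x' else nm v b) := by
  have : rename x x' (t.core : Term S A) = t.core := by cases t <;> rfl
  change Term.comp (Term.comp _ _) _ = _
  rw [rename_varsTerm, rename_varsTerm, this, List.map_map, List.map_map]
  rfl

theorem rename_soup {V : Type} {x x' : A} {nm : V → Bool → A} {ats : List (Atom S V)}
    {es : List (V × V)} (h : ∀ p ∈ es, nm p.1 false ≠ x ∧ nm p.2 true ≠ x) :
    rename x x' (soup nm ats es) =
      soup (fun v b => if nm v b = x then x' else nm v b) ats es := by
  rw [soup, rename_linksTerm, rename_tensorTerm, List.map_map, soup]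
  · congr 1
    · refine List.map_congr_left fun p hp => ?_
      refine Prod.ext ?_ ?_
      · exact (if_neg (h p hp).1).symm
      · exact (if_neg (h p hp).2).symm
    · congr 1
      exact List.map_congr_left fun t _ => rename_atom x x' nm t
  · intro p hp
    obtain ⟨q, hq, rfl⟩ := List.mem_map.1 hp
    exact h q hq

theorem names_varsTerm (l : List A) : names (varsTerm l : Term S A) = l.toFinset := by
  induction l with
  | nil => rfl
  | cons z l ih =>
    change {z} ∪ names (varsTerm l : Term S A) = _
    rw [ih, List.toFinset_cons, Finset.insert_eq]

theorem mem_names_soup {V : Type} {nm : V → Bool → A} {ats : List (Atom S V)}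
    {es : List (V × V)} {z : A} (hz : z ∈ names (soup nm ats es)) : ∃ v b, z = nm v b := by
  have ha : ∀ t : Atom S V, z ∈ names (t.term nm) → ∃ v b, z = nm v b := by
    intro t ht
    have hc : names (t.core : Term S A) = ∅ := by cases t <;> rfl
    change z ∈ (names (varsTerm _) ∪ names t.core) ∪ names (varsTerm _) at ht
    rw [names_varsTerm, names_varsTerm, hc] at ht
    simp only [Finset.union_empty, Finset.mem_union, List.mem_toFinset, List.mem_map] at ht
    rcases ht with ⟨v, -, rfl⟩ | ⟨v, -, rfl⟩ <;> exact ⟨_, _, rfl⟩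
  have ht : ∀ ats : List (Atom S V), z ∈ names (tensorTerm (ats.map (Atom.term nm))) →
      ∃ v b, z = nm v b := by
    intro ats
    induction ats with
    | nil => intro h; exact absurd h (Finset.notMem_empty z)
    | cons t ats ih =>
      intro h
      exact (Finset.mem_union.1 h).elim (ha t) ih
  rw [soup] at hz
  induction es with
  | nil => exact ht ats hz
  | cons p es ih =>
    change z ∈ ({nm p.1 false, nm p.2 true} : Finset A) ∪ names (linksTerm _ _) at hz
    rcases Finset.mem_union.1 hz with h | h
    · simp only [Finset.mem_insert, Finset.mem_singleton] at h
      rcases h with rfl | rfl <;> exact ⟨_, _, rfl⟩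
    · exact ih h

open Classical in
/-- The naming `nm` in which the name for the wire that starts at `v` becomes `x`, and the name for
the wire that ends at `w` becomes `y`. -/
noncomputable def override {V : Type} (nm : V → Bool → A) (v w : V) (x y : A) : V → Bool → A :=
  fun u b => if u = v ∧ b = false then x else if u = w ∧ b = true then y else nm u b

theorem override_left {V : Type} (nm : V → Bool → A) (v w : V) (x y : A) :
    override nm v w x y v false = x := by simp [override]

theorem override_right {V : Type} (nm : V → Bool → A) (v w : V) (x y : A) :
    override nm v w x y w true = y := by simp [override]

theorem override_of_ne {V : Type} {nm : V → Bool → A} {v w : V} {x y : A} {u : V} {b : Bool}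
    (h1 : ¬(u = v ∧ b = false)) (h2 : ¬(u = w ∧ b = true)) :
    override nm v w x y u b = nm u b := by simp [override, h1, h2]

theorem override_cases {V : Type} (nm : V → Bool → A) (v w : V) (x y : A) (u : V) (b : Bool) :
    (u = v ∧ b = false ∧ override nm v w x y u b = x) ∨
    (u = w ∧ b = true ∧ override nm v w x y u b = y) ∨
    (¬(u = v ∧ b = false) ∧ ¬(u = w ∧ b = true) ∧ override nm v w x y u b = nm u b) := by
  by_cases h1 : u = v ∧ b = false
  · obtain ⟨rfl, rfl⟩ := h1; exact .inl ⟨rfl, rfl, override_left _ _ _ _ _⟩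
  · by_cases h2 : u = w ∧ b = true
    · obtain ⟨rfl, rfl⟩ := h2; exact .inr (.inl ⟨rfl, rfl, override_right _ _ _ _ _⟩)
    · exact .inr (.inr ⟨h1, h2, override_of_ne h1 h2⟩)

theorem override_inj {V : Type} {nm : V → Bool → A} {v w : V} {x y : A}
    (h : ∀ {u b u' c}, nm u b = nm u' c → u = u' ∧ b = c)
    (hx : ∀ u b, nm u b ≠ x) (hy : ∀ u b, nm u b ≠ y) (hxy : x ≠ y) {u b u' c}
    (e : override nm v w x y u b = override nm v w x y u' c) : u = u' ∧ b = c := by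
  rcases override_cases nm v w x y u b with ⟨h1, h2, e1⟩ | ⟨h1, h2, e1⟩ | ⟨-, -, e1⟩ <;>
  rcases override_cases nm v w x y u' c with ⟨h3, h4, e2⟩ | ⟨h3, h4, e2⟩ | ⟨-, -, e2⟩ <;>
  rw [e1, e2] at e
  · exact ⟨h1.trans h3.symm, h2.trans h4.symm⟩
  · exact (hxy e).elim
  · exact (hx _ _ e.symm).elim
  · exact (hxy e.symm).elim
  · exact ⟨h1.trans h3.symm, h2.trans h4.symm⟩
  · exact (hy _ _ e.symm).elim
  · exact (hx _ _ e).elim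
  · exact (hy _ _ e).elim
  · exact h e

/-- Renaming undoes an override. -/
theorem rename_rename_soup {V : Type} {nm : V → Bool → A} {v w : V} {x y : A}
    {ats : List (Atom S V)} {es : List (V × V)} (hx : ∀ u b, nm u b ≠ x) (hy : ∀ u b, nm u b ≠ y)
    (hxy : x ≠ y) (h : ∀ p ∈ es, p.1 ≠ v ∧ p.2 ≠ w) :
    rename y (nm w true) (rename x (nm v false) (soup (override nm v w x y) ats es)) =
      soup nm ats es := by
  have e : (fun u b => if (if override nm v w x y u b = x then nm v false else
      override nm v w x y u b) = y then nm w true else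
        if override nm v w x y u b = x then nm v false else override nm v w x y u b) = nm := by
    funext u b
    rcases override_cases nm v w x y u b with ⟨rfl, rfl, e⟩ | ⟨rfl, rfl, e⟩ | ⟨-, -, e⟩
    · rw [e, if_pos rfl, if_neg (hy _ _)]
    · rw [e, if_neg hxy.symm, if_pos rfl]
    · rw [e, if_neg (hx _ _), if_neg (hy _ _)]
  have h1 : ∀ p ∈ es, override nm v w x y p.1 false = nm p.1 false ∧
      override nm v w x y p.2 true = nm p.2 true := fun p hp =>
    ⟨override_of_ne (by simp [h p hp]) (by simp), override_of_ne (by simp) (by simp [h p hp])⟩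
  rw [rename_soup, rename_soup, e]
  · intro p hp
    rw [(h1 p hp).1, (h1 p hp).2, if_neg (hx _ _), if_neg (hx _ _)]
    exact ⟨hy _ _, hy _ _⟩
  · intro p hp
    rw [(h1 p hp).1, (h1 p hp).2]
    exact ⟨hx _ _, hx _ _⟩

/-- Typed soups: a vertex whose name for outgoing wires is free has no edge out of it, and
dually. -/
theorem Naming.not_mem_of_fvs {V : Type} {f : V → Option (Label S A)} {nm : V → Bool → A}
    (h : Naming P f nm) {ats : List (Atom S V)} {es : List (V × V)}
    (ht : (cl P (soup nm ats es)).HasTy 0 0) {v : V} :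
    (nm v false ∈ (cl P (soup nm ats es)).fvs → ∀ w, (v, w) ∉ es) ∧
    (nm v true ∈ (cl P (soup nm ats es)).fvs → ∀ w, (w, v) ∉ es) := by
  rw [cl_soup h] at ht ⊢
  rw [(hasTy_links (h.isPolar _) ht).2.1]
  simp only [Finset.mem_sdiff, List.mem_toFinset, List.mem_append, List.map_map, List.mem_map,
    not_or, not_exists, not_and]
  exact ⟨fun e w hw => e.2.1 _ hw rfl, fun e w hw => e.2.2 _ hw rfl⟩

/-- In a naming for `M` the two ends of the linked wire carry the names `x` and `y`. The soup of
`M` is linked along these, and the two bound names are replaced by those prescribed for the ends. -/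
theorem soupFor_link {x y : A} {M : Term S A} {m n : ℕ} (hM : Ty P (.link x y M) m n)
    (ih : SoupFor (polUpdate P x y) (graphP (polUpdate P x y) M) (cl _ M) (names M)) :
    SoupFor P (graphP P (.link x y M)) (cl P (.link x y M)) (names (.link x y M)) := by
  obtain ⟨hxM, hyM, hxy, tM⟩ := id hM
  have tl := tM.labels
  have tt := tM.tidy
  have tf := fun nm (h : Naming _ (graphP (polUpdate P x y) M).f nm) z (hz : z ∈ (cl _ M).fvs) v hv b =>
    h.ne_of_mem_fv tM hz (v := v) hv b
  change SoupFor P ((graphP (polUpdate P x y) M).link x y) _ _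
  have hQx : polUpdate P x y x = false := polUpdate_left hxy
  have hQy : polUpdate P x y y = true := polUpdate_right
  have hQ : ∀ z, z ≠ x → z ≠ y → polUpdate P x y z = P z := fun _ => polUpdate_of_ne
  have hlink : ∀ {M N : Term S A}, cl (polUpdate P x y) M = cl (polUpdate P x y) N →
      cl P (.link x y M) = cl P (.link x y N) := fun h => cl_eq.2 (.link x y (cl_eq.1 h))
  have hty : ∀ {M : Term S A}, Ty (polUpdate P x y) M 0 0 → x ∈ fv M → y ∈ fv M →
      Ty P (.link x y M) 0 0 := fun h1 h2 h3 => ⟨h2, h3, hxy, h1⟩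
  generalize graphP (polUpdate P x y) M = D at *
  generalize polUpdate P x y = Q at *
  -- Only these three properties of the labelling after erasure of `x` and `y` matter.
  suffices main : ∀ f' : D.V → Option (Label S A),
      (∀ v z, f' v = some (.var z) ↔ D.f v = some (.var z) ∧ z ≠ x ∧ z ≠ y) →
      (∀ v, f' v = D.f v ∨ (f' v = none ∧ ∃ z, D.f v = some (.var z))) →
      (∀ u k, f' u = some (.box k) → D.f u = some (.box k)) →
      ∀ nm, Naming P f' nm → Avoids P f' nm (names (.link x y M)) →
      ∃ ats es, Pres f' (fun a b => D.E a b ∨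
        (D.f a = some (.var x) ∧ D.f b = some (.var y))) ats es ∧
        cl P (soup nm ats es) = hub (D.I.map (nm · true)) (cl P (.link x y M))
          (D.O.map (nm · false)) by
    refine main (D.link x y).f (D.link_f_eq_var x y) (fun u => ?_) fun u k h => ?_
    · by_cases hu : D.f u = some (.var x) ∨ D.f u = some (.var y)
      · refine .inr ⟨if_pos hu, ?_⟩
        rcases hu with hu | hu <;> exact ⟨_, hu⟩
      · exact .inl (if_neg hu)
    · by_cases hu : D.f u = some (.var x) ∨ D.f u = some (.var y)
      · rw [show (D.link x y).f u = none from if_pos hu] at h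
        simp at h
      · rwa [show (D.link x y).f u = D.f u from if_neg hu] at h
  intro f' hf hrel hu nm hnm hs
  have hne : ∀ u b, nm u b ≠ x ∧ nm u b ≠ y := by
    intro u b
    rw [← not_or]
    intro h
    have : nm u b ∈ names (.link x y M) := by rcases h with h | h <;> simp [names, h]
    obtain ⟨z, hz, rfl⟩ := hs u b this
    rw [hnm.var hz] at h
    have := ((hf _ _).1 hz).2
    tauto
  have hx := fun u b => (hne u b).1
  have hy := fun u b => (hne u b).2
  obtain ⟨v, hv⟩ := (tl.1 x).1 hxM
  obtain ⟨w, hw⟩ := (tl.1 y).1 hyM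
  -- `M` is named as prescribed, except that the labels `x` and `y` are kept.
  have hnm' : Naming Q D.f (override nm v w x y) := by
    refine ⟨override_inj hnm.inj hx hy hxy, fun u b => ?_, fun {u z} hu => ?_⟩
    · rcases override_cases nm v w x y u b with ⟨rfl, rfl, e⟩ | ⟨rfl, rfl, e⟩ | ⟨-, -, e⟩ <;> rw [e]
      · exact hQx
      · exact hQy
      · rw [hQ _ (hx _ _) (hy _ _)]; exact hnm.pol _ _
    · by_cases hzx : z = x
      · subst hzx
        rw [tl.2 u v z hu hv, hQx, override_left]
      · by_cases hzy : z = y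
        · subst hzy
          rw [tl.2 u w z hu hw, hQy, override_right]
        · rw [hQ _ hzx hzy, override_of_ne, hnm.var ((hf _ _).2 ⟨hu, hzx, hzy⟩)]
          · rintro ⟨rfl, -⟩
            rw [hv] at hu
            simp only [Option.some.injEq, Label.var.injEq] at hu
            exact hzx hu.symm
          · rintro ⟨rfl, -⟩
            rw [hw] at hu
            simp only [Option.some.injEq, Label.var.injEq] at hu
            exact hzy hu.symm
  have hs' : Avoids Q D.f (override nm v w x y) (names M) := by
    intro u b hu
    rcases override_cases nm v w x y u b with ⟨rfl, rfl, e⟩ | ⟨rfl, rfl, e⟩ | ⟨-, -, e⟩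
    · exact ⟨x, hv, hQx⟩
    · exact ⟨y, hw, hQy⟩
    · rw [e] at hu
      obtain ⟨z, hz, hb⟩ := hs u b (by simp only [names, Finset.mem_union]; exact .inr hu)
      obtain ⟨h1, h2, h3⟩ := (hf _ _).1 hz
      exact ⟨z, h1, by rw [hQ _ h2 h3, hb]⟩
  obtain ⟨ats, es, hp, he⟩ := ih _ hnm' hs'
  have hI : D.I.map (override nm v w x y · true) = D.I.map (nm · true) :=
    List.map_congr_left fun u hu => override_of_ne (by simp) (by
      rintro ⟨rfl, -⟩
      simp [D.I_unlabelled u hu] at hw)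
  have hO : D.O.map (override nm v w x y · false) = D.O.map (nm · false) :=
    List.map_congr_left fun u hu => override_of_ne (by
      rintro ⟨rfl, -⟩
      simp [D.O_unlabelled u hu] at hv) (by simp)
  have ht : (hub (D.I.map (override nm v w x y · true)) (cl Q M)
      (D.O.map (override nm v w x y · false))).HasTy 0 0 := by
    refine hasTy_hub ?_ (hnm'.map_nodup tt.I_nodup _) (hnm'.map_nodup tt.O_nodup _)
      hnm'.pol_of_mem hnm'.pol_of_mem ?_
    · simpa [tt.I_length, tt.O_length] using hasTy_cl.2 tM
    · intro z hz
      constructor <;> rw [List.mem_map] <;> rintro ⟨u, hu, e⟩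
      · exact tf _ hnm' z hz _ (.inr hu) _ e.symm
      · exact tf _ hnm' z hz _ (.inl hu) _ e.symm
  have hfx : x ∈ (cl Q (soup (override nm v w x y) ats es)).fvs := by
    rw [he, fvs_hub ht, fvs_cl tM]; simp [hxM]
  have hfy : y ∈ (cl Q (soup (override nm v w x y) ats es)).fvs := by
    rw [he, fvs_hub ht, fvs_cl tM]; simp [hyM]
  have hs0 : (cl Q (soup (override nm v w x y) ats es)).HasTy 0 0 := he ▸ ht
  -- `x` is free in the soup, so no edge of the presentation starts at `v`; dually for `y`.
  have hout : ∀ u, (v, u) ∉ es := (hnm'.not_mem_of_fvs hs0).1 (by rwa [override_left])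
  have hin : ∀ u, (u, w) ∉ es := (hnm'.not_mem_of_fvs hs0).2 (by rwa [override_right])
  have hes : ∀ p ∈ es, p.1 ≠ v ∧ p.2 ≠ w := by
    rintro ⟨a, b⟩ hab
    constructor <;> rintro rfl
    · exact hout _ hab
    · exact hin _ hab
  have hp' := hp.relabel hrel
  refine ⟨ats, es ++ [(v, w)], hp'.add_edges (by simp) ?_ ?_ ?_, ?_⟩
  · simpa using hout w
  · intro p hp
    obtain rfl := List.mem_singleton.1 hp
    refine ⟨fun k h => ?_, fun k h => ?_⟩
    · have := hu _ _ h
      simp [hv] at this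
    · have := hu _ _ h
      simp [hw] at this
  · intro a b
    rw [List.mem_singleton, Prod.mk.injEq]
    refine or_congr Iff.rfl ⟨fun h => ⟨tl.2 _ _ _ h.1 hv, tl.2 _ _ _ h.2 hw⟩, ?_⟩
    rintro ⟨rfl, rfl⟩
    exact ⟨hv, hw⟩
  · have hne' : ∀ u b, override nm v w x y u b ≠ nm v false ∧
        override nm v w x y u b ≠ nm w true := by
      intro u b
      rcases override_cases nm v w x y u b with ⟨rfl, rfl, e⟩ | ⟨rfl, rfl, e⟩ | ⟨h1, h2, e⟩ <;>
        rw [e]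
      · exact ⟨(hx _ _).symm, (hx _ _).symm⟩
      · exact ⟨(hy _ _).symm, (hy _ _).symm⟩
      · exact ⟨fun e => h1 (hnm.inj e), fun e => h2 (hnm.inj e)⟩
    have hfr : nm v false ∉ names (.link x y (soup (override nm v w x y) ats es)) ∧
        nm w true ∉ names (.link x y (soup (override nm v w x y) ats es)) := by
      simp only [names, Finset.mem_union, Finset.mem_insert, Finset.mem_singleton, hx, hy,
        or_false, false_or]
      constructor <;> intro h <;> obtain ⟨u, b, h⟩ := mem_names_soup h
      · exact (hne' u b).1 h.symm
      · exact (hne' u b).2 h.symm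
    -- The bound names `x` and `y` are renamed to the prescribed names of `v` and `w`.
    have hal := cl_link_rename (hty hs0 (fvs_cl_subset hfx) (fvs_cl_subset hfy)) hfr.1 hfr.2
      (hnm.pol _ _) (hnm.pol _ _)
    rw [rename_rename_soup hx hy hxy hes] at hal
    have h1 : cl P (soup nm ats (es ++ [(v, w)])) =
        cl P (.link (nm v false) (nm w true) (soup nm ats es)) := by
      rw [cl_soup hnm, List.map_append, links_perm List.perm_append_comm
        ((List.map_append ▸ hnm.isPolar _ :)), cl_link (hnm.pol _ _) (hnm.pol _ _), cl_soup hnm]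
      rfl
    rw [h1, ← hal, hlink (he.trans (cl_hubTerm _ _ M).symm), hI, hO, ← cl_hubTerm]
    have hfl : ∀ l : List D.V, ∀ b, x ∉ fv (varsTerm (l.map (nm · b)) : Term S A) ∧
        y ∉ fv (varsTerm (l.map (nm · b)) : Term S A) := by
      intro l b
      constructor <;> intro h <;> have h := fv_subset_names _ h <;>
        rw [names_varsTerm, List.mem_toFinset, List.mem_map] at h <;> obtain ⟨u, -, h⟩ := h
      · exact hx _ _ h
      · exact hy _ _ h
    exact cl_eq.2 (((Eqv.link_comp_left P _ (hfl _ _).1 (hfl _ _).2)).trans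
      ((Eqv.link_comp_right P _ (hfl _ _).1 (hfl _ _).2).comp (.refl _ _)))

/-- Every typed term is provably equal to the soup of its graph, wherever the vertices are named
without clashes. -/
theorem Ty.soupFor {M : Term S A} : ∀ {P : A → Bool} {m n : ℕ}, Ty P M m n →
    SoupFor P (graphP P M) (cl P M) (names M) := by
  induction M with
  | const k => intro P m n _; exact soupFor_const k _
  | zero => intro P m n _; exact soupFor_zero _
  | one => intro P m n _; exact soupFor_one _
  | sym => intro P m n _; exact soupFor_sym _
  | comp M N ihM ihN =>
    rintro P m n ⟨hd, k, h1, h2⟩; exact soupFor_comp h1 h2 hd (ihM h1) (ihN h2)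
  | tensor M N ihM ihN =>
    rintro P m n ⟨-, _, _, _, _, rfl, rfl, h1, h2⟩; exact soupFor_tensor h1 h2 (ihM h1) (ihN h2)
  | var x =>
    intro P m n _
    rcases Bool.eq_false_or_eq_true (P x) with hx | hx
    · have hg : graphP P (.var x : Term S A) = .inVar x := if_pos hx
      rw [hg]; exact soupFor_inVar hx _
    · have hg : graphP P (.var x : Term S A) = .outVar x := if_neg (by simp [hx])
      rw [hg]; exact soupFor_outVar hx _
  | trace i M ih => intro P m n h; exact soupFor_trace h (ih h)
  | link x y M ih => intro P m n h; exact soupFor_link h (ih h.2.2.2)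

/-! ### Presentations and removal of wire nodes -/

theorem Pres.perm {V : Type} {f : V → Option (Label S A)} {E : V → V → Prop}
    {ats ats' : List (Atom S V)} {es es' : List (V × V)} (h : Pres f E ats es)
    (ha : ats.Perm ats') (he : es.Perm es') : Pres f E ats' es' where
  nodup := ((ha.flatMap_right _).nodup_iff).1 h.nodup
  complete v := (ha.flatMap_right _).mem_iff.1 (h.complete v)
  good t ht := h.good t (ha.mem_iff.2 ht)
  es_nodup := he.nodup_iff.1 h.es_nodup
  edge_iff a b := by simp only [h.edge_iff, he.mem_iff, ha.mem_iff]
  es_box p hp := h.es_box p (he.mem_iff.2 hp)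

theorem Atom.map_id_of {V : Type} {g : V → V} {t : Atom S V} (h : ∀ v ∈ t.verts, g v = v) :
    t.map g = t := by
  cases t with
  | wire v => simp only [Atom.map, h v (by simp [Atom.verts])]
  | box k v is os =>
    have h1 : is.map g = is :=
      (List.map_congr_left fun v hv => h v (by simp [Atom.verts, hv])).trans (List.map_id _)
    have h2 : os.map g = os :=
      (List.map_congr_left fun v hv => h v (by simp [Atom.verts, hv])).trans (List.map_id _)
    simp only [Atom.map, h v (by simp [Atom.verts]), h1, h2]

theorem Atom.map_map {U V W : Type} (g : V → W) (h : U → V) (t : Atom S U) :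
    (t.map h).map g = t.map (g ∘ h) := by
  cases t <;> simp [Atom.map]

section Removal

variable {V V' : Type} {f : V → Option (Label S A)} {E : V → V → Prop}
  {f' : V' → Option (Label S A)} {E' : V' → V' → Prop} {w : V} {a b : V'} {e : V' → V}
  {ats : List (Atom S V')} {es : List (V' × V')}

theorem mem_insert_edges (he : Function.Injective e) (hne : ∀ z, e z ≠ w) (s t : V') :
    (e s, e t) ∈ (e a, w) :: (w, e b) :: es.map (Prod.map e e) ↔ (s, t) ∈ es := by
  simp only [List.mem_cons, Prod.mk.injEq, hne, and_false, false_and, false_or, List.mem_map,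
    Prod.exists, Prod.map_apply, he.eq_iff, exists_eq_right_right, exists_eq_right]

theorem exists_inner_insert (he : Function.Injective e) (s t : V') :
    (∃ u ∈ Atom.wire w :: ats.map (Atom.map e), u.Inner (e s) (e t)) ↔
      ∃ u ∈ ats, u.Inner s t := by
  simp only [List.mem_cons, exists_eq_or_imp, List.mem_map, exists_exists_and_eq_and,
    Atom.inner_map, he.eq_iff]
  constructor
  · rintro (h | ⟨u, hu, _, _, rfl, rfl, h⟩)
    · exact h.elim
    · exact ⟨u, hu, h⟩
  · rintro ⟨u, hu, h⟩
    exact .inr ⟨u, hu, _, _, rfl, rfl, h⟩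

/-- Insertion of a wire node into a presentation. -/
theorem Pres.insert_wire (he : Function.Injective e) (hr : Set.range e = {w}ᶜ) (hw : f w = none)
    (hin : ∀ z, E z w ↔ z = e a) (hout : ∀ z, E w z ↔ z = e b) (hab : ¬ E (e a) (e b))
    (hf : ∀ z, f' z = f (e z))
    (hE : ∀ s t, E' s t ↔ E (e s) (e t) ∨ (s = a ∧ t = b)) (h : Pres f' E' ats ((a, b) :: es)) :
    Pres f E (.wire w :: ats.map (Atom.map e))
      ((e a, w) :: (w, e b) :: es.map (Prod.map e e)) := by
  have hne : ∀ z, e z ≠ w := fun z h => by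
    have : e z ∈ ({w}ᶜ : Set V) := hr ▸ ⟨z, rfl⟩
    exact this h
  have hcov : ∀ v, v = w ∨ ∃ z, e z = v := fun v => by
    by_cases hv : v = w
    · exact .inl hv
    · exact .inr (show v ∈ Set.range e by rw [hr]; exact hv)
  have hfe : f ∘ e = f' := funext fun z => (hf z).symm
  obtain ⟨hes1, hes2⟩ := List.nodup_cons.1 h.es_nodup
  refine ⟨?_, ?_, ?_, ?_, ?_, ?_⟩
  · rw [List.flatMap_cons, flatMap_verts_map]
    change (w :: _).Nodup
    rw [List.nodup_cons]
    refine ⟨fun hm => ?_, h.nodup.map he⟩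
    obtain ⟨z, -, hz⟩ := List.mem_map.1 hm
    exact hne z hz
  · intro v
    rw [List.flatMap_cons, flatMap_verts_map]
    change v ∈ w :: _
    rcases hcov v with rfl | ⟨z, rfl⟩
    · exact List.mem_cons_self
    · exact List.mem_cons_of_mem _ (List.mem_map_of_mem (h.complete z))
  · intro t ht
    rcases List.mem_cons.1 ht with rfl | ht
    · exact .inl hw
    · obtain ⟨t', ht', rfl⟩ := List.mem_map.1 ht
      rw [Atom.good_map, hfe]
      exact h.good t' ht'
  · rw [List.nodup_cons, List.nodup_cons]
    refine ⟨?_, ?_, hes2.map (he.prodMap he)⟩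
    · simp only [List.mem_cons, List.mem_map, Prod.mk.injEq, hne, Prod.map_apply, Prod.exists,
        and_false, exists_false, or_false, false_and, not_false_iff]
    · simp only [List.mem_map, Prod.mk.injEq, hne, Prod.map_apply, Prod.exists,
        and_false, exists_false, or_false, false_and, not_false_iff]
  · have hm := mem_insert_edges (a := a) (b := b) (es := es) he hne
    have hi := exists_inner_insert (S := S) (ats := ats) (w := w) he
    have hi' : ∀ v v', (∃ u ∈ Atom.wire w :: ats.map (Atom.map e), u.Inner v v') →
        ∃ s t, v = e s ∧ v' = e t := by
      rintro v v' ⟨u, hu, h⟩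
      rcases List.mem_cons.1 hu with rfl | hu
      · exact h.elim
      · obtain ⟨u, -, rfl⟩ := List.mem_map.1 hu
        obtain ⟨s, t, h1, h2, -⟩ := (Atom.inner_map e u v v').1 h
        exact ⟨s, t, h1, h2⟩
    have hmw : ∀ v, (v, w) ∈ (e a, w) :: (w, e b) :: es.map (Prod.map e e) ↔ v = e a := by
      intro v
      simp only [List.mem_cons, Prod.mk.injEq, hne, (hne _).symm, and_true, and_false, false_or,
        List.mem_map, Prod.exists, Prod.map_apply, exists_false, or_false]
    have hmw' : ∀ v, (w, v) ∈ (e a, w) :: (w, e b) :: es.map (Prod.map e e) ↔ v = e b := by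
      intro v
      simp only [List.mem_cons, Prod.mk.injEq, hne, (hne _).symm, true_and, false_and, false_or,
        List.mem_map, Prod.exists, Prod.map_apply, and_false, exists_false, or_false]
    intro v v'
    rcases hcov v' with rfl | ⟨t, rfl⟩
    · rw [hin, hmw]
      refine ⟨.inl, fun h => h.elim _root_.id fun h => ?_⟩
      obtain ⟨_, t, -, h⟩ := hi' _ _ h
      exact (hne t h.symm).elim
    rcases hcov v with rfl | ⟨s, rfl⟩
    · rw [hout, hmw']
      refine ⟨.inl, fun h => h.elim _root_.id fun h => ?_⟩
      obtain ⟨s, _, h, -⟩ := hi' _ _ h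
      exact (hne s h.symm).elim
    rw [hm, hi]
    have h1 := hE s t
    rw [h.edge_iff, List.mem_cons, Prod.mk.injEq] at h1
    by_cases hst : s = a ∧ t = b
    · obtain ⟨rfl, rfl⟩ := hst
      refine iff_of_false hab ?_
      rintro (h2 | ⟨u, hu, h2⟩)
      · exact hes1 h2
      · obtain ⟨h3, h4⟩ := h.es_box (s, t) (by simp)
        rcases h.box_label_of_inner hu h2 with ⟨k, hk⟩ | ⟨k, hk⟩
        · exact h3 k hk
        · exact h4 k hk
    · simp only [hst, false_or, or_false] at h1
      exact h1.symm
  · have hb := fun p hp => h.es_box p hp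
    simp only [hf] at hb
    intro p hp
    simp only [List.mem_cons, List.mem_map] at hp
    have h0 := hb (a, b) (by simp)
    rcases hp with rfl | rfl | ⟨q, hq, rfl⟩
    · exact ⟨h0.1, by simp [hw]⟩
    · exact ⟨by simp [hw], h0.2⟩
    · exact hb q (by simp [hq])

/-- Removal of a wire node from a presentation. -/
theorem Pres.remove_wire (he : Function.Injective e) (hr : Set.range e = {w}ᶜ)
    (hab : ¬ E (e a) (e b)) (hbox : (∀ k, f (e a) ≠ some (.box k)) ∧ ∀ k, f (e b) ≠ some (.box k))
    (hf : ∀ z, f' z = f (e z))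
    (hE : ∀ s t, E' s t ↔ E (e s) (e t) ∨ (s = a ∧ t = b))
    (h : Pres f E (.wire w :: ats.map (Atom.map e))
      ((e a, w) :: (w, e b) :: es.map (Prod.map e e))) : Pres f' E' ats ((a, b) :: es) := by
  have hne : ∀ z, e z ≠ w := fun z h => by
    have : e z ∈ ({w}ᶜ : Set V) := hr ▸ ⟨z, rfl⟩
    exact this h
  have hfe : f ∘ e = f' := funext fun z => (hf z).symm
  have hm := mem_insert_edges (a := a) (b := b) (es := es) he hne
  have hi := exists_inner_insert (S := S) (ats := ats) (w := w) he
  have hn := h.nodup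
  rw [List.flatMap_cons, flatMap_verts_map] at hn
  have hn2 := (List.nodup_cons.1 (List.nodup_cons.1 h.es_nodup).2).2
  refine ⟨(List.nodup_cons.1 hn).2.of_map, ?_, ?_, ?_, ?_, ?_⟩
  · intro v
    have h1 := h.complete (e v)
    rw [List.flatMap_cons, flatMap_verts_map] at h1
    rcases List.mem_cons.1 h1 with h1 | h1
    · exact (hne v h1).elim
    · obtain ⟨v', hv, h2⟩ := List.mem_map.1 h1
      rwa [he h2] at hv
  · intro t ht
    have := h.good (t.map e) (List.mem_cons_of_mem _ (List.mem_map_of_mem ht))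
    rwa [Atom.good_map, hfe] at this
  · rw [List.nodup_cons]
    refine ⟨fun hm' => hab ((h.edge_iff _ _).2 (.inl ((hm a b).2 hm'))), hn2.of_map⟩
  · intro s t
    rw [hE, h.edge_iff, hm, hi, List.mem_cons, Prod.mk.injEq, or_right_comm,
      or_comm (a := (s, t) ∈ es)]
  · intro p hp
    simp only [hf]
    rcases List.mem_cons.1 hp with rfl | hp
    · exact hbox
    · exact h.es_box (Prod.map e e p) (.tail _ (.tail _ (List.mem_map_of_mem hp)))

end Removal

/-! ### Soups and removal of wire nodes -/

section Fusion

variable {V V' : Type} {f : V → Option (Label S A)} {f' : V' → Option (Label S A)} {w : V}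
  {a b : V'} {e : V' → V} {ats : List (Atom S V')} {es : List (V' × V')}

/-- Two wire atoms linked to each other are a single wire. -/
theorem Naming.fuse {nm : V → Bool → A} (h : Naming P f nm) {v w : V} (hvw : v ≠ w) :
    links [edgeNames nm (v, w)] (Atom.cls P nm (.wire v : Atom S V) +
      Atom.cls P nm (.wire w : Atom S V)) = hub [nm v true] (cl P .one) [nm w false] := by
  have h1 := h.hub_fuse (S := S) (l₁ := [v]) (l₂ := [v]) (l₃ := [w]) (l₄ := [w])
    rfl (by simpa using hvw) (by simpa using hvw) (hasTy_id 1) (hasTy_id 1) (by simp) (by simp)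
  rw [mul_id (hasTy_id 1)] at h1
  rw [← id_one]
  refine Eq.trans ?_ h1
  simp [Atom.cls, Atom.ins, Atom.outs, Atom.core, id_one]

theorem hasTy_cls_wire {nm : V → Bool → A} (h : Naming P f nm) (v : V) :
    (Atom.cls P nm (.wire v : Atom S V)).HasTy 0 0 := by
  refine hasTy_hub (a := cl P .one) ⟨rfl, rfl⟩ (by simp [Atom.ins]) (by simp [Atom.outs])
    h.pol_of_mem h.pol_of_mem fun z hz => ?_
  exact absurd (fvs_cl_subset hz) (Finset.notMem_empty z)

theorem cls_congr {nm nm' : V → Bool → A} {t : Atom S V}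
    (h1 : ∀ v ∈ t.ins, nm v true = nm' v true) (h2 : ∀ v ∈ t.outs, nm v false = nm' v false) :
    t.cls P nm = t.cls P nm' := by
  rw [Atom.cls, Atom.cls, List.map_congr_left h1, List.map_congr_left h2]

theorem sum_cls_congr {nm nm' : V → Bool → A} {ats : List (Atom S V)}
    (h : ∀ v ∈ ats.flatMap Atom.verts, ∀ b, nm v b = nm' v b) :
    (ats.map (Atom.cls P nm)).sum = (ats.map (Atom.cls P nm')).sum := by
  congr 1
  refine List.map_congr_left fun t ht => cls_congr ?_ ?_ <;> intro v hv <;>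
    refine h v (List.mem_flatMap.2 ⟨t, ht, ?_⟩) _
  · exact Atom.mem_verts_of_ins hv
  · exact Atom.mem_verts_of_outs hv

/-- Insertion of a wire node before an unlabelled vertex does not change the soup, if the new node
takes over a name. -/
theorem cl_soup_insert_before {nm : V → Bool → A} {nm' : V' → Bool → A} (h : Naming P f nm)
    (h' : Naming P f' nm') (he : Function.Injective e) (hne : ∀ z, e z ≠ w)
    (hnm : ∀ v γ, ¬(v = b ∧ γ = true) → nm' v γ = nm (e v) γ) (hb : nm' b true = nm w true)
    (hat : b ∉ ats.flatMap Atom.verts) (hes : ∀ p ∈ es, p.2 ≠ b) :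
    cl P (soup nm (.wire w :: (.wire b :: ats).map (Atom.map e))
      ((e a, w) :: (w, e b) :: es.map (Prod.map e e))) =
    cl P (soup nm' (.wire b :: ats) ((a, b) :: es)) := by
  have hE : (es.map (Prod.map e e)).map (edgeNames nm) = es.map (edgeNames nm') := by
    rw [map_edgeNames_map]
    refine List.map_congr_left fun p hp => Prod.ext ?_ ?_
    · exact (hnm _ _ (by simp)).symm
    · exact (hnm _ _ (by simp [hes p hp])).symm
  have hS : ((ats.map (Atom.map e)).map (Atom.cls P nm)).sum = (ats.map (Atom.cls P nm')).sum := by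
    rw [map_cls_map]
    exact sum_cls_congr fun v hv γ => (hnm v γ fun hv' => hat (hv'.1 ▸ hv)).symm
  have hF : Fresh [edgeNames nm (w, e b)] ((ats.map (Atom.map e)).map (Atom.cls P nm)).sum := by
    refine fresh_sum h (es := [(w, e b)]) fun p hp => ?_
    obtain rfl := List.mem_singleton.1 hp
    rw [Pres.flatMap_verts_map, List.mem_map_of_injective he]
    refine ⟨fun hm => ?_, hat⟩
    obtain ⟨z, -, hz⟩ := List.mem_map.1 hm
    exact hne z hz
  have hp : (edgeNames nm (e a, w) :: edgeNames nm (w, e b) ::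
      (es.map (Prod.map e e)).map (edgeNames nm)).Perm
      ((edgeNames nm (e a, w) :: (es.map (Prod.map e e)).map (edgeNames nm)) ++
        [edgeNames nm (w, e b)]) := by
    rw [List.cons_append]
    exact (List.perm_append_singleton _ _).symm.cons _
  rw [cl_soup h, cl_soup h', List.map_cons, List.map_cons, List.map_cons, List.map_cons,
    List.map_cons, List.sum_cons, List.sum_cons,
    links_perm hp (h.isPolar ((e a, w) :: (w, e b) :: es.map (Prod.map e e))), links_append,
    ← add_assoc, links_add_left (L := [edgeNames nm (w, e b)]) (h.isPolar [(w, e b)]) _ hF]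
  change links _ (links [edgeNames nm (w, e b)] (Atom.cls P nm (.wire w) +
    Atom.cls P nm (.wire (e b))) + _) = _
  rw [h.fuse (hne b).symm, hE, hS, List.map_cons, List.map_cons, List.sum_cons, ← hb,
    ← hnm b false (by simp)]
  have : edgeNames nm (e a, w) = edgeNames nm' (a, b) :=
    Prod.ext (hnm a false (by simp)).symm hb.symm
  rw [this]
  rfl

/-- Insertion of a wire node after an unlabelled vertex does not change the soup, if the new node
takes over a name. -/
theorem cl_soup_insert_after {nm : V → Bool → A} {nm' : V' → Bool → A} (h : Naming P f nm)
    (h' : Naming P f' nm') (he : Function.Injective e) (hne : ∀ z, e z ≠ w)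
    (hnm : ∀ v γ, ¬(v = a ∧ γ = false) → nm' v γ = nm (e v) γ) (ha : nm' a false = nm w false)
    (hat : a ∉ ats.flatMap Atom.verts) (hes : ∀ p ∈ es, p.1 ≠ a) :
    cl P (soup nm (.wire w :: (.wire a :: ats).map (Atom.map e))
      ((e a, w) :: (w, e b) :: es.map (Prod.map e e))) =
    cl P (soup nm' (.wire a :: ats) ((a, b) :: es)) := by
  have hE : (es.map (Prod.map e e)).map (edgeNames nm) = es.map (edgeNames nm') := by
    rw [map_edgeNames_map]
    refine List.map_congr_left fun p hp => Prod.ext ?_ ?_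
    · exact (hnm _ _ (by simp [hes p hp])).symm
    · exact (hnm _ _ (by simp)).symm
  have hS : ((ats.map (Atom.map e)).map (Atom.cls P nm)).sum = (ats.map (Atom.cls P nm')).sum := by
    rw [map_cls_map]
    exact sum_cls_congr fun v hv γ => (hnm v γ fun hv' => hat (hv'.1 ▸ hv)).symm
  have hF : Fresh [edgeNames nm (e a, w)] ((ats.map (Atom.map e)).map (Atom.cls P nm)).sum := by
    refine fresh_sum h (es := [(e a, w)]) fun p hp => ?_
    obtain rfl := List.mem_singleton.1 hp
    rw [Pres.flatMap_verts_map, List.mem_map_of_injective he]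
    refine ⟨hat, fun hm => ?_⟩
    obtain ⟨z, -, hz⟩ := List.mem_map.1 hm
    exact hne z hz
  have hp : (edgeNames nm (e a, w) :: edgeNames nm (w, e b) ::
      (es.map (Prod.map e e)).map (edgeNames nm)).Perm
      ((edgeNames nm (w, e b) :: (es.map (Prod.map e e)).map (edgeNames nm)) ++
        [edgeNames nm (e a, w)]) := (List.perm_append_singleton _ _).symm
  rw [cl_soup h, cl_soup h', List.map_cons, List.map_cons, List.map_cons, List.map_cons,
    List.map_cons, List.sum_cons, List.sum_cons,
    links_perm hp (h.isPolar ((e a, w) :: (w, e b) :: es.map (Prod.map e e))), links_append,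
    ← add_assoc, show Atom.map e (.wire a : Atom S V') = .wire (e a) from rfl,
    add_comm_of_hasTy (hasTy_cls_wire h _) (hasTy_cls_wire h _),
    links_add_left (L := [edgeNames nm (e a, w)]) (h.isPolar [(e a, w)]) _ hF]
  change links _ (links [edgeNames nm (e a, w)] (Atom.cls P nm (.wire (e a)) +
    Atom.cls P nm (.wire w)) + _) = _
  rw [h.fuse (hne a), hE, hS, List.map_cons, List.map_cons, List.sum_cons, ← ha,
    ← hnm a true (by simp)]
  have : edgeNames nm (w, e b) = edgeNames nm' (a, b) :=
    Prod.ext ha.symm (hnm b true (by simp)).symm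
  rw [this]
  rfl

end Fusion

/-! ### Invariance of soups -/

section Removal

variable {V V' : Type} {f : V → Option (Label S A)} {E : V → V → Prop}
  {f' : V' → Option (Label S A)} {E' : V' → V' → Prop} {w : V} {a b c : V'} {β : Bool} {e : V' → V}

/-- In a typed soup, different edges have different sources and different targets. -/
theorem Naming.nodup_of_hasTy {nm : V → Bool → A} (h : Naming P f nm) {ats : List (Atom S V)}
    {es : List (V × V)} (ht : (cl P (soup nm ats es)).HasTy 0 0) :
    (es.map Prod.fst).Nodup ∧ (es.map Prod.snd).Nodup := by
  rw [cl_soup h] at ht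
  obtain ⟨-, -, h1, h2, -⟩ := hasTy_links (h.isPolar _) ht
  constructor
  · refine List.Nodup.of_map (nm · false) ?_
    rw [List.map_map] at h1 ⊢
    exact h1
  · refine List.Nodup.of_map (nm · true) ?_
    rw [List.map_map] at h2 ⊢
    exact h2

/-- An edge at an unlabelled vertex is not inside a box. -/
theorem Pres.mem_es_of_unlabelled {ats : List (Atom S V)} {es : List (V × V)}
    (h : Pres f E ats es) {v v' : V} (hE : E v v') (hv : f v = none ∨ f v' = none) :
    (v, v') ∈ es := by
  refine ((h.edge_iff v v').1 hE).resolve_right ?_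
  rintro ⟨t, ht, hi⟩
  have key : ∀ {u}, f u = none → u ∈ t.verts → False := by
    intro u hu hm
    have := h.eq_of_mem ht (h.wire_mem (.inl hu)) hm (by simp [Atom.verts])
    rw [this] at hi
    exact hi
  have hm : v ∈ t.verts ∧ v' ∈ t.verts := by
    cases t with
    | wire u => exact hi.elim
    | box k u is os => rcases hi with ⟨h1, rfl⟩ | ⟨rfl, h1⟩ <;> simp [Atom.verts, h1]
  exact hv.elim (fun h => key h hm.1) fun h => key h hm.2

/-- Insertion of a wire node does not change the soup, if the new node takes over a name of an
unlabelled neighbour `c`. -/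
theorem cl_soup_insert {nm : V → Bool → A} {nm' : V' → Bool → A} {ats : List (Atom S V')}
    {es : List (V' × V')} (h : Naming P f nm)
    (h' : Naming P f' nm') (he : Function.Injective e) (hne : ∀ z, e z ≠ w)
    (hp : Pres f E (.wire w :: ats.map (Atom.map e))
      ((e a, w) :: (w, e b) :: es.map (Prod.map e e)))
    (hp' : Pres f' E' ats ((a, b) :: es))
    (hc : (β = true ∧ c = b) ∨ (β = false ∧ c = a)) (hcf : f' c = none)
    (hnm : ∀ v γ, ¬(v = c ∧ γ = β) → nm' v γ = nm (e v) γ) (hn : nm' c β = nm w β)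
    (hes1 : ∀ p ∈ es, p.1 ≠ a) (hes2 : ∀ p ∈ es, p.2 ≠ b) :
    cl P (soup nm (.wire w :: ats.map (Atom.map e))
      ((e a, w) :: (w, e b) :: es.map (Prod.map e e))) =
    cl P (soup nm' ats ((a, b) :: es)) := by
  classical
  have hperm := List.perm_cons_erase (hp'.wire_mem (.inl hcf))
  have hn' := ((hperm.flatMap_right Atom.verts).nodup_iff).1 hp'.nodup
  have hat : c ∉ (ats.erase (.wire c)).flatMap Atom.verts := (List.nodup_cons.1 hn').1
  rw [cl_soup_perm h (fun t ht => ⟨hp.good t ht, hp.verts_nodup ht⟩)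
    ((hperm.map (Atom.map e)).cons (.wire w)) (List.Perm.refl _),
    cl_soup_perm h' (fun t ht => ⟨hp'.good t ht, hp'.verts_nodup ht⟩) hperm (List.Perm.refl _)]
  rcases hc with ⟨rfl, rfl⟩ | ⟨rfl, rfl⟩
  · exact cl_soup_insert_before h h' he hne hnm hn hat hes2
  · exact cl_soup_insert_after h h' he hne hnm hn hat hes1

end Removal

/-- The graph `D` can be named and presented in such a way that its soup is `T`, with the names `ys`
at the inputs and `xs` at the outputs. -/
def Reads (P : A → Bool) (T : Cl S P) (ys xs : List A) {V : Type} (f : V → Option (Label S A))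
    (E : V → V → Prop) (I O : List V) : Prop :=
  ∃ nm ats es, Naming P f nm ∧ Pres f E ats es ∧ cl P (soup nm ats es) = T ∧
    I.map (nm · true) = ys ∧ O.map (nm · false) = xs

section Removal

variable {V V' : Type} {f : V → Option (Label S A)} {E : V → V → Prop}
  {f' : V' → Option (Label S A)} {E' : V' → V' → Prop} {w : V} {a b c : V'} {β : Bool} {e : V' → V}
  {T : Cl S P} {ys xs : List A} {I O : List V'}

theorem Reads.map_equiv {I O : List V} (h : Reads P T ys xs f E I O) (e : V ≃ V')
    (hf : ∀ v, f' (e v) = f v) (hE : ∀ a b, E a b ↔ E' (e a) (e b)) :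
    Reads P T ys xs f' E' (I.map e) (O.map e) := by
  obtain ⟨nm, ats, es, hn, hp, ht, hI, hO⟩ := h
  have hn' : Naming P f' (fun v => nm (e.symm v)) :=
    hn.comp e.symm.injective fun v => by rw [← hf, e.apply_symm_apply]
  refine ⟨_, _, _, hn', hp.map_equiv e hf hE, ?_, ?_, ?_⟩
  · rw [← ht, cl_soup hn', cl_soup hn, map_cls_map, map_edgeNames_map]
    simp only [e.symm_apply_apply]
  · rw [List.map_map, ← hI]
    simp only [Function.comp_def, e.symm_apply_apply]
  · rw [List.map_map, ← hO]
    simp only [Function.comp_def, e.symm_apply_apply]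

/-- The unlabelled neighbour `c` of the removed node `w` takes over a name of `w`. The
presentation is transported from `V` to `V'` along a partial inverse of `e`. -/
theorem Reads.remove_wire (hT : T.HasTy 0 0) (hys : ∀ y ∈ ys, y ∈ T.fvs) (hxs : ∀ x ∈ xs, x ∈ T.fvs)
    (he : Function.Injective e) (hr : Set.range e = {w}ᶜ) (hw : f w = none)
    (hin : ∀ z, E z w ↔ z = e a) (hout : ∀ z, E w z ↔ z = e b) (hab : ¬ E (e a) (e b))
    (hf : ∀ z, f' z = f (e z)) (hE : ∀ s t, E' s t ↔ E (e s) (e t) ∨ (s = a ∧ t = b))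
    (hc : (β = true ∧ c = b) ∨ (β = false ∧ c = a)) (hcf : f' c = none)
    (h : Reads P T ys xs f E (I.map e) (O.map e)) : Reads P T ys xs f' E' I O := by
  classical
  obtain ⟨nm, ats, es, hn, hp, ht, hI, hO⟩ := h
  have hne : ∀ z, e z ≠ w := fun z h => by
    have : e z ∈ ({w}ᶜ : Set V) := hr ▸ ⟨z, rfl⟩
    exact this h
  have hcov : ∀ v, v ≠ w → ∃ z, e z = v := fun v hv => show v ∈ Set.range e by rw [hr]; exact hv
  have m1 := hp.mem_es_of_unlabelled ((hin _).2 rfl) (.inr hw)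
  have m2 := hp.mem_es_of_unlabelled ((hout _).2 rfl) (.inl hw)
  have pa := List.perm_cons_erase (hp.wire_mem (.inl hw))
  have m2' : (w, e b) ∈ es.erase (e a, w) := (List.mem_erase_of_ne fun h => by
    exact hne a (Prod.mk.inj h).1.symm).2 m2
  have pe := (List.perm_cons_erase m1).trans ((List.perm_cons_erase m2').cons _)
  generalize ats.erase (.wire w) = ats₁ at pa
  generalize (es.erase (e a, w)).erase (w, e b) = es₁ at pe
  have hp₁ := hp.perm pa pe
  have ht₁ := (cl_soup_perm hn (fun t ht => ⟨hp.good t ht, hp.verts_nodup ht⟩) pa pe).symm.trans ht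
  clear pa pe m2' m1 m2 ht hp
  let g : V → V' := fun v => if h : ∃ z, e z = v then h.choose else a
  have hg : ∀ v, v ≠ w → e (g v) = v := fun v hv => by
    have h := hcov v hv
    simp only [g, dif_pos h]
    exact h.choose_spec
  have hnw := (List.nodup_cons.1 hp₁.nodup).1
  have ea : ats₁ = (ats₁.map (Atom.map g)).map (Atom.map e) := by
    rw [List.map_map]
    refine ((List.map_congr_left fun t ht => ?_).trans (List.map_id _)).symm
    simp only [Function.comp_apply, Atom.map_map, id_eq]
    exact Atom.map_id_of fun v hv => hg v fun h => hnw (List.mem_flatMap.2 ⟨t, ht, h ▸ hv⟩)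
  have hE₁ : ∀ p ∈ es₁, E p.1 p.2 := fun p hp => (hp₁.edge_iff _ _).2 (.inl (by simp [hp]))
  have hn₁ := hp₁.es_nodup
  rw [List.nodup_cons, List.nodup_cons] at hn₁
  have ee : es₁ = (es₁.map (Prod.map g g)).map (Prod.map e e) := by
    rw [List.map_map]
    refine ((List.map_congr_left fun p hp => ?_).trans (List.map_id _)).symm
    refine Prod.ext (hg _ fun h => ?_) (hg _ fun h => ?_)
    · have := hE₁ p hp
      rw [h, hout] at this
      exact hn₁.2.1 (by rwa [← this, ← h])
    · have := hE₁ p hp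
      rw [h, hin] at this
      exact hn₁.1 (.tail _ (by rwa [← this, ← h]))
  rw [ea, ee] at hp₁ ht₁
  generalize ats₁.map (Atom.map g) = ats' at hp₁ ht₁
  generalize es₁.map (Prod.map g g) = es' at hp₁ ht₁
  have hb := hp₁.es_box
  have hp' := hp₁.remove_wire he hr hab ⟨(hb _ (.head _)).1, (hb _ (.tail _ (.head _))).2⟩ hf hE
  have hT₁ := ht₁ ▸ hT
  obtain ⟨d1, d2⟩ := hn.nodup_of_hasTy hT₁
  obtain ⟨n1, n2⟩ := hn.not_mem_of_fvs (v := e c) hT₁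
  rw [ht₁] at n1 n2
  simp only [List.map_cons, List.nodup_cons, List.mem_cons, not_or, List.map_map] at d1 d2
  have hes1 : ∀ p ∈ es', p.1 ≠ a := by
    rintro p hp rfl
    exact d1.1.2 (List.mem_map.2 ⟨p, hp, rfl⟩)
  have hes2 : ∀ p ∈ es', p.2 ≠ b := by
    rintro p hp rfl
    exact d2.2.1 (List.mem_map.2 ⟨p, hp, rfl⟩)
  -- `β` tells on which side of `c` the removed node lies.
  let nm' : V' → Bool → A := fun v γ => if v = c ∧ γ = β then nm w β else nm (e v) γ
  have hnm : ∀ v γ, ¬(v = c ∧ γ = β) → nm' v γ = nm (e v) γ := fun v γ h => if_neg h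
  have hnc : nm' c β = nm w β := if_pos ⟨rfl, rfl⟩
  have hn' : Naming P f' nm' := by
    refine ⟨fun {v γ v' γ'} h => ?_, fun v γ => ?_, fun {v z} hv => ?_⟩
    · by_cases h1 : v = c ∧ γ = β <;> by_cases h2 : v' = c ∧ γ' = β
      · exact ⟨h1.1.trans h2.1.symm, h1.2.trans h2.2.symm⟩
      · rw [hnm _ _ h2, h1.1, h1.2, hnc] at h
        exact (hne _ (hn.inj h).1.symm).elim
      · rw [hnm _ _ h1, h2.1, h2.2, hnc] at h
        exact (hne _ (hn.inj h).1).elim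
      · rw [hnm _ _ h1, hnm _ _ h2] at h
        exact ⟨he (hn.inj h).1, (hn.inj h).2⟩
    · by_cases h1 : v = c ∧ γ = β
      · rw [h1.1, h1.2, hnc, hn.pol]
      · rw [hnm _ _ h1, hn.pol]
    · rw [hnm, hn.var (by rw [← hf, hv])]
      rintro ⟨rfl, -⟩
      simp [hcf] at hv
  refine ⟨nm', ats', (a, b) :: es', hn', hp', ?_, ?_, ?_⟩
  · rw [← ht₁, cl_soup_insert hn hn' he hne hp₁ hp' hc hcf hnm hnc hes1 hes2]
  · rw [← hI, List.map_map]
    refine List.map_congr_left fun v hv => hnm _ _ ?_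
    rintro ⟨rfl, rfl⟩
    obtain ⟨-, rfl⟩ := hc.resolve_right (by simp)
    refine n2 (hys _ ?_) w (by simp)
    rw [← hI]
    exact List.mem_map_of_mem (f := (nm · true)) (List.mem_map_of_mem hv)
  · rw [← hO, List.map_map]
    refine List.map_congr_left fun v hv => hnm _ _ ?_
    rintro ⟨rfl, rfl⟩
    obtain ⟨-, rfl⟩ := hc.resolve_left (by simp)
    refine n1 (hxs _ ?_) w (by simp)
    rw [← hO]
    exact List.mem_map_of_mem (f := (nm · false)) (List.mem_map_of_mem hv)

/-- The new node `w` takes over a name of its unlabelled neighbour `c`, and the two ends that face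
each other get fresh names. The interface keeps its names because they are free in `T`. -/
theorem Reads.insert_wire [Finite V'] (hP : ∀ b, {z | P z = b}.Infinite)
    (hT : T.HasTy 0 0) (hys : ∀ y ∈ ys, y ∈ T.fvs) (hxs : ∀ x ∈ xs, x ∈ T.fvs)
    (he : Function.Injective e) (hr : Set.range e = {w}ᶜ) (hw : f w = none)
    (hin : ∀ z, E z w ↔ z = e a) (hout : ∀ z, E w z ↔ z = e b) (hab : ¬ E (e a) (e b))
    (hf : ∀ z, f' z = f (e z)) (hE : ∀ s t, E' s t ↔ E (e s) (e t) ∨ (s = a ∧ t = b))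
    (hc : (β = true ∧ c = b) ∨ (β = false ∧ c = a)) (hcf : f' c = none)
    (h : Reads P T ys xs f' E' I O) : Reads P T ys xs f E (I.map e) (O.map e) := by
  classical
  obtain ⟨nm', ats, es, hn', hp, ht, hI, hO⟩ := h
  have hne : ∀ z, e z ≠ w := fun z h => by
    have : e z ∈ ({w}ᶜ : Set V) := hr ▸ ⟨z, rfl⟩
    exact this h
  have hcov : ∀ v, v ≠ w → ∃ z, e z = v := fun v hv => show v ∈ Set.range e by rw [hr]; exact hv
  have hab' : f' a = none ∨ f' b = none := by
    rcases hc with ⟨-, rfl⟩ | ⟨-, rfl⟩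
    · exact .inr hcf
    · exact .inl hcf
  have pe := List.perm_cons_erase (hp.mem_es_of_unlabelled ((hE a b).2 (.inr ⟨rfl, rfl⟩)) hab')
  generalize es.erase (a, b) = es' at pe
  have hp' := hp.perm (List.Perm.refl _) pe
  have ht' := (cl_soup_perm hn' (fun t ht => ⟨hp.good t ht, hp.verts_nodup ht⟩)
    (List.Perm.refl _) pe).symm.trans ht
  clear pe hp ht
  have hp₁ := hp'.insert_wire he hr hw hin hout hab hf hE
  have hT₁ := ht' ▸ hT
  obtain ⟨d1, d2⟩ := hn'.nodup_of_hasTy hT₁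
  obtain ⟨n1, n2⟩ := hn'.not_mem_of_fvs (v := c) hT₁
  rw [ht'] at n1 n2
  simp only [List.map_cons, List.nodup_cons] at d1 d2
  have hes1 : ∀ p ∈ es', p.1 ≠ a := by
    rintro p hp rfl
    exact d1.1 (List.mem_map.2 ⟨p, hp, rfl⟩)
  have hes2 : ∀ p ∈ es', p.2 ≠ b := by
    rintro p hp rfl
    exact d2.1 (List.mem_map.2 ⟨p, hp, rfl⟩)
  have hfin : (Set.range fun q : V' × Bool => nm' q.1 q.2).Finite := Set.finite_range _
  obtain ⟨x, hx, hx'⟩ := (hP (!β)).exists_notMem_finite hfin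
  obtain ⟨y, hy, hy'⟩ := (hP β).exists_notMem_finite hfin
  have hx1 : ∀ v γ, nm' v γ ≠ x := fun v γ h => hx' ⟨(v, γ), h⟩
  have hy1 : ∀ v γ, nm' v γ ≠ y := fun v γ h => hy' ⟨(v, γ), h⟩
  have hxy : x ≠ y := by
    rintro rfl
    have : P x = !β := hx
    have : P x = β := hy
    simp_all
  let g : V → V' := fun v => if h : ∃ z, e z = v then h.choose else a
  have hg : ∀ z, g (e z) = z := fun z => by
    have h : ∃ z', e z' = e z := ⟨z, rfl⟩
    simp only [g, dif_pos h]
    exact he h.choose_spec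
  let nm : V → Bool → A := fun v γ => if v = w then (if γ = β then nm' c β else x) else
    if v = e c ∧ γ = β then y else nm' (g v) γ
  have e1 : nm w β = nm' c β := by simp [nm]
  have e2 : ∀ γ, γ ≠ β → nm w γ = x := fun γ h => by simp [nm, h]
  have e3 : nm (e c) β = y := by simp [nm, hne]
  have e4 : ∀ v γ, ¬(v = c ∧ γ = β) → nm (e v) γ = nm' v γ := fun v γ h => by
    simp [nm, hne, hg, he.eq_iff, h]
  have cases : ∀ v γ, (v = w ∧ γ = β ∧ nm v γ = nm' c β) ∨ (v = w ∧ γ ≠ β ∧ nm v γ = x) ∨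
      (v = e c ∧ γ = β ∧ nm v γ = y) ∨ ∃ z, v = e z ∧ ¬(z = c ∧ γ = β) ∧ nm v γ = nm' z γ := by
    intro v γ
    by_cases hv : v = w
    · subst hv
      by_cases hγ : γ = β
      · subst hγ; exact .inl ⟨rfl, rfl, e1⟩
      · exact .inr (.inl ⟨rfl, hγ, e2 _ hγ⟩)
    · obtain ⟨z, rfl⟩ := hcov v hv
      by_cases hz : z = c ∧ γ = β
      · obtain ⟨rfl, rfl⟩ := hz; exact .inr (.inr (.inl ⟨rfl, rfl, e3⟩))
      · exact .inr (.inr (.inr ⟨z, rfl, hz, e4 _ _ hz⟩))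
  have hn : Naming P f nm := by
    refine ⟨fun {v γ v' γ'} h => ?_, fun v γ => ?_, fun {v z} hv => ?_⟩
    · rcases cases v γ with ⟨h1, h2, h3⟩ | ⟨h1, h2, h3⟩ | ⟨h1, h2, h3⟩ | ⟨u, h1, h2, h3⟩ <;>
      rcases cases v' γ' with ⟨h4, h5, h6⟩ | ⟨h4, h5, h6⟩ | ⟨h4, h5, h6⟩ | ⟨u', h4, h5, h6⟩ <;>
      rw [h3, h6] at h
      · exact ⟨h1.trans h4.symm, h2.trans h5.symm⟩
      · exact (hx1 _ _ h).elim
      · exact (hy1 _ _ h).elim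
      · exact (h5 ⟨(hn'.inj h).1.symm, (hn'.inj h).2.symm⟩).elim
      · exact (hx1 _ _ h.symm).elim
      · exact ⟨h1.trans h4.symm, by revert h2 h5; cases γ <;> cases γ' <;> cases β <;> simp⟩
      · exact (hxy h).elim
      · exact (hx1 _ _ h.symm).elim
      · exact (hy1 _ _ h.symm).elim
      · exact (hxy h.symm).elim
      · exact ⟨h1.trans h4.symm, h2.trans h5.symm⟩
      · exact (hy1 _ _ h.symm).elim
      · exact (h2 (hn'.inj h)).elim
      · exact (hx1 _ _ h).elim
      · exact (hy1 _ _ h).elim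
      · obtain ⟨rfl, rfl⟩ := hn'.inj h
        exact ⟨h1.trans h4.symm, rfl⟩
    · rcases cases v γ with ⟨h1, h2, h3⟩ | ⟨h1, h2, h3⟩ | ⟨h1, h2, h3⟩ | ⟨u, h1, h2, h3⟩ <;> rw [h3]
      · rw [hn'.pol, h2]
      · have : P x = !β := hx
        rw [this]
        revert h2
        cases γ <;> cases β <;> simp
      · rw [h2]; exact hy
      · exact hn'.pol _ _
    · have hvw : v ≠ w := by rintro rfl; simp [hw] at hv
      obtain ⟨u, rfl⟩ := hcov v hvw
      rw [← hf] at hv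
      rw [e4, hn'.var hv]
      rintro ⟨rfl, -⟩
      simp [hcf] at hv
  refine ⟨nm, _, _, hn, hp₁, ?_, ?_, ?_⟩
  · rw [← ht', cl_soup_insert hn hn' he hne hp₁ hp' hc hcf (fun v γ h => (e4 v γ h).symm) e1.symm
      hes1 hes2]
  · rw [← hI, List.map_map]
    refine List.map_congr_left fun v hv => e4 _ _ ?_
    rintro ⟨rfl, rfl⟩
    obtain ⟨-, rfl⟩ := hc.resolve_right (by simp)
    refine n2 (hys _ ?_) a (by simp)
    rw [← hI]
    exact List.mem_map_of_mem (f := (nm' · true)) hv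
  · rw [← hO, List.map_map]
    refine List.map_congr_left fun v hv => e4 _ _ ?_
    rintro ⟨rfl, rfl⟩
    obtain ⟨-, rfl⟩ := hc.resolve_left (by simp)
    refine n1 (hxs _ ?_) b (by simp)
    rw [← hO]
    exact List.mem_map_of_mem (f := (nm' · false)) hv

end Removal

/-- What a graph reads as is an invariant of the biflow diagram. -/
theorem Graph.Step.reads {D D' : Graph S A} (h : D.Step D') (hP : ∀ b, {z | P z = b}.Infinite)
    {T : Cl S P} {ys xs : List A} (hT : T.HasTy 0 0) (hys : ∀ y ∈ ys, y ∈ T.fvs)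
    (hxs : ∀ x ∈ xs, x ∈ T.fvs) :
    Reads P T ys xs D.f D.E D.I D.O ↔ Reads P T ys xs D'.f D'.E D'.I D'.O := by
  rcases h with ⟨e, hI, hO, hE, hf⟩ | ⟨w, a, b, e, hw, haw, hbw, hin, hout, hab, hl, he, hr, hI, hO,
    hf, hE⟩
  · rw [hI, hO]
    refine ⟨fun h => h.map_equiv e hf hE, fun h => ?_⟩
    have := h.map_equiv e.symm (f' := D.f) (E' := D.E)
      (fun v => by rw [← hf, e.apply_symm_apply]) fun a b => by
        rw [hE, e.apply_symm_apply, e.apply_symm_apply]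
    simpa [List.map_map, Function.comp_def] using this
  · have hcov : ∀ v, v ≠ w → ∃ z, e z = v := fun v hv => show v ∈ Set.range e by rw [hr]; exact hv
    obtain ⟨a, rfl⟩ := hcov a haw
    obtain ⟨b, rfl⟩ := hcov b hbw
    have := D'.finite
    simp only [he.eq_iff] at hE
    rw [← hf, ← hf] at hl
    rw [hI, hO]
    rcases hl with hl | hl
    · exact ⟨.remove_wire hT hys hxs he hr hw hin hout hab hf hE (.inr ⟨rfl, rfl⟩) hl,
        .insert_wire hP hT hys hxs he hr hw hin hout hab hf hE (.inr ⟨rfl, rfl⟩) hl⟩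
    · exact ⟨.remove_wire hT hys hxs he hr hw hin hout hab hf hE (.inl ⟨rfl, rfl⟩) hl,
        .insert_wire hP hT hys hxs he hr hw hin hout hab hf hE (.inl ⟨rfl, rfl⟩) hl⟩

/-- All graphs of a biflow diagram read as the same classes. -/
theorem reads_of_eqvGen {D D' : Graph S A} (h : Relation.EqvGen Graph.Step D D')
    (hP : ∀ b, {z | P z = b}.Infinite)
    {T : Cl S P} {ys xs : List A} (hT : T.HasTy 0 0) (hys : ∀ y ∈ ys, y ∈ T.fvs)
    (hxs : ∀ x ∈ xs, x ∈ T.fvs) :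
    Reads P T ys xs D.f D.E D.I D.O ↔ Reads P T ys xs D'.f D'.E D'.I D'.O := by
  induction h with
  | rel _ _ h => exact h.reads hP hT hys hxs
  | refl => rfl
  | symm _ _ _ ih => exact ih.symm
  | trans _ _ _ _ _ ih ih' => exact ih.trans ih'

/-! ### Renaming of linked names -/

section Alpha

variable {V : Type} {f : V → Option (Label S A)}

open Classical in
/-- The naming that agrees with `nm'` at the ends of the edges in `L`, and with `nm` elsewhere. -/
noncomputable def overrideList (nm nm' : V → Bool → A) (L : List (V × V)) : V → Bool → A :=
  fun u b => if (b = false ∧ u ∈ L.map Prod.fst) ∨ (b = true ∧ u ∈ L.map Prod.snd) then nm' u b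
    else nm u b

theorem overrideList_cons (nm nm' : V → Bool → A) (p : V × V) (L : List (V × V)) :
    overrideList nm nm' (p :: L) =
      override (overrideList nm nm' L) p.1 p.2 (nm' p.1 false) (nm' p.2 true) := by
  funext u b
  rcases override_cases (overrideList nm nm' L) p.1 p.2 (nm' p.1 false) (nm' p.2 true) u b with
    ⟨rfl, rfl, e⟩ | ⟨rfl, rfl, e⟩ | ⟨h1, h2, e⟩ <;> rw [e]
  · exact if_pos (.inl ⟨rfl, .head _⟩)
  · exact if_pos (.inr ⟨rfl, .head _⟩)
  · have : ((b = false ∧ u ∈ (p :: L).map Prod.fst) ∨ (b = true ∧ u ∈ (p :: L).map Prod.snd)) ↔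
        ((b = false ∧ u ∈ L.map Prod.fst) ∨ (b = true ∧ u ∈ L.map Prod.snd)) := by
      rw [List.map_cons, List.map_cons, List.mem_cons, List.mem_cons]
      tauto
    classical
    exact if_congr this rfl rfl

theorem override_override {nm : V → Bool → A} {v w : V} {x y : A} :
    override (override nm v w x y) v w (nm v false) (nm w true) = nm := by
  funext u b
  rcases override_cases (override nm v w x y) v w (nm v false) (nm w true) u b with
    ⟨rfl, rfl, e⟩ | ⟨rfl, rfl, e⟩ | ⟨h1, h2, e⟩
  · rw [e]
  · rw [e]
  · rw [e, override_of_ne h1 h2]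

variable {nm nm' : V → Bool → A} {ats : List (Atom S V)} {es : List (V × V)}

theorem Naming.overrideList (h : Naming P f nm) (h' : Naming P f nm') {L : List (V × V)}
    (hfr : ∀ p ∈ L, ∀ v b, nm v b ≠ nm' p.1 false ∧ nm v b ≠ nm' p.2 true) :
    Naming P f (overrideList nm nm' L) := by
  have cases : ∀ u b, Biflow.overrideList nm nm' L u b = nm u b ∨
      (Biflow.overrideList nm nm' L u b = nm' u b ∧ ∀ v c, nm v c ≠ nm' u b) := by
    intro u b
    by_cases hc : (b = false ∧ u ∈ L.map Prod.fst) ∨ (b = true ∧ u ∈ L.map Prod.snd)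
    · refine .inr ⟨if_pos hc, fun v c => ?_⟩
      rcases hc with ⟨rfl, hc⟩ | ⟨rfl, hc⟩ <;> obtain ⟨p, hp, rfl⟩ := List.mem_map.1 hc
      · exact (hfr p hp v c).1
      · exact (hfr p hp v c).2
    · exact .inl (if_neg hc)
  refine ⟨fun {v b w c} e => ?_, fun v b => ?_, fun {v z} hv => ?_⟩
  · rcases cases v b with h1 | ⟨h1, h2⟩ <;> rcases cases w c with h3 | ⟨h3, h4⟩ <;> rw [h1, h3] at e
    · exact h.inj e
    · exact (h4 _ _ e).elim
    · exact (h2 _ _ e.symm).elim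
    · exact h'.inj e
  · rcases cases v b with h1 | ⟨h1, -⟩ <;> rw [h1]
    · exact h.pol v b
    · exact h'.pol v b
  · rcases cases v (P z) with h1 | ⟨h1, -⟩ <;> rw [h1]
    · exact h.var hv
    · exact h'.var hv

/-- The names of one edge can be changed. -/
theorem cl_soup_override (h : Naming P f nm) {v w : V} {x y : A} (hx : ∀ u b, nm u b ≠ x)
    (hy : ∀ u b, nm u b ≠ y) (hxP : P x = false) (hyP : P y = true)
    (ht : (cl P (soup nm ats ((v, w) :: es))).HasTy 0 0) :
    cl P (soup nm ats ((v, w) :: es)) = cl P (soup (override nm v w x y) ats ((v, w) :: es)) := by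
  obtain ⟨d1, d2⟩ := h.nodup_of_hasTy ht
  simp only [List.map_cons, List.nodup_cons, List.mem_map, not_exists, not_and] at d1 d2
  have hxy := ne_of_pol hxP hyP
  have hne : nm v false ≠ nm w true := fun e => by simpa using (h.inj e).2
  have key : ∀ u b, override nm v w x y u b ≠ nm v false ∧ override nm v w x y u b ≠ nm w true := by
    intro u b
    rcases override_cases nm v w x y u b with ⟨-, -, e⟩ | ⟨-, -, e⟩ | ⟨h1, h2, e⟩ <;> rw [e]
    · exact ⟨(hx _ _).symm, (hx _ _).symm⟩
    · exact ⟨(hy _ _).symm, (hy _ _).symm⟩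
    · exact ⟨fun e => h1 (h.inj e), fun e => h2 (h.inj e)⟩
  have e := rename_rename_soup (ats := ats) (es := es) (v := v) (w := w) (fun u b => (key u b).1)
    (fun u b => (key u b).2) hne fun p hp => ⟨d1.1 p hp, d2.1 p hp⟩
  rw [override_override, override_left, override_right] at e
  have e2 : soup (override nm v w x y) ats ((v, w) :: es) =
      .link x y (soup (override nm v w x y) ats es) := by
    rw [← override_left nm v w x y, ← override_right nm v w x y]
    simp only [override_left, override_right]
    change Term.link _ _ _ = _
    simp only [edgeNames, Prod.map, override_left, override_right]
    rfl
  rw [e2, ← e]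
  have hr : ∀ {z}, (∀ u b, nm u b ≠ z) → z ∉ names (soup nm ats ((v, w) :: es)) := fun hz hm => by
    obtain ⟨u, b, rfl⟩ := mem_names_soup hm
    exact hz u b rfl
  exact cl_link_rename (hasTy_cl.1 ht) (hr hx) (hr hy) hxP hyP

theorem fvs_subset_sum {a : Cl S P} {l : List (Cl S P)} (h : l.sum.HasTy 0 0) (ha : a ∈ l) :
    a.fvs ⊆ l.sum.fvs := by
  induction l with
  | nil => simp at ha
  | cons b l ih =>
    rw [List.sum_cons] at h ⊢
    rw [fvs_add h]
    rcases List.mem_cons.1 ha with rfl | ha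
    · exact Finset.subset_union_left
    · obtain ⟨-, m₁, n₁, m₂, n₂, h1, h2, -, h3⟩ := hasTy_add.1 h
      obtain ⟨rfl, rfl⟩ : m₂ = 0 ∧ n₂ = 0 := by omega
      exact (ih h3 ha).trans Finset.subset_union_right

/-- The class of a soup depends only on the names that are free in it, since those at the ends of
the edges are bound. -/
theorem cl_soup_alpha {E : V → V → Prop} (h : Naming P f nm) (h' : Naming P f nm')
    (hp : Pres f E ats es) (ht : (cl P (soup nm ats es)).HasTy 0 0)
    (hfr : ∀ p ∈ es, ∀ v b, nm v b ≠ nm' p.1 false ∧ nm v b ≠ nm' p.2 true)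
    (hag : ∀ v b, nm v b ∈ (cl P (soup nm ats es)).fvs → nm v b = nm' v b) :
    cl P (soup nm ats es) = cl P (soup nm' ats es) := by
  classical
  have hg : ∀ t ∈ ats, t.Good f ∧ t.verts.Nodup := fun t ht => ⟨hp.good t ht, hp.verts_nodup ht⟩
  obtain ⟨d1, d2⟩ := h.nodup_of_hasTy ht
  -- The names are changed at one edge after the other.
  have main : ∀ L, L <:+ es →
      cl P (soup nm ats es) = cl P (soup (Biflow.overrideList nm nm' L) ats es) := by
    intro L hL
    induction L with
    | nil =>
      rw [show Biflow.overrideList nm nm' [] = nm from funext fun u => funext fun b =>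
        if_neg (by simp)]
    | cons p L ih =>
      have hL' : L <:+ es := (List.suffix_cons p L).trans hL
      have ih := ih hL'
      have hN := h.overrideList h' (L := L) fun p hp => hfr p (hL'.subset hp)
      have hpe : p ∈ es := hL.subset (by simp)
      have n1 := (List.nodup_cons.1 ((hL.map Prod.fst).sublist.nodup d1)).1
      have n2 := (List.nodup_cons.1 ((hL.map Prod.snd).sublist.nodup d2)).1
      have hx : ∀ u b, Biflow.overrideList nm nm' L u b ≠ nm' p.1 false := by
        intro u b e
        unfold Biflow.overrideList at e
        split_ifs at e with hc
        · obtain ⟨rfl, rfl⟩ := h'.inj e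
          exact n1 (hc.resolve_right (by simp)).2
        · exact (hfr p hpe u b).1 e
      have hy : ∀ u b, Biflow.overrideList nm nm' L u b ≠ nm' p.2 true := by
        intro u b e
        unfold Biflow.overrideList at e
        split_ifs at e with hc
        · obtain ⟨rfl, rfl⟩ := h'.inj e
          exact n2 (hc.resolve_left (by simp)).2
        · exact (hfr p hpe u b).2 e
      have pe := List.perm_cons_erase hpe
      rw [ih, overrideList_cons, cl_soup_perm hN hg (List.Perm.refl _) pe]
      rw [ih, cl_soup_perm hN hg (List.Perm.refl _) pe] at ht
      have hN' := h.overrideList h' (L := p :: L) fun p hp => hfr p (hL.subset hp)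
      rw [overrideList_cons] at hN'
      rw [cl_soup_perm hN' hg (List.Perm.refl _) pe]
      exact cl_soup_override hN hx hy (h'.pol _ _) (h'.pol _ _) ht
  have hN := h.overrideList h' hfr
  rw [main es (List.suffix_refl _), cl_soup hN, cl_soup h']
  rw [cl_soup h] at ht hag
  obtain ⟨hts, hfv, -⟩ := hasTy_links (h.isPolar _) ht
  have agree : ∀ v b, (b = false ∧ v ∈ es.map Prod.fst) ∨ (b = true ∧ v ∈ es.map Prod.snd) ∨
      nm v b ∉ ((ats.map (Atom.cls P nm)).sum).fvs ∨ Biflow.overrideList nm nm' es v b = nm' v b := by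
    intro v b
    by_cases hc : (b = false ∧ v ∈ es.map Prod.fst) ∨ (b = true ∧ v ∈ es.map Prod.snd)
    · tauto
    · by_cases hm : nm v b ∈ ((ats.map (Atom.cls P nm)).sum).fvs
      · refine .inr (.inr (.inr ?_))
        rw [show Biflow.overrideList nm nm' es v b = nm v b from if_neg hc]
        refine hag v b ?_
        rw [hfv, Finset.mem_sdiff]
        refine ⟨hm, fun hm' => hc ?_⟩
        simp only [List.mem_toFinset, List.mem_append, List.map_map, List.mem_map,
          Function.comp_apply, edgeNames, Prod.map] at hm'
        rcases hm' with ⟨p, hp, e⟩ | ⟨p, hp, e⟩ <;> obtain ⟨rfl, rfl⟩ := h.inj e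
        · exact .inl ⟨rfl, List.mem_map_of_mem hp⟩
        · exact .inr ⟨rfl, List.mem_map_of_mem hp⟩
      · tauto
  have agree' : ∀ v b, nm v b ∈ ((ats.map (Atom.cls P nm)).sum).fvs →
      Biflow.overrideList nm nm' es v b = nm' v b := by
    intro v b hm
    rcases agree v b with h1 | h1 | h1 | h1
    · exact if_pos (.inl h1)
    · exact if_pos (.inr h1)
    · exact (h1 hm).elim
    · exact h1
  congr 1
  · refine List.map_congr_left fun p hp => Prod.ext (if_pos (.inl ⟨rfl, ?_⟩)) (if_pos (.inr ⟨rfl, ?_⟩))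
    · exact List.mem_map_of_mem hp
    · exact List.mem_map_of_mem hp
  · congr 1
    refine List.map_congr_left fun t htm => ?_
    have hsub := fvs_subset_sum hts (List.mem_map_of_mem (f := Atom.cls P nm) htm)
    have hfh := fvs_hub (h.hasTy_cls (hg t htm).1 (hg t htm).2)
    refine cls_congr (fun v hv => agree' v true (hsub ?_)) fun v hv => agree' v false (hsub ?_)
    · rw [Atom.cls, hfh]
      simp only [Finset.mem_union, List.mem_toFinset]
      exact .inl (.inl (List.mem_map_of_mem (f := (nm · true)) hv))
    · rw [Atom.cls, hfh]
      simp only [Finset.mem_union, List.mem_toFinset]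
      exact .inr (List.mem_map_of_mem (f := (nm · false)) hv)

end Alpha

/-! ### Completeness -/

/-- A partial naming extends to all vertices, by names outside of a given finite set. -/
theorem exists_naming_extension {V : Type} [Finite V] (hP : ∀ b, {z | P z = b}.Infinite)
    (k : V → Bool → Option A) (hk : ∀ {v b w c z}, k v b = some z → k w c = some z → v = w ∧ b = c)
    (hpol : ∀ {v b z}, k v b = some z → P z = b) (s : Finset A) :
    ∃ nm : V → Bool → A, (∀ {v b w c}, nm v b = nm w c → v = w ∧ b = c) ∧ (∀ v b, P (nm v b) = b) ∧
      ∀ v b, k v b = some (nm v b) ∨ (k v b = none ∧ nm v b ∉ s) := by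
  have hfin : {z | ∃ v b, k v b = some z}.Finite := by
    have : Finite (V × Bool) := inferInstance
    refine ((Set.finite_range fun p : V × Bool => k p.1 p.2).preimage
      (Option.some_injective A).injOn).subset ?_
    rintro z ⟨v, b, h⟩
    exact ⟨(v, b), h⟩
  have key : ∀ b, ∃ g : V → A, Function.Injective g ∧ ∀ v, P (g v) = b ∧ g v ∉ s ∧
      ∀ w c, k w c ≠ some (g v) := by
    intro b
    have hinf := ((hP b).sdiff s.finite_toSet).sdiff hfin
    have := hinf.to_subtype
    obtain ⟨n, ⟨e⟩⟩ := Finite.exists_equiv_fin V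
    let g := (e.toEmbedding.trans Fin.valEmbedding).trans
      (Infinite.natEmbedding ↥((({z | P z = b} : Set A) \ s) \ {z | ∃ v b, k v b = some z}))
    refine ⟨fun v => g v, fun v w h => g.injective (Subtype.ext h), fun v => ?_⟩
    have := (g v).2
    exact ⟨this.1.1, this.1.2, fun w c h => this.2 ⟨w, c, h⟩⟩
  choose g hg hg' using key
  refine ⟨fun v b => (k v b).getD (g b v), fun {v b w c} h => ?_, fun v b => ?_, fun v b => ?_⟩
  · rcases h1 : k v b with - | z <;> rcases h2 : k w c with - | z' <;>
      simp only [h1, h2, Option.getD_none, Option.getD_some] at h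
    · have hb : b = c := by rw [← (hg' b v).1, h, (hg' c w).1]
      subst hb
      exact ⟨hg b h, rfl⟩
    · exact ((hg' b v).2.2 w c (by rw [h2, h])).elim
    · exact ((hg' c w).2.2 v b (by rw [h1, h])).elim
    · exact hk h1 (by rw [h2, h])
  · rcases h : k v b with - | z
    · simpa [h] using (hg' b v).1
    · simpa [h] using hpol h
  · rcases h : k v b with - | z
    · simpa [h] using (hg' b v).2.1
    · simp [h]

theorem exists_fresh_list {b : Bool} (hP : {z | P z = b}.Infinite) (s : Finset A) (n : ℕ) :
    ∃ l : List A, l.length = n ∧ l.Nodup ∧ ∀ z ∈ l, P z = b ∧ z ∉ s := by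
  obtain ⟨t, ht, hn⟩ := (hP.sdiff s.finite_toSet).exists_subset_card_eq n
  exact ⟨t.toList, by simpa using hn, t.nodup_toList, fun z hz => by simpa using ht (by simpa using hz)⟩

/-- The variables attached to the interfaces can be removed again by links. -/
theorem links_hub {b : Cl S P} {ys xs ys' xs' : List A} (hb : b.HasTy ys.length xs.length)
    (hys : ys.Nodup) (hxs : xs.Nodup) (hy : ∀ y ∈ ys, P y = true) (hx : ∀ x ∈ xs, P x = false)
    (hl : xs'.length = ys.length) (hl' : xs.length = ys'.length)
    (hys' : ys'.Nodup) (hxs' : xs'.Nodup) (hy' : ∀ y ∈ ys', P y = true)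
    (hx' : ∀ x ∈ xs', P x = false) (hfb : ∀ z ∈ b.fvs, z ∉ xs ∧ z ∉ ys)
    (hf' : ∀ z, z ∈ ys' ∨ z ∈ xs' → z ∉ b.fvs ∧ z ∉ xs ∧ z ∉ ys) :
    links (xs'.zip ys) (links (xs.zip ys') (vars xs' * hub ys b xs * vars ys')) = b := by
  have p1 : IsPolar P (xs'.zip ys) := isPolar_zip hx' hy
  have p2 : IsPolar P (xs.zip ys') := isPolar_zip hx hy'
  have hxy : ∀ z ∈ xs, z ∉ ys := fun z h1 h2 => by simpa [hx z h1] using hy z h2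
  have hxy' : ∀ z ∈ xs', z ∉ ys' := fun z h1 h2 => by simpa [hx' z h1] using hy' z h2
  have e : vars xs' * hub ys b xs * vars ys' =
      vars xs' * vars ys * b * (vars xs * vars ys' : Cl S P) := by
    simp only [hub, mul_assoc]
  rw [e, links_mul_right p2, links_vars_mul_vars hl' hxs hys' hx hy', mul_id (n := xs.length),
    links_mul_left p1, links_vars_mul_vars hl hxs' hys hx' hy, hl, id_mul hb]
  · intro p hp
    obtain ⟨h1, h2⟩ := List.of_mem_zip (a := p.1) (b := p.2) hp
    exact ⟨(hf' _ (.inr h1)).1, fun h => (hfb _ h).2 h2⟩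
  · refine HasTy.mul (k := ys.length) (m := xs'.length) ?_ hb ?_
    · refine (hasTy_vars_out hxs' hx').mul (hasTy_vars_in hys hy) ?_
      refine Finset.disjoint_left.2 fun z h1 h2 => ?_
      exact (hf' z (.inr (by simpa using fvs_vars_subset _ h1))).2.2
        (by simpa using fvs_vars_subset _ h2)
    · refine Finset.disjoint_left.2 fun z h1 h2 => ?_
      rcases Finset.mem_union.1 (fvs_mul_subset _ _ h1) with h | h
      · exact (hf' z (.inr (by simpa using fvs_vars_subset _ h))).1 h2
      · exact (hfb z h2).2 (by simpa using fvs_vars_subset _ h)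
  · refine Fresh.of_subset (s := xs'.toFinset ∪ ys.toFinset ∪ b.fvs) ?_ ?_
    · refine (fvs_mul_subset _ _).trans (Finset.union_subset_union_left ?_)
      exact (fvs_mul_subset _ _).trans
        (Finset.union_subset_union (fvs_vars_subset _) (fvs_vars_subset _))
    · intro p hp
      obtain ⟨h1, h2⟩ := List.of_mem_zip (a := p.1) (b := p.2) hp
      simp only [Finset.mem_union, List.mem_toFinset, not_or]
      refine ⟨⟨⟨fun h => (hf' _ (.inr h)).2.1 h1, hxy _ h1⟩, fun h => (hfb _ h).1 h1⟩,
        ⟨fun h => hxy' _ h h2, (hf' _ (.inl h2)).2.2⟩, (hf' _ (.inl h2)).1⟩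

/-- A diagram is determined by the closed diagram that results when variables are attached to it. -/
theorem hub_injective {a b : Cl S P} (hP : ∀ b, {z | P z = b}.Infinite) {ys xs : List A}
    (ha : a.HasTy ys.length xs.length) (hb : b.HasTy ys.length xs.length)
    (hys : ys.Nodup) (hxs : xs.Nodup) (hy : ∀ y ∈ ys, P y = true) (hx : ∀ x ∈ xs, P x = false)
    (hfa : ∀ z ∈ a.fvs, z ∉ xs ∧ z ∉ ys) (hfb : ∀ z ∈ b.fvs, z ∉ xs ∧ z ∉ ys)
    (h : hub ys a xs = hub ys b xs) : a = b := by
  obtain ⟨ys', l1, n1, h1⟩ := exists_fresh_list (hP true)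
    (a.fvs ∪ b.fvs ∪ xs.toFinset ∪ ys.toFinset) xs.length
  obtain ⟨xs', l2, n2, h2⟩ := exists_fresh_list (hP false)
    (a.fvs ∪ b.fvs ∪ xs.toFinset ∪ ys.toFinset) ys.length
  have key : ∀ z, z ∈ ys' ∨ z ∈ xs' → ((z ∉ a.fvs ∧ z ∉ b.fvs) ∧ z ∉ xs) ∧ z ∉ ys := by
    intro z hz
    have : z ∉ a.fvs ∪ b.fvs ∪ xs.toFinset ∪ ys.toFinset :=
      hz.elim (fun hz => (h1 z hz).2) fun hz => (h2 z hz).2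
    simpa only [Finset.mem_union, List.mem_toFinset, not_or] using this
  rw [← links_hub ha hys hxs hy hx l2 l1.symm n1 n2 (fun z hz => (h1 z hz).1)
      (fun z hz => (h2 z hz).1) hfa fun z hz => ⟨(key z hz).1.1.1, (key z hz).1.2, (key z hz).2⟩, h,
    links_hub hb hys hxs hy hx l2 l1.symm n1 n2 (fun z hz => (h1 z hz).1)
      (fun z hz => (h2 z hz).1) hfb fun z hz => ⟨(key z hz).1.1.2, (key z hz).1.2, (key z hz).2⟩]

/-- Terms with the same diagram are provably equal. -/
theorem Ty.cl_eq_of_eqvGen (hP : ∀ b, {z | P z = b}.Infinite) {M N : Term S A} {m n : ℕ}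
    (hM : Ty P M m n) (hN : Ty P N m n) (hfv : fv M = fv N)
    (h : Relation.EqvGen Graph.Step (graphP P M) (graphP P N)) : cl P M = cl P N := by
  have sM := hM.soupFor
  have sN := hN.soupFor
  have tM := hM.tidy
  have tN := hN.tidy
  have lM := hM.labels
  have lN := hN.labels
  have neM := fun nm (h : Naming _ (graphP P M).f nm) z (hz : z ∈ (cl _ M).fvs) v hv b =>
    h.ne_of_mem_fv hM hz (v := v) hv b
  have cM := hasTy_cl.2 hM
  have cN := hasTy_cl.2 hN
  have fM := fvs_cl hM
  have fN := fvs_cl hN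
  generalize graphP P M = D at *
  generalize graphP P N = D' at *
  have := D.finite
  have := D'.finite
  -- The vertices of `D` get fresh names, except for the labels.
  let k : D.V → Bool → Option A := fun v b => match D.f v with
    | some (.var z) => if P z = b then some z else none
    | _ => none
  have hk : ∀ v b z, k v b = some z ↔ D.f v = some (.var z) ∧ P z = b := by
    intro v b z
    simp only [k]
    split
    · rename_i z' hz'
      split_ifs with hb
      · simp only [Option.some.injEq, hz', Label.var.injEq]
        constructor
        · rintro rfl; exact ⟨rfl, hb⟩
        · exact fun h => h.1
      · simp only [reduceCtorEq, hz', Option.some.injEq, Label.var.injEq, false_iff]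
        rintro ⟨rfl, h⟩
        exact hb h
    · rename_i hz'
      simp only [reduceCtorEq, false_iff]
      rintro ⟨h, -⟩
      exact hz' z h
  obtain ⟨nm, n1, n2, n3⟩ := exists_naming_extension hP k (fun {v b w c z} h1 h2 => by
    rw [hk] at h1 h2
    exact ⟨lM.2 _ _ _ h1.1 h2.1, h1.2.symm.trans h2.2⟩) (fun {v b z} h => ((hk _ _ _).1 h).2)
    (names M ∪ names N)
  have hn : Naming P D.f nm := by
    refine ⟨n1, n2, fun {v z} hv => ?_⟩
    have := (hk v (P z) z).2 ⟨hv, rfl⟩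
    have h' := n3 v (P z)
    rw [this] at h'
    simpa [eq_comm] using h'
  have hav : ∀ v b, nm v b ∈ names M ∪ names N → ∃ z, D.f v = some (.var z) ∧ P z = b :=
    fun v b h => (n3 v b).elim (fun h' => ⟨_, (hk _ _ _).1 h'⟩) fun h' => (h'.2 h).elim
  obtain ⟨ats, es, pD, eD⟩ := sM nm hn fun v b hv => hav v b (Finset.mem_union_left _ hv)
  have hyN : ∀ z ∈ D.I.map (nm · true), z ∉ names N := by
    rintro z hz hzN
    obtain ⟨v, hv, rfl⟩ := List.mem_map.1 hz
    obtain ⟨z, hz, -⟩ := hav v true (Finset.mem_union_right _ hzN)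
    rw [D.I_unlabelled v hv] at hz
    simp at hz
  have hxN : ∀ z ∈ D.O.map (nm · false), z ∉ names N := by
    rintro z hz hzN
    obtain ⟨v, hv, rfl⟩ := List.mem_map.1 hz
    obtain ⟨z, hz, -⟩ := hav v false (Finset.mem_union_right _ hzN)
    rw [D.O_unlabelled v hv] at hz
    simp at hz
  have ynd := hn.map_nodup tM.I_nodup true
  have xnd := hn.map_nodup tM.O_nodup false
  have hfa : ∀ z ∈ (cl P M).fvs, z ∉ D.O.map (nm · false) ∧ z ∉ D.I.map (nm · true) := by
    intro z hz
    constructor <;> intro hz' <;> obtain ⟨v, hv, e⟩ := List.mem_map.1 hz'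
    · exact neM nm hn z hz v (.inr hv) false e.symm
    · exact neM nm hn z hz v (.inl hv) true e.symm
  have hlI : (D.I.map (nm · true)).length = m := by rw [List.length_map, tM.I_length]
  have hlO : (D.O.map (nm · false)).length = n := by rw [List.length_map, tM.O_length]
  have py := hn.pol_of_mem (l := D.I) (b := true)
  have px := hn.pol_of_mem (l := D.O) (b := false)
  have hr : ∃ T, T = hub (D.I.map (nm · true)) (cl P M) (D.O.map (nm · false)) ∧
      Reads P T (D.I.map (nm · true)) (D.O.map (nm · false)) D.f D.E D.I D.O :=
    ⟨_, rfl, nm, ats, es, hn, pD, eD, rfl, rfl⟩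
  generalize D.I.map (nm · true) = ys at *
  generalize D.O.map (nm · false) = xs at *
  obtain ⟨T, hTe, hr⟩ := hr
  subst hlI hlO
  have hT : T.HasTy 0 0 := hTe ▸ hasTy_hub cM ynd xnd py px hfa
  have hTf : T.fvs = ys.toFinset ∪ fv M ∪ xs.toFinset := by
    rw [hTe, fvs_hub (hTe ▸ hT), fM]
  rw [reads_of_eqvGen h hP hT (fun y hy => by simp [hTf, hy]) (fun x hx => by simp [hTf, hx])] at hr
  obtain ⟨nm', ats', es', hn', pD', eT, eI, eO⟩ := hr
  -- Names that are not free in `T` are replaced by names that do not occur in `N`.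
  have hfin : (Set.range fun p : D'.V × Bool => nm' p.1 p.2).Finite := Set.finite_range _
  obtain ⟨nm'', m1, m2, m3⟩ := exists_naming_extension hP
    (fun v b => if nm' v b ∈ T.fvs then some (nm' v b) else none)
    (fun {v b w c z} h1 h2 => by
      split_ifs at h1 h2
      exact hn'.inj (Option.some.inj (h1.trans h2.symm)))
    (fun {v b z} h => by
      split_ifs at h
      rw [← Option.some.inj h, hn'.pol]) (names N ∪ hfin.toFinset)
  have m4 : ∀ v b, nm' v b ∈ T.fvs → nm' v b = nm'' v b := by
    intro v b hv
    simpa [hv] using m3 v b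
  have m5 : ∀ v b, nm' v b ∉ T.fvs → nm'' v b ∉ names N ∧ ∀ w c, nm' w c ≠ nm'' v b := by
    intro v b hv
    simpa [hv] using m3 v b
  have hvar : ∀ {v z}, D'.f v = some (.var z) → nm' v (P z) = z ∧ z ∈ T.fvs := fun {v z} hv =>
    ⟨hn'.var hv, by rw [hTf, hfv]; simp [(lN.1 z).2 ⟨v, hv⟩]⟩
  have hn'' : Naming P D'.f nm'' := by
    refine ⟨m1, m2, fun {v z} hv => ?_⟩
    obtain ⟨h1, h2⟩ := hvar hv
    rw [← m4 _ _ (by rwa [h1]), h1]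
  have hav'' : Avoids P D'.f nm'' (names N) := by
    intro v b hv
    by_cases hm : nm' v b ∈ T.fvs
    · rw [← m4 v b hm] at hv
      rw [hTf, hfv] at hm
      simp only [Finset.mem_union, List.mem_toFinset] at hm
      rcases hm with (hm | hm) | hm
      · exact (hyN _ hm hv).elim
      · obtain ⟨w, hw⟩ := (lN.1 _).1 hm
        obtain ⟨rfl, e⟩ := hn'.inj (hvar hw).1
        exact ⟨_, hw, e⟩
      · exact (hxN _ hm hv).elim
    · exact ((m5 v b hm).1 hv).elim
  have eI' : D'.I.map (nm'' · true) = ys := by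
    rw [← eI]
    refine List.map_congr_left fun v hv => (m4 _ _ ?_).symm
    rw [hTf, ← eI]
    simp only [Finset.mem_union, List.mem_toFinset]
    exact .inl (.inl (List.mem_map_of_mem (f := (nm' · true)) hv))
  have eO' : D'.O.map (nm'' · false) = xs := by
    rw [← eO]
    refine List.map_congr_left fun v hv => (m4 _ _ ?_).symm
    rw [hTf, ← eO]
    simp only [Finset.mem_union, List.mem_toFinset]
    exact .inr (List.mem_map_of_mem (f := (nm' · false)) hv)
  obtain ⟨ats'', es'', pD'', eD''⟩ := sN nm'' hn'' hav''
  rw [eI', eO', cl_soup_perm hn'' (fun t ht => ⟨pD''.good t ht, pD''.verts_nodup ht⟩)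
    (pD''.ats_perm pD') (pD''.es_perm pD')] at eD''
  have hT' := eT.symm ▸ hT
  rw [← cl_soup_alpha hn' hn'' pD' hT' (fun p hp v b => ?_) (fun v b hv => m4 v b (eT ▸ hv)), eT, hTe]
    at eD''
  · refine hub_injective hP cM cN ynd xnd py px hfa (fun z hz => ?_) eD''
    rw [fN, ← hfv, ← fM] at hz
    exact hfa z hz
  · have key := fun v => hn'.not_mem_of_fvs (v := v) hT'
    rw [eT] at key
    exact ⟨(m5 _ _ fun hm => (key p.1).1 hm _ hp).2 v b, (m5 _ _ fun hm => (key p.2).2 hm _ hp).2 v b⟩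

/-- There are infinitely many names of both polarities beyond those of the context. -/
theorem exists_polarity [Infinite A] {Γ Δ : Finset A} (h : Disjoint Γ Δ) : ∃ P : A → Bool,
    (∀ z ∈ Γ, P z = true) ∧ (∀ z ∈ Δ, P z = false) ∧ ∀ b, {z | P z = b}.Infinite := by
  classical
  let ι := Infinite.natEmbedding A
  -- Outside of the contexts, every other element of an infinite sequence is an input name.
  let P : A → Bool := fun z => decide (z ∈ Γ ∨ (z ∉ Δ ∧ ∃ n, z = ι (2 * n)))
  refine ⟨P, fun z hz => by simp [P, hz], fun z hz => ?_, fun b => ?_⟩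
  · simp [P, hz, Finset.disjoint_right.1 h hz]
  · let g : ℕ → A := fun n => ι (2 * n + if b then 0 else 1)
    have hg : Function.Injective g := fun m n h => by
      have := ι.injective h
      omega
    refine ((Set.infinite_range_of_injective hg).sdiff (Γ ∪ Δ).finite_toSet).mono ?_
    rintro _ ⟨⟨n, rfl⟩, hn⟩
    simp only [Finset.coe_union, Set.mem_union, SetLike.mem_coe, not_or] at hn
    cases b
    · simp only [Set.mem_ofPred_eq, P, decide_eq_false_iff_not, not_or, not_and, not_exists]
      refine ⟨hn.1, fun _ m h => ?_⟩
      have := ι.injective h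
      simp at this
      omega
    · simp only [Set.mem_ofPred_eq, P, decide_eq_true_eq]
      exact .inr ⟨hn.2, n, rfl⟩

/-- Completeness: the polarity is chosen so as to provide fresh names. -/
theorem provable_of_eqvGen [Infinite A] {Γ Δ : Finset A} {M N : Term S A} {m n : ℕ}
    (d : Derivation Γ Δ M m n) (e : Derivation Γ Δ N m n)
    (h : Relation.EqvGen Graph.Step d.graph e.graph) : Provable Γ Δ m n M N := by
  obtain ⟨P, h1, h2, hP⟩ := exists_polarity d.ctx.1
  obtain ⟨tM, gM⟩ := d.ty h1 h2
  obtain ⟨tN, gN⟩ := e.ty h1 h2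
  rw [← gM, ← gN] at h
  have := cl_eq.1 (tM.cl_eq_of_eqvGen hP tN (d.ctx.2.trans e.ctx.2.symm) h)
  obtain ⟨-, -, -, hp⟩ := this m n (.inl tM)
  rwa [(d.ctx_eq h1 h2).1, (d.ctx_eq h1 h2).2] at hp

/-! ### Graphs with the same diagram -/

namespace Graph

-- The graphs do not depend on the decidability of equality of names.
variable {S : Signature.{u}} {A : Type v}

/-- The two graphs represent the same biflow diagram. -/
def Same (D D' : Graph S A) : Prop := Relation.EqvGen Step D D'

/-- An isomorphism of graphs along which the labels change by `g`. -/
def IsoVia (g : Option (Label S A) → Option (Label S A)) (D D' : Graph S A) : Prop :=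
  ∃ e : D.V ≃ D'.V, D'.I = D.I.map e ∧ D'.O = D.O.map e ∧
    (∀ a b, D.E a b ↔ D'.E (e a) (e b)) ∧ ∀ a, D'.f (e a) = g (D.f a)

variable {D D' D'' X X' : Graph S A} {g g' : Option (Label S A) → Option (Label S A)}

theorem Iso.isoVia (h : D.Iso D') : D.IsoVia _root_.id D' := h

theorem IsoVia.iso (h : D.IsoVia _root_.id D') : D.Iso D' := h

theorem Iso.same (h : D.Iso D') : D.Same D' := .rel _ _ (.inl h)

theorem Same.refl (D : Graph S A) : D.Same D := Relation.EqvGen.refl D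

theorem Same.symm (h : D.Same D') : D'.Same D := Relation.EqvGen.symm _ _ h

theorem Same.trans (h : D.Same D') (h' : D'.Same D'') : D.Same D'' := Relation.EqvGen.trans _ _ _ h h'

theorem Same.of_step {F : Graph S A → Graph S A} (h : D.Same D')
    (hF : ∀ D D' : Graph S A, D.Step D' → (F D).Same (F D')) : (F D).Same (F D') := by
  induction h with
  | rel _ _ h => exact hF _ _ h
  | refl => exact .refl _
  | symm _ _ _ ih => exact ih.symm
  | trans _ _ _ _ _ ih ih' => exact ih.trans ih'

theorem IsoVia.trans (h : D.IsoVia g D') (h' : D'.IsoVia g' D'') : D.IsoVia (g' ∘ g) D'' := by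
  obtain ⟨e, hI, hO, hE, hf⟩ := h
  obtain ⟨e', hI', hO', hE', hf'⟩ := h'
  refine ⟨e.trans e', ?_, ?_, fun a b => (hE a b).trans (hE' _ _), fun a => ?_⟩
  · rw [hI', hI, List.map_map]; rfl
  · rw [hO', hO, List.map_map]; rfl
  · exact (hf' _).trans (congrArg g' (hf a))

theorem mem_zip_map {α β α' β' : Type} {φ : α → α'} {ψ : β → β'} {l : List α} {k : List β} {a : α'}
    {b : β'} : (a, b) ∈ (l.map φ).zip (k.map ψ) ↔ ∃ v w, (v, w) ∈ l.zip k ∧ φ v = a ∧ ψ w = b := by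
  simp [List.zip_map]

theorem mem_zip_map_injective {α α' : Type} {φ : α → α'} (hφ : Function.Injective φ)
    {l k : List α} {a b : α} : (φ a, φ b) ∈ (l.map φ).zip (k.map φ) ↔ (a, b) ∈ l.zip k := by
  simp [List.zip_map, hφ.eq_iff]

/-- An isomorphism in terms of the components of the graphs. -/
theorem IsoVia.intro {V V' : Type} {n : Finite V} {n' : Finite V'} {I O : List V} {I' O' : List V'}
    {E : V → V → Prop} {E' : V' → V' → Prop} {f : V → Option (Label S A)}
    {f' : V' → Option (Label S A)} {hI : ∀ w ∈ I, f w = none} {hO : ∀ w ∈ O, f w = none}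
    {hI' : ∀ w ∈ I', f' w = none} {hO' : ∀ w ∈ O', f' w = none} (e : V ≃ V')
    (h1 : I' = I.map e) (h2 : O' = O.map e) (h3 : ∀ a b, E a b ↔ E' (e a) (e b))
    (h4 : ∀ a, f' (e a) = g (f a)) :
    IsoVia g ⟨V, n, I, O, E, f, hI, hO⟩ ⟨V', n', I', O', E', f', hI', hO'⟩ :=
  ⟨e, h1, h2, h3, h4⟩

theorem IsoVia.refl (D : Graph S A) : D.IsoVia _root_.id D :=
  ⟨Equiv.refl _, (List.map_id _).symm, (List.map_id _).symm, fun _ _ => .rfl, fun _ => rfl⟩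

theorem IsoVia.tensor (h : D.IsoVia g D') (h' : X.IsoVia g X') :
    (D.tensor X).IsoVia g (D'.tensor X') := by
  obtain ⟨e, hI, hO, hE, hf⟩ := h
  obtain ⟨e', hI', hO', hE', hf'⟩ := h'
  refine IsoVia.intro (Equiv.sumCongr e e') ?_ ?_ ?_ ?_
  · simp [hI, hI', Function.comp_def]
  · simp [hO, hO', Function.comp_def]
  · rintro (a | a) (b | b) <;> simp [hE, hE']
  · rintro (a | a)
    · exact hf a
    · exact hf' a

theorem IsoVia.comp (h : D.IsoVia g D') (h' : X.IsoVia g X') :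
    (D.comp X).IsoVia g (D'.comp X') := by
  obtain ⟨e, hI, hO, hE, hf⟩ := h
  obtain ⟨e', hI', hO', hE', hf'⟩ := h'
  refine IsoVia.intro (Equiv.sumCongr e e') ?_ ?_ ?_ ?_
  · simp [hI]
  · simp [hO']
  · rintro (a | a) (b | b) <;> simp [hE, hE', mem_zip_map, hI', hO]
  · rintro (a | a)
    · exact hf a
    · exact hf' a

theorem map_rdrop {α β : Type} (φ : α → β) (l : List α) (i : ℕ) :
    (l.map φ).rdrop i = (l.rdrop i).map φ := by
  simp [List.rdrop]

theorem map_rtake {α β : Type} (φ : α → β) (l : List α) (i : ℕ) :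
    (l.map φ).rtake i = (l.rtake i).map φ := by
  simp [List.rtake]

theorem IsoVia.trace (i : ℕ) (h : D.IsoVia g D') : (D.trace i).IsoVia g (D'.trace i) := by
  obtain ⟨e, hI, hO, hE, hf⟩ := h
  refine IsoVia.intro e ?_ ?_ (fun a b => ?_) hf
  · exact (congrArg (List.rdrop · i) hI).trans (map_rdrop _ _ _)
  · exact (congrArg (List.rdrop · i) hO).trans (map_rdrop _ _ _)
  · rw [hE, hI, hO, map_rtake, map_rtake, mem_zip_map_injective e.injective]

theorem IsoVia.link {x y x' y' : A} {g' : Option (Label S A) → Option (Label S A)}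
    (h : D.IsoVia g D') (hx : ∀ v, g (D.f v) = some (.var x') ↔ D.f v = some (.var x))
    (hy : ∀ v, g (D.f v) = some (.var y') ↔ D.f v = some (.var y)) (h0 : g' none = none)
    (hl : ∀ v, D.f v ≠ some (.var x) → D.f v ≠ some (.var y) → g (D.f v) = g' (D.f v)) :
    (D.link x y).IsoVia g' (D'.link x' y') := by
  classical
  obtain ⟨e, hI, hO, hE, hf⟩ := h
  refine (IsoVia.intro e hI hO (fun a b => ?_) (fun a => ?_) :
    IsoVia g' (Graph.link x y D) (Graph.link x' y' D'))
  · rw [hE, hf, hf, hx, hy]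
  · rw [hf]
    simp only [hx, hy]
    by_cases hc : D.f a = some (.var x) ∨ D.f a = some (.var y)
    · rw [if_pos hc, if_pos hc]; exact h0.symm
    · rw [if_neg hc, if_neg hc]
      rw [not_or] at hc
      exact hl _ hc.1 hc.2

/-- The data of a wire removal: the node `w` on the wire `a → w → b` is removed. -/
structure Removal (D D' : Graph S A) (w a b : D.V) (e : D'.V → D.V) : Prop where
  unlabelled : D.f w = none
  left_ne : a ≠ w
  right_ne : b ≠ w
  in_iff : ∀ z, D.E z w ↔ z = a
  out_iff : ∀ z, D.E w z ↔ z = b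
  not_edge : ¬ D.E a b
  wire : D.f a = none ∨ D.f b = none
  inj : Function.Injective e
  range : Set.range e = {w}ᶜ
  I_eq : D.I = D'.I.map e
  O_eq : D.O = D'.O.map e
  f_eq : ∀ z, D'.f z = D.f (e z)
  edge_iff : ∀ s t, D'.E s t ↔ D.E (e s) (e t) ∨ (e s = a ∧ e t = b)

theorem wireRemoval_iff : D.WireRemoval D' ↔ ∃ w a b e, Removal D D' w a b e := by
  constructor
  · rintro ⟨w, a, b, e, h1, h2, h3, h4, h5, h6, h7, h8, h9, h10, h11, h12, h13⟩
    exact ⟨w, a, b, e, ⟨h1, h2, h3, h4, h5, h6, h7, h8, h9, h10, h11, h12, h13⟩⟩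
  · rintro ⟨w, a, b, e, ⟨h1, h2, h3, h4, h5, h6, h7, h8, h9, h10, h11, h12, h13⟩⟩
    exact ⟨w, a, b, e, h1, h2, h3, h4, h5, h6, h7, h8, h9, h10, h11, h12, h13⟩

theorem Removal.same {w a b : D.V} {e : D'.V → D.V} (h : Removal D D' w a b e) : D.Same D' :=
  .rel _ _ (.inr (wireRemoval_iff.2 ⟨w, a, b, e, h⟩))

theorem Removal.ne {w a b : D.V} {e : D'.V → D.V} (h : Removal D D' w a b e) (z : D'.V) : e z ≠ w :=
  fun hz => by
    have : e z ∈ ({w}ᶜ : Set D.V) := h.range ▸ ⟨z, rfl⟩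
    exact this hz

theorem Removal.exists_eq {w a b : D.V} {e : D'.V → D.V} (h : Removal D D' w a b e) {v : D.V}
    (hv : v ≠ w) : ∃ z, e z = v :=
  show v ∈ Set.range e by rw [h.range]; exact hv

/-- A wire removal in a part `D` of a larger graph `C`, whose other edges `F` do not meet the
removed node and do not double the new edge. -/
theorem Removal.context {V V' : Type} {n : Finite V} {n' : Finite V'} {I O : List V}
    {I' O' : List V'} {E : V → V → Prop} {E' : V' → V' → Prop} {f : V → Option (Label S A)}
    {f' : V' → Option (Label S A)} {uI : ∀ w ∈ I, f w = none} {uO : ∀ w ∈ O, f w = none}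
    {uI' : ∀ w ∈ I', f' w = none} {uO' : ∀ w ∈ O', f' w = none} {w a b : D.V} {e : D'.V → D.V}
    (h : Removal D D' w a b e) {ι : D.V → V} {ι' : D'.V → V'} {e' : V' → V}
    (hι : Function.Injective ι) (he : Function.Injective e') (hr : Set.range e' = {ι w}ᶜ)
    (hc : ∀ v, e' (ι' v) = ι (e v)) {F : V → V → Prop}
    (hE : ∀ p q, E p q ↔ (∃ s t, ι s = p ∧ ι t = q ∧ D.E s t) ∨ F p q)
    (hE' : ∀ p q, E' p q ↔ (∃ s t, ι' s = p ∧ ι' t = q ∧ D'.E s t) ∨ F (e' p) (e' q))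
    (h1 : ∀ p, ¬ F p (ι w)) (h2 : ∀ p, ¬ F (ι w) p) (h3 : ¬ F (ι a) (ι b))
    (hf : ∀ v, D.f v = none → f (ι v) = none) (hI : I = I'.map e') (hO : O = O'.map e')
    (hf' : ∀ z, f' z = f (e' z)) :
    Same ⟨V, n, I, O, E, f, uI, uO⟩ ⟨V', n', I', O', E', f', uI', uO'⟩ := by
  refine Relation.EqvGen.rel _ _ (.inr ⟨ι w, ι a, ι b, e', hf _ h.unlabelled, hι.ne h.left_ne,
    hι.ne h.right_ne, fun z => ?_, fun z => ?_, ?_, h.wire.imp (hf _) (hf _), he, hr, hI, hO, hf',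
    fun p q => ?_⟩)
  · refine (hE _ _).trans ?_
    rw [or_iff_left (h1 z)]
    constructor
    · rintro ⟨s, t, rfl, ht, hst⟩
      rw [hι ht, h.in_iff] at hst
      rw [hst]
    · rintro rfl
      exact ⟨a, w, rfl, rfl, (h.in_iff _).2 rfl⟩
  · refine (hE _ _).trans ?_
    rw [or_iff_left (h2 z)]
    constructor
    · rintro ⟨s, t, hs, rfl, hst⟩
      rw [hι hs, h.out_iff] at hst
      rw [hst]
    · rintro rfl
      exact ⟨w, b, rfl, rfl, (h.out_iff _).2 rfl⟩
  · refine fun hab => ?_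
    have hab := ((hE _ _).1 hab).resolve_right h3
    revert hab
    rintro ⟨s, t, hs, ht, hst⟩
    rw [hι hs, hι ht] at hst
    exact h.not_edge hst
  · change E' _ _ ↔ E _ _ ∨ _
    rw [hE, hE']
    constructor
    · rintro (⟨s, t, rfl, rfl, hst⟩ | hF)
      · rcases (h.edge_iff s t).1 hst with hst | ⟨hs, ht⟩
        · exact .inl (.inl ⟨e s, e t, (hc s).symm, (hc t).symm, hst⟩)
        · exact .inr ⟨by rw [hc, hs], by rw [hc, ht]⟩
      · exact .inl (.inr hF)
    · have lift : ∀ {p s}, ι s = e' p → ∃ s', e s' = s ∧ ι' s' = p := by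
        intro p s hs
        have hw : s ≠ w := by
          rintro rfl
          have : e' p ∈ ({ι s}ᶜ : Set V) := hr ▸ ⟨p, rfl⟩
          exact this hs.symm
        obtain ⟨s', rfl⟩ := h.exists_eq hw
        exact ⟨s', rfl, he (by rw [hc, hs])⟩
      rintro ((⟨s, t, hs, ht, hst⟩ | hF) | ⟨hs, ht⟩)
      · obtain ⟨s', rfl, rfl⟩ := lift hs
        obtain ⟨t', rfl, rfl⟩ := lift ht
        exact .inl ⟨s', t', rfl, rfl, (h.edge_iff _ _).2 (.inl hst)⟩
      · exact .inr hF
      · obtain ⟨s', rfl, rfl⟩ := lift hs.symm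
        obtain ⟨t', rfl, rfl⟩ := lift ht.symm
        exact .inl ⟨s', t', rfl, rfl, (h.edge_iff _ _).2 (.inr ⟨rfl, rfl⟩)⟩

theorem range_sumMap_left {α β γ : Type} {e : α → β} {w : β} (h : Set.range e = {w}ᶜ) :
    Set.range (Sum.map e (_root_.id : γ → γ)) = {Sum.inl w}ᶜ := by
  ext (v | v)
  · have : v ∈ Set.range e ↔ v ≠ w := by rw [h]; rfl
    simpa using this
  · simp

theorem range_sumMap_right {α β γ : Type} {e : α → β} {w : β} (h : Set.range e = {w}ᶜ) :
    Set.range (Sum.map (_root_.id : γ → γ) e) = {Sum.inr w}ᶜ := by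
  ext (v | v)
  · simp
  · have : v ∈ Set.range e ↔ v ≠ w := by rw [h]; rfl
    simpa using this

theorem Same.tensor_left (h : D.Same D') (X : Graph S A) : (D.tensor X).Same (D'.tensor X) := by
  refine h.of_step (F := fun D => D.tensor X) ?_
  rintro D D' (h | h)
  · exact (h.isoVia.tensor (.refl X)).iso.same
  · obtain ⟨w, a, b, e, h⟩ := wireRemoval_iff.1 h
    refine (h.context (ι := Sum.inl) (ι' := Sum.inl)
      (e' := Sum.map e _root_.id) (F := fun p q => ∃ s t, Sum.inr s = p ∧ Sum.inr t = q ∧ X.E s t)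
      Sum.inl_injective (h.inj.sumMap Function.injective_id) (range_sumMap_left h.range)
      (fun v => rfl) ?_ ?_ ?_ ?_ ?_ ?_ ?_ ?_ ?_)
    · rintro (p | p) (q | q) <;> simp
    · rintro (p | p) (q | q) <;> simp
    · simp
    · simp
    · simp
    · exact fun v hv => hv
    · simp [h.I_eq, Function.comp_def]
    · simp [h.O_eq, Function.comp_def]
    · rintro (z | z)
      · exact h.f_eq z
      · rfl

theorem Same.tensor_right (h : D.Same D') (X : Graph S A) : (X.tensor D).Same (X.tensor D') := by
  refine h.of_step (F := fun D => X.tensor D) ?_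
  rintro D D' (h | h)
  · exact (IsoVia.tensor (.refl X) h.isoVia).iso.same
  · obtain ⟨w, a, b, e, h⟩ := wireRemoval_iff.1 h
    refine (h.context (ι := Sum.inr) (ι' := Sum.inr)
      (e' := Sum.map _root_.id e) (F := fun p q => ∃ s t, Sum.inl s = p ∧ Sum.inl t = q ∧ X.E s t)
      Sum.inr_injective (Function.injective_id.sumMap h.inj) (range_sumMap_right h.range)
      (fun v => rfl) ?_ ?_ ?_ ?_ ?_ ?_ ?_ ?_ ?_)
    · rintro (p | p) (q | q) <;> simp
    · rintro (p | p) (q | q) <;> simp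
    · simp
    · simp
    · simp
    · exact fun v hv => hv
    · simp [h.I_eq, Function.comp_def]
    · simp [h.O_eq, Function.comp_def]
    · rintro (z | z)
      · rfl
      · exact h.f_eq z

theorem Same.tensor (h : D.Same D') (h' : X.Same X') : (D.tensor X).Same (D'.tensor X') :=
  (h.tensor_left X).trans (h'.tensor_right D')

theorem Removal.not_mem_I {w a b : D.V} {e : D'.V → D.V} (h : Removal D D' w a b e) : w ∉ D.I := by
  rw [h.I_eq]
  intro hw
  obtain ⟨z, -, hz⟩ := List.mem_map.1 hw
  exact h.ne z hz

theorem Removal.not_mem_O {w a b : D.V} {e : D'.V → D.V} (h : Removal D D' w a b e) : w ∉ D.O := by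
  rw [h.O_eq]
  intro hw
  obtain ⟨z, -, hz⟩ := List.mem_map.1 hw
  exact h.ne z hz

theorem Same.comp_left (h : D.Same D') (X : Graph S A) : (D.comp X).Same (D'.comp X) := by
  refine h.of_step (F := fun D => D.comp X) ?_
  rintro D D' (h | h)
  · exact (h.isoVia.comp (.refl X)).iso.same
  · obtain ⟨w, a, b, e, h⟩ := wireRemoval_iff.1 h
    refine (h.context (ι := Sum.inl) (ι' := Sum.inl)
      (e' := Sum.map e _root_.id) (F := fun p q => (∃ s t, Sum.inr s = p ∧ Sum.inr t = q ∧ X.E s t) ∨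
        ∃ s t, Sum.inl s = p ∧ Sum.inr t = q ∧ (s, t) ∈ D.O.zip X.I)
      Sum.inl_injective (h.inj.sumMap Function.injective_id) (range_sumMap_left h.range)
      (fun v => rfl) ?_ ?_ ?_ ?_ ?_ ?_ ?_ ?_ ?_)
    · rintro (p | p) (q | q) <;> simp [mem_zip_map]
    · have key : ∀ p q, (e p, q) ∈ D.O.zip X.I ↔ (p, q) ∈ D'.O.zip X.I := by
        intro p q
        rw [h.O_eq, ← List.map_id X.I, mem_zip_map]
        simp [h.inj.eq_iff]
      rintro (p | p) (q | q) <;> simp [mem_zip_map, key]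
    · simp
    · rintro p (⟨s, t, h1, -⟩ | ⟨s, t, h1, -, h2⟩)
      · simp at h1
      · obtain rfl := Sum.inl_injective h1
        exact h.not_mem_O (List.of_mem_zip h2).1
    · simp
    · exact fun v hv => hv
    · simp [h.I_eq, Function.comp_def]
    · simp
    · rintro (z | z)
      · exact h.f_eq z
      · rfl

theorem Same.comp_right (h : D.Same D') (X : Graph S A) : (X.comp D).Same (X.comp D') := by
  refine h.of_step (F := fun D => X.comp D) ?_
  rintro D D' (h | h)
  · exact (IsoVia.comp (.refl X) h.isoVia).iso.same
  · obtain ⟨w, a, b, e, h⟩ := wireRemoval_iff.1 h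
    refine (h.context (ι := Sum.inr) (ι' := Sum.inr)
      (e' := Sum.map _root_.id e) (F := fun p q => (∃ s t, Sum.inl s = p ∧ Sum.inl t = q ∧ X.E s t) ∨
        ∃ s t, Sum.inl s = p ∧ Sum.inr t = q ∧ (s, t) ∈ X.O.zip D.I)
      Sum.inr_injective (Function.injective_id.sumMap h.inj) (range_sumMap_right h.range)
      (fun v => rfl) ?_ ?_ ?_ ?_ ?_ ?_ ?_ ?_ ?_)
    · rintro (p | p) (q | q) <;> simp [mem_zip_map]
    · have key : ∀ p q, (p, e q) ∈ X.O.zip D.I ↔ (p, q) ∈ X.O.zip D'.I := by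
        intro p q
        rw [h.I_eq, ← List.map_id X.O, mem_zip_map]
        simp [h.inj.eq_iff]
      rintro (p | p) (q | q) <;> simp [mem_zip_map, key]
    · rintro p (⟨s, t, -, h1, -⟩ | ⟨s, t, -, h1, h2⟩)
      · simp at h1
      · obtain rfl := Sum.inr_injective h1
        exact h.not_mem_I (List.of_mem_zip h2).2
    · simp
    · simp
    · exact fun v hv => hv
    · simp
    · simp [h.O_eq, Function.comp_def]
    · rintro (z | z)
      · rfl
      · exact h.f_eq z

theorem Same.comp (h : D.Same D') (h' : X.Same X') : (D.comp X).Same (D'.comp X') :=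
  (h.comp_left X).trans (h'.comp_right D')

theorem Same.link (h : D.Same D') (x y : A) : (D.link x y).Same (D'.link x y) := by
  classical
  refine h.of_step (F := fun D => D.link x y) ?_
  rintro D D' (h | h)
  · exact (h.isoVia.link (g' := _root_.id) (fun _ => .rfl) (fun _ => .rfl) rfl fun _ _ _ => rfl).iso.same
  · obtain ⟨w, a, b, e, h⟩ := wireRemoval_iff.1 h
    have hl : ∀ v, D.f v = none → (D.link x y).f v = none := fun v hv => by
      change (if D.f v = some (.var x) ∨ D.f v = some (.var y) then none else D.f v) = none
      simp [hv]
    refine (h.context (ι := _root_.id) (ι' := _root_.id)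
      (e' := e) (F := fun p q => D.f p = some (.var x) ∧ D.f q = some (.var y))
      Function.injective_id h.inj h.range (fun v => rfl) (fun p q => ?_) (fun p q => ?_)
      (fun p hp => ?_) (fun p hp => ?_) (fun hp => ?_) hl h.I_eq h.O_eq fun z => ?_)
    · simp
    · simp [h.f_eq]
    · simp [h.unlabelled] at hp
    · simp [h.unlabelled] at hp
    · rcases h.wire with h | h <;> simp [h] at hp
    · rw [h.f_eq]

/-- No wire starts at an output. -/
def NoOut (D : Graph S A) : Prop := ∀ v ∈ D.O, ∀ w, ¬ D.E v w

theorem Step.noOut (h : D.Step D') : D.NoOut ↔ D'.NoOut := by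
  rcases h with ⟨e, -, hO, hE, -⟩ | h
  · constructor
    · intro h v hv w hvw
      rw [hO] at hv
      obtain ⟨v, hv', rfl⟩ := List.mem_map.1 hv
      obtain ⟨w, rfl⟩ := e.surjective w
      exact h v hv' w ((hE _ _).2 hvw)
    · exact fun h v hv w hvw => h (e v) (hO ▸ List.mem_map_of_mem hv) _ ((hE _ _).1 hvw)
  · obtain ⟨w, a, b, e, h⟩ := wireRemoval_iff.1 h
    have ha := (h.in_iff a).2 rfl
    constructor
    · intro hD v hv t hvt
      have hv' : e v ∈ D.O := h.O_eq ▸ List.mem_map_of_mem hv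
      rcases (h.edge_iff _ _).1 hvt with hE | ⟨h1, -⟩
      · exact hD _ hv' _ hE
      · exact hD _ hv' w (h1 ▸ ha)
    · intro hD v hv t hvt
      rw [h.O_eq] at hv
      obtain ⟨v, hv', rfl⟩ := List.mem_map.1 hv
      by_cases ht : t = w
      · obtain ⟨b', hb⟩ := h.exists_eq h.right_ne
        rw [ht, h.in_iff] at hvt
        exact hD v hv' b' ((h.edge_iff _ _).2 (.inr ⟨hvt, hb⟩))
      · obtain ⟨t, rfl⟩ := h.exists_eq ht
        exact hD v hv' t ((h.edge_iff _ _).2 (.inl hvt))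

theorem Same.noOut (h : D.Same D') : D.NoOut ↔ D'.NoOut := by
  induction h with
  | rel _ _ h => exact h.noOut
  | refl => rfl
  | symm _ _ _ ih => exact ih.symm
  | trans _ _ _ _ _ ih ih' => exact ih.trans ih'

/-- If no wire starts at an output, then an edge of the trace cannot double the edge that replaces
a removed node. -/
theorem Step.trace (h : D.Step D') (i : ℕ) (hD : D.NoOut) : (D.trace i).Same (D'.trace i) := by
  rcases h with h | h
  · exact (h.isoVia.trace i).iso.same
  · obtain ⟨w, a, b, e, h⟩ := wireRemoval_iff.1 h
    have hsub : ∀ l : List D.V, ∀ v, v ∈ l.rtake i → v ∈ l := fun l v hv => List.mem_of_mem_drop hv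
    refine (h.context (ι := _root_.id) (ι' := _root_.id)
      (e' := e) (F := fun p q => (p, q) ∈ (D.O.rtake i).zip (D.I.rtake i))
      Function.injective_id h.inj h.range (fun v => rfl) (fun p q => ?_) (fun p q => ?_)
      (fun p hp => ?_) (fun p hp => ?_) (fun hp => ?_) (fun v hv => hv) ?_ ?_ h.f_eq)
    · simp
    · rw [h.I_eq, h.O_eq, map_rtake, map_rtake, mem_zip_map_injective h.inj]
      simp
    · exact h.not_mem_I (hsub _ _ (List.of_mem_zip hp).2)
    · exact h.not_mem_O (hsub _ _ (List.of_mem_zip hp).1)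
    · exact hD a (hsub _ _ (List.of_mem_zip hp).1) w ((h.in_iff _).2 rfl)
    · exact (congrArg (List.rdrop · i) h.I_eq).trans (map_rdrop _ _ _)
    · exact (congrArg (List.rdrop · i) h.O_eq).trans (map_rdrop _ _ _)

theorem Same.trace (h : D.Same D') (i : ℕ) (hD : D.NoOut) : (D.trace i).Same (D'.trace i) := by
  induction h with
  | rel _ _ h => exact h.trace i hD
  | refl => exact .refl _
  | symm _ _ h ih => exact (ih ((Same.noOut h).2 hD)).symm
  | trans _ _ _ h _ ih ih' => exact (ih hD).trans (ih' ((Same.noOut h).1 hD))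

/-- The graph with all edges reversed. -/
def rev (D : Graph S A) : Graph S A where
  V := D.V
  finite := D.finite
  I := D.O
  O := D.I
  E a b := D.E b a
  f := D.f
  I_unlabelled := D.O_unlabelled
  O_unlabelled := D.I_unlabelled

theorem Same.rev (h : D.Same D') : D.rev.Same D'.rev := by
  refine h.of_step (F := Graph.rev) ?_
  rintro D D' (⟨e, hI, hO, hE, hf⟩ | h)
  · exact Iso.same ⟨e, hO, hI, fun a b => hE b a, hf⟩
  · obtain ⟨w, a, b, e, h⟩ := wireRemoval_iff.1 h
    exact (show Removal D.rev D'.rev w b a e from ⟨h.unlabelled, h.right_ne, h.left_ne, h.out_iff,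
      h.in_iff, h.not_edge, h.wire.symm, h.inj, h.range, h.O_eq, h.I_eq, h.f_eq,
      fun s t => (h.edge_iff t s).trans (or_congr_right and_comm)⟩).same

theorem rev_comp (D X : Graph S A) : (D.comp X).rev.Iso (X.rev.comp D.rev) := by
  refine (IsoVia.intro (V := D.V ⊕ X.V) (V' := X.V ⊕ D.V) (Equiv.sumComm _ _) ?_ ?_ ?_ ?_ : IsoVia _root_.id _ _)
  · simp [Graph.comp, rev]
  · simp [Graph.comp, rev]
  · have key : ∀ (l : List D.V) (k : List X.V) v w, (v, w) ∈ l.zip k ↔ (w, v) ∈ k.zip l := by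
      intro l k v w
      rw [← List.zip_swap l k]
      simp [-List.zip_swap]
    change ∀ a b : D.V ⊕ X.V, Sum.LiftRel D.E X.E b a ∨
      (b, a) ∈ (D.O.map (Sum.inl : D.V → D.V ⊕ X.V)).zip (X.I.map Sum.inr) ↔
      Sum.LiftRel (fun a b => X.E b a) (fun a b => D.E b a) (Sum.swap a) (Sum.swap b) ∨
      (Sum.swap a, Sum.swap b) ∈ (X.I.map (Sum.inl : X.V → X.V ⊕ D.V)).zip (D.O.map Sum.inr)
    rintro (a | a) (b | b) <;> simp [mem_zip_map, key D.O]
  · rintro (a | a) <;> rfl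

/-! ### Isomorphisms of composite graphs -/

theorem rdrop_append {α : Type} {l k : List α} {i : ℕ} (h : k.length = i) : (l ++ k).rdrop i = l := by
  subst h
  simp [List.rdrop]

theorem rtake_append {α : Type} {l k : List α} {i : ℕ} (h : k.length = i) : (l ++ k).rtake i = k := by
  subst h
  simp [List.rtake]

theorem exists_eq_append {α : Type} {l : List α} {m i : ℕ} (h : l.length = m + i) :
    ∃ l₁ l₂, l = l₁ ++ l₂ ∧ l₁.length = m ∧ l₂.length = i :=
  ⟨l.take m, l.drop m, (List.take_append_drop _ _).symm, by simp [h], by simp [h]⟩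

theorem length_map_eq {α β : Type} (φ : α → β) {l : List α} {k : ℕ} (h : l.length = k) :
    (l.map φ).length = k := by
  simp [h]

theorem iso_comp_assoc (D₁ D₂ D₃ : Graph S A) :
    ((D₁.comp D₂).comp D₃).Iso (D₁.comp (D₂.comp D₃)) := by
  dsimp only [Graph.comp]
  refine (IsoVia.intro (Equiv.sumAssoc _ _ _) ?_ ?_ ?_ ?_ : IsoVia _root_.id _ _)
  · simp [Function.comp_def]
  · simp [Function.comp_def]
  · rintro ((a | a) | a) ((b | b) | b) <;> simp [mem_zip_map]
  · rintro ((a | a) | a) <;> rfl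

theorem iso_tensor_assoc (D₁ D₂ D₃ : Graph S A) :
    ((D₁.tensor D₂).tensor D₃).Iso (D₁.tensor (D₂.tensor D₃)) := by
  dsimp only [Graph.tensor]
  refine (IsoVia.intro (Equiv.sumAssoc _ _ _) ?_ ?_ ?_ ?_ : IsoVia _root_.id _ _)
  · simp [Function.comp_def]
  · simp [Function.comp_def]
  · rintro ((a | a) | a) ((b | b) | b) <;> simp
  · rintro ((a | a) | a) <;> rfl

theorem iso_tensor_zero (D : Graph S A) : (D.tensor .zero).Iso D := by
  dsimp only [Graph.tensor, Graph.zero]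
  refine (IsoVia.intro (Equiv.sumEmpty _ Empty) ?_ ?_ ?_ ?_ : IsoVia _root_.id _ ⟨D.V, D.finite, D.I, D.O,
    D.E, D.f, D.I_unlabelled, D.O_unlabelled⟩)
  · simp [Function.comp_def]
  · simp [Function.comp_def]
  · rintro (a | a) (b | b) <;> first | exact a.elim | exact b.elim | simp
  · rintro (a | a)
    · rfl
    · exact a.elim

theorem iso_zero_tensor (D : Graph S A) : (Graph.zero.tensor D).Iso D := by
  dsimp only [Graph.tensor, Graph.zero]
  refine (IsoVia.intro (Equiv.emptySum Empty _) ?_ ?_ ?_ ?_ : IsoVia _root_.id _ ⟨D.V, D.finite, D.I, D.O,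
    D.E, D.f, D.I_unlabelled, D.O_unlabelled⟩)
  · simp [Function.comp_def]
  · simp [Function.comp_def]
  · rintro (a | a) (b | b) <;> first | exact a.elim | exact b.elim | simp
  · rintro (a | a)
    · exact a.elim
    · rfl

theorem iso_functoriality (D D' X X' : Graph S A) (h : D.O.length = D'.I.length) :
    ((D.comp D').tensor (X.comp X')).Iso ((D.tensor X).comp (D'.tensor X')) := by
  dsimp only [Graph.tensor, Graph.comp]
  refine (IsoVia.intro (Equiv.sumSumSumComm _ _ _ _) ?_ ?_ ?_ ?_ : IsoVia _root_.id _ _)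
  · simp [Function.comp_def]
  · simp [Function.comp_def]
  · rintro ((a | a) | (a | a)) ((b | b) | (b | b)) <;> simp [mem_zip_map, List.zip_append, h]
  · rintro ((a | a) | (a | a)) <;> rfl

theorem iso_trace_zero (D : Graph S A) : (D.trace 0).Iso D := by
  have e : ∀ l : List D.V, l.rdrop 0 = l ∧ l.rtake 0 = [] := fun l => by
    simp [List.rdrop, List.rtake]
  dsimp only [Graph.trace]
  simp only [e]
  refine (IsoVia.intro (Equiv.refl _) (List.map_id _).symm (List.map_id _).symm (fun a b => ?_)
    (fun a => rfl) : IsoVia _root_.id _ ⟨D.V, D.finite, D.I, D.O, D.E, D.f, D.I_unlabelled,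
      D.O_unlabelled⟩)
  simp

theorem iso_trace_add (D : Graph S A) {i j m n : ℕ} (hI : D.I.length = m + (i + j))
    (hO : D.O.length = n + (i + j)) : (D.trace (i + j)).Iso ((D.trace j).trace i) := by
  obtain ⟨V, _, I, O, E, f, _, _⟩ := D
  change I.length = _ at hI
  change O.length = _ at hO
  obtain ⟨I₁, I', rfl, -, h⟩ := exists_eq_append hI
  obtain ⟨I₂, I₃, rfl, h2, h3⟩ := exists_eq_append h
  obtain ⟨O₁, O', rfl, -, h⟩ := exists_eq_append hO
  obtain ⟨O₂, O₃, rfl, h2', h3'⟩ := exists_eq_append h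
  dsimp only [Graph.trace]
  simp only [rdrop_append (show (I₂ ++ I₃).length = i + j by simp [h2, h3]),
    rdrop_append (show (O₂ ++ O₃).length = i + j by simp [h2', h3']),
    rtake_append (show (I₂ ++ I₃).length = i + j by simp [h2, h3]),
    rtake_append (show (O₂ ++ O₃).length = i + j by simp [h2', h3'])]
  simp only [← List.append_assoc, rdrop_append h3, rdrop_append h3', rtake_append h3, rtake_append h3',
    rdrop_append h2, rdrop_append h2', rtake_append h2, rtake_append h2']
  refine (IsoVia.intro (Equiv.refl V) (List.map_id _).symm (List.map_id _).symm (fun a b => ?_)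
    ?_ : IsoVia _root_.id _ _)
  swap
  · exact fun _ => rfl
  rw [List.zip_append (h2'.trans h2.symm), List.mem_append, Equiv.refl_apply, Equiv.refl_apply]
  tauto

theorem iso_superposing (D X : Graph S A) {i m n : ℕ} (hI : D.I.length = m + i)
    (hO : D.O.length = n + i) : ((X.tensor D).trace i).Iso (X.tensor (D.trace i)) := by
  obtain ⟨V, _, I, O, E, f, _, _⟩ := D
  change I.length = _ at hI
  change O.length = _ at hO
  obtain ⟨I₁, I₂, rfl, -, h⟩ := exists_eq_append hI
  obtain ⟨O₁, O₂, rfl, -, h'⟩ := exists_eq_append hO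
  dsimp only [Graph.trace, Graph.tensor]
  simp only [List.map_append, ← List.append_assoc, rdrop_append ((List.length_map Sum.inr).trans h),
    rdrop_append ((List.length_map Sum.inr).trans h'), rtake_append ((List.length_map Sum.inr).trans h),
    rtake_append ((List.length_map Sum.inr).trans h'), rdrop_append h, rdrop_append h', rtake_append h,
    rtake_append h']
  refine (IsoVia.intro (Equiv.refl (X.V ⊕ V)) (List.map_id _).symm (List.map_id _).symm ?_
    ?_ : IsoVia _root_.id _ _)
  swap
  · exact fun _ => rfl
  rintro (a | a) (b | b) <;> simp [mem_zip_map]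

/-- Right tightening is an isomorphism if the diagrams `D` and `Z` are separated by a diagram `X`,
for which an identity is taken later on. -/
theorem iso_right_tightening (D X Y Z : Graph S A) {i m n : ℕ} (hI : D.I.length = m + i)
    (hO : D.O.length = n + i) (hX : X.I.length = n) (hY : Y.O.length = i) :
    (((D.comp (X.tensor Y)).trace i).comp Z).Iso ((D.comp ((X.comp Z).tensor Y)).trace i) := by
  obtain ⟨V, _, I, O, E, f, _, _⟩ := D
  change I.length = _ at hI
  change O.length = _ at hO
  obtain ⟨I₁, I₂, rfl, -, h⟩ := exists_eq_append hI
  obtain ⟨O₁, O₂, rfl, h₁, h'⟩ := exists_eq_append hO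
  dsimp only [Graph.trace, Graph.tensor, Graph.comp]
  simp only [List.map_append, List.map_map, rdrop_append (length_map_eq _ h), rtake_append (length_map_eq _ h),
    rdrop_append (length_map_eq _ hY), rtake_append (length_map_eq _ hY)]
  refine (IsoVia.intro ((Equiv.sumAssoc _ _ _).trans (Equiv.sumCongr (Equiv.refl _)
    ((Equiv.sumAssoc _ _ _).trans ((Equiv.sumCongr (Equiv.refl _) (Equiv.sumComm _ _)).trans
      (Equiv.sumAssoc _ _ _).symm)))) ?_ ?_ ?_ ?_ : IsoVia _root_.id _ _)
  · simp [Function.comp_def]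
  · simp [Function.comp_def]
  · have h2 : O₁.length = X.I.length := h₁.trans hX.symm
    rintro ((a | (a | a)) | a) ((b | (b | b)) | b) <;> simp [mem_zip_map, List.zip_append, h2]
  · rintro ((a | (a | a)) | a) <;> rfl

/-- Left tightening is an isomorphism if the diagrams `Z` and `D` are separated by a diagram `X`,
for which an identity is taken later on. -/
theorem iso_left_tightening (D X Y Z : Graph S A) {i m n : ℕ} (hI : D.I.length = m + i)
    (hO : D.O.length = n + i) (hX : X.O.length = m) (hY : Y.I.length = i) :
    (Z.comp (((X.tensor Y).comp D).trace i)).Iso ((((Z.comp X).tensor Y).comp D).trace i) := by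
  obtain ⟨V, _, I, O, E, f, _, _⟩ := D
  change I.length = _ at hI
  change O.length = _ at hO
  obtain ⟨I₁, I₂, rfl, h₁, h⟩ := exists_eq_append hI
  obtain ⟨O₁, O₂, rfl, -, h'⟩ := exists_eq_append hO
  dsimp only [Graph.trace, Graph.tensor, Graph.comp]
  simp only [List.map_append, List.map_map, rdrop_append (length_map_eq _ h'), rtake_append (length_map_eq _ h'),
    rdrop_append (length_map_eq _ hY), rtake_append (length_map_eq _ hY)]
  refine (IsoVia.intro ((Equiv.sumAssoc _ _ _).symm.trans (Equiv.sumCongr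
    (Equiv.sumAssoc _ _ _).symm (Equiv.refl _))) ?_ ?_ ?_ ?_ : IsoVia _root_.id _ _)
  · simp [Function.comp_def]
  · simp [Function.comp_def]
  · have h2 : X.O.length = I₁.length := hX.trans h₁.symm
    rintro (a | ((a | a) | a)) (b | ((b | b) | b)) <;> simp [mem_zip_map, List.zip_append, h2]
  · rintro (a | ((a | a) | a)) <;> rfl

/-- Sliding is an isomorphism if both sides are extended by the diagrams `X` and `Y`, for which
identities are taken later on. -/
theorem iso_sliding (D X Y Z : Graph S A) {m n p q : ℕ} (hI : D.I.length = q + m)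
    (hO : D.O.length = n + p) (hX : X.O.length = q) (hY : Y.I.length = n) (hZ : Z.I.length = p)
    (hZ' : Z.O.length = m) :
    (X.comp ((D.comp (Y.tensor Z)).trace m)).Iso ((((X.tensor Z).comp D).trace p).comp Y) := by
  obtain ⟨V, _, I, O, E, f, _, _⟩ := D
  change I.length = _ at hI
  change O.length = _ at hO
  obtain ⟨I₁, I₂, rfl, h₁, h⟩ := exists_eq_append hI
  obtain ⟨O₁, O₂, rfl, h₁', h'⟩ := exists_eq_append hO
  dsimp only [Graph.trace, Graph.tensor, Graph.comp]
  simp only [List.map_append, List.map_map, rdrop_append (length_map_eq _ h), rtake_append (length_map_eq _ h),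
    rdrop_append (length_map_eq _ h'), rtake_append (length_map_eq _ h'),
    rdrop_append (length_map_eq _ hZ), rtake_append (length_map_eq _ hZ), rdrop_append (length_map_eq _ hZ'), rtake_append (length_map_eq _ hZ')]
  let φ : X.V ⊕ (V ⊕ Y.V ⊕ Z.V) ≃ ((X.V ⊕ Z.V) ⊕ V) ⊕ Y.V :=
    { toFun := Sum.elim (fun a => .inl (.inl (.inl a))) (Sum.elim (fun a => .inl (.inr a))
        (Sum.elim .inr fun a => .inl (.inl (.inr a))))
      invFun := Sum.elim (Sum.elim (Sum.elim .inl fun a => .inr (.inr (.inr a)))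
        fun a => .inr (.inl a)) fun a => .inr (.inr (.inl a))
      left_inv := by rintro (a | a | a | a) <;> rfl
      right_inv := by rintro (((a | a) | a) | a) <;> rfl }
  have φ1 : ∀ a, φ (.inl a) = .inl (.inl (.inl a)) := fun _ => rfl
  have φ2 : ∀ a, φ (.inr (.inl a)) = .inl (.inr a) := fun _ => rfl
  have φ3 : ∀ a, φ (.inr (.inr (.inl a))) = .inr a := fun _ => rfl
  have φ4 : ∀ a, φ (.inr (.inr (.inr a))) = .inl (.inl (.inr a)) := fun _ => rfl
  clear_value φ
  refine (IsoVia.intro φ ?_ ?_ ?_ ?_ : IsoVia _root_.id _ _)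
  · simp [Function.comp_def, φ1]
  · simp [Function.comp_def, φ3]
  · have h2 : X.O.length = I₁.length := hX.trans h₁.symm
    have h3 : O₁.length = Y.I.length := h₁'.trans hY.symm
    rintro (a | a | a | a) (b | b | b | b) <;>
      simp [mem_zip_map, List.zip_append, h2, h3, φ1, φ2, φ3, φ4]
  · rintro (a | a | a | a) <;> simp [φ1, φ2, φ3, φ4]

/-! ### Wirings -/

/-- The graph with the output interface replaced. -/
def withO (D : Graph S A) (O : List D.V) (h : ∀ w ∈ O, D.f w = none) : Graph S A where
  V := D.V
  finite := D.finite
  I := D.I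
  O := O
  E := D.E
  f := D.f
  I_unlabelled := D.I_unlabelled
  O_unlabelled := h

theorem withO_same {D : Graph S A} {O : List D.V} (h : ∀ w ∈ O, D.f w = none) (e : O = D.O) :
    (D.withO O h).Same D := by
  subst e
  exact .refl _

/-- The graph `D` extended by new vertices `i`, each with an edge `φ i → i`. The outputs are moved
along these edges as prescribed by the list `O`. -/
def sprout (D : Graph S A) {ι : Type} [Finite ι] (φ : ι → D.V) (O : List (D.V ⊕ ι))
    (hO : D.O = O.map (Sum.elim _root_.id φ)) : Graph S A where
  V := D.V ⊕ ι
  finite := by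
    have := D.finite
    infer_instance
  I := D.I.map Sum.inl
  O := O
  E a b := Sum.LiftRel D.E (fun _ _ => False) a b ∨ ∃ i, a = .inl (φ i) ∧ b = .inr i
  f := Sum.elim D.f fun _ => none
  I_unlabelled := by
    intro w hw
    obtain ⟨z, hz, rfl⟩ := List.mem_map.1 hw
    exact D.I_unlabelled z hz
  O_unlabelled := by
    rintro (w | w) hw
    · exact D.O_unlabelled w (hO ▸ List.mem_map.2 ⟨_, hw, rfl⟩)
    · rfl

/-- An output from which a new edge may sprout. -/
structure Tip (D : Graph S A) (v : D.V) : Prop where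
  unlabelled : D.f v = none
  no_out : ∀ z, ¬ D.E v z
  exists_in : ∃ a, ∀ z, D.E z v ↔ z = a
  not_mem_I : v ∉ D.I

/-- The new vertices of a sprouted graph can be absorbed again. -/
theorem sprout_same (D : Graph S A) (ι : Type) [Finite ι] : ∀ (φ : ι → D.V) (O : List (D.V ⊕ ι))
    (hO : D.O = O.map (Sum.elim _root_.id φ)), Function.Injective φ → (∀ i, D.Tip (φ i)) →
    (∀ i, Sum.inl (φ i) ∉ O) → (D.sprout φ O hO).Same D := by
  classical
  -- The new vertices are absorbed one at a time.
  have main : ∀ [Finite ι] (φ : ι → D.V) (O : List (D.V ⊕ ι))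
      (hO : D.O = O.map (Sum.elim _root_.id φ)), Function.Injective φ → (∀ i, D.Tip (φ i)) →
      (∀ i, Sum.inl (φ i) ∉ O) → (D.sprout φ O hO).Same D := by
    refine Finite.induction_empty_option (P := fun ι => ∀ [Finite ι] (φ : ι → D.V)
      (O : List (D.V ⊕ ι)) (hO : D.O = O.map (Sum.elim _root_.id φ)), Function.Injective φ →
      (∀ i, D.Tip (φ i)) → (∀ i, Sum.inl (φ i) ∉ O) → (D.sprout φ O hO).Same D) ?_ ?_ ?_ ι
    · intro α β e ih _ φ O hO hφ ht hn
      have : Finite α := Finite.of_equiv β e.symm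
      have hO' : D.O = (O.map (Sum.map _root_.id e.symm)).map (Sum.elim _root_.id (φ ∘ e)) := by
        rw [hO, List.map_map]
        congr 1
        funext z
        rcases z with z | z <;> simp
      refine Same.trans (Iso.same ?_) (ih (φ ∘ e) (O.map (Sum.map _root_.id e.symm)) hO'
        (hφ.comp e.injective) (fun i => ht _) fun i hi => ?_)
      · dsimp only [sprout]
        refine (IsoVia.intro (Equiv.sumCongr (Equiv.refl D.V) e.symm) ?_ ?_ ?_ ?_ :
          IsoVia _root_.id _ _)
        · simp [Function.comp_def]
        · rfl
        · rintro (a | a) (b | b) <;> simp [Equiv.symm_apply_eq]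
          exact ⟨fun h => ⟨e.symm b, by simp [h], by simp⟩, by rintro ⟨i, h, rfl⟩; exact h⟩
        · rintro (a | a) <;> rfl
      · obtain ⟨z, hz, hzi⟩ := List.mem_map.1 hi
        rcases z with z | z
        · obtain rfl := Sum.inl_injective hzi
          exact hn _ hz
        · simp at hzi
    · intro _ φ O hO _ _ _
      dsimp only [sprout]
      refine Iso.same (IsoVia.intro (Equiv.sumEmpty D.V PEmpty) ?_ ?_ ?_ ?_ : IsoVia _root_.id _
        ⟨D.V, D.finite, D.I, D.O, D.E, D.f, D.I_unlabelled, D.O_unlabelled⟩)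
      · simp [Function.comp_def]
      · rw [hO]
        refine List.map_congr_left fun z _ => ?_
        rcases z with z | z
        · rfl
        · exact z.elim
      · rintro (a | a) (b | b) <;> first | exact a.elim | exact b.elim | simp
      · rintro (a | a)
        · rfl
        · exact a.elim
    · intro κ _ ih _ φ O hO hφ ht hn
      let ψ : D.V ⊕ Option κ → D.V ⊕ κ :=
        Sum.elim .inl fun o => o.elim (.inl (φ none)) .inr
      have hO' : D.O = (O.map ψ).map (Sum.elim _root_.id (φ ∘ some)) := by
        rw [hO, List.map_map]
        congr 1
        funext z
        rcases z with z | _ | z <;> rfl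
      refine Same.trans ?_ (ih (φ ∘ some) (O.map ψ) hO' (hφ.comp (Option.some_injective _))
        (fun i => ht _) fun i hi => ?_)
      · obtain ⟨hu, ho, ⟨a, ha⟩, hI⟩ := ht none
        have hne : a ≠ φ none := fun e => ho _ (e ▸ (ha a).2 rfl)
        -- The node removed is `φ none`; the new vertex next to it takes its place.
        let e : D.V ⊕ κ → D.V ⊕ Option κ :=
          Sum.elim (fun v => if v = φ none then .inr none else .inl v) fun k => .inr (some k)
        have e1 : e (.inl (φ none)) = .inr none := if_pos rfl
        have e2 : ∀ v, v ≠ φ none → e (.inl v) = .inl v := fun v hv => if_neg hv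
        have e3 : ∀ k, e (.inr k) = .inr (some k) := fun k => rfl
        clear_value e
        dsimp only [sprout]
        refine .rel _ _ (.inr ⟨Sum.inl (φ none), Sum.inl a, Sum.inr none, e, hu, ?_, ?_, ?_, ?_, ?_,
          .inr rfl, ?_, ?_, ?_, ?_, ?_, ?_⟩)
        · exact fun h => hne (Sum.inl_injective h)
        · exact Sum.inr_ne_inl
        · rintro (z | z) <;> simp [ha]
        · rintro (z | z)
          · simp [ho]
          · simp only [Sum.not_liftRel_inl_inr, false_or, Sum.inl.injEq, Sum.inr.injEq,
              exists_eq_right', hφ.eq_iff]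
            exact eq_comm
        · simp [hne]
        · have key : ∀ v k, e (.inl v) ≠ .inr (some k) := by
            intro v k
            by_cases hv : v = φ none
            · rw [hv, e1]; simp
            · rw [e2 v hv]; simp
          rintro (v | v) (w | w) h
          · by_cases hv : v = φ none <;> by_cases hw : w = φ none
            · rw [hv, hw]
            · rw [hv, e1, e2 w hw] at h; simp at h
            · rw [hw, e1, e2 v hv] at h; simp at h
            · rw [e2 v hv, e2 w hw] at h
              rw [Sum.inl_injective h]
          · exact (key _ _ (h.trans (e3 w))).elim
          · exact (key _ _ (h.symm.trans (e3 v))).elim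
          · rw [e3, e3] at h
            simpa using h
        · ext (v | v | v)
          · simp only [Set.mem_range, Set.mem_compl_iff, Set.mem_singleton_iff, Sum.inl.injEq]
            constructor
            · rintro ⟨z | z, hz⟩ rfl
              · by_cases hv : z = φ none
                · rw [hv, e1] at hz; simp at hz
                · rw [e2 z hv] at hz; exact hv (Sum.inl_injective hz)
              · rw [e3] at hz; simp at hz
            · exact fun hv => ⟨.inl v, e2 v hv⟩
          · exact iff_of_true ⟨_, e1⟩ (by simp)
          · exact iff_of_true ⟨_, e3 v⟩ (by simp)
        · rw [List.map_map]
          exact List.map_congr_left fun v hv => (e2 v fun h => hI (h ▸ hv)).symm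
        · rw [List.map_map]
          refine ((List.map_congr_left fun z hz => ?_).trans (List.map_id O)).symm
          rcases z with z | _ | z
          · exact e2 z fun h => hn none (h ▸ hz)
          · exact e1
          · exact e3 z
        · rintro (z | z)
          · by_cases hz : z = φ none
            · rw [hz, e1]; exact hu
            · rw [e2 z hz]; rfl
          · rw [e3]; rfl
        · rintro (s | s) (t | t)
          · by_cases hs : s = φ none <;> by_cases ht' : t = φ none
            · rw [hs, ht', e1]; simp [ho]
            · rw [hs, e1, e2 t ht']; simp [ho]
            · rw [ht', e1, e2 s hs]; simp [ha, hs, hφ.eq_iff]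
            · rw [e2 s hs, e2 t ht']; simp
          · by_cases hs : s = φ none
            · rw [hs, e1, e3]; simp [hφ.eq_iff]
            · rw [e2 s hs, e3]; simp
          · by_cases ht' : t = φ none
            · rw [ht', e1, e3]; simp
            · rw [e2 t ht', e3]; simp
          · rw [e3, e3]; simp
      · obtain ⟨z, hz, hzi⟩ := List.mem_map.1 hi
        rcases z with z | _ | z
        · exact hn _ ((Sum.inl_injective hzi : z = φ (some i)) ▸ hz)
        · simpa using hφ (Sum.inl_injective hzi : φ none = φ (some i))
        · simp [ψ] at hzi
  exact main

/-- Wires `i` that lead from the inputs, in the order `l`, to the outputs, in the order `l'`. -/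
def wiring (S : Signature.{u}) (A : Type v) {ι : Type} [Finite ι] (l l' : List ι) : Graph S A where
  V := ι × Bool
  finite := inferInstance
  I := l.map (·, false)
  O := l'.map (·, true)
  E a b := a.1 = b.1 ∧ a.2 = false ∧ b.2 = true
  f _ := none
  I_unlabelled _ _ := rfl
  O_unlabelled _ _ := rfl

/-- Composition with a wiring permutes the outputs. -/
theorem comp_wiring {D : Graph S A} {m n : ℕ} (hD : D.Tidy m n) {ι : Type} [Finite ι]
    {l l' : List ι} (hc : ∀ i, i ∈ l) (hl : l.Nodup) {φ : ι → D.V} (hφ : D.O = l.map φ)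
    (h : ∀ w ∈ l'.map φ, D.f w = none) :
    (D.comp (wiring S A l l')).Same (D.withO (l'.map φ) h) := by
  have hinj : Function.Injective φ := fun i j hij =>
    List.inj_on_of_nodup_map (hφ ▸ hD.O_nodup) (hc i) (hc j) hij
  have hmem : ∀ i, φ i ∈ D.O := fun i => hφ ▸ List.mem_map_of_mem (hc i)
  have h1 : (D.withO (l'.map φ) h).O = (l'.map Sum.inr).map (Sum.elim _root_.id φ) := by
    rw [List.map_map]; rfl
  have h2 : ((D.withO (l'.map φ) h).sprout φ (l'.map Sum.inr) h1).O =
      (l'.map Sum.inr).map (Sum.elim _root_.id Sum.inr) := by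
    rw [List.map_map]; rfl
  -- Each wire of the wiring consists of two vertices, so the outputs sprout twice.
  refine Same.trans (Iso.same ?_) ((sprout_same _ ι Sum.inr (l'.map Sum.inr) h2 Sum.inr_injective
    (fun i => ⟨rfl, ?_, ⟨Sum.inl (φ i), ?_⟩, ?_⟩) fun i hi => ?_).trans
    (sprout_same (D.withO (l'.map φ) h) ι φ (l'.map Sum.inr) h1 hinj (fun i => ⟨D.O_unlabelled _ (hmem i),
      hD.no_out _ (hmem i), ?_, fun hI =>
        let ⟨u, hu, _⟩ := hD.exists_out _ hI
        hD.no_out _ (hmem i) u hu⟩) fun i hi => ?_))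
  · dsimp only [Graph.comp, wiring, sprout, withO]
    let e : D.V ⊕ ι × Bool ≃ (D.V ⊕ ι) ⊕ ι :=
      { toFun := Sum.elim (fun v => .inl (.inl v)) fun p => if p.2 then .inr p.1 else .inl (.inr p.1)
        invFun := Sum.elim (Sum.elim .inl fun i => .inr (i, false)) fun i => .inr (i, true)
        left_inv := by rintro (v | ⟨i, _ | _⟩) <;> rfl
        right_inv := by rintro ((v | i) | i) <;> rfl }
    have e1 : ∀ v, e (.inl v) = .inl (.inl v) := fun _ => rfl
    have e2 : ∀ i, e (.inr (i, false)) = .inl (.inr i) := fun _ => rfl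
    have e3 : ∀ i, e (.inr (i, true)) = .inr i := fun _ => rfl
    clear_value e
    refine (IsoVia.intro e ?_ ?_ ?_ ?_ : IsoVia _root_.id _ _)
    · simp [Function.comp_def, e1]
    · simp [Function.comp_def, e3]
    · have key : ∀ p : (D.V ⊕ ι × Bool) × (D.V ⊕ ι × Bool),
          p ∈ (D.O.map Sum.inl).zip ((l.map (·, false)).map Sum.inr) ↔
            ∃ i, p = (.inl (φ i), .inr (i, false)) := by
        intro p
        rw [hφ, List.map_map, List.map_map, List.zip_map']
        simp [hc, eq_comm]
      intro v w
      refine (or_congr Iff.rfl (key _)).trans ?_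
      rcases v with v | ⟨i, _ | _⟩ <;> rcases w with w | ⟨j, _ | _⟩ <;>
        simp [e1, e2, e3]; exact eq_comm
    · rintro (v | ⟨i, _ | _⟩) <;> simp [e1, e2, e3]
  · rintro (z | z) <;> simp [sprout]
  · rintro (z | z)
    · constructor
      · rintro (h | ⟨j, hj, hi⟩)
        · cases h
        · obtain rfl := Sum.inr_injective hi
          exact hj
      · exact fun h => .inr ⟨i, h, rfl⟩
    · simp [sprout]
  · intro hm
    obtain ⟨z, -, hz⟩ := List.mem_map.1 hm
    exact Sum.inl_ne_inr hz
  · simp at hi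
  · obtain ⟨a, ha, ha'⟩ := hD.exists_in _ (hmem i)
    exact ⟨a, fun z => ⟨ha' z, fun h => h ▸ ha⟩⟩
  · simp at hi

theorem exists_map_eq {ι α : Type} {l : List ι} (hc : ∀ i, i ∈ l) (hl : l.Nodup) {k : List α}
    (h : l.length = k.length) : ∃ φ : ι → α, l.map φ = k := by
  classical
  let e := hl.getEquivOfForallMemList l hc
  refine ⟨fun i => k[(e.symm i).1]'(h ▸ (e.symm i).2), ?_⟩
  refine List.ext_getElem (by simpa using h) fun j h1 h2 => ?_
  have hj : j < l.length := by simpa using h1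
  have : e.symm l[j] = ⟨j, hj⟩ := (Equiv.symm_apply_eq e).2 rfl
  simp [this]

theorem Tidy.rev {D : Graph S A} {m n : ℕ} (h : D.Tidy m n) : D.rev.Tidy n m :=
  ⟨h.O_length, h.I_length, h.O_nodup, h.I_nodup, h.no_out, h.no_in, h.exists_in, h.exists_out⟩

theorem Tidy.wiring {ι : Type} [Finite ι] {l l' : List ι} (hl : l.Nodup) (hl' : l'.Nodup) :
    (wiring S A l l').Tidy l.length l'.length := by
  refine ⟨List.length_map _, List.length_map _, hl.map fun a b h => (Prod.mk.inj h).1,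
    hl'.map fun a b h => (Prod.mk.inj h).1, fun v hv u hu => ?_, fun v hv u hu => ?_, fun v hv => ?_,
    fun v hv => ?_⟩ <;> obtain ⟨i, -, rfl⟩ := List.mem_map.1 hv
  · simpa using hu.2.2
  · simpa using hu.2.1
  · exact ⟨(i, true), ⟨rfl, rfl, rfl⟩, fun u hu => Prod.ext hu.1.symm hu.2.2⟩
  · exact ⟨(i, false), ⟨rfl, rfl, rfl⟩, fun u hu => Prod.ext hu.1 hu.2.1⟩

/-- Composition of wirings. -/
theorem wiring_comp {ι κ : Type} [Finite ι] [Finite κ] {l l' : List ι} {k k' : List κ}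
    (hl : l.Nodup) (hl' : l'.Nodup) (hc : ∀ i, i ∈ k) (hk : k.Nodup) {φ : κ → ι}
    (hφ : k.map φ = l') :
    ((wiring S A l l').comp (wiring S A k k')).Same (wiring S A l (k'.map φ)) := by
  have e : (k'.map φ).map (·, true) = k'.map fun i => (φ i, true) := List.map_map
  refine (comp_wiring (.wiring hl hl') hc hk (φ := fun i => (φ i, true)) ?_ fun _ _ => rfl).trans ?_
  · subst hφ
    exact List.map_map
  · unfold withO wiring
    simp only [e]
    exact .refl _

theorem wiring_tensor {ι κ : Type} [Finite ι] [Finite κ] (l l' : List ι) (k k' : List κ) :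
    ((wiring S A l l').tensor (wiring S A k k')).Same
      (wiring S A (l.map Sum.inl ++ k.map Sum.inr) (l'.map Sum.inl ++ k'.map Sum.inr)) := by
  dsimp only [Graph.tensor, wiring]
  refine Iso.same (IsoVia.intro (Equiv.sumProdDistrib ι κ Bool).symm ?_ ?_ ?_ ?_ :
    IsoVia _root_.id _ _)
  · simp [Function.comp_def]
  · simp [Function.comp_def]
  · rintro (⟨a, _ | _⟩ | ⟨a, _ | _⟩) (⟨b, _ | _⟩ | ⟨b, _ | _⟩) <;> simp
  · rintro (⟨a, _ | _⟩ | ⟨a, _ | _⟩) <;> rfl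

/-! ### Identities and symmetries as wirings -/

/-- `D` is the identity diagram at `n`. -/
def Wires (D : Graph S A) (n : ℕ) : Prop :=
  D.Tidy n n ∧ ∃ (ι : Type) (_ : Finite ι) (l : List ι), (∀ i, i ∈ l) ∧ l.Nodup ∧ l.length = n ∧
    D.Same (wiring S A l l)

/-- `D` is the diagram of the symmetry `m + n → n + m`. -/
def Swaps (D : Graph S A) (m n : ℕ) : Prop :=
  ∃ (ι : Type) (_ : Finite ι) (l k : List ι), (∀ i, i ∈ l ++ k) ∧ (l ++ k).Nodup ∧ l.length = m ∧
    k.length = n ∧ D.Same (wiring S A (l ++ k) (k ++ l))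

theorem Wires.swaps_zero {D : Graph S A} {n : ℕ} (h : D.Wires n) : D.Swaps n 0 := by
  obtain ⟨-, ι, _, l, hc, hl, hn, h⟩ := h
  exact ⟨ι, _, l, [], by simpa using hc, by simpa using hl, hn, rfl, by simpa using h⟩

theorem Wires.zero_swaps {D : Graph S A} {n : ℕ} (h : D.Wires n) : D.Swaps 0 n := by
  obtain ⟨-, ι, _, l, hc, hl, hn, h⟩ := h
  exact ⟨ι, _, [], l, hc, hl, rfl, hn, by simpa using h⟩

theorem wires_zero : (Graph.zero : Graph S A).Wires 0 := by
  classical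
  refine ⟨.zero, Empty, inferInstance, [], (·.elim), .nil, rfl, Iso.same ?_⟩
  dsimp only [wiring, Graph.zero]
  exact (IsoVia.intro (Equiv.equivOfIsEmpty Empty (Empty × Bool)) rfl rfl (fun a => nomatch a)
    (fun a => nomatch a) :
    IsoVia _root_.id _ _)

theorem wires_one : (Graph.one : Graph S A).Wires 1 := by
  classical
  refine ⟨.one, Unit, inferInstance, [()], fun _ => List.mem_singleton.2 rfl,
    List.nodup_singleton _, rfl, Iso.same ?_⟩
  dsimp only [wiring, Graph.one]
  refine (IsoVia.intro (Equiv.punitProd Bool).symm rfl rfl ?_ ?_ : IsoVia _root_.id _ _)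
  · simp
  · exact fun _ => rfl

theorem swaps_sym : (Graph.sym : Graph S A).Swaps 1 1 := by
  refine ⟨Bool, inferInstance, [false], [true], by simp, by simp, rfl, rfl, Iso.same ?_⟩
  dsimp only [wiring, Graph.sym]
  let e : Bool × Bool ≃ Bool × Bool := ⟨fun p => (xor p.1 p.2, p.1), fun p => (p.2, xor p.2 p.1),
    by decide, by decide⟩
  refine (IsoVia.intro e rfl rfl ?_ ?_ : IsoVia _root_.id _ _)
  · decide
  · exact fun _ => rfl

theorem Wires.tensor {D X : Graph S A} {m n : ℕ} (h : D.Wires m) (h' : X.Wires n) :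
    (D.tensor X).Wires (m + n) := by
  obtain ⟨t, ι, _, l, hc, hl, hn, h⟩ := h
  obtain ⟨t', κ, _, k, hc', hk, hn', h'⟩ := h'
  classical
  refine ⟨t.tensor t', ι ⊕ κ, inferInstance, l.map Sum.inl ++ k.map Sum.inr, ?_, ?_, ?_,
    (h.tensor h').trans (wiring_tensor _ _ _ _)⟩
  · rintro (i | i) <;> simp [hc, hc']
  · exact (hl.map Sum.inl_injective).append (hk.map Sum.inr_injective) (by simp [List.Disjoint])
  · simp [hn, hn']

theorem Wires.rev {D : Graph S A} {n : ℕ} (h : D.Wires n) : D.rev.Wires n := by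
  obtain ⟨t, ι, _, l, hc, hl, hn, h⟩ := h
  refine ⟨t.rev, ι, ‹_›, l, hc, hl, hn, h.rev.trans (Iso.same ?_)⟩
  dsimp only [wiring, Graph.rev]
  refine (IsoVia.intro ((Equiv.refl ι).prodCongr Equiv.boolNot) ?_ ?_ ?_ ?_ :
    IsoVia _root_.id _ _)
  · simp
  · simp
  · rintro ⟨a, _ | _⟩ ⟨b, _ | _⟩ <;> simp [eq_comm]
  · exact fun _ => rfl

theorem comp_id {D X : Graph S A} {m n : ℕ} (hD : D.Tidy m n) (hX : X.Wires n) :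
    (D.comp X).Same D := by
  obtain ⟨-, ι, _, l, hc, hl, hn, h⟩ := hX
  obtain ⟨φ, hφ⟩ := exists_map_eq hc hl (hn.trans hD.O_length.symm)
  exact (h.comp_right D).trans ((comp_wiring hD hc hl hφ.symm fun w hw =>
    D.O_unlabelled w (hφ ▸ hw)).trans (withO_same _ hφ))

/-- This follows from `comp_id` by reversing all edges. -/
theorem id_comp {D X : Graph S A} {m n : ℕ} (hD : D.Tidy m n) (hX : X.Wires m) :
    (X.comp D).Same D :=
  ((rev_comp X D).same.trans (comp_id hD.rev hX.rev)).rev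

/-- The symmetry of `m` and `n + p` wires in terms of smaller ones. -/
theorem Swaps.add {X Y Y' Z : Graph S A} {m n p : ℕ} (hX : X.Swaps m n) (hY : Y.Wires p)
    (hY' : Y'.Wires n) (hZ : Z.Swaps m p) :
    ((X.tensor Y).comp (Y'.tensor Z)).Swaps m (n + p) := by
  obtain ⟨ι, _, l₁, l₂, hc, hl, h₁, h₂, h⟩ := hX
  obtain ⟨-, κ, _, k, hck, hk, hkn, h'⟩ := hY
  obtain ⟨-, κ', _, k', hck', hk', hkn', h''⟩ := hY'
  obtain ⟨ι', _, j₁, j₂, hcj, hj, hj₁, hj₂, h'''⟩ := hZ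
  have hs : (l₂ ++ l₁).Nodup := List.nodup_append_comm.1 hl
  have aux : ∀ {α β : Type} {a : List α} {b : List β}, a.Nodup → b.Nodup →
      (a.map Sum.inl ++ b.map Sum.inr : List (α ⊕ β)).Nodup := fun h h' =>
    (h.map Sum.inl_injective).append (h'.map Sum.inr_injective) (by simp [List.Disjoint])
  have hcc : ∀ i, i ∈ k'.map Sum.inl ++ (j₁ ++ j₂).map (Sum.inr : ι' → κ' ⊕ ι') := by
    rintro (i | i)
    · simp [hck']
    · exact List.mem_append_right _ (List.mem_map_of_mem (hcj i))
  obtain ⟨φ, hφ⟩ := exists_map_eq hcc (aux hk' hj)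
    (k := (l₂ ++ l₁).map Sum.inl ++ k.map (Sum.inr : κ → ι ⊕ κ)) (by simp; omega)
  refine ⟨ι ⊕ κ, inferInstance, l₁.map Sum.inl, l₂.map Sum.inl ++ k.map Sum.inr, ?_, ?_, by simpa, by simp; omega,
    (((h.tensor h').trans (wiring_tensor _ _ _ _)).comp
      ((h''.tensor h''').trans (wiring_tensor _ _ _ _))).trans ?_⟩
  · rintro (i | i)
    · simpa using hc i
    · simp [hck]
  · simpa using aux hl hk
  refine (wiring_comp (aux hl hk) (aux hs hk) hcc (aux hk' hj) hφ).trans ?_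
  simp only [List.map_append, List.append_assoc] at hφ ⊢
  obtain ⟨e1, hφ⟩ := List.append_inj hφ (by simp; omega)
  obtain ⟨e2, e3⟩ := List.append_inj hφ (by simp; omega)
  rw [e1, e2, e3]
  exact .refl _

/-- The symmetry of `m + p` and `q` wires in terms of smaller ones. -/
theorem Swaps.add' {X Y Y' Z : Graph S A} {m p q : ℕ} (hY : Y.Wires m) (hX : X.Swaps p q)
    (hZ : Z.Swaps m q) (hY' : Y'.Wires p) :
    ((Y.tensor X).comp (Z.tensor Y')).Swaps (m + p) q := by
  obtain ⟨ι, _, l₁, l₂, hc, hl, h₁, h₂, h⟩ := hX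
  obtain ⟨-, κ, _, k, hck, hk, hkn, h'⟩ := hY
  obtain ⟨-, κ', _, k', hck', hk', hkn', h''⟩ := hY'
  obtain ⟨ι', _, j₁, j₂, hcj, hj, hj₁, hj₂, h'''⟩ := hZ
  have hs : (l₂ ++ l₁).Nodup := List.nodup_append_comm.1 hl
  have aux : ∀ {α β : Type} {a : List α} {b : List β}, a.Nodup → b.Nodup →
      (a.map Sum.inl ++ b.map Sum.inr : List (α ⊕ β)).Nodup := fun h h' =>
    (h.map Sum.inl_injective).append (h'.map Sum.inr_injective) (by simp [List.Disjoint])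
  have hcc : ∀ i, i ∈ (j₁ ++ j₂).map Sum.inl ++ k'.map (Sum.inr : κ' → ι' ⊕ κ') := by
    rintro (i | i)
    · exact List.mem_append_left _ (List.mem_map_of_mem (hcj i))
    · simp [hck']
  obtain ⟨φ, hφ⟩ := exists_map_eq hcc (aux hj hk')
    (k := k.map Sum.inl ++ (l₂ ++ l₁).map (Sum.inr : ι → κ ⊕ ι)) (by simp; omega)
  refine ⟨κ ⊕ ι, inferInstance, k.map Sum.inl ++ l₁.map Sum.inr, l₂.map Sum.inr, ?_, ?_,
    by simp; omega, by simpa, (((h'.tensor h).trans (wiring_tensor _ _ _ _)).comp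
      ((h'''.tensor h'').trans (wiring_tensor _ _ _ _))).trans ?_⟩
  · rintro (i | i)
    · simp [hck]
    · simpa using hc i
  · simpa using aux hk hl
  refine (wiring_comp (aux hk hl) (aux hk hs) hcc (aux hj hk') hφ).trans ?_
  simp only [List.map_append, List.append_assoc] at hφ ⊢
  obtain ⟨e1, hφ⟩ := List.append_inj hφ (by simp; omega)
  obtain ⟨e2, e3⟩ := List.append_inj hφ (by simp; omega)
  rw [e1, e2, e3]
  exact .refl _

/-- The diagram of a symmetry is determined by its arities. -/
theorem Swaps.same {X Y : Graph S A} {m n : ℕ} (hX : X.Swaps m n) (hY : Y.Swaps m n) :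
    X.Same Y := by
  obtain ⟨ι, _, l, k, hc, hl, h₁, h₂, h⟩ := hX
  obtain ⟨κ, _, l', k', hc', hl', h₁', h₂', h'⟩ := hY
  obtain ⟨φ, hφ⟩ := exists_map_eq hc hl (k := l' ++ k') (by simp; omega)
  refine h.trans (Same.trans (Iso.same ?_) h'.symm)
  have hb : Function.Bijective φ := by
    refine ⟨fun i j hij => List.inj_on_of_nodup_map (hφ ▸ hl') (hc i) (hc j) hij, fun i => ?_⟩
    obtain ⟨j, -, hj⟩ := List.mem_map.1 (hφ ▸ hc' i)
    exact ⟨j, hj⟩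
  rw [List.map_append] at hφ
  obtain ⟨e1, e2⟩ := List.append_inj hφ (by simp; omega)
  dsimp only [wiring]
  refine (IsoVia.intro ((Equiv.ofBijective φ hb).prodCongr (Equiv.refl Bool)) ?_ ?_ ?_ ?_ :
    IsoVia _root_.id _ _)
  · simp [← e1, ← e2, Function.comp_def]
  · simp [← e1, ← e2, Function.comp_def]
  · rintro ⟨a, _⟩ ⟨b, _⟩
    simp [hb.1.eq_iff]
  · exact fun _ => rfl

theorem Tidy.withO {D : Graph S A} {m n : ℕ} (h : D.Tidy m n) {O : List D.V}
    (hO : O.Perm D.O) (hf : ∀ w ∈ O, D.f w = none) : (D.withO O hf).Tidy m n :=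
  ⟨h.I_length, hO.length_eq.trans h.O_length, h.I_nodup, hO.nodup_iff.2 h.O_nodup, h.no_in,
    fun v hv => h.no_out v (hO.mem_iff.1 hv), h.exists_out,
    fun v hv => h.exists_in v (hO.mem_iff.1 hv)⟩

/-- Exchanging two diagrams after an identity and permuting their outputs amounts to permuting their
inputs. -/
theorem iso_symmetry (D₁ D₂ : Graph S A) {ι : Type} [Finite ι] {l k : List ι}
    (h₁ : l.length = D₁.I.length) (h₂ : k.length = D₂.I.length) {O : List (D₁.tensor D₂).V}
    (hf : ∀ w ∈ O, (D₁.tensor D₂).f w = none) (hO : O = D₂.O.map Sum.inr ++ D₁.O.map Sum.inl) :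
    ((wiring S A (l ++ k) (l ++ k)).comp ((D₁.tensor D₂).withO O hf)).Iso
      ((wiring S A (l ++ k) (k ++ l)).comp (D₂.tensor D₁)) := by
  subst hO
  dsimp only [Graph.comp, wiring, withO, Graph.tensor]
  refine (IsoVia.intro ((Equiv.refl _).sumCongr (Equiv.sumComm _ _)) ?_ ?_ ?_ ?_ :
    IsoVia _root_.id _ _)
  · simp [Function.comp_def]
  · simp [Function.comp_def]
  · rintro (a | a | a) (b | b | b) <;> simp [mem_zip_map, List.zip_append, h₁, h₂, or_comm]
  · rintro (a | a | a) <;> rfl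

/-- Naturality of the symmetry. -/
theorem symmetry {D₁ D₂ X Y : Graph S A} {m₁ n₁ m₂ n₂ : ℕ} (h₁ : D₁.Tidy m₁ n₁)
    (h₂ : D₂.Tidy m₂ n₂) (hX : X.Swaps n₁ n₂) (hY : Y.Swaps m₁ m₂) :
    ((D₁.tensor D₂).comp X).Same (Y.comp (D₂.tensor D₁)) := by
  classical
  obtain ⟨ι, _, l, k, hc, hl, hl₁, hk₁, h⟩ := hX
  obtain ⟨κ, _, l', k', hc', hl', hl₁', hk₁', h'⟩ := hY
  have hT : (D₁.tensor D₂).O = D₁.O.map Sum.inl ++ D₂.O.map Sum.inr := rfl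
  obtain ⟨φ, hφ⟩ := exists_map_eq hc hl (k := (D₁.tensor D₂).O)
    (by simp [(h₁.tensor h₂).O_length, hl₁, hk₁])
  have hφ' := hφ
  rw [List.map_append, hT] at hφ'
  obtain ⟨e1, e2⟩ := List.append_inj hφ' ((List.length_map _).trans
    (hl₁.trans (h₁.O_length.symm.trans (List.length_map _).symm)))
  have hO : ∀ w ∈ (k ++ l).map φ, (D₁.tensor D₂).f w = none := fun w hw =>
    (D₁.tensor D₂).O_unlabelled w (by
      rw [← hφ]
      rw [List.map_append] at hw ⊢
      exact List.mem_append.2 (List.mem_append.1 hw).symm)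
  refine (h.comp_right _).trans ((comp_wiring (h₁.tensor h₂) hc hl hφ.symm hO).trans ?_)
  have hp : ((k ++ l).map φ).Perm (D₁.tensor D₂).O := by
    rw [← hφ]
    exact List.perm_append_comm.map φ
  have ht := (h₁.tensor h₂).withO hp hO
  have hw : (wiring S A (l' ++ k') (l' ++ k')).Wires (m₁ + m₂) :=
    ⟨by simpa [hl₁', hk₁'] using Tidy.wiring (S := S) (A := A) hl' hl', κ, _, _, hc', hl', by simp [hl₁', hk₁'], .refl _⟩
  refine ((id_comp ht hw).symm.trans (Iso.same ?_)).trans (h'.comp_left _).symm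
  exact iso_symmetry D₁ D₂ (hl₁'.trans h₁.I_length.symm) (hk₁'.trans h₂.I_length.symm) hO
    (by rw [List.map_append, e1, e2]; rfl)

/-! ### Trace and link -/

theorem Tidy.noOut {D : Graph S A} {m n : ℕ} (h : D.Tidy m n) : D.NoOut := h.no_out

theorem Same.trace_tidy {D D' : Graph S A} {m n : ℕ} (h : D.Same D') (i : ℕ) (hD : D'.Tidy m n) :
    (D.trace i).Same (D'.trace i) :=
  h.trace i (h.noOut.2 hD.noOut)

theorem exists_wires (S : Signature.{u}) (A : Type v) (n : ℕ) : ∃ D : Graph S A, D.Wires n := by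
  have h := Tidy.wiring (S := S) (A := A) (List.nodup_finRange n) (List.nodup_finRange n)
  rw [List.length_finRange] at h
  exact ⟨_, h, Fin n, inferInstance, _, List.mem_finRange, List.nodup_finRange n,
    List.length_finRange, .refl _⟩

theorem left_tightening {D G Y : Graph S A} {a b m n : ℕ} (hG : G.Tidy a b)
    (hD : D.Tidy (b + m) (n + m)) (hY : Y.Wires m) :
    (((G.tensor Y).comp D).trace m).Same (G.comp (D.trace m)) := by
  classical
  obtain ⟨X, hX⟩ := exists_wires S A b
  refine Same.trans ?_ ((iso_left_tightening D X Y G hD.I_length hD.O_length hX.1.O_length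
    hY.1.I_length).same.symm.trans
      (((id_comp hD (hX.tensor hY)).trace_tidy m hD).comp_right G))
  exact (((comp_id hG hX).symm.tensor_left Y).comp_left D).trace_tidy m
    (((hG.comp hX.1).tensor hY.1).comp hD)

theorem right_tightening {D G Y : Graph S A} {a b m n : ℕ} (hG : G.Tidy a b)
    (hD : D.Tidy (n + m) (a + m)) (hY : Y.Wires m) :
    ((D.comp (G.tensor Y)).trace m).Same ((D.trace m).comp G) := by
  classical
  obtain ⟨X, hX⟩ := exists_wires S A a
  refine Same.trans ?_ ((iso_right_tightening D X Y G hD.I_length hD.O_length hX.1.I_length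
    hY.1.O_length).same.symm.trans
      (((comp_id hD (hX.tensor hY)).trace_tidy m hD).comp_left G))
  exact (((id_comp hG hX).symm.tensor_left Y).comp_right D).trace_tidy m
    (hD.comp ((hX.1.comp hG).tensor hY.1))

theorem sliding {D X Y Z : Graph S A} {m n p q : ℕ} (hD : D.Tidy (q + m) (n + p)) (hX : X.Wires q)
    (hY : Y.Wires n) (hZ : Z.Tidy p m) :
    ((D.comp (Y.tensor Z)).trace m).Same (((X.tensor Z).comp D).trace p) := by
  classical
  have h₁ : ((D.comp (Y.tensor Z)).trace m).Tidy q n := (hD.comp (hY.1.tensor hZ)).trace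
  have h₂ : (((X.tensor Z).comp D).trace p).Tidy q n := ((hX.1.tensor hZ).comp hD).trace
  exact (id_comp h₁ hX).symm.trans ((iso_sliding D X Y Z hD.I_length hD.O_length hX.1.O_length
    hY.1.I_length hZ.I_length hZ.O_length).same.trans (comp_id h₂ hY))

theorem one_comp_one : ((Graph.one : Graph S A).comp .one).Same .one := by
  classical
  exact comp_id .one wires_one

theorem mem_joint (p : (Bool ⊕ Bool) × (Bool ⊕ Bool)) :
    p ∈ [Sum.inl true].zip [Sum.inr false] ↔ p = (.inl true, .inr false) := by simp

theorem yanking : ((Graph.sym : Graph S A).trace 1).Same .one := by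
  refine Same.trans (Iso.same ?_) one_comp_one
  dsimp only [Graph.comp, Graph.one, Graph.trace, Graph.sym]
  refine (IsoVia.intro ((Equiv.boolProdEquivSum Bool).trans ?_) ?_ ?_ ?_ ?_ : IsoVia _root_.id _ _)
  · exact ⟨Sum.elim (fun b => if b then .inr false else .inl false)
      fun b => if b then .inl true else .inr true,
      Sum.elim (fun b => if b then .inr true else .inl false)
        fun b => if b then .inr false else .inl true,
      by rintro ((_ | _) | (_ | _)) <;> rfl, by rintro ((_ | _) | (_ | _)) <;> rfl⟩
  · rfl
  · rfl
  · have h₁ : ∀ p : (Bool × Bool) × Bool × Bool,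
        p ∈ [(true, true)].zip [(false, true)] ↔ p = ((true, true), false, true) := by simp
    intro a b
    refine (or_congr Iff.rfl (h₁ _)).trans (Iff.trans ?_ (or_congr Iff.rfl (mem_joint _)).symm)
    rcases a with ⟨_ | _, _ | _⟩ <;> rcases b with ⟨_ | _, _ | _⟩ <;>
      simp [Equiv.boolProdEquivSum]
  · rintro ⟨_ | _, _ | _⟩ <;> rfl

theorem link_identity {x y : A} (hxy : x ≠ y) :
    (((Graph.outVar x : Graph S A).comp (.inVar y)).link x y).Same .one := by
  refine Same.trans (Iso.same ?_) one_comp_one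
  dsimp only [Graph.comp, Graph.one, Graph.link, Graph.inVar, Graph.outVar]
  refine (IsoVia.intro (Equiv.refl _) ?_ ?_ ?_ ?_ : IsoVia _root_.id _ _)
  · rfl
  · rfl
  · intro a b
    refine (or_congr (or_congr Iff.rfl (?_ : _ ↔ False)) Iff.rfl).trans
      (Iff.trans ?_ (or_congr Iff.rfl (mem_joint _)).symm)
    · simp
    rcases a with (_ | _) | (_ | _) <;> rcases b with (_ | _) | (_ | _) <;> simp [hxy, hxy.symm]
  · rintro ((_ | _) | (_ | _)) <;> simp

theorem iso_link_comp_left {D X : Graph S A} {x y : A} (hx : ∀ v, X.f v ≠ some (.var x))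
    (hy : ∀ v, X.f v ≠ some (.var y)) : ((D.comp X).link x y).Iso ((D.link x y).comp X) := by
  dsimp only [Graph.comp, Graph.link]
  refine (IsoVia.intro (Equiv.refl _) ?_ ?_ ?_ ?_ : IsoVia _root_.id _ _)
  · simp
  · simp
  · rintro (a | a) (b | b) <;> simp [hx, hy]
    tauto
  · rintro (a | a) <;> simp [hx, hy]
    rfl

theorem iso_link_comp_right {D X : Graph S A} {x y : A} (hx : ∀ v, D.f v ≠ some (.var x))
    (hy : ∀ v, D.f v ≠ some (.var y)) : ((D.comp X).link x y).Iso (D.comp (X.link x y)) := by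
  dsimp only [Graph.comp, Graph.link]
  refine (IsoVia.intro (Equiv.refl _) ?_ ?_ ?_ ?_ : IsoVia _root_.id _ _)
  · simp
  · simp
  · rintro (a | a) (b | b) <;> simp [hx, hy]
    tauto
  · rintro (a | a) <;> simp [hx, hy]
    rfl

theorem iso_link_tensor_left {D X : Graph S A} {x y : A} (hx : ∀ v, X.f v ≠ some (.var x))
    (hy : ∀ v, X.f v ≠ some (.var y)) : ((D.tensor X).link x y).Iso ((D.link x y).tensor X) := by
  dsimp only [Graph.tensor, Graph.link]
  refine (IsoVia.intro (Equiv.refl _) ?_ ?_ ?_ ?_ : IsoVia _root_.id _ _)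
  · simp
  · simp
  · rintro (a | a) (b | b) <;> simp [hx, hy]
  · rintro (a | a) <;> simp [hx, hy]
    rfl

theorem iso_link_tensor_right {D X : Graph S A} {x y : A} (hx : ∀ v, D.f v ≠ some (.var x))
    (hy : ∀ v, D.f v ≠ some (.var y)) : ((D.tensor X).link x y).Iso (D.tensor (X.link x y)) := by
  dsimp only [Graph.tensor, Graph.link]
  refine (IsoVia.intro (Equiv.refl _) ?_ ?_ ?_ ?_ : IsoVia _root_.id _ _)
  · simp
  · simp
  · rintro (a | a) (b | b) <;> simp [hx, hy]
  · rintro (a | a) <;> simp [hx, hy]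
    rfl

theorem iso_link_trace (D : Graph S A) (x y : A) (i : ℕ) :
    ((D.trace i).link x y).Iso ((D.link x y).trace i) := by
  dsimp only [Graph.trace, Graph.link]
  refine (IsoVia.intro (Equiv.refl _) ?_ ?_ ?_ ?_ : IsoVia _root_.id _ _)
  · simp
  · simp
  · intro a b
    simp [or_right_comm]
  · exact fun _ => rfl

open Classical in
/-- The renaming of the label `x` to `x'`. -/
noncomputable def relabel (x x' : A) (l : Option (Label S A)) : Option (Label S A) :=
  if l = some (.var x) then some (.var x') else l

theorem isoVia_relabel {D : Graph S A} {x x' : A} (h : ∀ v, D.f v ≠ some (.var x)) :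
    D.IsoVia (relabel x x') D :=
  ⟨Equiv.refl _, (List.map_id _).symm, (List.map_id _).symm, fun _ _ => .rfl,
    fun v => (if_neg (h v)).symm⟩

theorem relabel_eq_var {x x' z : A} {l : Option (Label S A)} (hz : z ≠ x) (hz' : z ≠ x') :
    relabel x x' l = some (.var z) ↔ l = some (.var z) := by
  unfold relabel
  split_ifs with h
  · subst h
    simp [hz.symm, hz'.symm]
  · rfl

end Graph

/-- Renaming a variable of a term relabels its graph. The polarities `P` and `Q` agree up to this
renaming. -/
theorem Ty.isoVia_rename {x x' : A} {M : Term S A} : ∀ {P Q : A → Bool} {m n : ℕ}, Ty P M m n →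
    x' ∉ names M → (x ∈ fv M → Q x' = P x) → (∀ z ∈ fv M, z ≠ x → Q z = P z) →
    (graphP P M).IsoVia (Graph.relabel x x') (graphP Q (Term.rename x x' M)) := by
  induction M with
  | const k =>
    intro P Q m n h h' _ _
    exact Graph.isoVia_relabel fun v hv => by simpa [fv] using (Ty.labels h).1 x |>.2 ⟨v, hv⟩
  | zero | one | sym =>
    intro P Q m n h h' _ _
    exact Graph.isoVia_relabel fun v hv => by simpa [fv] using (Ty.labels h).1 x |>.2 ⟨v, hv⟩
  | var z =>
    intro P Q m n h h' h1 h2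
    by_cases hz : z = x
    · subst hz
      have h1 := h1 (by simp [fv])
      simp only [Term.rename, if_true, graphP, h1]
      split_ifs
      · dsimp only [Graph.inVar]
        refine Graph.IsoVia.intro (Equiv.refl _) rfl rfl (fun _ _ => .rfl) ?_
        rintro (_ | _) <;> simp [Graph.relabel]
      · dsimp only [Graph.outVar]
        refine Graph.IsoVia.intro (Equiv.refl _) rfl rfl (fun _ _ => .rfl) ?_
        rintro (_ | _) <;> simp [Graph.relabel]
    · simp only [Term.rename, if_neg hz, graphP, h2 z (by simp [fv]) hz]
      exact Graph.isoVia_relabel fun v hv => hz (by simpa [fv, eq_comm] using (Ty.labels h).1 x |>.2 ⟨v, hv⟩)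
  | comp M N ihM ihN =>
    rintro P Q m n ⟨hd, k, h3, h4⟩ h h1 h2
    simp only [names, Finset.mem_union, not_or] at h
    simp only [fv, Finset.mem_union] at h1 h2
    exact (ihM h3 h.1 (fun h => h1 (.inl h)) fun z hz => h2 z (.inl hz)).comp
      (ihN h4 h.2 (fun h => h1 (.inr h)) fun z hz => h2 z (.inr hz))
  | tensor M N ihM ihN =>
    rintro P Q m n ⟨hd, _, _, _, _, rfl, rfl, h3, h4⟩ h h1 h2
    simp only [names, Finset.mem_union, not_or] at h
    simp only [fv, Finset.mem_union] at h1 h2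
    exact (ihM h3 h.1 (fun h => h1 (.inl h)) fun z hz => h2 z (.inl hz)).tensor
      (ihN h4 h.2 (fun h => h1 (.inr h)) fun z hz => h2 z (.inr hz))
  | trace i M ih =>
    intro P Q m n h3 h h1 h2
    exact (ih (P := P) h3 h h1 h2).trace i
  | link a b M ih =>
    rintro P Q m n ht h h1 h2
    simp only [names, Finset.mem_union, Finset.mem_insert, Finset.mem_singleton, not_or] at h
    simp only [Term.rename]
    split_ifs with hx
    · have hxM : x ∉ fv (link a b M) := by
        simp only [fv, Finset.mem_sdiff, Finset.mem_insert, Finset.mem_singleton]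
        rcases hx with rfl | rfl <;> simp
      rw [graphP_congr (P := Q) fun z hz => h2 z hz fun e => hxM (e ▸ hz)]
      exact Graph.isoVia_relabel fun v hv => hxM ((Ty.labels ht).1 x |>.2 ⟨v, hv⟩)
    · push Not at hx
      obtain ⟨ha, hb, hab, h3⟩ := ht
      refine (ih (Q := polUpdate Q a b) h3 h.2 ?_ ?_).link (fun v => Graph.relabel_eq_var hx.1 (Ne.symm h.1.1))
        (fun v => Graph.relabel_eq_var hx.2 (Ne.symm h.1.2)) (by simp [Graph.relabel]) fun _ _ _ => rfl
      · intro hxM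
        rw [polUpdate_of_ne h.1.1 h.1.2, polUpdate_of_ne hx.1.symm hx.2.symm]
        exact h1 (by simp [fv, hxM, hx.1.symm, hx.2.symm])
      · intro z hz hzx
        simp only [polUpdate, Function.update_apply]
        split_ifs with h4 h5 <;> try rfl
        exact h2 z (by simp [fv, hz, h4, h5]) hzx

/-- The two labels that are renamed are erased by the link. -/
theorem Ty.iso_alpha {P : A → Bool} {x y x' y' : A} {M : Term S A} {m n : ℕ}
    (h : Ty P (.link x y M) m n) (hx : x' ∉ names (.link x y M)) (hy : y' ∉ names (.link x y M))
    (hxy : x' ≠ y') : (graphP P (.link x y M)).Iso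
      (graphP P (.link x' y' (Term.rename y y' (Term.rename x x' M)))) := by
  obtain ⟨hxM, hyM, hne, ht⟩ := h
  simp only [names, Finset.mem_union, Finset.mem_insert, Finset.mem_singleton, not_or] at hx hy
  have hyr : y' ∉ names (Term.rename x x' M) := fun h =>
    (Finset.mem_insert.1 (names_rename_subset x x' M h)).elim hxy.symm hy.2
  have f1 := fv_rename (x := x) hx.2
  have q1 : ∀ z ∈ fv M, z ≠ x → polUpdate (polUpdate P x y) x' y z = polUpdate P x y z := by
    intro z hz hzx
    by_cases hzy : z = y
    · subst hzy; rw [polUpdate_right, polUpdate_right]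
    · rw [polUpdate_of_ne _ hzy]
      rintro rfl
      exact hx.2 (fv_subset_names _ hz)
  have q2 : ∀ z ∈ fv (Term.rename x x' M), z ≠ y →
      polUpdate P x' y' z = polUpdate (polUpdate P x y) x' y z := by
    intro z hz hzy
    by_cases hzx : z = x'
    · subst hzx; rw [polUpdate_left hxy, polUpdate_left hx.1.2]
    · have hzx2 : z ≠ x := by
        rintro rfl
        rw [f1, Finset.mem_image] at hz
        obtain ⟨w, -, hw⟩ := hz
        split_ifs at hw with h'
        · exact hx.1.1 hw
        · exact h' hw
      rw [polUpdate_of_ne hzx, polUpdate_of_ne hzx hzy, polUpdate_of_ne hzx2 hzy]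
      rintro rfl
      exact hyr (fv_subset_names _ hz)
  have e1 : x ∈ fv M → polUpdate (polUpdate P x y) x' y x' = polUpdate P x y x := fun _ => by
    rw [polUpdate_left hx.1.2, polUpdate_left hne]
  have h1 := ht.isoVia_rename hx.2 e1 q1
  have h2 := (ht.rename hx.2 e1 q1).isoVia_rename (Q := polUpdate P x' y') hyr
    (fun _ => by rw [polUpdate_right, polUpdate_right]) q2
  have hl : ∀ z, z ∉ names M → ∀ v, (graphP (polUpdate P x y) M).f v ≠ some (.var z) :=
    fun z hz v hv => hz (fv_subset_names _ (ht.labels.1 z |>.2 ⟨v, hv⟩))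
  refine ((h1.trans h2).link (g' := _root_.id) (fun v => ?_) (fun v => ?_) rfl
    fun v hv hv' => ?_).iso
  · rw [Function.comp_apply, Graph.relabel_eq_var hx.1.2 hxy]
    have := hl x' hx.2 v
    simp only [Graph.relabel]
    split_ifs with h
    · exact iff_of_true rfl h
    · exact iff_of_false this h
  · have := hl y' hy.2 v
    rw [← Graph.relabel_eq_var (x := x) (x' := x') hne.symm (Ne.symm hx.1.2)]
    simp only [Function.comp_apply]
    have : Graph.relabel x x' ((graphP (polUpdate P x y) M).f v) ≠ some (.var y') := by
      rwa [Ne, Graph.relabel_eq_var hy.1.1 hxy.symm]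
    generalize Graph.relabel x x' ((graphP (polUpdate P x y) M).f v) = l at this ⊢
    simp only [Graph.relabel]
    split_ifs with h
    · exact iff_of_true rfl h
    · exact iff_of_false this h
  · simp [Graph.relabel, hv, hv']

/-! ### Soundness -/

theorem wires_idn (P : A → Bool) (n : ℕ) : (graphP P (idn n : Term S A)).Wires n := by
  induction n with
  | zero => exact Graph.wires_zero
  | succ n ih => exact ih.tensor Graph.wires_one

theorem swaps_symOne (P : A → Bool) (m : ℕ) : (graphP P (symOne m : Term S A)).Swaps m 1 := by
  induction m with
  | zero => exact Graph.wires_one.zero_swaps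
  | succ m ih => exact Graph.Swaps.add' (wires_idn P m) Graph.swaps_sym ih Graph.wires_one

theorem swaps_symn (P : A → Bool) (m n : ℕ) : (graphP P (symn m n : Term S A)).Swaps m n := by
  induction n with
  | zero => exact (wires_idn P m).swaps_zero
  | succ n ih => exact ih.add Graph.wires_one (wires_idn P n) (swaps_symOne P m)

theorem HasTypeIn.ty {Γ Δ : Finset A} {M : Term S A} {m n : ℕ} (h : HasTypeIn Γ Δ M m n)
    {P : A → Bool} (h1 : ∀ z ∈ Γ, P z = true) (h2 : ∀ z ∈ Δ, P z = false) : Ty P M m n := by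
  obtain ⟨Γ', hΓ, Δ', hΔ, ⟨d⟩⟩ := h
  exact (d.ty (fun z hz => h1 z (hΓ hz)) fun z hz => h2 z (hΔ hz)).1

theorem Ty.label_ne {P : A → Bool} {M : Term S A} {m n : ℕ} (h : Ty P M m n) {z : A}
    (hz : z ∉ fv M) (v) : (graphP P M).f v ≠ some (.var z) :=
  fun hv => hz ((h.labels.1 z).2 ⟨v, hv⟩)

theorem graphP_polUpdate {P : A → Bool} {x y : A} {M : Term S A} (hx : x ∉ fv M) (hy : y ∉ fv M) :
    graphP (polUpdate P x y) M = graphP P M :=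
  graphP_congr fun z hz =>
    polUpdate_of_ne (fun e => hx (e ▸ hz)) fun e => hy (e ▸ hz)

/-- The equations hold in diagrams. -/
theorem Equation.same {Γ Δ : Finset A} {M N : Term S A} (h : Equation Γ Δ M N) {P : A → Bool}
    (h1 : ∀ z ∈ Γ, P z = true) (h2 : ∀ z ∈ Δ, P z = false) {m n : ℕ} (tM : Ty P M m n)
    (tN : Ty P N m n) : (graphP P M).Same (graphP P N) := by
  cases h with
  | comp_assoc => exact (Graph.iso_comp_assoc _ _ _).same
  | id_comp k =>
    obtain ⟨-, _, t1, t2⟩ := tM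
    obtain ⟨rfl, rfl⟩ := t1.unique (Ty.id P k)
    exact Graph.id_comp t2.tidy (wires_idn P _)
  | comp_id k =>
    obtain ⟨-, _, t1, t2⟩ := tM
    obtain ⟨rfl, rfl⟩ := t2.unique (Ty.id P k)
    exact Graph.comp_id t1.tidy (wires_idn P _)
  | functoriality =>
    obtain ⟨-, _, _, _, _, -, -, ⟨-, _, t1, t2⟩, -⟩ := tM
    exact (Graph.iso_functoriality _ _ _ _ (t1.tidy.O_length.trans t2.tidy.I_length.symm)).same
  | tensor_assoc => exact (Graph.iso_tensor_assoc _ _ _).same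
  | tensor_zero => exact (Graph.iso_tensor_zero _).same
  | zero_tensor => exact (Graph.iso_zero_tensor _).same
  | symmetry M₁ M₂ m₁ n₁ m₂ n₂ h₁ h₂ =>
    exact Graph.symmetry (h₁.ty h1 ‹_›).tidy (h₂.ty h1 ‹_›).tidy (swaps_symn P _ _)
      (swaps_symn P _ _)
  | sym_zero_one => exact (swaps_symn P 0 1).same Graph.wires_one.zero_swaps
  | sym_one_zero => exact (swaps_symn P 1 0).same Graph.wires_one.swaps_zero
  | sym_add k l p =>
    exact (swaps_symn P _ _).same ((swaps_symn P k l).add (wires_idn P p) (wires_idn P l)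
      (swaps_symn P k p))
  | alpha x y x' y' M hx hy hxy => exact (tM.iso_alpha hx hy hxy).same
  | link_comp_left x y M N hx hy =>
    obtain ⟨-, _, -, t⟩ := tN
    simp only [graphP]
    rw [graphP_polUpdate hx hy]
    exact (Graph.iso_link_comp_left (t.label_ne hx) (t.label_ne hy)).same
  | link_tensor_left x y M N hx hy =>
    obtain ⟨-, _, _, _, _, -, -, -, t⟩ := tN
    simp only [graphP]
    rw [graphP_polUpdate hx hy]
    exact (Graph.iso_link_tensor_left (t.label_ne hx) (t.label_ne hy)).same
  | link_comp_right x y M N hx hy =>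
    obtain ⟨-, _, t, -⟩ := tN
    simp only [graphP]
    rw [graphP_polUpdate hx hy]
    exact (Graph.iso_link_comp_right (t.label_ne hx) (t.label_ne hy)).same
  | link_tensor_right x y M N hx hy =>
    obtain ⟨-, _, _, _, _, -, -, t, -⟩ := tN
    simp only [graphP]
    rw [graphP_polUpdate hx hy]
    exact (Graph.iso_link_tensor_right (t.label_ne hx) (t.label_ne hy)).same
  | link_identity x y =>
    have hxy := tM.2.2.1
    simp only [graphP, polUpdate_left hxy, polUpdate_right]
    exact Graph.link_identity hxy
  | left_tightening k =>
    obtain ⟨-, _, ⟨-, _, _, _, _, e, rfl, t1, t2⟩, t3⟩ := tM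
    obtain ⟨rfl, rfl⟩ := t2.unique (Ty.id P k)
    exact Graph.left_tightening t1.tidy t3.tidy (wires_idn P _)
  | right_tightening k =>
    obtain ⟨-, _, t3, -, _, _, _, _, rfl, e, t1, t2⟩ := tM
    obtain ⟨rfl, rfl⟩ := t2.unique (Ty.id P k)
    exact Graph.right_tightening t1.tidy t3.tidy (wires_idn P _)
  | sliding k l p q f g hf hg =>
    exact Graph.sliding (hf.ty h1 h2).tidy (wires_idn P _) (wires_idn P _) (hg.ty h1 h2).tidy
  | vanishing_zero => exact (Graph.iso_trace_zero _).same
  | vanishing_add k l f =>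
    have t : Ty P f (m + (k + l)) (n + (k + l)) := tM
    exact (Graph.iso_trace_add _ t.tidy.I_length t.tidy.O_length).same
  | superposing k l f =>
    obtain ⟨-, m₁, n₁, m₂, n₂, -, -, -, t⟩ := tN
    have t : Ty P f (m₂ + k) (n₂ + k) := t
    exact (Graph.iso_superposing _ _ t.tidy.I_length t.tidy.O_length).same
  | yanking => exact Graph.yanking
  | link_trace x y i => exact (Graph.iso_link_trace _ x y i).same

theorem Provable.hasType {Γ Δ : Finset A} {M N : Term S A} {m n : ℕ} (h : Provable Γ Δ m n M N) :
    HasType Γ Δ M m n ∧ HasType Γ Δ N m n := by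
  induction h with
  | ax _ hM hN => exact ⟨hM, hN⟩
  | refl hM => exact ⟨hM, hM⟩
  | symm _ ih => exact ih.symm
  | trans _ _ ih ih' => exact ⟨ih.1, ih'.2⟩
  | comp hd _ _ ih ih' =>
    obtain ⟨⟨⟨d⟩, ⟨e⟩⟩, ⟨d'⟩, ⟨e'⟩⟩ := ih, ih'
    exact ⟨⟨.comp hd d d'⟩, ⟨.comp hd e e'⟩⟩
  | tensor hd _ _ ih ih' =>
    obtain ⟨⟨⟨d⟩, ⟨e⟩⟩, ⟨d'⟩, ⟨e'⟩⟩ := ih, ih'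
    exact ⟨⟨.tensor hd d d'⟩, ⟨.tensor hd e e'⟩⟩
  | trace i _ ih =>
    obtain ⟨⟨d⟩, ⟨e⟩⟩ := ih
    exact ⟨⟨.trace i d⟩, ⟨.trace i e⟩⟩
  | link x y hx hy _ ih =>
    obtain ⟨⟨d⟩, ⟨e⟩⟩ := ih
    exact ⟨⟨.link x y hx hy d⟩, ⟨.link x y hx hy e⟩⟩

/-- Provable equality is sound, by induction on proofs. -/
theorem Provable.same {Γ Δ : Finset A} {M N : Term S A} {m n : ℕ} (h : Provable Γ Δ m n M N) :
    ∀ {P : A → Bool}, (∀ z ∈ Γ, P z = true) → (∀ z ∈ Δ, P z = false) →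
      (graphP P M).Same (graphP P N) := by
  induction h with
  | ax h hM hN =>
    intro P h1 h2
    obtain ⟨⟨d⟩, ⟨e⟩⟩ := hM, hN
    exact h.same h1 h2 (d.ty h1 h2).1 (e.ty h1 h2).1
  | refl => exact fun _ _ => .refl _
  | symm _ ih => exact fun h1 h2 => (ih h1 h2).symm
  | trans _ _ ih ih' => exact fun h1 h2 => (ih h1 h2).trans (ih' h1 h2)
  | comp _ _ _ ih ih' =>
    intro P h1 h2
    simp only [Finset.mem_union] at h1 h2
    exact (ih (fun z hz => h1 z (.inl hz)) fun z hz => h2 z (.inl hz)).comp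
      (ih' (fun z hz => h1 z (.inr hz)) fun z hz => h2 z (.inr hz))
  | tensor _ _ _ ih ih' =>
    intro P h1 h2
    simp only [Finset.mem_union] at h1 h2
    exact (ih (fun z hz => h1 z (.inl hz)) fun z hz => h2 z (.inl hz)).tensor
      (ih' (fun z hz => h1 z (.inr hz)) fun z hz => h2 z (.inr hz))
  | trace i h ih =>
    intro P h1 h2
    obtain ⟨-, ⟨e⟩⟩ := h.hasType
    exact (ih h1 h2).trace_tidy i (e.ty h1 h2).1.tidy
  | link x y hx hy h ih =>
    intro P h1 h2
    obtain ⟨⟨d⟩, -⟩ := h.hasType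
    have hd := d.ctx.1
    simp only [Finset.disjoint_insert_left, Finset.disjoint_insert_right, Finset.mem_insert,
      not_or] at hd
    refine (ih (P := polUpdate P x y) (fun z hz => ?_) fun z hz => ?_).link x y
    · rcases Finset.mem_insert.1 hz with rfl | hz
      · exact polUpdate_right
      · rw [polUpdate_of_ne, h1 z hz] <;> rintro rfl <;> tauto
    · rcases Finset.mem_insert.1 hz with rfl | hz
      · exact polUpdate_left fun h => hd.1.1 h
      · rw [polUpdate_of_ne, h2 z hz] <;> rintro rfl <;> tauto

/-- Soundness: the diagrams agree for all derivations, by the choice of any polarity that fits. -/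
theorem Provable.diagram_eq {Γ Δ : Finset A} {M N : Term S A} {m n : ℕ}
    (d : Derivation Γ Δ M m n) (e : Derivation Γ Δ N m n) (h : Provable Γ Δ m n M N) :
    d.diagram = e.diagram := by
  have h1 : ∀ z ∈ Γ, decide (z ∈ Γ) = true := fun z hz => decide_eq_true hz
  have h2 : ∀ z ∈ Δ, decide (z ∈ Γ) = false := fun z hz =>
    decide_eq_false fun hz' => Finset.disjoint_left.1 d.ctx.1 hz' hz
  have := h.same h1 h2
  rw [(d.ty h1 h2).2, (e.ty h1 h2).2] at this
  exact Quot.eqvGen_sound this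

end Biflow

theorem mainTheorem2 {S : Biflow.Signature} {A : Type*} [DecidableEq A] [Infinite A]
    {Γ Δ : Finset A} {M N : Biflow.Term S A} {m n : ℕ}
    (d : Biflow.Derivation Γ Δ M m n) (e : Biflow.Derivation Γ Δ N m n) :
    Biflow.Provable Γ Δ m n M N ↔ d.diagram = e.diagram :=
  ⟨fun h => h.diagram_eq d e, fun h => Biflow.provable_of_eqvGen d e (Quot.eqvGen_exact h)⟩
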